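/- Let $V=\mathbb C^g$ with coordinates $z_1,\dots,z_g$ and $|z|^2=\sum_j|z_j|^2$, let $\Lambda\subset V$ be a lattice (discrete, of full real rank $2g$), $X=V/\Lambda$, and let $B$ be a real-valued alternating $\mathbb R$-bilinear form on $V$. Put $\sigma(u,v)=e^{2\pi i B(u,v)}$ for $u,v\in V$, and write $$B(u,z)=\sum_{j=1}^g\bigl(B_j(u)z_j+\overline{B_j(u)z_j}\bigr),\qquad \omega=\sum_{j=1}^g\overline{B_j(z)}\,d\bar z_j .$$ Let $\mathcal A(\Lambda;\sigma)$ be the algebra of functions $a=\sum_\mu a(\mu)[\mu]$ on $\Lambda$ that decrease faster than any polynomial, with the product determined by $[\lambda_1]\circ[\lambda_2]=\sigma(\lambda_1,\lambda_2)[\lambda_1+\lambda_2]$. Let $V^{0,1}$ be the space with basis $d\bar z_1,\dots,d\bar z_g$ and $V_{1,0}$ the space with basis $d\bar\zeta_1,\dots,d\bar\zeta_g$. Let $\mathcal A(X)$ be the algebra of smooth $\Lambda$-periodic functions on $V$, and let $\mathcal P=\mathcal Q=\mathcal S(V)$ be the Schwartz space, with $\mathcal A(X)$ acting by multiplication, and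 with the right action $(p\cdot\mu)(v)=\sigma(\mu,v)\,p(\mu+v)$ $(\mu\in\Lambda)$ of $\mathcal A(\Lambda;\sigma)$ on $\mathcal P$. Put $$\mathcal Q^\bullet=\mathcal Q\otimes\Lambda^\bullet V_{1,0},\quad \mathcal P^\bullet=\mathcal P\otimes\Lambda^\bullet V^{0,1},\quad \mathbb Q=2\pi i\sum_j z_j\,d\bar\zeta_j\wedge{}+\bar\partial_V-2\pi i\,\omega\wedge,\quad \mathbb P^0=\bar\partial_V+2\pi i\,\omega\wedge .$$ **(The complex.)** The map $(q,p)\mapsto\bigl((z,\lambda)\mapsto q(z)\,p(z+\lambda)\bigr)$ identifies the completed tensor product $\mathcal Q\otimes_{\mathcal A(X)}\mathcal P$ of Fréchet modules (that is, the target of the universal continuous $\mathcal A(X)$-balanced bilinear map on $\mathcal Q\times\mathcal P$ to Fréchet spaces) with the Schwartz space $\mathcal S(V\times\Lambda)$, and hence $\mathcal X^\bullet=\mathcal Q^\bullet\otimes_{\mathcal A(X;B)}\mathcal P^\bullet$ with $\mathcal S(V\times\Lambda)\otimes\Lambda^\bullet V_{1,0}\otimes\Lambda^\bullet V^{0,1}$.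 The right action induced from $\mathcal P$ is $$(\phi\cdot\mu)(z,\lambda)=\sigma(\mu,z+\lambda)\,\phi(z,\lambda+\mu),$$ and $\mathbb X^0=\mathbb Q\otimes 1+1\otimes\mathbb P^0$ (that is, $\mathbb X^0(q\otimes p)=\mathbb Q(q)\otimes p+(-1)^{\deg q}q\otimes\mathbb P^0(p)$ for $q\in\mathcal Q^\bullet$, $p\in\mathcal P^\bullet$) is the right $\mathcal A(\Lambda;\sigma)$-linear operator $$\mathbb X^0\phi(z,\lambda)=\sum_{j=1}^g\Bigl(2\pi i\,z_j\,d\bar\zeta_j\wedge\phi+d\bar z_j\wedge\frac{\partial\phi}{\partial\bar z_j}+2\pi i\,\overline{B_j(\lambda)}\,d\bar z_j\wedge\phi\Bigr).$$ It raises the degree by one and satisfies $(\mathbb X^0)^2=0$. For $\mu\in\Lambda$ let $$b_\mu(z,\lambda)=\exp\Bigl(-2\pi\bigl(|z|^2+\sum_j iB_j(\mu)z_j+\sum_j i\,\overline{B_j(\mu)z_j}\bigr)\Bigr)\ \text{ if }\lambda=\mu,\qquad b_\mu(z,\lambda)=0\ \text{ if }\lambda\ne\mu,$$ $e^-_j=d\bar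 z_j-i\,d\bar\zeta_j$, and $\eta^0_\mu=b_\mu\,e^-_1\wedge\cdots\wedge e^-_g\in\mathcal X^g$. Give $\mathcal X^\bullet$ the Hermitian product for which the $d\bar z_j,d\bar\zeta_k$ are orthonormal (with the induced product on exterior powers), integrated against Lebesgue measure on $V$ times counting measure on $\Lambda$. **(Cohomology.)** $H^k(\mathcal X^\bullet,\mathbb X^0)=0$ for every $k\ne g$, and $H^g(\mathcal X^\bullet,\mathbb X^0)$ is a free right $\mathcal A(\Lambda;\sigma)$-module of rank one, generated by the class of the closed element $\eta^0_0$. **(Harmonic representatives.)** $\mathbb X^0$ has an adjoint $(\mathbb X^0)^*$ on $\mathcal X^\bullet$. The kernel of $\Delta^0=(\mathbb X^0)^*\mathbb X^0+\mathbb X^0(\mathbb X^0)^*$ on $\mathcal X^k$ is zero for $k\ne g$. The $\eta^0_\mu$ $(\mu\in\Lambda)$ are nonzero elements of $\mathcal X^g$, pairwise orthogonal, and they are a basis of $\ker\Delta^0$ in the sense that the elements of $\ker\Delta^0$ are exactly the sums $\sum_{\mu\in\Lambda}c(\mu)\,\eta^0_\mu$, with $c$ a function on $\Lambda$ that decreases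 faster than any polynomial; $c$ is uniquely determined, and all these series converge in $\mathcal S(V\times\Lambda)$. -/

import Mathlib

namespace NCTorus

noncomputable section

open scoped SchwartzMap LineDeriv ContDiff TensorProduct ComplexConjugate

variable {g : ℕ}

/-- The `g`-dimensional complex vector space `V = ℂ^g`, with coordinates `z_1, …, z_g` and
`|z|^2 = ∑_j |z_j|^2`. -/
abbrev V (g : ℕ) : Type := EuclideanSpace ℂ (Fin g)


/-- The cocycle `σ(u, v) = exp (2 π i B(u, v))`, extended to `V × V`. -/
def sigma (B : V g →L[ℝ] V g →L[ℝ] ℝ) (u v : V g) : ℂ :=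
  Complex.exp (2 * Real.pi * Complex.I * (B u v : ℝ))

theorem norm_sigma (B : V g →L[ℝ] V g →L[ℝ] ℝ) (u v : V g) : ‖sigma B u v‖ = 1 := by
  have h : (2 * Real.pi * Complex.I * (B u v : ℝ) : ℂ) =
      ((2 * Real.pi * B u v : ℝ) : ℂ) * Complex.I := by push_cast; ring
  rw [sigma, h, Complex.norm_exp_ofReal_mul_I]

theorem sigma_add_left (B : V g →L[ℝ] V g →L[ℝ] ℝ) (u u' v : V g) :
    sigma B (u + u') v = sigma B u v * sigma B u' v := by
  simp only [sigma, ← Complex.exp_add, map_add, add_apply]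
  congr 1; push_cast; ring

theorem sigma_add_right (B : V g →L[ℝ] V g →L[ℝ] ℝ) (u v v' : V g) :
    sigma B u (v + v') = sigma B u v * sigma B u v' := by
  simp only [sigma, ← Complex.exp_add, map_add]
  congr 1; push_cast; ring

@[simp] theorem sigma_zero_left (B : V g →L[ℝ] V g →L[ℝ] ℝ) (v : V g) : sigma B 0 v = 1 := by
  simp [sigma]

@[simp] theorem sigma_zero_right (B : V g →L[ℝ] V g →L[ℝ] ℝ) (v : V g) : sigma B v 0 = 1 := by
  simp [sigma]

theorem sigma_assoc (B : V g →L[ℝ] V g →L[ℝ] ℝ) (u v w : V g) :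
    sigma B u v * sigma B (u + v) w = sigma B v w * sigma B u (v + w) := by
  rw [sigma_add_left, sigma_add_right]; ring

/-- Functions on the lattice `Λ` which decrease faster than any polynomial. -/
def rapid (Λ : Submodule ℤ (V g)) : Submodule ℂ (Λ → ℂ) where
  carrier := {a | ∀ m : ℕ, ∃ C : ℝ, ∀ l : Λ, ‖l‖ ^ m * ‖a l‖ ≤ C}
  zero_mem' m := ⟨0, by simp⟩
  add_mem' := by
    intro a b ha hb m
    obtain ⟨C, hC⟩ := ha m
    obtain ⟨D, hD⟩ := hb m
    refine ⟨C + D, fun l => ?_⟩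
    calc ‖l‖ ^ m * ‖a l + b l‖ ≤ ‖l‖ ^ m * (‖a l‖ + ‖b l‖) := by gcongr; exact norm_add_le _ _
      _ ≤ C + D := by rw [mul_add]; exact add_le_add (hC l) (hD l)
  smul_mem' := by
    intro c a ha m
    obtain ⟨C, hC⟩ := ha m
    refine ⟨‖c‖ * C, fun l => ?_⟩
    calc ‖l‖ ^ m * ‖c * a l‖ = ‖c‖ * (‖l‖ ^ m * ‖a l‖) := by rw [norm_mul]; ring
      _ ≤ ‖c‖ * C := by gcongr; exact hC l

/-- The underlying space of the twisted group algebra `𝒜(Λ; σ)`. -/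
def TwAlg (Λ : Submodule ℤ (V g)) (_B : V g →L[ℝ] V g →L[ℝ] ℝ) : Type := rapid Λ

variable {Λ : Submodule ℤ (V g)} {B : V g →L[ℝ] V g →L[ℝ] ℝ}

namespace TwAlg

instance : AddCommGroup (TwAlg Λ B) := inferInstanceAs (AddCommGroup (rapid Λ))
instance : Module ℂ (TwAlg Λ B) := inferInstanceAs (Module ℂ (rapid Λ))
instance : FunLike (TwAlg Λ B) Λ ℂ := ⟨fun a => a.1, fun _ _ h => Subtype.ext h⟩

@[ext] theorem ext {a b : TwAlg Λ B} (h : ∀ l, a l = b l) : a = b := DFunLike.ext _ _ h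

@[simp] theorem add_apply (a b : TwAlg Λ B) (l : Λ) : (a + b) l = a l + b l := rfl
@[simp] theorem zero_apply (l : Λ) : (0 : TwAlg Λ B) l = 0 := rfl
@[simp] theorem smul_apply (c : ℂ) (a : TwAlg Λ B) (l : Λ) : (c • a) l = c * a l := rfl

end TwAlg

theorem one_add_pow_le' {x y C D : ℝ} (m : ℕ) (hx : 0 ≤ x) (_hy : 0 ≤ y) (h0 : y ≤ C)
    (hm : x ^ m * y ≤ D) : (1 + x) ^ m * y ≤ 2 ^ (m - 1) * (C + D) := by
  have := add_pow_le (zero_le_one) hx m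
  calc (1 + x) ^ m * y ≤ (2 ^ (m - 1) * (1 ^ m + x ^ m)) * y := by gcongr
    _ = 2 ^ (m - 1) * (y + x ^ m * y) := by rw [one_pow]; ring
    _ ≤ _ := by gcongr

theorem TwAlg.bound (a : TwAlg Λ B) (m : ℕ) :
    ∃ C : ℝ, 0 ≤ C ∧ ∀ l : Λ, (1 + ‖l‖) ^ m * ‖a l‖ ≤ C := by
  obtain ⟨C, hC⟩ : ∃ C : ℝ, ∀ l : Λ, ‖l‖ ^ 0 * ‖a l‖ ≤ C := a.2 0
  obtain ⟨D, hD⟩ : ∃ D : ℝ, ∀ l : Λ, ‖l‖ ^ m * ‖a l‖ ≤ D := a.2 m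
  have h : ∀ l : Λ, (1 + ‖l‖) ^ m * ‖a l‖ ≤ 2 ^ (m - 1) * (C + D) := fun l =>
    one_add_pow_le' m (norm_nonneg _) (norm_nonneg _) (by simpa using hC l) (hD l)
  exact ⟨_, le_trans (by positivity) (h 0), h⟩

theorem peetre {E : Type*} [SeminormedAddCommGroup E] (x y : E) (m : ℕ) :
    (1 + ‖x + y‖) ^ m ≤ (1 + ‖x‖) ^ m * (1 + ‖y‖) ^ m := by
  rw [← mul_pow]
  gcongr
  nlinarith [norm_add_le x y, norm_nonneg x, norm_nonneg y, mul_nonneg (norm_nonneg x) (norm_nonneg y)]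

open Classical in
/-- The element `[m]` of the twisted group algebra, for `m ∈ Λ`. -/
def single (Λ : Submodule ℤ (V g)) (B : V g →L[ℝ] V g →L[ℝ] ℝ) (m : Λ) : TwAlg Λ B :=
  ⟨Pi.single m 1, fun k => ⟨‖m‖ ^ k, fun l => by
    by_cases h : l = m
    · subst h; simp
    · simp [h]⟩⟩

open Classical in
theorem single_apply (m l : Λ) : single Λ B m l = if l = m then 1 else 0 := by
  change (Pi.single m 1 : Λ → ℂ) l = _
  rw [Pi.single_apply]

section
variable [DiscreteTopology Λ]

theorem exists_summable_weight (Λ : Submodule ℤ (V g)) [DiscreteTopology Λ] :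
    ∃ N : ℕ, Summable fun l : Λ => ((1 + ‖l‖) ^ N)⁻¹ := by
  refine ⟨Module.finrank ℤ Λ + 1, ?_⟩
  have h := ZLattice.summable_norm_pow_inv Λ (Module.finrank ℤ Λ + 1) (Nat.lt_succ_self _)
  refine Summable.of_norm_bounded_eventually h ?_
  refine (Set.finite_singleton (0 : Λ)).subset fun l hl => ?_
  by_contra h0
  apply hl
  have hp : 0 < ‖l‖ := norm_pos_iff.mpr h0
  simp only [Set.mem_ofPred_eq]
  rw [Real.norm_of_nonneg (by positivity), inv_pow]
  gcongr
  linarith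

theorem TwAlg.summable_weight (a : TwAlg Λ B) (m : ℕ) :
    Summable fun l : Λ => (1 + ‖l‖) ^ m * ‖a l‖ := by
  obtain ⟨N, hN⟩ := exists_summable_weight Λ
  obtain ⟨C, hC0, hC⟩ := a.bound (m + N)
  refine Summable.of_nonneg_of_le (fun l => by positivity) (fun l => ?_) (hN.mul_left C)
  rw [← div_eq_mul_inv, le_div_iff₀ (by positivity)]
  calc _ = (1 + ‖l‖) ^ (m + N) * ‖a l‖ := by ring
    _ ≤ C := hC l

theorem TwAlg.summable_norm (a : TwAlg Λ B) : Summable fun l : Λ => ‖a l‖ := by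
  simpa using a.summable_weight 0

/-- The twisted convolution, i.e. the product determined by
`[l₁] ∘ [l₂] = σ(l₁, l₂) [l₁ + l₂]`. -/
def conv (a b : TwAlg Λ B) : TwAlg Λ B :=
  ⟨fun n => ∑' l : Λ, a l * b (n - l) * sigma B (l : V g) ((n - l : Λ) : V g), by
    intro m
    obtain ⟨C, hC0, hC⟩ := b.bound m
    have hs := a.summable_weight m
    refine ⟨∑' l : Λ, C * ((1 + ‖l‖) ^ m * ‖a l‖), fun n => ?_⟩
    have key : ∀ l : Λ, ‖n‖ ^ m * ‖a l * b (n - l) * sigma B (l : V g) ((n - l : Λ) : V g)‖ ≤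
        C * ((1 + ‖l‖) ^ m * ‖a l‖) := by
      intro l
      have h1 : ‖n‖ ^ m ≤ (1 + ‖l‖) ^ m * (1 + ‖n - l‖) ^ m := by
        have := peetre l (n - l) m
        rw [add_sub_cancel] at this
        exact le_trans (by gcongr; linarith [norm_nonneg n]) this
      rw [norm_mul, norm_sigma, mul_one, norm_mul]
      calc ‖n‖ ^ m * (‖a l‖ * ‖b (n - l)‖)
          ≤ ((1 + ‖l‖) ^ m * (1 + ‖n - l‖) ^ m) * (‖a l‖ * ‖b (n - l)‖) := by gcongr
        _ = ((1 + ‖n - l‖) ^ m * ‖b (n - l)‖) * ((1 + ‖l‖) ^ m * ‖a l‖) := by ring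
        _ ≤ C * ((1 + ‖l‖) ^ m * ‖a l‖) := by gcongr; exact hC _
    have h2 : ‖((‖n‖ ^ m : ℝ) : ℂ) *
        ∑' l : Λ, a l * b (n - l) * sigma B (l : V g) ((n - l : Λ) : V g)‖ ≤
        ∑' l : Λ, C * ((1 + ‖l‖) ^ m * ‖a l‖) := by
      rw [← tsum_mul_left]
      refine tsum_of_norm_bounded (hs.mul_left C).hasSum fun l => ?_
      rw [norm_mul, Complex.norm_real, norm_pow, norm_norm]
      exact key l
    rwa [norm_mul, Complex.norm_real, norm_pow, norm_norm] at h2⟩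

theorem conv_apply (a b : TwAlg Λ B) (n : Λ) :
    conv a b n = ∑' l : Λ, a l * b (n - l) * sigma B (l : V g) ((n - l : Λ) : V g) := rfl

theorem conv_summable (a b : TwAlg Λ B) (n : Λ) :
    Summable fun l : Λ => a l * b (n - l) * sigma B (l : V g) ((n - l : Λ) : V g) := by
  obtain ⟨C, hC0, hC⟩ := b.bound 0
  refine Summable.of_norm_bounded (a.summable_norm.mul_left C) fun l => ?_
  rw [norm_mul, norm_sigma, mul_one, norm_mul, mul_comm]
  gcongr
  simpa using hC (n - l)

theorem conv_assoc (a b c : TwAlg Λ B) : conv (conv a b) c = conv a (conv b c) := by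
  ext n
  let F : Λ × Λ → ℂ := fun p => a p.1 * b (p.2 - p.1) * c (n - p.2) *
    (sigma B (p.1 : V g) ((p.2 - p.1 : Λ) : V g) * sigma B (p.2 : V g) ((n - p.2 : Λ) : V g))
  have hF : Summable F := by
    obtain ⟨C, hC0, hC⟩ := c.bound 0
    have h1 : Summable fun p : Λ × Λ => ‖a p.1‖ * ‖b p.2‖ :=
      a.summable_norm.mul_of_nonneg b.summable_norm (fun _ => norm_nonneg _) (fun _ => norm_nonneg _)
    let e : Λ × Λ ≃ Λ × Λ := ⟨fun p => (p.1, p.2 - p.1), fun p => (p.1, p.2 + p.1),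
      fun p => by simp, fun p => by simp⟩
    have h2 : Summable fun p : Λ × Λ => ‖a p.1‖ * ‖b (p.2 - p.1)‖ := (e.summable_iff).2 h1
    refine Summable.of_norm_bounded (h2.mul_left C) fun p => ?_
    simp only [F, norm_mul, norm_sigma, mul_one]
    rw [mul_comm]
    gcongr
    simpa using hC (n - p.2)
  have hF' : Summable (Function.uncurry fun (k l : Λ) => F (l, k)) :=
    ((Equiv.prodComm Λ Λ).summable_iff).2 hF
  calc conv (conv a b) c n = ∑' k : Λ, ∑' l : Λ, F (l, k) := by
        rw [conv_apply]
        refine tsum_congr fun k => ?_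
        rw [conv_apply, ← tsum_mul_right, ← tsum_mul_right]
        refine tsum_congr fun l => ?_
        simp only [F]; ring
    _ = ∑' l : Λ, ∑' k : Λ, F (l, k) := hF'.tsum_comm.symm
    _ = conv a (conv b c) n := by
        rw [conv_apply]
        refine tsum_congr fun l => ?_
        rw [← (Equiv.addLeft l).tsum_eq, conv_apply, ← tsum_mul_left, ← tsum_mul_right]
        refine tsum_congr fun m => ?_
        simp only [F, Equiv.coe_addLeft, add_sub_cancel_left]
        have h := sigma_assoc B (l : V g) (m : V g) ((n - (l + m) : Λ) : V g)
        have e1 : n - l - m = n - (l + m) := by abel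
        have e2 : ((n - l : Λ) : V g) = (m : V g) + ((n - (l + m) : Λ) : V g) := by
          push_cast; abel
        rw [e1, e2, Submodule.coe_add, h]; ring

instance : Mul (TwAlg Λ B) := ⟨conv⟩
instance : One (TwAlg Λ B) := ⟨single Λ B 0⟩

theorem TwAlg.mul_apply (a b : TwAlg Λ B) (n : Λ) :
    (a * b) n = ∑' l : Λ, a l * b (n - l) * sigma B (l : V g) ((n - l : Λ) : V g) := rfl

open Classical in
theorem TwAlg.one_apply (l : Λ) : (1 : TwAlg Λ B) l = if l = 0 then 1 else 0 := single_apply 0 l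

instance instRingTwAlg : Ring (TwAlg Λ B) :=
  { (inferInstance : AddCommGroup (TwAlg Λ B)) with
    mul := (· * ·)
    one := 1
    mul_assoc := conv_assoc
    one_mul := fun a => by
      ext n
      rw [TwAlg.mul_apply, tsum_eq_single 0]
      · simp [TwAlg.one_apply]
      · intro l hl; simp [TwAlg.one_apply, hl]
    mul_one := fun a => by
      ext n
      rw [TwAlg.mul_apply, tsum_eq_single n]
      · simp [TwAlg.one_apply]
      · intro l hl
        have : n - l ≠ 0 := sub_ne_zero.2 (Ne.symm hl)
        simp [TwAlg.one_apply, this]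
    left_distrib := fun a b c => by
      ext n
      simp only [TwAlg.mul_apply, TwAlg.add_apply]
      rw [← (conv_summable a b n).tsum_add (conv_summable a c n)]
      exact tsum_congr fun l => by ring
    right_distrib := fun a b c => by
      ext n
      simp only [TwAlg.mul_apply, TwAlg.add_apply]
      rw [← (conv_summable a c n).tsum_add (conv_summable b c n)]
      exact tsum_congr fun l => by ring
    zero_mul := fun a => by ext n; simp [TwAlg.mul_apply]
    mul_zero := fun a => by ext n; simp [TwAlg.mul_apply] }

instance instAlgebraTwAlg : Algebra ℂ (TwAlg Λ B) :=
  Algebra.ofModule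
    (fun c a b => by
      ext n
      simp only [TwAlg.mul_apply, TwAlg.smul_apply]
      rw [← tsum_mul_left]
      exact tsum_congr fun l => by ring)
    (fun c a b => by
      ext n
      simp only [TwAlg.mul_apply, TwAlg.smul_apply]
      rw [← tsum_mul_left]
      exact tsum_congr fun l => by ring)

end

/-- The Schwartz space `𝓢(V × Λ)`, as the space of families `(φ(·, l))_{l ∈ Λ}` of Schwartz
functions on `V` all of whose Schwartz seminorms decrease rapidly in `l`. -/
def schwartzVL (Λ : Submodule ℤ (V g)) : Submodule ℂ (Λ → 𝓢(V g, ℂ)) where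
  carrier := {φ | ∀ k n m : ℕ, ∃ C : ℝ, ∀ l : Λ, ‖l‖ ^ m * SchwartzMap.seminorm ℂ k n (φ l) ≤ C}
  zero_mem' k n m := ⟨0, by simp⟩
  add_mem' := by
    intro a b ha hb k n m
    obtain ⟨C, hC⟩ := ha k n m
    obtain ⟨D, hD⟩ := hb k n m
    refine ⟨C + D, fun l => ?_⟩
    calc ‖l‖ ^ m * SchwartzMap.seminorm ℂ k n (a l + b l)
        ≤ ‖l‖ ^ m * (SchwartzMap.seminorm ℂ k n (a l) + SchwartzMap.seminorm ℂ k n (b l)) := by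
          gcongr; exact map_add_le_add _ _ _
      _ ≤ C + D := by rw [mul_add]; exact add_le_add (hC l) (hD l)
  smul_mem' := by
    intro c a ha k n m
    obtain ⟨C, hC⟩ := ha k n m
    refine ⟨‖c‖ * C, fun l => ?_⟩
    calc ‖l‖ ^ m * SchwartzMap.seminorm ℂ k n (c • a l)
        = ‖c‖ * (‖l‖ ^ m * SchwartzMap.seminorm ℂ k n (a l)) := by rw [map_smul_eq_mul]; ring
      _ ≤ ‖c‖ * C := by gcongr; exact hC l

/-- The Schwartz space `𝓢(V × Λ)`. -/
def SX (Λ : Submodule ℤ (V g)) : Type := schwartzVL Λ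

namespace SX

instance : AddCommGroup (SX Λ) := inferInstanceAs (AddCommGroup (schwartzVL Λ))
instance : Module ℂ (SX Λ) := inferInstanceAs (Module ℂ (schwartzVL Λ))
instance : FunLike (SX Λ) Λ 𝓢(V g, ℂ) := ⟨fun a => a.1, fun _ _ h => Subtype.ext h⟩

theorem ext {a b : SX Λ} (h : ∀ l z, a l z = b l z) : a = b :=
  DFunLike.ext _ _ fun l => SchwartzMap.ext (h l)

@[simp] theorem add_apply (a b : SX Λ) (l : Λ) : (a + b) l = a l + b l := rfl
@[simp] theorem zero_apply (l : Λ) : (0 : SX Λ) l = 0 := rfl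
@[simp] theorem smul_apply (c : ℂ) (a : SX Λ) (l : Λ) : (c • a) l = c • a l := rfl

theorem decay (φ : SX Λ) (k n m : ℕ) :
    ∃ C : ℝ, ∀ l : Λ, ‖l‖ ^ m * SchwartzMap.seminorm ℂ k n (φ l) ≤ C := φ.2 k n m

theorem bound (φ : SX Λ) (k n m : ℕ) :
    ∃ C : ℝ, 0 ≤ C ∧ ∀ l : Λ, (1 + ‖l‖) ^ m * SchwartzMap.seminorm ℂ k n (φ l) ≤ C := by
  obtain ⟨C, hC⟩ := φ.decay k n 0
  obtain ⟨D, hD⟩ := φ.decay k n m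
  have h : ∀ l : Λ, (1 + ‖l‖) ^ m * SchwartzMap.seminorm ℂ k n (φ l) ≤ 2 ^ (m - 1) * (C + D) :=
    fun l => one_add_pow_le' m (norm_nonneg _) (apply_nonneg _ _) (by simpa using hC l) (hD l)
  exact ⟨_, le_trans (by positivity) (h 0), h⟩

/-- The seminorms `sup_{z, l} ‖l‖^m ‖z‖^k ‖D_z^n φ(z, l)‖` of `𝓢(V × Λ)`. -/
def seminorm (Λ : Submodule ℤ (V g)) (i : ℕ × ℕ × ℕ) : Seminorm ℂ (SX Λ) :=
  Seminorm.ofSMulLE (fun φ => ⨆ l : Λ, ‖l‖ ^ i.2.2 * SchwartzMap.seminorm ℂ i.1 i.2.1 (φ l))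
    (by simp)
    (fun φ ψ => by
      have bd : ∀ χ : SX Λ, BddAbove (Set.range fun l : Λ =>
          ‖l‖ ^ i.2.2 * SchwartzMap.seminorm ℂ i.1 i.2.1 (χ l)) := fun χ => by
        obtain ⟨C, hC⟩ := χ.decay i.1 i.2.1 i.2.2
        exact ⟨C, by rintro _ ⟨l, rfl⟩; exact hC l⟩
      refine ciSup_le fun l => ?_
      refine le_trans ?_ (add_le_add (le_ciSup (bd φ) l) (le_ciSup (bd ψ) l))
      rw [← mul_add]
      gcongr
      exact map_add_le_add _ _ _)
    (fun c φ => by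
      have bd : BddAbove (Set.range fun l : Λ =>
          ‖l‖ ^ i.2.2 * SchwartzMap.seminorm ℂ i.1 i.2.1 (φ l)) := by
        obtain ⟨C, hC⟩ := φ.decay i.1 i.2.1 i.2.2
        exact ⟨C, by rintro _ ⟨l, rfl⟩; exact hC l⟩
      refine ciSup_le fun l => ?_
      calc ‖l‖ ^ i.2.2 * SchwartzMap.seminorm ℂ i.1 i.2.1 (c • φ l)
          = ‖c‖ * (‖l‖ ^ i.2.2 * SchwartzMap.seminorm ℂ i.1 i.2.1 (φ l)) := by
            rw [map_smul_eq_mul]; ring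
        _ ≤ _ := by gcongr; exact le_ciSup bd l)

instance : TopologicalSpace (SX Λ) :=
  (SeminormFamily.moduleFilterBasis (𝕜 := ℂ) (F := SX Λ) (seminorm Λ)).topology

theorem withSeminorms : WithSeminorms (𝕜 := ℂ) (E := SX Λ) (seminorm Λ) := ⟨rfl⟩

instance : IsTopologicalAddGroup (SX Λ) := (withSeminorms (Λ := Λ)).topologicalAddGroup
instance : ContinuousSMul ℂ (SX Λ) := (withSeminorms (Λ := Λ)).continuousSMul

end SX

theorem schwartz_seminorm_clm (T : 𝓢(V g, ℂ) →L[ℂ] 𝓢(V g, ℂ)) (k n : ℕ) :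
    ∃ (s : Finset (ℕ × ℕ)) (C : ℝ), 0 ≤ C ∧ ∀ f, SchwartzMap.seminorm ℂ k n (T f) ≤
      C * ∑ i ∈ s, SchwartzMap.seminorm ℂ i.1 i.2 f := by
  have hc : Continuous ((SchwartzMap.seminorm ℂ k n).comp T.toLinearMap) :=
    ((schwartz_withSeminorms ℂ (V g) ℂ).continuous_seminorm (k, n)).comp T.continuous
  obtain ⟨s, C, -, h⟩ := Seminorm.bound_of_continuous (schwartz_withSeminorms ℂ (V g) ℂ) _ hc
  refine ⟨s, C, C.2, fun f => ?_⟩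
  refine (h f).trans ?_
  rw [smul_apply, NNReal.smul_def, smul_eq_mul]
  gcongr
  have := Seminorm.finset_sup_le_sum (schwartzSeminormFamily ℂ (V g) ℂ) s f
  refine this.trans (le_of_eq ?_)
  rw [_root_.sum_apply]
  rfl

/-- A continuous operator on `𝓢(V)`, applied on each slice `V × {l}`. -/
def SX.map (T : 𝓢(V g, ℂ) →L[ℂ] 𝓢(V g, ℂ)) : SX Λ →ₗ[ℂ] SX Λ where
  toFun φ := ⟨fun l => T (φ l), fun k n m => by
    obtain ⟨s, C, hC0, hC⟩ := schwartz_seminorm_clm T k n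
    choose D hD using fun i : ℕ × ℕ => φ.decay i.1 i.2 m
    refine ⟨C * ∑ i ∈ s, D i, fun l => ?_⟩
    calc ‖l‖ ^ m * SchwartzMap.seminorm ℂ k n (T (φ l))
        ≤ ‖l‖ ^ m * (C * ∑ i ∈ s, SchwartzMap.seminorm ℂ i.1 i.2 (φ l)) := by
          gcongr; exact hC _
      _ = C * ∑ i ∈ s, ‖l‖ ^ m * SchwartzMap.seminorm ℂ i.1 i.2 (φ l) := by
          rw [Finset.mul_sum, Finset.mul_sum, Finset.mul_sum]
          exact Finset.sum_congr rfl fun i _ => by ring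
      _ ≤ C * ∑ i ∈ s, D i := by
          gcongr with i _
          exact hD i l⟩
  map_add' φ ψ := by
    refine DFunLike.ext _ _ fun l => ?_
    exact map_add T _ _
  map_smul' c φ := by
    refine DFunLike.ext _ _ fun l => ?_
    exact map_smul T _ _

@[simp] theorem SX.map_apply (T : 𝓢(V g, ℂ) →L[ℂ] 𝓢(V g, ℂ)) (φ : SX Λ) (l : Λ) :
    SX.map T φ l = T (φ l) := rfl

/-- Multiplication by a function of `l ∈ Λ` that is the restriction of an `ℝ`-linear function. -/
def SX.mulLin (c : V g →L[ℝ] ℂ) : SX Λ →ₗ[ℂ] SX Λ where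
  toFun φ := ⟨fun l => c (l : V g) • φ l, fun k n m => by
    obtain ⟨D, hD⟩ := φ.decay k n (m + 1)
    refine ⟨‖c‖ * D, fun l => ?_⟩
    rw [map_smul_eq_mul]
    have h1 : ‖c (l : V g)‖ ≤ ‖c‖ * ‖l‖ := c.le_opNorm _
    calc ‖l‖ ^ m * (‖c (l : V g)‖ * SchwartzMap.seminorm ℂ k n (φ l))
        ≤ ‖l‖ ^ m * ((‖c‖ * ‖l‖) * SchwartzMap.seminorm ℂ k n (φ l)) := by gcongr
      _ = ‖c‖ * (‖l‖ ^ (m + 1) * SchwartzMap.seminorm ℂ k n (φ l)) := by ring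
      _ ≤ ‖c‖ * D := by gcongr; exact hD l⟩
  map_add' φ ψ := by
    refine DFunLike.ext _ _ fun l => ?_
    exact smul_add _ _ _
  map_smul' a φ := by
    refine DFunLike.ext _ _ fun l => ?_
    exact smul_comm (c (l : V g)) a (φ l)

@[simp] theorem SX.mulLin_apply (c : V g →L[ℝ] ℂ) (φ : SX Λ) (l : Λ) :
    SX.mulLin c φ l = c (l : V g) • φ l := rfl

theorem iteratedDeriv_circle (n : ℕ) :
    iteratedDeriv n (fun t : ℝ => Complex.exp (2 * Real.pi * Complex.I * t)) =
      fun t : ℝ => (2 * Real.pi * Complex.I) ^ n * Complex.exp (2 * Real.pi * Complex.I * t) := by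
  induction n with
  | zero => simp
  | succ n ih =>
    rw [iteratedDeriv_succ, ih]
    ext t
    have h : HasDerivAt (fun t : ℝ => (2 * Real.pi * Complex.I * t : ℂ))
        (2 * Real.pi * Complex.I) t := by
      simpa using (Complex.ofRealCLM.hasDerivAt (x := t)).const_mul (2 * Real.pi * Complex.I : ℂ)
    rw [((h.cexp).const_mul _).deriv]
    ring

theorem norm_iteratedFDeriv_sigma (B : V g →L[ℝ] V g →L[ℝ] ℝ) (u z : V g) (n : ℕ) :
    ‖iteratedFDeriv ℝ n (sigma B u) z‖ ≤ (2 * Real.pi * (‖B‖ * ‖u‖)) ^ n := by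
  have hs : ContDiff ℝ ∞ (fun t : ℝ => Complex.exp (2 * Real.pi * Complex.I * t)) := by
    have : ContDiff ℝ ∞ (fun t : ℝ => (t : ℂ)) := Complex.ofRealCLM.contDiff
    fun_prop
  have h := (B u).iteratedFDeriv_comp_right hs z (i := n) (mod_cast le_top)
  have e : (fun t : ℝ => Complex.exp (2 * Real.pi * Complex.I * t)) ∘ (B u) = sigma B u := rfl
  rw [e] at h
  rw [h]
  refine (ContinuousMultilinearMap.norm_compContinuousLinearMap_le _ _).trans ?_
  rw [norm_iteratedFDeriv_eq_norm_iteratedDeriv, iteratedDeriv_circle]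
  have h1 : ‖Complex.exp (2 * Real.pi * Complex.I * ((B u z : ℝ) : ℂ))‖ = 1 := norm_sigma B u z
  have h2 : ‖(2 * Real.pi * Complex.I : ℂ)‖ = 2 * Real.pi := by
    simp [abs_of_pos Real.pi_pos]
  rw [norm_mul, norm_pow, h1, h2, mul_one, Finset.prod_const, Finset.card_univ, Fintype.card_fin,
    ← mul_pow]
  gcongr
  exact B.le_opNorm u

theorem contDiff_sigma (B : V g →L[ℝ] V g →L[ℝ] ℝ) (u : V g) : ContDiff ℝ ∞ (sigma B u) := by
  have : ContDiff ℝ ∞ (fun z => ((B u z : ℝ) : ℂ)) := (Complex.ofRealCLM.comp (B u)).contDiff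
  unfold sigma
  fun_prop

theorem hasTemperateGrowth_sigma (B : V g →L[ℝ] V g →L[ℝ] ℝ) (u : V g) :
    Function.HasTemperateGrowth (sigma B u) :=
  ⟨contDiff_sigma B u, fun n => ⟨0, _, fun z => by
    simpa using norm_iteratedFDeriv_sigma B u z n⟩⟩

/-- Multiplication of a Schwartz function by `z ↦ σ(u, z)`. -/
def gauge (B : V g →L[ℝ] V g →L[ℝ] ℝ) (u : V g) : 𝓢(V g, ℂ) →L[ℂ] 𝓢(V g, ℂ) :=
  SchwartzMap.smulLeftCLM ℂ (sigma B u)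

@[simp] theorem gauge_apply (u z : V g) (f : 𝓢(V g, ℂ)) : gauge B u f z = sigma B u z * f z :=
  SchwartzMap.smulLeftCLM_apply_apply (hasTemperateGrowth_sigma B u) f z

theorem gauge_bound (B : V g →L[ℝ] V g →L[ℝ] ℝ) (k n : ℕ) :
    ∃ C : ℝ, 0 ≤ C ∧ ∀ (u : V g) (f : 𝓢(V g, ℂ)), SchwartzMap.seminorm ℂ k n (gauge B u f) ≤
      C * (1 + ‖u‖) ^ n * ∑ i ∈ Finset.range (n + 1), SchwartzMap.seminorm ℂ k i f := by
  let K : ℝ := 1 + 2 * Real.pi * ‖B‖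
  have hK : 1 ≤ K := by
    have : 0 ≤ 2 * Real.pi * ‖B‖ := by positivity
    simp only [K]; linarith
  refine ⟨2 ^ n * K ^ n, by positivity, fun u f => ?_⟩
  refine SchwartzMap.seminorm_le_bound ℂ k n _ (by positivity) fun z => ?_
  have he : (⇑(gauge B u f) : V g → ℂ) = fun z => sigma B u z * f z := by
    ext z; exact gauge_apply u z f
  rw [he]
  have h1 := norm_iteratedFDeriv_mul_le (contDiff_sigma B u) (f.smooth ⊤) z (n := n)
    (mod_cast le_top)
  have h2 : ∀ i ∈ Finset.range (n + 1), ‖z‖ ^ k * ((n.choose i : ℝ) *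
      ‖iteratedFDeriv ℝ i (sigma B u) z‖ * ‖iteratedFDeriv ℝ (n - i) f z‖) ≤
      2 ^ n * K ^ n * (1 + ‖u‖) ^ n * SchwartzMap.seminorm ℂ k (n - i) f := by
    intro i hi
    have hi' : i ≤ n := Nat.lt_succ_iff.mp (Finset.mem_range.mp hi)
    have c1 : (n.choose i : ℝ) ≤ 2 ^ n := by
      exact_mod_cast Nat.choose_le_two_pow n i
    have c2 : ‖iteratedFDeriv ℝ i (sigma B u) z‖ ≤ K ^ n * (1 + ‖u‖) ^ n := by
      refine (norm_iteratedFDeriv_sigma B u z i).trans ?_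
      rw [← mul_pow]
      have : 2 * Real.pi * (‖B‖ * ‖u‖) ≤ K * (1 + ‖u‖) := by
        have h3 : 0 ≤ 2 * Real.pi * ‖B‖ := by positivity
        have h4 := norm_nonneg u
        simp only [K]; nlinarith
      refine (pow_le_pow_left₀ (by positivity) this i).trans ?_
      refine pow_le_pow_right₀ ?_ hi'
      have h4 := norm_nonneg u
      nlinarith
    have c3 := SchwartzMap.le_seminorm ℂ k (n - i) f z
    calc ‖z‖ ^ k * ((n.choose i : ℝ) *
      ‖iteratedFDeriv ℝ i (sigma B u) z‖ * ‖iteratedFDeriv ℝ (n - i) f z‖)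
        = (n.choose i : ℝ) * ‖iteratedFDeriv ℝ i (sigma B u) z‖ *
          (‖z‖ ^ k * ‖iteratedFDeriv ℝ (n - i) f z‖) := by ring
      _ ≤ 2 ^ n * (K ^ n * (1 + ‖u‖) ^ n) * SchwartzMap.seminorm ℂ k (n - i) f := by gcongr
      _ = _ := by ring
  calc ‖z‖ ^ k * ‖iteratedFDeriv ℝ n (fun z => sigma B u z * f z) z‖
      ≤ ‖z‖ ^ k * _ := by gcongr
    _ = _ := Finset.mul_sum _ _ _
    _ ≤ _ := Finset.sum_le_sum h2
    _ = 2 ^ n * K ^ n * (1 + ‖u‖) ^ n *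
        ∑ i ∈ Finset.range (n + 1), SchwartzMap.seminorm ℂ k (n - i) f := by rw [Finset.mul_sum]
    _ = _ := by
      congr 1
      exact Finset.sum_range_reflect (fun i => SchwartzMap.seminorm ℂ k i f) (n + 1)

theorem gauge_bound' (φ : SX Λ) (k n m : ℕ) :
    ∃ C : ℝ, 0 ≤ C ∧ ∀ (u : V g) (l : Λ), (1 + ‖l‖) ^ m *
      SchwartzMap.seminorm ℂ k n (gauge B u (φ l)) ≤ C * (1 + ‖u‖) ^ n := by
  obtain ⟨C, hC0, hC⟩ := gauge_bound B k n
  choose D hD0 hD using fun i => φ.bound k i m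
  refine ⟨C * ∑ i ∈ Finset.range (n + 1), D i,
    mul_nonneg hC0 (Finset.sum_nonneg fun i _ => hD0 i), fun u l => ?_⟩
  calc (1 + ‖l‖) ^ m * SchwartzMap.seminorm ℂ k n (gauge B u (φ l))
      ≤ (1 + ‖l‖) ^ m * (C * (1 + ‖u‖) ^ n *
        ∑ i ∈ Finset.range (n + 1), SchwartzMap.seminorm ℂ k i (φ l)) := by gcongr; exact hC u _
    _ = C * (∑ i ∈ Finset.range (n + 1), (1 + ‖l‖) ^ m * SchwartzMap.seminorm ℂ k i (φ l)) *
        (1 + ‖u‖) ^ n := by rw [← Finset.mul_sum]; ring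
    _ ≤ _ := by
      gcongr with i _
      exact hD i l

/-- The sum of a family of Schwartz functions all of whose seminorms are summable. -/
def schwartzSum {ι : Type*} (h : ι → 𝓢(V g, ℂ))
    (hs : ∀ k n, Summable fun i => SchwartzMap.seminorm ℂ k n (h i)) : 𝓢(V g, ℂ) where
  toFun z := ∑' i, h i z
  smooth' := contDiff_tsum (v := fun n i => SchwartzMap.seminorm ℂ 0 n (h i))
    (fun i => (h i).smooth ⊤) (fun n _ => hs 0 n)
    (fun n i z _ => SchwartzMap.norm_iteratedFDeriv_le_seminorm ℂ (h i) n z)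
  decay' k n := by
    refine ⟨∑' i, SchwartzMap.seminorm ℂ k n (h i), fun z => ?_⟩
    rw [iteratedFDeriv_tsum_apply (N := ⊤) (v := fun n i => SchwartzMap.seminorm ℂ 0 n (h i))
      (fun i => (h i).smooth ⊤) (fun n _ => hs 0 n)
      (fun n i z _ => SchwartzMap.norm_iteratedFDeriv_le_seminorm ℂ (h i) n z) le_top]
    rw [← norm_norm z, ← norm_pow, ← norm_smul, ← tsum_const_smul'']
    refine tsum_of_norm_bounded (hs k n).hasSum fun i => ?_
    rw [norm_smul, norm_pow, norm_norm]
    exact SchwartzMap.le_seminorm ℂ k n (h i) z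

@[simp] theorem schwartzSum_apply {ι : Type*} (h : ι → 𝓢(V g, ℂ))
    (hs : ∀ k n, Summable fun i => SchwartzMap.seminorm ℂ k n (h i)) (z : V g) :
    schwartzSum h hs z = ∑' i, h i z := rfl

theorem seminorm_schwartzSum {ι : Type*} (h : ι → 𝓢(V g, ℂ))
    (hs : ∀ k n, Summable fun i => SchwartzMap.seminorm ℂ k n (h i)) (k n : ℕ) :
    SchwartzMap.seminorm ℂ k n (schwartzSum h hs) ≤ ∑' i, SchwartzMap.seminorm ℂ k n (h i) := by
  refine SchwartzMap.seminorm_le_bound ℂ k n _ (tsum_nonneg fun i => apply_nonneg _ _) fun z => ?_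
  have e : (⇑(schwartzSum h hs) : V g → ℂ) = fun z => ∑' i, h i z := rfl
  rw [e, iteratedFDeriv_tsum_apply (N := ⊤) (v := fun n i => SchwartzMap.seminorm ℂ 0 n (h i))
    (fun i => (h i).smooth ⊤) (fun n _ => hs 0 n)
    (fun n i z _ => SchwartzMap.norm_iteratedFDeriv_le_seminorm ℂ (h i) n z) le_top]
  rw [← norm_norm z, ← norm_pow, ← norm_smul, ← tsum_const_smul'']
  refine tsum_of_norm_bounded (hs k n).hasSum fun i => ?_
  rw [norm_smul, norm_pow, norm_norm]
  exact SchwartzMap.le_seminorm ℂ k n (h i) z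

theorem fderiv_schwartzSum {ι : Type*} (h : ι → 𝓢(V g, ℂ))
    (hs : ∀ k n, Summable fun i => SchwartzMap.seminorm ℂ k n (h i)) (v z : V g) :
    (∂_{v} (schwartzSum h hs)) z = ∑' i, (∂_{v} (h i)) z := by
  have b : ∀ i z, ‖fderiv ℝ (h i) z‖ ≤ SchwartzMap.seminorm ℂ 0 1 (h i) := fun i z => by
    have := SchwartzMap.norm_iteratedFDeriv_le_seminorm ℂ (h i) 1 z
    rwa [norm_iteratedFDeriv_one] at this
  have h0 : Summable fun i => h i 0 := Summable.of_norm_bounded (hs 0 0) fun i =>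
    SchwartzMap.norm_le_seminorm ℂ (h i) 0
  have hd := hasFDerivAt_tsum (hs 0 1) (fun i z => (h i).hasFDerivAt z) b h0 z
  have e : (⇑(schwartzSum h hs) : V g → ℂ) = fun z => ∑' i, h i z := rfl
  rw [SchwartzMap.lineDerivOp_apply_eq_fderiv, e, hd.fderiv]
  have hs' : Summable fun i => fderiv ℝ (h i) z :=
    Summable.of_norm_bounded (hs 0 1) fun i => b i z
  exact (ContinuousLinearMap.apply ℝ ℂ v).map_tsum hs'

/-- The function `z ↦ a(m) σ(m, z + l) φ(z, l + m)`, i.e. `a(m) (φ · [m])(z, l)`. -/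
def actTerm (φ : SX Λ) (a : TwAlg Λ B) (l m : Λ) : 𝓢(V g, ℂ) :=
  (a m * sigma B (m : V g) (l : V g)) • gauge B (m : V g) (φ (l + m))

theorem actTerm_apply (φ : SX Λ) (a : TwAlg Λ B) (l m : Λ) (z : V g) :
    actTerm φ a l m z = a m * (sigma B (m : V g) (z + (l : V g)) * φ (l + m) z) := by
  simp only [actTerm, smul_apply, gauge_apply, smul_eq_mul, sigma_add_right]
  ring

theorem actTerm_bound (φ : SX Λ) (a : TwAlg Λ B) (k n p : ℕ) :
    ∃ C : ℝ, 0 ≤ C ∧ ∀ l m : Λ, (1 + ‖l‖) ^ p * SchwartzMap.seminorm ℂ k n (actTerm φ a l m) ≤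
      C * ((1 + ‖m‖) ^ (n + p) * ‖a m‖) := by
  obtain ⟨C, hC0, hC⟩ := gauge_bound' (B := B) φ k n p
  refine ⟨C, hC0, fun l m => ?_⟩
  have h1 : (1 + ‖l‖) ^ p ≤ (1 + ‖l + m‖) ^ p * (1 + ‖m‖) ^ p := by
    have := peetre (l + m) (-m) p
    rwa [add_neg_cancel_right, norm_neg] at this
  rw [actTerm, map_smul_eq_mul, norm_mul, norm_sigma, mul_one]
  calc (1 + ‖l‖) ^ p * (‖a m‖ * SchwartzMap.seminorm ℂ k n (gauge B (m : V g) (φ (l + m))))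
      ≤ ((1 + ‖l + m‖) ^ p * (1 + ‖m‖) ^ p) *
        (‖a m‖ * SchwartzMap.seminorm ℂ k n (gauge B (m : V g) (φ (l + m)))) := by gcongr
    _ = ((1 + ‖l + m‖) ^ p * SchwartzMap.seminorm ℂ k n (gauge B (m : V g) (φ (l + m)))) *
        ((1 + ‖m‖) ^ p * ‖a m‖) := by ring
    _ ≤ (C * (1 + ‖(m : V g)‖) ^ n) * ((1 + ‖m‖) ^ p * ‖a m‖) :=
        mul_le_mul_of_nonneg_right (hC _ _) (by positivity)
    _ = _ := by rw [Submodule.coe_norm, pow_add]; ring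

section
variable [DiscreteTopology Λ]

theorem actTerm_summable (φ : SX Λ) (a : TwAlg Λ B) (l : Λ) (k n : ℕ) :
    Summable fun m : Λ => SchwartzMap.seminorm ℂ k n (actTerm φ a l m) := by
  obtain ⟨C, hC0, hC⟩ := actTerm_bound φ a k n 0
  exact Summable.of_nonneg_of_le (fun m => apply_nonneg _ _) (fun m => by simpa using hC l m)
    ((a.summable_weight (n + 0)).mul_left C)

/-- The right action of the twisted group algebra on `𝓢(V × Λ)`, determined by
`(φ · [m])(z, l) = σ(m, z + l) φ(z, l + m)`. -/
def act (φ : SX Λ) (a : TwAlg Λ B) : SX Λ :=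
  ⟨fun l => schwartzSum (actTerm φ a l) (actTerm_summable φ a l), fun k n p => by
    obtain ⟨C, hC0, hC⟩ := actTerm_bound φ a k n p
    refine ⟨∑' m : Λ, C * ((1 + ‖m‖) ^ (n + p) * ‖a m‖), fun l => ?_⟩
    calc ‖l‖ ^ p * SchwartzMap.seminorm ℂ k n (schwartzSum (actTerm φ a l) (actTerm_summable φ a l))
        ≤ (1 + ‖l‖) ^ p * ∑' m : Λ, SchwartzMap.seminorm ℂ k n (actTerm φ a l m) := by
          gcongr
          · linarith [norm_nonneg l]
          · exact seminorm_schwartzSum _ _ k n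
      _ = ∑' m : Λ, (1 + ‖l‖) ^ p * SchwartzMap.seminorm ℂ k n (actTerm φ a l m) :=
          tsum_mul_left.symm
      _ ≤ _ := Summable.tsum_le_tsum (hC l) ((actTerm_summable φ a l k n).mul_left _)
          ((a.summable_weight (n + p)).mul_left C)⟩

theorem act_apply (φ : SX Λ) (a : TwAlg Λ B) (l : Λ) (z : V g) :
    act φ a l z = ∑' m : Λ, a m * (sigma B (m : V g) (z + (l : V g)) * φ (l + m) z) :=
  tsum_congr fun m => actTerm_apply φ a l m z

theorem act_summable (φ : SX Λ) (a : TwAlg Λ B) (l : Λ) (z : V g) :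
    Summable fun m : Λ => a m * (sigma B (m : V g) (z + (l : V g)) * φ (l + m) z) := by
  simp only [← actTerm_apply]
  exact Summable.of_norm_bounded (actTerm_summable φ a l 0 0)
    fun m => SchwartzMap.norm_le_seminorm ℂ _ z

theorem act_act (φ : SX Λ) (a b : TwAlg Λ B) : act (act φ a) b = act φ (a * b) := by
  refine SX.ext fun l z => ?_
  let F : Λ × Λ → ℂ := fun p => a p.1 * b (p.2 - p.1) *
    (sigma B (p.1 : V g) ((p.2 - p.1 : Λ) : V g) *
      (sigma B (p.2 : V g) (z + (l : V g)) * φ (l + p.2) z))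
  have hF : Summable F := by
    obtain ⟨C, hC0, hC⟩ := φ.bound 0 0 0
    have h1 : Summable fun p : Λ × Λ => ‖a p.1‖ * ‖b p.2‖ :=
      a.summable_norm.mul_of_nonneg b.summable_norm (fun _ => norm_nonneg _) (fun _ => norm_nonneg _)
    let e : Λ × Λ ≃ Λ × Λ := ⟨fun p => (p.1, p.2 - p.1), fun p => (p.1, p.2 + p.1),
      fun p => by simp, fun p => by simp⟩
    have h2 : Summable fun p : Λ × Λ => ‖a p.1‖ * ‖b (p.2 - p.1)‖ := (e.summable_iff).2 h1
    refine Summable.of_norm_bounded (h2.mul_left C) fun p => ?_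
    simp only [F, norm_mul, norm_sigma, one_mul]
    rw [mul_comm]
    gcongr
    refine (SchwartzMap.norm_le_seminorm ℂ _ z).trans ?_
    simpa using hC (l + p.2)
  have hF' : Summable (Function.uncurry fun (k l : Λ) => F (l, k)) :=
    ((Equiv.prodComm Λ Λ).summable_iff).2 hF
  have hF'' : Summable (Function.uncurry fun (k m : Λ) => F (m, m + k)) := by
    let e : Λ × Λ ≃ Λ × Λ := ⟨fun p => (p.2, p.2 + p.1), fun p => (p.2 - p.1, p.1),
      fun p => by simp, fun p => by simp⟩
    exact (e.summable_iff).2 hF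
  calc act (act φ a) b l z = ∑' k : Λ, ∑' m : Λ, F (m, m + k) := by
        rw [act_apply]
        refine tsum_congr fun k => ?_
        rw [act_apply, ← tsum_mul_left, ← tsum_mul_left]
        refine tsum_congr fun m => ?_
        simp only [F, add_sub_cancel_left]
        have h := sigma_assoc B (m : V g) (k : V g) (z + (l : V g))
        have e1 : z + ((l + k : Λ) : V g) = (k : V g) + (z + (l : V g)) := by push_cast; abel
        have e2 : l + k + m = l + (m + k) := by abel
        rw [e1, e2, Submodule.coe_add]
        linear_combination (- (a m * b k * φ (l + (m + k)) z)) * h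
    _ = ∑' m : Λ, ∑' k : Λ, F (m, m + k) := hF''.tsum_comm.symm
    _ = ∑' m : Λ, ∑' k : Λ, F (m, k) :=
        tsum_congr fun m => (Equiv.addLeft m).tsum_eq fun k => F (m, k)
    _ = ∑' k : Λ, ∑' m : Λ, F (m, k) := hF'.tsum_comm
    _ = act φ (a * b) l z := by
        rw [act_apply]
        refine tsum_congr fun k => ?_
        rw [TwAlg.mul_apply, ← tsum_mul_right]
        refine tsum_congr fun m => ?_
        simp only [F]; ring

/-- `𝓢(V × Λ)` as a right module over the twisted group algebra. -/
instance instModuleSX : Module (TwAlg Λ B)ᵐᵒᵖ (SX Λ) where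
  smul a φ := act φ a.unop
  one_smul φ := by
    refine SX.ext fun l z => ?_
    change act φ (1 : TwAlg Λ B) l z = _
    rw [act_apply, tsum_eq_single 0]
    · simp [TwAlg.one_apply]
    · intro m hm; simp [TwAlg.one_apply, hm]
  mul_smul a b φ := (act_act φ b.unop a.unop).symm
  smul_zero a := by
    refine SX.ext fun l z => ?_
    change act (0 : SX Λ) a.unop l z = _
    rw [act_apply]; simp
  smul_add a φ ψ := by
    refine SX.ext fun l z => ?_
    change act (φ + ψ) a.unop l z = act φ a.unop l z + act ψ a.unop l z
    simp only [act_apply]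
    rw [← (act_summable φ a.unop l z).tsum_add (act_summable ψ a.unop l z)]
    exact tsum_congr fun m => by simp; ring
  add_smul a b φ := by
    refine SX.ext fun l z => ?_
    change act φ (a.unop + b.unop) l z = act φ a.unop l z + act φ b.unop l z
    simp only [act_apply]
    rw [← (act_summable φ a.unop l z).tsum_add (act_summable φ b.unop l z)]
    exact tsum_congr fun m => by simp; ring
  zero_smul φ := by
    refine SX.ext fun l z => ?_
    change act φ (0 : TwAlg Λ B) l z = _
    rw [act_apply]; simp

theorem op_smul_apply (a : TwAlg Λ B) (φ : SX Λ) (l : Λ) (z : V g) :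
    (MulOpposite.op a • φ) l z =
      ∑' m : Λ, a m * (sigma B (m : V g) (z + (l : V g)) * φ (l + m) z) := act_apply φ a l z

instance : IsScalarTower ℂ (TwAlg Λ B)ᵐᵒᵖ (SX Λ) := ⟨fun c a φ => by
  refine SX.ext fun l z => ?_
  change act φ (c • a.unop) l z = c * act φ a.unop l z
  simp only [act_apply, ← tsum_mul_left]
  exact tsum_congr fun m => by simp; ring⟩

instance : SMulCommClass ℂ (TwAlg Λ B)ᵐᵒᵖ (SX Λ) := ⟨fun c a φ => by
  refine SX.ext fun l z => ?_
  change c * act φ a.unop l z = act (c • φ) a.unop l z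
  simp only [act_apply, ← tsum_mul_left]
  exact tsum_congr fun m => by simp; ring⟩

instance : SMulCommClass (TwAlg Λ B)ᵐᵒᵖ ℂ (SX Λ) := SMulCommClass.symm _ _ _

end

/-- The basis vector `e_j` of `V = ℂ^g`. -/
def stdVec (j : Fin g) : V g := EuclideanSpace.single j (1 : ℂ)

/-- `B_j(u)`, the coefficient of `z_j` in the real linear function
`z ↦ B(u, z) = ∑_j (B_j(u) z_j + conj (B_j(u) z_j))`. -/
def Bj (B : V g →L[ℝ] V g →L[ℝ] ℝ) (j : Fin g) : V g →L[ℝ] ℂ :=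
  (1 / 2 : ℂ) • (Complex.ofRealCLM.comp (B.flip (stdVec j)) -
    Complex.I • Complex.ofRealCLM.comp (B.flip (Complex.I • stdVec j)))

theorem Bj_apply (B : V g →L[ℝ] V g →L[ℝ] ℝ) (j : Fin g) (u : V g) :
    Bj B j u = (1 / 2) * (B u (stdVec j) - Complex.I * B u (Complex.I • stdVec j)) := rfl

theorem eq_sum_Bj (B : V g →L[ℝ] V g →L[ℝ] ℝ) (u z : V g) :
    ((B u z : ℝ) : ℂ) = ∑ j, (Bj B j u * z j + conj (Bj B j u * z j)) := by
  have hz : z = ∑ j, ((z j).re • stdVec j + (z j).im • (Complex.I • stdVec j)) := by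
    ext i
    simp [stdVec, Finset.sum_add_distrib, Pi.single_apply]
  conv_lhs => rw [hz]
  simp only [map_sum, map_add, map_smul, smul_eq_mul, Complex.ofReal_sum, Complex.ofReal_add,
    Complex.ofReal_mul]
  refine Finset.sum_congr rfl fun j _ => ?_
  rw [Bj_apply]
  apply Complex.ext <;> simp <;> ring

/-- The complex conjugate of `B_j`, i.e. the coefficient of `d\bar z_j` in the `(0,1)`-part
of the form `B(u, ·)`. -/
def BjConj (B : V g →L[ℝ] V g →L[ℝ] ℝ) (j : Fin g) : V g →L[ℝ] ℂ :=
  (Complex.conjCLE : ℂ →L[ℝ] ℂ).comp (Bj B j)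

@[simp] theorem BjConj_apply (B : V g →L[ℝ] V g →L[ℝ] ℝ) (j : Fin g) (u : V g) :
    BjConj B j u = conj (Bj B j u) := rfl

/-- The operator `∂/∂\bar z_j = (∂/∂x_j + i ∂/∂y_j) / 2` on `𝓢(V)`. -/
def dbar (j : Fin g) : 𝓢(V g, ℂ) →L[ℂ] 𝓢(V g, ℂ) :=
  (1 / 2 : ℂ) • (LineDeriv.lineDerivOpCLM ℂ 𝓢(V g, ℂ) (stdVec j) +
    Complex.I • LineDeriv.lineDerivOpCLM ℂ 𝓢(V g, ℂ) (Complex.I • stdVec j))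

theorem dbar_apply (j : Fin g) (f : 𝓢(V g, ℂ)) (z : V g) :
    dbar j f z = (1 / 2) * ((∂_{stdVec j} f) z + Complex.I * (∂_{Complex.I • stdVec j} f) z) := rfl

/-- Multiplication by the coordinate `z_j` on `𝓢(V)`. -/
def mulZ (j : Fin g) : 𝓢(V g, ℂ) →L[ℂ] 𝓢(V g, ℂ) :=
  SchwartzMap.smulLeftCLM ℂ (fun z : V g => z j)

theorem mulZ_apply (j : Fin g) (f : 𝓢(V g, ℂ)) (z : V g) : mulZ j f z = z j * f z := by
  have h : Function.HasTemperateGrowth (fun z : V g => z j) :=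
    ((EuclideanSpace.proj j : V g →L[ℂ] ℂ).restrictScalars ℝ).hasTemperateGrowth
  exact SchwartzMap.smulLeftCLM_apply_apply h f z

theorem lineDeriv_gauge (u v : V g) (f : 𝓢(V g, ℂ)) (z : V g) :
    (∂_{v} (gauge B u f)) z =
      sigma B u z * (2 * Real.pi * Complex.I * (B u v : ℝ) * f z + (∂_{v} f) z) := by
  have h1 : HasFDerivAt (fun z => (2 * Real.pi * Complex.I * (B u z : ℝ) : ℂ))
      ((2 * Real.pi * Complex.I : ℂ) • Complex.ofRealCLM.comp (B u)) z :=
    (Complex.ofRealCLM.comp (B u)).hasFDerivAt.const_mul (2 * Real.pi * Complex.I : ℂ)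
  have h2 := h1.cexp.mul (f.hasFDerivAt z)
  have e : (⇑(gauge B u f) : V g → ℂ) =
      (fun z => Complex.exp (2 * Real.pi * Complex.I * (B u z : ℝ))) * f := by
    ext z; exact gauge_apply u z f
  rw [SchwartzMap.lineDerivOp_apply_eq_fderiv, e, h2.fderiv,
    SchwartzMap.lineDerivOp_apply_eq_fderiv]
  simp [sigma]
  ring

theorem dbar_gauge (j : Fin g) (u : V g) (f : 𝓢(V g, ℂ)) (z : V g) :
    dbar j (gauge B u f) z =
      sigma B u z * (2 * Real.pi * Complex.I * conj (Bj B j u) * f z + dbar j f z) := by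
  have hc : conj (Bj B j u) =
      (1 / 2) * ((B u (stdVec j) : ℂ) + Complex.I * B u (Complex.I • stdVec j)) := by
    rw [Bj_apply]; simp [Complex.conj_ofNat]
  rw [dbar_apply, lineDeriv_gauge, lineDeriv_gauge, hc, dbar_apply]
  ring

theorem dbar_schwartzSum {ι : Type*} (j : Fin g) (h : ι → 𝓢(V g, ℂ))
    (hs : ∀ k n, Summable fun i => SchwartzMap.seminorm ℂ k n (h i)) (z : V g) :
    HasSum (fun i => dbar j (h i) z) (dbar j (schwartzSum h hs) z) := by
  have hd : ∀ v : V g, HasSum (fun i => (∂_{v} (h i)) z) ((∂_{v} (schwartzSum h hs)) z) := by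
    intro v
    rw [fderiv_schwartzSum]
    refine Summable.hasSum (Summable.of_norm_bounded ((hs 0 1).mul_right ‖v‖) fun i => ?_)
    rw [SchwartzMap.lineDerivOp_apply_eq_fderiv]
    refine (ContinuousLinearMap.le_opNorm _ _).trans ?_
    gcongr
    have := SchwartzMap.norm_iteratedFDeriv_le_seminorm ℂ (h i) 1 z
    rwa [norm_iteratedFDeriv_one] at this
  simp only [dbar_apply]
  exact ((hd _).add ((hd _).mul_left _)).mul_left _

/-- The operator `∂/∂\bar z_j + 2 π i conj (B_j(l))` on `𝓢(V × Λ)`. -/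
def covDbarL (Λ : Submodule ℤ (V g)) (B : V g →L[ℝ] V g →L[ℝ] ℝ) (j : Fin g) :
    SX Λ →ₗ[ℂ] SX Λ :=
  SX.map (dbar j) + (2 * Real.pi * Complex.I : ℂ) • SX.mulLin (BjConj B j)

theorem covDbarL_apply (j : Fin g) (φ : SX Λ) (l : Λ) (z : V g) : covDbarL Λ B j φ l z =
    dbar j (φ l) z + 2 * Real.pi * Complex.I * (conj (Bj B j (l : V g)) * φ l z) := rfl

section
variable [DiscreteTopology Λ]

/-- Multiplication by `z_j` on `𝓢(V × Λ)`, as a map of right modules. -/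
def zOp (Λ : Submodule ℤ (V g)) [DiscreteTopology Λ] (B : V g →L[ℝ] V g →L[ℝ] ℝ) (j : Fin g) :
    SX Λ →ₗ[(TwAlg Λ B)ᵐᵒᵖ] SX Λ :=
  { SX.map (mulZ j) with
    map_smul' := fun a φ => by
      refine SX.ext fun l z => ?_
      change mulZ j (act φ a.unop l) z = act (SX.map (mulZ j) φ) a.unop l z
      rw [mulZ_apply, act_apply, act_apply, ← tsum_mul_left]
      exact tsum_congr fun m => by rw [SX.map_apply, mulZ_apply]; ring }

theorem dbar_act (j : Fin g) (φ : SX Λ) (a : TwAlg Λ B) (l : Λ) (z : V g) :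
    HasSum (fun m : Λ => dbar j (actTerm φ a l m) z) (dbar j (act φ a l) z) :=
  dbar_schwartzSum j (actTerm φ a l) (actTerm_summable φ a l) z

theorem covDbarL_act (j : Fin g) (φ : SX Λ) (a : TwAlg Λ B) :
    covDbarL Λ B j (act φ a) = act (covDbarL Λ B j φ) a := by
  refine SX.ext fun l z => ?_
  have h := (dbar_act j φ a l z).add (((act_summable φ a l z).hasSum.mul_left
    (conj (Bj B j (l : V g)))).mul_left (2 * Real.pi * Complex.I : ℂ))
  rw [← act_apply, ← covDbarL_apply] at h
  rw [← h.tsum_eq, act_apply]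
  refine tsum_congr fun m => ?_
  rw [covDbarL_apply, actTerm, map_smul, smul_apply, smul_eq_mul, dbar_gauge, sigma_add_right,
    Submodule.coe_add, map_add (Bj B j), map_add (starRingEnd ℂ)]
  ring

/-- The operator `∂/∂\bar z_j + 2 π i conj (B_j(l))` on `𝓢(V × Λ)`, as a map of right modules. -/
def covDbar (Λ : Submodule ℤ (V g)) [DiscreteTopology Λ] (B : V g →L[ℝ] V g →L[ℝ] ℝ) (j : Fin g) :
    SX Λ →ₗ[(TwAlg Λ B)ᵐᵒᵖ] SX Λ :=
  { covDbarL Λ B j with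
    map_smul' := fun a φ => covDbarL_act j φ a.unop }

theorem zOp_apply (j : Fin g) (φ : SX Λ) (l : Λ) (z : V g) : zOp Λ B j φ l z = z j * φ l z :=
  mulZ_apply j (φ l) z

theorem covDbar_apply (j : Fin g) (φ : SX Λ) (l : Λ) (z : V g) : covDbar Λ B j φ l z =
    dbar j (φ l) z + 2 * Real.pi * Complex.I * (conj (Bj B j (l : V g)) * φ l z) := rfl

end

/-- `V_{1,0} ⊕ V^{0,1}`, where `V_{1,0}` has the basis `d\bar ζ_1, …, d\bar ζ_g` and `V^{0,1}` has
the basis `d\bar z_1, …, d\bar z_g`. -/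
abbrev Cov (g : ℕ) : Type := (Fin g → ℂ) × (Fin g → ℂ)

/-- `d\bar ζ_j`. -/
def dzeta (j : Fin g) : Cov g := (Pi.single j 1, 0)

/-- `d\bar z_j`. -/
def dzbar (j : Fin g) : Cov g := (0, Pi.single j 1)

/-- `Λ^• V_{1,0} ⊗ Λ^• V^{0,1} = Λ^• (V_{1,0} ⊕ V^{0,1})`. -/
abbrev Ext (g : ℕ) : Type := ExteriorAlgebra ℂ (Cov g)

/-- Left exterior multiplication by an element of `V_{1,0} ⊕ V^{0,1}`. -/
def wedge (v : Cov g) : Ext g →ₗ[ℂ] Ext g := LinearMap.mulLeft ℂ (ExteriorAlgebra.ι ℂ v)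

/-- `𝒳 = 𝓢(V × Λ; Λ^• V_{1,0} ⊗ Λ^• V^{0,1})`. -/
abbrev XForms (Λ : Submodule ℤ (V g)) : Type := SX Λ ⊗[ℂ] Ext g

section
variable (Λ) [DiscreteTopology Λ] (B)

/-- The operator `𝕏^0 = ∑_j 2 π i z_j d\bar ζ_j ∧ + d\bar z_j ∧ ∂/∂\bar z_j
+ 2 π i conj (B_j(l)) d\bar z_j ∧`. -/
def connX : XForms Λ →ₗ[(TwAlg Λ B)ᵐᵒᵖ] XForms Λ :=
  ∑ j : Fin g, ((2 * Real.pi * Complex.I : ℂ) •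
      TensorProduct.AlgebraTensorModule.map (zOp Λ B j) (wedge (dzeta j)) +
    TensorProduct.AlgebraTensorModule.map (covDbar Λ B j) (wedge (dzbar j)))

/-- The degree `k` part of `𝒳`. -/
def gr (k : ℕ) : Submodule (TwAlg Λ B)ᵐᵒᵖ (XForms Λ) :=
  LinearMap.range (TensorProduct.AlgebraTensorModule.map
    (LinearMap.id : SX Λ →ₗ[(TwAlg Λ B)ᵐᵒᵖ] SX Λ) (⋀[ℂ]^k (Cov g)).subtype)

/-- The `𝕏^0`-closed elements of degree `k`. -/
def cocycles (k : ℕ) : Submodule (TwAlg Λ B)ᵐᵒᵖ (XForms Λ) :=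
  LinearMap.ker (connX Λ B) ⊓ gr Λ B k

/-- The `𝕏^0`-exact elements of degree `k`. -/
def coboundaries : ℕ → Submodule (TwAlg Λ B)ᵐᵒᵖ (XForms Λ)
  | 0 => ⊥
  | k + 1 => (gr Λ B k).map (connX Λ B)

/-- The degree `k` cohomology of `(𝒳, 𝕏^0)`, as a right module over the twisted group algebra. -/
abbrev Cohomology (k : ℕ) : Type :=
  cocycles Λ B k ⧸ (coboundaries Λ B k).submoduleOf (cocycles Λ B k)

end

/-- The basis of `Λ^• (V_{1,0} ⊕ V^{0,1})` of the wedge monomials in the `d\bar ζ_j, d\bar z_j`. -/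
def extBasis (g : ℕ) : Module.Basis (Finset (Fin g ⊕ₗ Fin g)) ℂ (Ext g) :=
  (((Pi.basisFun ℂ (Fin g)).prod (Pi.basisFun ℂ (Fin g))).reindex toLex).ExteriorAlgebra

/-- The coefficient of an element of `𝒳` at a wedge monomial. -/
def coeff (I : Finset (Fin g ⊕ₗ Fin g)) : XForms Λ →ₗ[ℂ] SX Λ :=
  (TensorProduct.rid ℂ (SX Λ)).toLinearMap ∘ₗ LinearMap.lTensor (SX Λ) ((extBasis g).coord I)

/-- The Hermitian inner product on `𝒳`: the wedge monomials in the `d\bar ζ_j, d\bar z_j` are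
orthonormal, and functions on `V × Λ` are paired by Lebesgue measure times counting measure. -/
def innerX (φ ψ : XForms Λ) : ℂ :=
  ∑ I : Finset (Fin g ⊕ₗ Fin g), ∑' l : Λ, ∫ z : V g, conj (coeff I φ l z) * coeff I ψ l z

theorem poly_mul_gauss (N : ℕ) (r : ℝ) (hr : 0 ≤ r) :
    (1 + r) ^ N * Real.exp (-(2 * Real.pi * r ^ 2)) ≤ 2 ^ N * (N.factorial * Real.exp 1) := by
  have h1 : (1 + r) ^ N ≤ 2 ^ N * (1 + r ^ 2) ^ N := by
    rw [← mul_pow]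
    gcongr
    nlinarith [sq_nonneg (r - 1)]
  have h2 : (1 + r ^ 2) ^ N ≤ N.factorial * Real.exp (1 + r ^ 2) := by
    have := Real.pow_div_factorial_le_exp (1 + r ^ 2) (by positivity) N
    rwa [div_le_iff₀ (by positivity), mul_comm] at this
  have h3 : Real.exp (1 + r ^ 2) * Real.exp (-(2 * Real.pi * r ^ 2)) ≤ Real.exp 1 := by
    rw [← Real.exp_add]
    apply Real.exp_le_exp.2
    have := Real.pi_gt_three
    nlinarith [sq_nonneg r]
  calc (1 + r) ^ N * Real.exp (-(2 * Real.pi * r ^ 2))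
      ≤ (2 ^ N * (N.factorial * Real.exp (1 + r ^ 2))) * Real.exp (-(2 * Real.pi * r ^ 2)) := by
        gcongr
        exact h1.trans (by gcongr)
    _ = 2 ^ N * (N.factorial * (Real.exp (1 + r ^ 2) * Real.exp (-(2 * Real.pi * r ^ 2)))) := by
        ring
    _ ≤ _ := by gcongr

/-- The Gaussian `z ↦ exp (-2 π |z|^2)`. -/
def gaussR (g : ℕ) : 𝓢(V g, ℝ) where
  toFun z := Real.exp (-(2 * Real.pi * ‖z‖ ^ 2))
  smooth' := Real.contDiff_exp.comp ((contDiff_const.mul (contDiff_norm_sq ℝ)).neg)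
  decay' k n := by
    have ht : Function.HasTemperateGrowth (fun z : V g => -(2 * Real.pi * ‖z‖ ^ 2)) := by fun_prop
    obtain ⟨l, C, hC0, hC⟩ := ht.norm_iteratedFDeriv_le_uniform n
    refine ⟨n.factorial * (C + 1) ^ n *
      (2 ^ (k + l * n) * ((k + l * n).factorial * Real.exp 1)), fun z => ?_⟩
    have h1 : ‖iteratedFDeriv ℝ n (Real.exp ∘ fun z : V g => -(2 * Real.pi * ‖z‖ ^ 2)) z‖ ≤
        n.factorial * Real.exp (-(2 * Real.pi * ‖z‖ ^ 2)) * ((C + 1) * (1 + ‖z‖) ^ l) ^ n := by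
      refine norm_iteratedFDeriv_comp_le (N := ∞) Real.contDiff_exp ht.1
        (mod_cast le_top) z (fun i _ => ?_) (fun i hi1 hin => ?_)
      · rw [norm_iteratedFDeriv_eq_norm_iteratedDeriv, iteratedDeriv_eq_iterate,
          Real.iter_deriv_exp, Real.norm_of_nonneg (Real.exp_pos _).le]
      · refine (hC i hin z).trans ?_
        have h4 : 1 ≤ (1 + ‖z‖) ^ l := one_le_pow₀ (by linarith [norm_nonneg z])
        refine le_trans ?_ (le_self_pow₀ ?_ (by omega))
        · gcongr; linarith
        · nlinarith
    have h5 : ‖z‖ ^ k ≤ (1 + ‖z‖) ^ k := by gcongr; linarith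
    calc ‖z‖ ^ k * ‖iteratedFDeriv ℝ n (fun z : V g => Real.exp (-(2 * Real.pi * ‖z‖ ^ 2))) z‖
        ≤ (1 + ‖z‖) ^ k * (n.factorial * Real.exp (-(2 * Real.pi * ‖z‖ ^ 2)) *
          ((C + 1) * (1 + ‖z‖) ^ l) ^ n) := by gcongr; exact h1
      _ = n.factorial * (C + 1) ^ n *
          ((1 + ‖z‖) ^ (k + l * n) * Real.exp (-(2 * Real.pi * ‖z‖ ^ 2))) := by
          rw [mul_pow, ← pow_mul, pow_add]; ring
      _ ≤ _ := mul_le_mul_of_nonneg_left (poly_mul_gauss _ _ (norm_nonneg z)) (by positivity)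

theorem gauss_eq (B : V g →L[ℝ] V g →L[ℝ] ℝ) (u : V g) :
    (fun z : V g => Complex.exp (-2 * Real.pi * ((‖z‖ : ℂ) ^ 2 + ∑ j, Complex.I * (Bj B j u * z j) +
      ∑ j, Complex.I * conj (Bj B j u * z j)))) =
    ⇑(gauge B (-u) ((gaussR g).postcompCLM Complex.ofRealCLM)) := by
  ext z
  rw [gauge_apply, SchwartzMap.postcompCLM_apply]
  change _ = _ * ((Real.exp (-(2 * Real.pi * ‖z‖ ^ 2)) : ℝ) : ℂ)
  rw [sigma, Complex.ofReal_exp, ← Complex.exp_add, map_neg, neg_apply, Complex.ofReal_neg,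
    eq_sum_Bj, Finset.sum_add_distrib, ← Finset.mul_sum, ← Finset.mul_sum]
  congr 1
  push_cast
  ring

/-- The function `z ↦ exp (-2 π (|z|^2 + i ∑_j B_j(u) z_j + i ∑_j conj (B_j(u) z_j)))`. -/
def gauss (B : V g →L[ℝ] V g →L[ℝ] ℝ) (u : V g) : 𝓢(V g, ℂ) where
  toFun z := Complex.exp (-2 * Real.pi * ((‖z‖ : ℂ) ^ 2 + ∑ j, Complex.I * (Bj B j u * z j) +
    ∑ j, Complex.I * conj (Bj B j u * z j)))
  smooth' := by rw [gauss_eq]; exact SchwartzMap.smooth _ ⊤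
  decay' k n := by rw [gauss_eq]; exact SchwartzMap.decay' _ k n

open Classical in
/-- The deformed Gaussian `b_m`: on the slice `V × {m}` it is `gauss B m`, and it vanishes on the
other slices. -/
def bFun (B : V g →L[ℝ] V g →L[ℝ] ℝ) (m : Λ) : SX Λ :=
  ⟨Pi.single m (gauss B (m : V g)), fun k n p =>
    ⟨‖m‖ ^ p * SchwartzMap.seminorm ℂ k n (gauss B (m : V g)), fun l => by
      by_cases h : l = m
      · subst h; simp
      · simp only [Pi.single_apply, h, if_false, map_zero, mul_zero]
        positivity⟩⟩

/-- The covector `e^-_j = d\bar z_j - i d\bar ζ_j`. -/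
def eMinus (j : Fin g) : Cov g := dzbar j - Complex.I • dzeta j

/-- `e^-_1 ∧ ⋯ ∧ e^-_g`. -/
def eMinusTop (g : ℕ) : Ext g := ExteriorAlgebra.ιMulti ℂ g (fun j : Fin g => eMinus j)

/-- `η_m^0 = b_m e^-_1 ∧ ⋯ ∧ e^-_g`. -/
def eta (B : V g →L[ℝ] V g →L[ℝ] ℝ) (m : Λ) : XForms Λ := bFun B m ⊗ₜ[ℂ] eMinusTop g

theorem schwartz_weight_bound (q : 𝓢(V g, ℂ)) (M n : ℕ) :
    ∃ C : ℝ, 0 ≤ C ∧ ∀ i ≤ n, ∀ z, (1 + ‖z‖) ^ M * ‖iteratedFDeriv ℝ i q z‖ ≤ C :=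
  ⟨2 ^ M * (Finset.Iic (M, n)).sup (fun m => SchwartzMap.seminorm ℝ m.1 m.2) q, by positivity,
    fun _ hi z => SchwartzMap.one_add_le_sup_seminorm_apply (𝕜 := ℝ) (m := (M, n)) le_rfl hi q z⟩

/-- The Schwartz function `z ↦ q(z) p(z + l)`. -/
def shiftMul (q p : 𝓢(V g, ℂ)) (l : V g) : 𝓢(V g, ℂ) :=
  SchwartzMap.pairing (ContinuousLinearMap.mul ℂ ℂ) q (SchwartzMap.compSubConstCLM ℂ (-l) p)

@[simp] theorem shiftMul_apply (q p : 𝓢(V g, ℂ)) (l z : V g) :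
    shiftMul q p l z = q z * p (z + l) := by
  simp [shiftMul, SchwartzMap.pairing_apply_apply]

/-- The pairing `𝓢(V) × 𝓢(V) → 𝓢(V × Λ)`, `(q, p) ↦ ((z, l) ↦ q(z) p(z + l))`. -/
def tens (Λ : Submodule ℤ (V g)) : 𝓢(V g, ℂ) →ₗ[ℂ] 𝓢(V g, ℂ) →ₗ[ℂ] SX Λ :=
  LinearMap.mk₂ ℂ (fun q p => ⟨fun l => shiftMul q p (l : V g), fun k n m => by
      obtain ⟨C, hC0, hC⟩ := schwartz_weight_bound q (m + k) n
      obtain ⟨D, hD0, hD⟩ := schwartz_weight_bound p m n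
      refine ⟨∑ i ∈ Finset.range (n + 1), (n.choose i : ℝ) * (C * D), fun l => ?_⟩
      have hl : ∀ z : V g, ‖l‖ ^ m ≤ (1 + ‖z‖) ^ m * (1 + ‖z + (l : V g)‖) ^ m := fun z => by
        have := peetre (-z) (z + (l : V g)) m
        rw [neg_add_cancel_left, norm_neg] at this
        exact le_trans (by rw [Submodule.coe_norm]; gcongr; linarith) this
      have e : (⇑(shiftMul q p (l : V g)) : V g → ℂ) = fun z => q z * p (z + (l : V g)) :=
        funext fun z => shiftMul_apply q p l z
      have hs : ContDiff ℝ ∞ fun z => p (z + (l : V g)) :=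
        (p.smooth ⊤).comp (contDiff_id.add contDiff_const)
      have h : ∀ z, ‖l‖ ^ m * (‖z‖ ^ k * ‖iteratedFDeriv ℝ n (shiftMul q p (l : V g)) z‖) ≤
          ∑ i ∈ Finset.range (n + 1), (n.choose i : ℝ) * (C * D) := by
        intro z
        rw [e]
        have h1 := norm_iteratedFDeriv_mul_le (q.smooth ⊤) hs z (n := n) (mod_cast le_top)
        calc ‖l‖ ^ m * (‖z‖ ^ k * ‖iteratedFDeriv ℝ n (fun z => q z * p (z + (l : V g))) z‖)
            ≤ ((1 + ‖z‖) ^ m * (1 + ‖z + (l : V g)‖) ^ m) * ((1 + ‖z‖) ^ k *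
              ∑ i ∈ Finset.range (n + 1), (n.choose i : ℝ) * ‖iteratedFDeriv ℝ i q z‖ *
                ‖iteratedFDeriv ℝ (n - i) (fun z => p (z + (l : V g))) z‖) := by
              gcongr
              · exact hl z
              · linarith [norm_nonneg z]
          _ = ∑ i ∈ Finset.range (n + 1), (n.choose i : ℝ) *
              (((1 + ‖z‖) ^ (m + k) * ‖iteratedFDeriv ℝ i q z‖) * ((1 + ‖z + (l : V g)‖) ^ m *
                ‖iteratedFDeriv ℝ (n - i) p (z + (l : V g))‖)) := by
              rw [Finset.mul_sum, Finset.mul_sum]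
              refine Finset.sum_congr rfl fun i _ => ?_
              rw [iteratedFDeriv_comp_add_right, pow_add]; ring
          _ ≤ _ := by
              gcongr with i hi
              · exact hC i (Nat.lt_succ_iff.mp (Finset.mem_range.mp hi)) z
              · exact hD (n - i) (Nat.sub_le _ _) _
      rcases eq_or_lt_of_le (show 0 ≤ ‖l‖ ^ m by positivity) with h0 | h0
      · rw [← h0, zero_mul]; positivity
      · rw [mul_comm, ← le_div_iff₀ h0]
        refine SchwartzMap.seminorm_le_bound ℂ k n _ (by positivity) fun z => ?_
        rw [le_div_iff₀ h0, mul_comm]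
        exact h z⟩)
    (fun q q' p => SX.ext fun l z => by
      change shiftMul (q + q') p l z = shiftMul q p l z + shiftMul q' p l z
      simp; ring)
    (fun c q p => SX.ext fun l z => by
      change shiftMul (c • q) p l z = c * shiftMul q p l z
      simp; ring)
    (fun q p p' => SX.ext fun l z => by
      change shiftMul q (p + p') l z = shiftMul q p l z + shiftMul q p' l z
      simp; ring)
    (fun c q p => SX.ext fun l z => by
      change shiftMul q (c • p) l z = c * shiftMul q p l z
      simp; ring)

theorem tens_apply (q p : 𝓢(V g, ℂ)) (l : Λ) (z : V g) :
    tens Λ q p l z = q z * p (z + (l : V g)) := shiftMul_apply q p l z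

/-- Fréchet spaces over `ℂ`. -/
def IsFrechet (L : Type*) [AddCommGroup L] [Module ℂ L] [TopologicalSpace L]
    [IsTopologicalAddGroup L] : Prop :=
  (∃ p : SeminormFamily ℂ L ℕ, WithSeminorms p) ∧ T2Space L ∧
    @CompleteSpace L (IsTopologicalAddGroup.rightUniformSpace L)

/-- `T(q f, p) = T(q, f p)` for all smooth functions `f` on `V` that are periodic under `Λ`,
i.e. for all smooth functions `f` on `V / Λ`. -/
def IsBalanced (Λ : Submodule ℤ (V g)) {L : Type*} [AddCommGroup L] [Module ℂ L]
    (T : 𝓢(V g, ℂ) →ₗ[ℂ] 𝓢(V g, ℂ) →ₗ[ℂ] L) : Prop :=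
  ∀ f : V g → ℂ, ContDiff ℝ ∞ f → (∀ (l : Λ) (z : V g), f (z + (l : V g)) = f z) →
    ∀ q qf p fp : 𝓢(V g, ℂ), (∀ z, qf z = q z * f z) → (∀ z, fp z = f z * p z) →
      T qf p = T q fp

/-- `L₀` with the bilinear map `T₀` is the completed projective tensor product
`𝓢(V) ⊗_{𝒜(V / Λ)} 𝓢(V)` of Fréchet modules: `T₀` is the universal continuous balanced bilinear
map to Fréchet spaces. -/
def IsCompletedTensorProduct.{u} (Λ : Submodule ℤ (V g)) {L₀ : Type} [AddCommGroup L₀] [Module ℂ L₀]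
    [TopologicalSpace L₀] [IsTopologicalAddGroup L₀]
    (T₀ : 𝓢(V g, ℂ) →ₗ[ℂ] 𝓢(V g, ℂ) →ₗ[ℂ] L₀) : Prop :=
  IsFrechet L₀ ∧ IsBalanced Λ T₀ ∧
  (Continuous fun x : 𝓢(V g, ℂ) × 𝓢(V g, ℂ) => T₀ x.1 x.2) ∧
  ∀ (L : Type u) [AddCommGroup L] [Module ℂ L] [TopologicalSpace L] [IsTopologicalAddGroup L],
    IsFrechet L → ∀ T : 𝓢(V g, ℂ) →ₗ[ℂ] 𝓢(V g, ℂ) →ₗ[ℂ] L, IsBalanced Λ T →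
      (Continuous fun x : 𝓢(V g, ℂ) × 𝓢(V g, ℂ) => T x.1 x.2) →
      ∃! F : L₀ →L[ℂ] L, ∀ q p, F (T₀ q p) = T q p

/-- Multiplication by `conj (B_j(z))`, the coefficient of `d\bar z_j` in
`ω = ∑_j conj (B_j(z)) d\bar z_j`, on `𝓢(V)`. -/
def mulOmega (B : V g →L[ℝ] V g →L[ℝ] ℝ) (j : Fin g) : 𝓢(V g, ℂ) →L[ℂ] 𝓢(V g, ℂ) :=
  SchwartzMap.smulLeftCLM ℂ (fun z : V g => BjConj B j z)

theorem mulOmega_apply (j : Fin g) (f : 𝓢(V g, ℂ)) (z : V g) :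
    mulOmega B j f z = conj (Bj B j z) * f z :=
  SchwartzMap.smulLeftCLM_apply_apply (BjConj B j).hasTemperateGrowth f z

/-- `ℚ = 2 π i D' ∧ + \bar∂_V - 2 π i ω ∧`. -/
def connQ (B : V g →L[ℝ] V g →L[ℝ] ℝ) : 𝓢(V g, ℂ) ⊗[ℂ] Ext g →ₗ[ℂ] 𝓢(V g, ℂ) ⊗[ℂ] Ext g :=
  ∑ j : Fin g, (TensorProduct.map ((2 * Real.pi * Complex.I : ℂ) • (mulZ j).toLinearMap)
      (wedge (dzeta j)) +
    TensorProduct.map ((dbar j).toLinearMap -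
      (2 * Real.pi * Complex.I : ℂ) • (mulOmega B j).toLinearMap) (wedge (dzbar j)))

/-- `ℙ^0 = \bar∂_V + 2 π i ω ∧`. -/
def connP (B : V g →L[ℝ] V g →L[ℝ] ℝ) : 𝓢(V g, ℂ) ⊗[ℂ] Ext g →ₗ[ℂ] 𝓢(V g, ℂ) ⊗[ℂ] Ext g :=
  ∑ j : Fin g, TensorProduct.map ((dbar j).toLinearMap +
      (2 * Real.pi * Complex.I : ℂ) • (mulOmega B j).toLinearMap) (wedge (dzbar j))

/-- The product `(q ⊗ α, p ⊗ β) ↦ (q ⊗ p) ⊗ (α ∧ β)` of forms. -/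
def tensForms (Λ : Submodule ℤ (V g)) :
    𝓢(V g, ℂ) ⊗[ℂ] Ext g →ₗ[ℂ] 𝓢(V g, ℂ) ⊗[ℂ] Ext g →ₗ[ℂ] XForms Λ :=
  TensorProduct.map₂ (tens Λ) (LinearMap.mul ℂ (Ext g))

/-- The inclusion of `Λ^• V_{1,0}`, generated by the `d\bar ζ_j`. -/
def inQ : ExteriorAlgebra ℂ (Fin g → ℂ) →ₐ[ℂ] Ext g :=
  ExteriorAlgebra.map (LinearMap.inl ℂ (Fin g → ℂ) (Fin g → ℂ))

/-- The inclusion of `Λ^• V^{0,1}`, generated by the `d\bar z_j`. -/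
def inP : ExteriorAlgebra ℂ (Fin g → ℂ) →ₐ[ℂ] Ext g :=
  ExteriorAlgebra.map (LinearMap.inr ℂ (Fin g → ℂ) (Fin g → ℂ))

end

end NCTorus

universe u

open NCTorus
open scoped SchwartzMap TensorProduct

open scoped SchwartzMap LineDeriv ContDiff TensorProduct ComplexConjugate

/-! The argument has two independent halves: the cohomology with its harmonic theory, and the
universal property of the tensor product.

Cohomology. Conjugating the slice over l ∈ Λ by the phase σ(l, z) turns ∂̄_j + 2πi conj(B_j(l)) into
∂̄_j (`opX_dbar`), so in this gauge neither B nor l is visible. Written in the covectors u±_j =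
½(dz̄_j ± i dζ̄_j), the operator becomes ∑_j (α_j u⁺_j∧ + γ_j u⁻_j∧) with α_j = ∂̄_j + 2πz_j and γ_j
= ∂̄_j − 2πz_j (`connX_eq_connC`). This is the Koszul complex of 2g commuting operators on 𝓢(V). A
linear canonical transformation, built from quadratic phases and the Fourier transform, turns α_j
and γ_j into multiples of ∂_{y_j} + (π/2)y_j and ∂_{x_j} − (π/2)x_j (`canon_alphaOp`,
`canon_gammaOp`). Hence α_j has a right inverse that commutes with all the other operators
(`exists_rightInverse`), which disposes of the directions u⁺. On ker α_j the operator γ_j is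
multiplication by −4πz_j. The fundamental theorem of calculus along segments from the hyperplane z_j
= 0, with a Gaussian weight, gives a division formula (`one_sub_restr`): f differs from the Gaussian
extension of its restriction to that hyperplane by a multiple of z_j. So γ_j is injective on ker α_j
and a complement of its image consists of functions that are Gaussian in z_j.

Both facts enter through a Cartan type homotopy formula (`sum_mul_homotopy`). Applied for one index
after another (`exists_reduction`), it makes every closed form cohomologous to one killed by
contraction in the u⁺ directions and by all u⁻_j∧, and fixed by all the restrictions. Such a form
has degree g and is a multiple of e⁻_1∧⋯∧e⁻_g (`eq_tmul_eMinusTop`), with a multiple of the deformed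
Gaussian on each slice (`exists_eq_gaussSum`). These representatives are coclosed as well, since
their Gaussian factors are killed by ∂/∂z_j + 2πz̄_j. An exact coclosed form vanishes by positivity
of the Hermitian product, so the representatives are unique. This yields at once that the cohomology
is free of rank one (`exists_basis_cohomology`) and that they are exactly the harmonic forms
(`harmonic_iff_gaussSum`).

Tensor product. Take χ whose translates by s⁻¹Λ sum to 1, and a cutoff ψ that is 1 where χ ≠ 0 and
has disjoint Λ-translates. Then φ ∈ 𝓢(V × Λ) is an absolutely convergent sum of pure tensors, φ(·,
l) times a translate of χ paired with a translate of ψ (`IsLocalizer.hasSum_locTerm_tens`). This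
forces uniqueness of the induced map. Applying a balanced bilinear map T to the same terms defines
it; moving periodized functions across T shows that the sum returns T q p on the pairing of q and p
(`exists_lift_of_isBalanced`). -/

namespace NCTorus

/-! ### Differentiation under an integral over [0, 1], with bounds on all derivatives. -/

section ParametricIntegral

variable {E W : Type} [NormedAddCommGroup E] [NormedSpace ℝ E]
  [NormedAddCommGroup W] [NormedSpace ℝ W]

/-- A smooth family of functions, parametrized by `ℝ`, all of whose derivatives in the second
variable are bounded for parameters in `[0, 1]`. -/
structure BoundedFamily (F : ℝ → E → W) : Prop where
  contDiff : ContDiff ℝ ∞ (Function.uncurry F)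
  bound : ∀ n, ∃ C, ∀ τ ∈ Set.Icc (0 : ℝ) 1, ∀ v, ‖iteratedFDeriv ℝ n (F τ) v‖ ≤ C

theorem BoundedFamily.contDiff_apply {F : ℝ → E → W} (h : BoundedFamily F) (τ : ℝ) :
    ContDiff ℝ ∞ (F τ) := h.contDiff.comp (contDiff_const.prodMk contDiff_id)

theorem BoundedFamily.continuous_left {F : ℝ → E → W} (h : BoundedFamily F) (v : E) :
    Continuous fun τ => F τ v := h.contDiff.continuous.comp (continuous_id.prodMk continuous_const)

/-- Closure under differentiation in the second variable drives the inductions on the order of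
smoothness below. -/
theorem BoundedFamily.fderiv {F : ℝ → E → W} (h : BoundedFamily F) :
    BoundedFamily fun τ v => fderiv ℝ (F τ) v where
  contDiff := by
    refine ContDiff.fderiv (m := ∞) (n := ∞)
      (f := fun (x : ℝ × E) v => F x.1 v) ?_ contDiff_snd (by simp)
    exact h.contDiff.comp ((contDiff_fst.comp contDiff_fst).prodMk contDiff_snd)
  bound n := by
    obtain ⟨C, hC⟩ := h.bound (n + 1)
    exact ⟨C, fun τ hτ v => (norm_iteratedFDeriv_fderiv (𝕜 := ℝ)).trans_le (hC τ hτ v)⟩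

theorem BoundedFamily.hasFDerivAt {F : ℝ → E → W} (h : BoundedFamily F) (v : E) :
    HasFDerivAt (fun v => ∫ τ in (0 : ℝ)..1, F τ v)
      (∫ τ in (0 : ℝ)..1, _root_.fderiv ℝ (F τ) v) v := by
  obtain ⟨C, hC⟩ := h.bound 1
  refine (intervalIntegral.hasFDerivAt_integral_of_dominated_of_fderiv_le
      (F := fun v τ => F τ v) (F' := fun v τ => _root_.fderiv ℝ (F τ) v)
      (bound := fun _ => C) (s := Set.univ) Filter.univ_mem ?_
      ((h.continuous_left v).intervalIntegrable _ _) ?_ ?_ ?_ ?_)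
  · exact Filter.Eventually.of_forall fun v => (h.continuous_left v).aestronglyMeasurable
  · exact (h.fderiv.continuous_left v).aestronglyMeasurable
  · refine Filter.Eventually.of_forall fun τ hτ' v _ => ?_
    rw [Set.uIoc_of_le zero_le_one] at hτ'
    rw [← norm_iteratedFDeriv_one (𝕜 := ℝ)]
    exact hC τ ⟨hτ'.1.le, hτ'.2⟩ v
  · exact intervalIntegrable_const
  · exact Filter.Eventually.of_forall fun τ _ v _ =>
      ((h.contDiff_apply τ).differentiable (by simp) v).hasFDerivAt

theorem BoundedFamily.fderiv_integral {F : ℝ → E → W} (h : BoundedFamily F) :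
    _root_.fderiv ℝ (fun v => ∫ τ in (0 : ℝ)..1, F τ v) =
      fun v => ∫ τ in (0 : ℝ)..1, _root_.fderiv ℝ (F τ) v :=
  funext fun v => (h.hasFDerivAt v).fderiv

/-- The target space is quantified inside the induction because each step passes from W-valued
functions to functions with values in continuous linear maps E → W. -/
theorem BoundedFamily.contDiff_integral (n : ℕ) : ∀ {W : Type} [NormedAddCommGroup W]
    [NormedSpace ℝ W] [CompleteSpace W] {F : ℝ → E → W}, BoundedFamily F →
    ContDiff ℝ n (fun v => ∫ τ in (0 : ℝ)..1, F τ v) := by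
  induction n with
  | zero =>
    intro W _ _ _ F h
    exact contDiff_zero.2 (continuous_iff_continuousAt.2 fun v => (h.hasFDerivAt v).continuousAt)
  | succ n ih =>
    intro W _ _ _ F h
    rw [Nat.cast_succ, contDiff_succ_iff_fderiv]
    refine ⟨fun v => (h.hasFDerivAt v).differentiableAt, by simp, ?_⟩
    rw [h.fderiv_integral]
    exact ih h.fderiv

/-- The bound is kept pointwise in v, so that C may later carry the polynomial weight of a Schwartz
seminorm. -/
theorem BoundedFamily.norm_iteratedFDeriv_integral_le (n : ℕ) : ∀ {W : Type} [NormedAddCommGroup W]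
    [NormedSpace ℝ W] [CompleteSpace W] {F : ℝ → E → W}, BoundedFamily F → ∀ (v : E) (C : ℝ),
    (∀ τ ∈ Set.Icc (0 : ℝ) 1, ‖iteratedFDeriv ℝ n (F τ) v‖ ≤ C) →
    ‖iteratedFDeriv ℝ n (fun v => ∫ τ in (0 : ℝ)..1, F τ v) v‖ ≤ C := by
  induction n with
  | zero =>
    intro W _ _ _ F h v C hC
    simp only [norm_iteratedFDeriv_zero] at hC ⊢
    have := intervalIntegral.norm_integral_le_of_norm_le_const (a := 0) (b := 1) (C := C)
      (f := fun τ => F τ v) fun τ hτ => by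
        rw [Set.uIoc_of_le zero_le_one] at hτ
        exact hC τ ⟨hτ.1.le, hτ.2⟩
    simpa using this
  | succ n ih =>
    intro W _ _ _ F h v C hC
    rw [← norm_iteratedFDeriv_fderiv, h.fderiv_integral]
    exact ih h.fderiv v C fun τ hτ => norm_iteratedFDeriv_fderiv.trans_le (hC τ hτ)

end ParametricIntegral

/-! ### Gaussian-weighted contraction along a projection q, as continuous operators on Schwartz
functions. -/

section Slice

variable {E : Type} [NormedAddCommGroup E] [InnerProductSpace ℝ E]

/-- The function `v ↦ exp (-m (1 - τ^2) ‖q v‖^2) f (v - (1 - τ) q v)`. -/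
noncomputable def sliceFun (q : E →L[ℝ] E) (m τ : ℝ) (f : E → ℂ) (v : E) : ℂ :=
  (Real.exp (-(m * (1 - τ ^ 2) * ‖q v‖ ^ 2)) : ℂ) * f (v - (1 - τ) • q v)

theorem contDiff_sliceFun (q : E →L[ℝ] E) (m : ℝ) {f : E → ℂ} (hf : ContDiff ℝ ∞ f) :
    ContDiff ℝ ∞ (Function.uncurry fun τ => sliceFun q m τ f) := by
  have h1 : ContDiff ℝ ∞ fun x : ℝ × E => ((Real.exp (-(m * (1 - x.1 ^ 2) * ‖q x.2‖ ^ 2)) : ℝ) : ℂ) := by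
    refine Complex.ofRealCLM.contDiff.comp (Real.contDiff_exp.comp ?_)
    exact ((contDiff_const.mul (contDiff_const.sub (contDiff_fst.pow 2))).mul
      ((contDiff_norm_sq ℝ).comp (q.contDiff.comp contDiff_snd))).neg
  refine h1.mul (hf.comp ?_)
  exact contDiff_snd.sub ((contDiff_const.sub contDiff_fst).smul (q.contDiff.comp contDiff_snd))

/-- `1 + ‖v‖` is controlled by its values on the kernel and the range of `q`. -/
theorem one_add_norm_le_slice (q : E →L[ℝ] E) (hq : ∀ v, q (q v) = q v) (τ : ℝ) (v : E) :
    1 + ‖v‖ ≤ (1 + ‖q‖) * ((1 + ‖v - (1 - τ) • q v‖) * (1 + ‖q v‖)) := by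
  set w := v - (1 - τ) • q v with hw
  have h1 : v = w - q w + q v := by simp [hw, hq]
  have h2 : ‖v‖ ≤ ‖w‖ + ‖q‖ * ‖w‖ + ‖q v‖ := by
    calc ‖v‖ = ‖w - q w + q v‖ := by rw [← h1]
      _ ≤ ‖w‖ + ‖q w‖ + ‖q v‖ := (norm_add_le _ _).trans (by gcongr; exact norm_sub_le _ _)
      _ ≤ _ := by gcongr; exact q.le_opNorm w
  have := norm_nonneg w
  have := norm_nonneg (q v)
  have := norm_nonneg q
  nlinarith [mul_nonneg (norm_nonneg w) (norm_nonneg (q v)), mul_nonneg (norm_nonneg q) (norm_nonneg (q v)),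
    mul_nonneg (mul_nonneg (norm_nonneg q) (norm_nonneg w)) (norm_nonneg (q v))]

/-- Two regimes make the constant uniform in τ. For τ ≤ 1/2 the Gaussian has exponent at least m/2
and absorbs the power by itself. For τ ≥ 1/2 it may degenerate, but the contracted point still has
q-component τ q v, so its norm controls ‖q v‖. -/
theorem pow_mul_exp_slice_le (q : E →L[ℝ] E) (hq : ∀ v, q (q v) = q v) {m : ℝ} (hm : 0 < m)
    (N : ℕ) : ∃ C : ℝ, 0 ≤ C ∧ ∀ τ ∈ Set.Icc (0 : ℝ) 1, ∀ v : E,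
      (1 + ‖q v‖) ^ N * Real.exp (-(m * (1 - τ ^ 2) * ‖q v‖ ^ 2)) ≤
        C * (1 + ‖v - (1 - τ) • q v‖) ^ N := by
  obtain ⟨C, hC⟩ : ∃ C : ℝ, ∀ r : ℝ, 0 ≤ r → (1 + r) ^ N * Real.exp (-(m / 2 * r ^ 2)) ≤ C := by
    -- From t ^ N ≤ N! exp t with t = (m/2)(1 + r²); the factor (1 + 2/m) ^ N compares t with 1 +
    -- r².
    refine ⟨2 ^ N * (N.factorial * Real.exp (m / 2)) * (1 + 2 / m) ^ N, fun r hr => ?_⟩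
    have hM : 0 < m / 2 := by positivity
    have h1 : (1 + r) ^ N ≤ 2 ^ N * (1 + r ^ 2) ^ N := by
      rw [← mul_pow]; gcongr; nlinarith [sq_nonneg (r - 1)]
    have h2 : (1 + r ^ 2) ^ N ≤ (1 + 2 / m) ^ N * (m / 2 * (1 + r ^ 2)) ^ N := by
      rw [← mul_pow]; gcongr
      have : (1 + 2 / m) * (m / 2 * (1 + r ^ 2)) = (m / 2 + 1) * (1 + r ^ 2) := by field_simp
      rw [this]; nlinarith [sq_nonneg r]
    have h3 : (m / 2 * (1 + r ^ 2)) ^ N ≤ N.factorial * Real.exp (m / 2 * (1 + r ^ 2)) := by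
      have := Real.pow_div_factorial_le_exp (m / 2 * (1 + r ^ 2)) (by positivity) N
      rwa [div_le_iff₀' (by positivity)] at this
    calc (1 + r) ^ N * Real.exp (-(m / 2 * r ^ 2)) ≤ (2 ^ N * ((1 + 2 / m) ^ N *
          (N.factorial * Real.exp (m / 2 * (1 + r ^ 2))))) * Real.exp (-(m / 2 * r ^ 2)) := by
          gcongr
          exact h1.trans (by gcongr; exact h2.trans (by gcongr))
      _ = 2 ^ N * (N.factorial * (Real.exp (m / 2 * (1 + r ^ 2)) * Real.exp (-(m / 2 * r ^ 2)))) *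
          (1 + 2 / m) ^ N := by ring
      _ = _ := by rw [← Real.exp_add]; ring_nf
  have hC0 : 0 ≤ C := le_trans (by positivity) (hC 0 le_rfl)
  refine ⟨C + 2 ^ N * (1 + ‖q‖) ^ N, by positivity, fun τ hτ v => ?_⟩
  have hr := norm_nonneg (q v)
  have hw := norm_nonneg (v - (1 - τ) • q v)
  rcases le_total τ (1 / 2) with h | h
  · have h1 : Real.exp (-(m * (1 - τ ^ 2) * ‖q v‖ ^ 2)) ≤ Real.exp (-(m / 2 * ‖q v‖ ^ 2)) := by
      apply Real.exp_le_exp.2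
      have h5 : τ ^ 2 ≤ 1 / 4 := by nlinarith [hτ.1]
      have : m / 2 ≤ m * (1 - τ ^ 2) := by nlinarith
      nlinarith [sq_nonneg ‖q v‖]
    calc (1 + ‖q v‖) ^ N * Real.exp (-(m * (1 - τ ^ 2) * ‖q v‖ ^ 2)) ≤ C :=
          le_trans (by gcongr) (hC _ hr)
      _ ≤ (C + 2 ^ N * (1 + ‖q‖) ^ N) * 1 := by
          have : 0 ≤ 2 ^ N * (1 + ‖q‖) ^ N := by positivity
          linarith
      _ ≤ _ := by gcongr; exact one_le_pow₀ (by linarith)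
  · have h1 : Real.exp (-(m * (1 - τ ^ 2) * ‖q v‖ ^ 2)) ≤ 1 := by
      rw [Real.exp_le_one_iff, neg_nonpos]
      have : 0 ≤ 1 - τ ^ 2 := by nlinarith [hτ.1, hτ.2]
      positivity
    have h2 : 1 + ‖q v‖ ≤ 2 * ((1 + ‖q‖) * (1 + ‖v - (1 - τ) • q v‖)) := by
      have h3 : τ • q v = q (v - (1 - τ) • q v) := by simp [hq, sub_smul]
      have h4 : τ * ‖q v‖ ≤ ‖q‖ * ‖v - (1 - τ) • q v‖ := by
        rw [← Real.norm_of_nonneg hτ.1, ← norm_smul, Real.norm_of_nonneg hτ.1, h3]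
        exact q.le_opNorm _
      nlinarith [norm_nonneg q]
    calc (1 + ‖q v‖) ^ N * Real.exp (-(m * (1 - τ ^ 2) * ‖q v‖ ^ 2))
        ≤ (2 * ((1 + ‖q‖) * (1 + ‖v - (1 - τ) • q v‖))) ^ N * 1 := by gcongr
      _ = 2 ^ N * (1 + ‖q‖) ^ N * (1 + ‖v - (1 - τ) • q v‖) ^ N := by rw [mul_one, mul_pow, mul_pow]; ring
      _ ≤ _ := by gcongr; linarith

/-- Differentiating the exponential of a quadratic form costs only a polynomial factor and leaves
the exponential itself, which the weights still need. The scalar 1 - τ² ≤ 1 only shrinks the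
derivatives of the exponent, hence uniformity in τ. -/
theorem norm_iteratedFDeriv_exp_slice_le (q : E →L[ℝ] E) {m : ℝ} (n : ℕ) :
    ∃ (C : ℝ) (l : ℕ), 0 ≤ C ∧ ∀ i ≤ n, ∀ τ ∈ Set.Icc (0 : ℝ) 1, ∀ v : E,
      ‖iteratedFDeriv ℝ i (fun v => (Real.exp (-(m * (1 - τ ^ 2) * ‖q v‖ ^ 2)) : ℂ)) v‖ ≤
        C * (1 + ‖v‖) ^ l * Real.exp (-(m * (1 - τ ^ 2) * ‖q v‖ ^ 2)) := by
  have ht : Function.HasTemperateGrowth (fun v : E => -(m * ‖q v‖ ^ 2)) := by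
    have h := (Function.hasTemperateGrowth_norm_sq (H := E)).comp q.hasTemperateGrowth
    have := ((Function.HasTemperateGrowth.const (E := E) m).mul h).neg
    exact this
  obtain ⟨l, C, hC0, hC⟩ := ht.norm_iteratedFDeriv_le_uniform n
  -- C + 1 makes the base at least 1, so the powers i ≤ n can all be raised to n.
  refine ⟨n.factorial * (C + 1) ^ n, l * n, by positivity, fun i hi τ hτ v => ?_⟩
  have hτ2 : 0 ≤ 1 - τ ^ 2 ∧ 1 - τ ^ 2 ≤ 1 := ⟨by nlinarith [hτ.1, hτ.2], by nlinarith [hτ.1]⟩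
  have e : (fun v : E => -(m * (1 - τ ^ 2) * ‖q v‖ ^ 2)) =
      (1 - τ ^ 2) • fun v : E => -(m * ‖q v‖ ^ 2) := by
    ext v; simp only [Pi.smul_apply, smul_eq_mul]; ring
  have hsm : ContDiff ℝ ∞ (fun v : E => -(m * (1 - τ ^ 2) * ‖q v‖ ^ 2)) := by
    rw [e]; exact contDiff_const.smul ht.1
  have h1 : ‖iteratedFDeriv ℝ i (Real.exp ∘ fun v : E => -(m * (1 - τ ^ 2) * ‖q v‖ ^ 2)) v‖ ≤
      i.factorial * Real.exp (-(m * (1 - τ ^ 2) * ‖q v‖ ^ 2)) * ((C + 1) * (1 + ‖v‖) ^ l) ^ i := by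
    refine norm_iteratedFDeriv_comp_le (N := ∞) Real.contDiff_exp hsm
      (mod_cast le_top) v (fun i _ => ?_) (fun j hj1 hjn => ?_)
    · rw [norm_iteratedFDeriv_eq_norm_iteratedDeriv, iteratedDeriv_eq_iterate,
        Real.iter_deriv_exp, Real.norm_of_nonneg (Real.exp_pos _).le]
    · rw [e, iteratedFDeriv_const_smul_apply (ht.1.of_le (mod_cast le_top)).contDiffAt, norm_smul,
        Real.norm_of_nonneg hτ2.1]
      have h4 : 1 ≤ (1 + ‖v‖) ^ l := one_le_pow₀ (by linarith [norm_nonneg v])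
      calc (1 - τ ^ 2) * ‖iteratedFDeriv ℝ j (fun v : E => -(m * ‖q v‖ ^ 2)) v‖
          ≤ 1 * (C * (1 + ‖v‖) ^ l) := by gcongr; exacts [hτ2.2, hC j (hjn.trans hi) v]
        _ ≤ (C + 1) * (1 + ‖v‖) ^ l := by nlinarith
        _ ≤ _ := le_self_pow₀ (by nlinarith) (by omega)
  have h2 : ‖iteratedFDeriv ℝ i (fun v => (Real.exp (-(m * (1 - τ ^ 2) * ‖q v‖ ^ 2)) : ℂ)) v‖ ≤
      ‖iteratedFDeriv ℝ i (Real.exp ∘ fun v : E => -(m * (1 - τ ^ 2) * ‖q v‖ ^ 2)) v‖ := by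
    have := Complex.ofRealLI.norm_iteratedFDeriv_comp_left (n := ∞) (i := i) (x := v)
      (Real.contDiff_exp.comp hsm).contDiffAt (mod_cast le_top)
    exact this.le
  have h4 : 1 ≤ (C + 1) * (1 + ‖v‖) ^ l := by
    have : 1 ≤ (1 + ‖v‖) ^ l := one_le_pow₀ (by linarith [norm_nonneg v])
    nlinarith
  calc _ ≤ _ := h2.trans h1
    _ ≤ n.factorial * Real.exp (-(m * (1 - τ ^ 2) * ‖q v‖ ^ 2)) * ((C + 1) * (1 + ‖v‖) ^ l) ^ n := by
        have := Nat.factorial_le hi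
        gcongr
    _ = _ := by rw [mul_pow, ← pow_mul]; ring

/-- The Schwartz seminorms of the functions `sliceFun q m τ f`, `0 ≤ τ ≤ 1`, are uniformly bounded
by Schwartz seminorms of `f`. -/
theorem sliceFun_bound (q : E →L[ℝ] E) (hq : ∀ v, q (q v) = q v) {m : ℝ} (hm : 0 < m) (k n : ℕ) :
    ∃ (s : Finset (ℕ × ℕ)) (C : ℝ), 0 ≤ C ∧ ∀ (f : 𝓢(E, ℂ)), ∀ τ ∈ Set.Icc (0 : ℝ) 1, ∀ v,
      ‖v‖ ^ k * ‖iteratedFDeriv ℝ n (sliceFun q m τ f) v‖ ≤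
        C * s.sup (schwartzSeminormFamily ℂ E ℂ) f := by
  obtain ⟨A, l, hA0, hA⟩ := norm_iteratedFDeriv_exp_slice_le q (m := m) n
  obtain ⟨D, hD0, hD⟩ := pow_mul_exp_slice_le q hq hm (k + l)
  set M := k + l
  -- The weight 1 + ‖v‖ splits into a factor at the contracted point and one at q v. The M-th power
  -- of the latter, absorbed by the Gaussian, costs M further powers at the contracted point, so 2M
  -- in all; M = k + l adds to the requested weight the growth caused by differentiating the
  -- Gaussian.
  refine ⟨Finset.Iic (2 * M, n), 2 ^ n * (A * (1 + ‖q‖) ^ M * D * (2 + ‖q‖) ^ n * 2 ^ (2 * M)),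
    by positivity, fun f τ hτ v => ?_⟩
  set S := (Finset.Iic (2 * M, n)).sup (schwartzSeminormFamily ℂ E ℂ) f
  have hL : ‖ContinuousLinearMap.id ℝ E - (1 - τ) • q‖ ≤ 2 + ‖q‖ := by
    calc _ ≤ ‖ContinuousLinearMap.id ℝ E‖ + ‖(1 - τ) • q‖ := norm_sub_le _ _
      _ ≤ 1 + 1 * ‖q‖ := by
          rw [norm_smul, Real.norm_of_nonneg (by linarith [hτ.2])]
          gcongr
          · exact ContinuousLinearMap.norm_id_le
          · linarith [hτ.1]
      _ ≤ _ := by linarith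
  set ℓ := ContinuousLinearMap.id ℝ E - (1 - τ) • q with hℓ
  have hℓv : ℓ v = v - (1 - τ) • q v := by simp [hℓ]
  have hf : ∀ i ≤ n, ‖iteratedFDeriv ℝ i (fun v => f (v - (1 - τ) • q v)) v‖ ≤
      (2 + ‖q‖) ^ n * ‖iteratedFDeriv ℝ i f (ℓ v)‖ := by
    intro i hi
    have h := ℓ.iteratedFDeriv_comp_right (f.smooth ⊤) v (i := i) (mod_cast le_top)
    have e : (f ∘ ℓ) = fun v => f (v - (1 - τ) • q v) := by ext v; simp [hℓ]
    rw [e] at h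
    rw [h]
    refine (ContinuousMultilinearMap.norm_compContinuousLinearMap_le _ _).trans ?_
    rw [Finset.prod_const, Finset.card_univ, Fintype.card_fin, mul_comm]
    gcongr
    calc ‖ℓ‖ ^ i ≤ (2 + ‖q‖) ^ i := by gcongr
      _ ≤ _ := pow_le_pow_right₀ (by linarith [norm_nonneg q]) hi
  have hs1 : ContDiff ℝ ∞ fun v => (Real.exp (-(m * (1 - τ ^ 2) * ‖q v‖ ^ 2)) : ℂ) :=
    Complex.ofRealCLM.contDiff.comp (Real.contDiff_exp.comp
      ((contDiff_const.mul ((contDiff_norm_sq ℝ).comp q.contDiff)).neg))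
  have hs2 : ContDiff ℝ ∞ fun v => f (v - (1 - τ) • q v) :=
    (f.smooth ⊤).comp (contDiff_id.sub (contDiff_const.smul q.contDiff))
  have h1 := norm_iteratedFDeriv_mul_le hs1 hs2 v (n := n) (mod_cast le_top)
  set e := Real.exp (-(m * (1 - τ ^ 2) * ‖q v‖ ^ 2)) with he
  have hv : (1 + ‖v‖) ^ M * e ≤ (1 + ‖q‖) ^ M * D * (1 + ‖ℓ v‖) ^ (2 * M) := by
    have h2 := one_add_norm_le_slice q hq τ v
    rw [← hℓv] at h2
    have h3 := hD τ hτ v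
    rw [← hℓv, ← he] at h3
    calc (1 + ‖v‖) ^ M * e ≤ ((1 + ‖q‖) * ((1 + ‖ℓ v‖) * (1 + ‖q v‖))) ^ M * e := by gcongr
      _ = (1 + ‖q‖) ^ M * (1 + ‖ℓ v‖) ^ M * ((1 + ‖q v‖) ^ M * e) := by
          rw [mul_pow, mul_pow]; ring
      _ ≤ (1 + ‖q‖) ^ M * (1 + ‖ℓ v‖) ^ M * (D * (1 + ‖ℓ v‖) ^ M) := by gcongr
      _ = _ := by rw [two_mul, pow_add]; ring
  have hterm : ∀ i ∈ Finset.range (n + 1), ‖v‖ ^ k * ((n.choose i : ℝ) *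
      ‖iteratedFDeriv ℝ i (fun v => (Real.exp (-(m * (1 - τ ^ 2) * ‖q v‖ ^ 2)) : ℂ)) v‖ *
      ‖iteratedFDeriv ℝ (n - i) (fun v => f (v - (1 - τ) • q v)) v‖) ≤
      (n.choose i : ℝ) * (A * (1 + ‖q‖) ^ M * D * (2 + ‖q‖) ^ n * 2 ^ (2 * M) * S) := by
    intro i hi
    have hi' : i ≤ n := Nat.lt_succ_iff.mp (Finset.mem_range.mp hi)
    have hS : (1 + ‖ℓ v‖) ^ (2 * M) * ‖iteratedFDeriv ℝ (n - i) f (ℓ v)‖ ≤ 2 ^ (2 * M) * S :=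
      SchwartzMap.one_add_le_sup_seminorm_apply (𝕜 := ℂ) (m := (2 * M, n)) le_rfl
        (Nat.sub_le n i) f (ℓ v)
    calc _ ≤ (1 + ‖v‖) ^ k * ((n.choose i : ℝ) * (A * (1 + ‖v‖) ^ l * e) *
          ((2 + ‖q‖) ^ n * ‖iteratedFDeriv ℝ (n - i) f (ℓ v)‖)) := by
          gcongr
          · linarith
          · exact hA i hi' τ hτ v
          · exact hf _ (Nat.sub_le n i)
      _ = (n.choose i : ℝ) * (A * (2 + ‖q‖) ^ n * ((1 + ‖v‖) ^ M * e) *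
          ‖iteratedFDeriv ℝ (n - i) f (ℓ v)‖) := by rw [pow_add]; ring
      _ ≤ (n.choose i : ℝ) * (A * (2 + ‖q‖) ^ n * ((1 + ‖q‖) ^ M * D * (1 + ‖ℓ v‖) ^ (2 * M)) *
          ‖iteratedFDeriv ℝ (n - i) f (ℓ v)‖) := by gcongr
      _ = (n.choose i : ℝ) * (A * (1 + ‖q‖) ^ M * D * (2 + ‖q‖) ^ n *
          ((1 + ‖ℓ v‖) ^ (2 * M) * ‖iteratedFDeriv ℝ (n - i) f (ℓ v)‖)) := by ring
      _ ≤ (n.choose i : ℝ) * (A * (1 + ‖q‖) ^ M * D * (2 + ‖q‖) ^ n * (2 ^ (2 * M) * S)) := by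
          gcongr
      _ = _ := by ring
  calc ‖v‖ ^ k * ‖iteratedFDeriv ℝ n (sliceFun q m τ f) v‖ ≤ ‖v‖ ^ k * _ := by
        gcongr; exact h1
    _ = _ := Finset.mul_sum _ _ _
    _ ≤ _ := Finset.sum_le_sum hterm
    _ = _ := by
      rw [← Finset.sum_mul, ← Nat.cast_sum, Nat.sum_range_choose]; push_cast; ring

theorem boundedFamily_sliceFun (q : E →L[ℝ] E) (hq : ∀ v, q (q v) = q v) {m : ℝ} (hm : 0 < m)
    (f : 𝓢(E, ℂ)) : BoundedFamily fun τ => sliceFun q m τ f where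
  contDiff := contDiff_sliceFun q m (f.smooth ⊤)
  bound n := by
    obtain ⟨s, C, -, h⟩ := sliceFun_bound q hq hm 0 n
    exact ⟨_, fun τ hτ v => by simpa using h f τ hτ v⟩

/-- The operator `f ↦ exp (-m (1 - τ^2) ‖q v‖^2) f (v - (1 - τ) q v)` on Schwartz functions. -/
noncomputable def slice (q : E →L[ℝ] E) (hq : ∀ v, q (q v) = q v) {m : ℝ} (hm : 0 < m) (τ : ℝ)
    (hτ : τ ∈ Set.Icc (0 : ℝ) 1) : 𝓢(E, ℂ) →L[ℂ] 𝓢(E, ℂ) :=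
  SchwartzMap.mkCLM (fun f => sliceFun q m τ f)
    (fun f g x => by simp [sliceFun, mul_add])
    (fun a f x => by simp [sliceFun]; ring)
    (fun f => (boundedFamily_sliceFun q hq hm f).contDiff_apply τ)
    (fun n => by
      obtain ⟨s, C, h0, h⟩ := sliceFun_bound q hq hm n.1 n.2
      exact ⟨s, C, h0, fun f v => h f τ hτ v⟩)

/-- The operator `f ↦ ∫_0^1 exp (-m (1 - τ^2) ‖q v‖^2) f (v - (1 - τ) q v) dτ` on Schwartz
functions. -/
noncomputable def sliceInt (q : E →L[ℝ] E) (hq : ∀ v, q (q v) = q v) {m : ℝ} (hm : 0 < m) :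
    𝓢(E, ℂ) →L[ℂ] 𝓢(E, ℂ) :=
  SchwartzMap.mkCLM (fun f v => ∫ τ in (0 : ℝ)..1, sliceFun q m τ f v)
    (fun f g v => by
      rw [← intervalIntegral.integral_add]
      · simp [sliceFun, mul_add]
      · exact ((boundedFamily_sliceFun q hq hm f).continuous_left v).intervalIntegrable _ _
      · exact ((boundedFamily_sliceFun q hq hm g).continuous_left v).intervalIntegrable _ _)
    (fun a f v => by
      rw [RingHom.id_apply, smul_eq_mul, ← intervalIntegral.integral_const_mul]
      congr 1; ext τ; simp [sliceFun]; ring)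
    (fun f => contDiff_infty.2 fun n => (boundedFamily_sliceFun q hq hm f).contDiff_integral n)
    (fun n => by
      obtain ⟨s, C, h0, h⟩ := sliceFun_bound q hq hm n.1 n.2
      refine ⟨s, C, h0, fun f v => ?_⟩
      obtain ⟨D, hD⟩ := (boundedFamily_sliceFun q hq hm f).bound n.2
      -- The estimate for the integral bounds the derivative alone, so the weight is divided out and
      -- its vanishing is treated apart.
      rcases eq_or_lt_of_le (show 0 ≤ ‖v‖ ^ n.1 by positivity) with h1 | h1
      · rw [← h1, zero_mul]; positivity
      · rw [mul_comm, ← le_div_iff₀ h1]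
        refine (boundedFamily_sliceFun q hq hm f).norm_iteratedFDeriv_integral_le n.2 v _
          fun τ hτ => ?_
        rw [le_div_iff₀ h1, mul_comm]
        exact h f τ hτ v)

theorem slice_apply (q : E →L[ℝ] E) (hq : ∀ v, q (q v) = q v) {m : ℝ} (hm : 0 < m) (τ : ℝ)
    (hτ : τ ∈ Set.Icc (0 : ℝ) 1) (f : 𝓢(E, ℂ)) (v : E) :
    slice q hq hm τ hτ f v =
      (Real.exp (-(m * (1 - τ ^ 2) * ‖q v‖ ^ 2)) : ℂ) * f (v - (1 - τ) • q v) := rfl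

theorem sliceInt_apply (q : E →L[ℝ] E) (hq : ∀ v, q (q v) = q v) {m : ℝ} (hm : 0 < m)
    (f : 𝓢(E, ℂ)) (v : E) :
    sliceInt q hq hm f v = ∫ τ in (0 : ℝ)..1, sliceFun q m τ f v := rfl

end Slice
end NCTorus

open scoped SchwartzMap LineDeriv ContDiff TensorProduct ComplexConjugate

namespace NCTorus

noncomputable section

/-! ### Multiplication by linear forms and directional derivatives, with their commutation
relations. -/

section Operators

variable {E : Type} [NormedAddCommGroup E] [NormedSpace ℝ E]

/-- Multiplication of Schwartz functions by a linear function. -/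
def mulL (c : E →L[ℝ] ℂ) : 𝓢(E, ℂ) →L[ℂ] 𝓢(E, ℂ) := SchwartzMap.smulLeftCLM ℂ c

@[simp] theorem mulL_apply (c : E →L[ℝ] ℂ) (f : 𝓢(E, ℂ)) (v : E) : mulL c f v = c v * f v :=
  SchwartzMap.smulLeftCLM_apply_apply c.hasTemperateGrowth f v

/-- The derivative of Schwartz functions in the direction `w`. -/
def der (w : E) : 𝓢(E, ℂ) →L[ℂ] 𝓢(E, ℂ) := LineDeriv.lineDerivOpCLM ℂ 𝓢(E, ℂ) w

theorem der_apply (w : E) (f : 𝓢(E, ℂ)) (v : E) : der w f v = fderiv ℝ f v w := rfl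

theorem mulL_comm (c d : E →L[ℝ] ℂ) : mulL c * mulL d = mulL d * mulL c := by
  ext f v; simp; ring

theorem der_comm (v w : E) : der v * der w = der w * der v := by
  ext f x
  have h : ∀ v w : E, der v (der w f) x = fderiv ℝ (fderiv ℝ f) x v w := by
    intro v w
    have hd : DifferentiableAt ℝ (fderiv ℝ f) x :=
      ((f.smooth ⊤).fderiv_right (m := 1)
        (WithTop.coe_le_coe.2 (le_top : (2 : ℕ∞) ≤ ⊤))).differentiable (by simp) x
    rw [der_apply]
    change fderiv ℝ (fun x => fderiv ℝ f x w) x v = _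
    rw [fderiv_clm_apply hd (by fun_prop)]
    simp
  change der v (der w f) x = der w (der v f) x
  rw [h, h]
  exact ((f.smooth ⊤).contDiffAt.isSymmSndFDerivAt (by
    simpa using WithTop.coe_le_coe.2 (le_top : (2 : ℕ∞) ≤ ⊤))).eq _ _

theorem der_mul_mulL (w : E) (c : E →L[ℝ] ℂ) :
    der w * mulL c = mulL c * der w + c w • (1 : 𝓢(E, ℂ) →L[ℂ] 𝓢(E, ℂ)) := by
  ext f v
  have e : (⇑(mulL c f) : E → ℂ) = fun v => c v * f v := by ext v; simp
  change der w (mulL c f) v = mulL c (der w f) v + c w * f v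
  rw [der_apply, e, fderiv_fun_mul c.differentiableAt f.differentiableAt, mulL_apply, der_apply]
  simp
  ring

end Operators

/-! ### Commutation rules of the contraction operators and the fundamental theorem of calculus along
them. -/

section Slice

variable {E : Type} [NormedAddCommGroup E] [InnerProductSpace ℝ E]
  (q : E →L[ℝ] E) (hq : ∀ v, q (q v) = q v) {m : ℝ} (hm : 0 < m)

theorem fderiv_sliceFun (m τ : ℝ) (f : 𝓢(E, ℂ)) (v w : E) :
    fderiv ℝ (sliceFun q m τ f) v w = (Real.exp (-(m * (1 - τ ^ 2) * ‖q v‖ ^ 2)) : ℂ) *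
      ((-(2 * m * (1 - τ ^ 2) * inner ℝ (q v) (q w)) : ℝ) * f (v - (1 - τ) • q v) +
        fderiv ℝ f (v - (1 - τ) • q v) (w - (1 - τ) • q w)) := by
  have h1 : HasFDerivAt (fun v => -(m * (1 - τ ^ 2) * ‖q v‖ ^ 2))
      (-((m * (1 - τ ^ 2)) • (2 • (innerSL ℝ (q v)).comp q))) v :=
    ((q.hasFDerivAt.norm_sq).const_mul _).neg
  have h2 : HasFDerivAt (fun v => ((Real.exp (-(m * (1 - τ ^ 2) * ‖q v‖ ^ 2)) : ℝ) : ℂ)) _ v :=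
    Complex.ofRealCLM.hasFDerivAt.comp v h1.exp
  have h3 : HasFDerivAt (fun v => v - (1 - τ) • q v)
      (ContinuousLinearMap.id ℝ E - (1 - τ) • q) v :=
    (hasFDerivAt_id v).sub (q.hasFDerivAt.const_smul (1 - τ))
  have h4 : HasFDerivAt (sliceFun q m τ f) _ v := h2.mul ((f.hasFDerivAt _).comp v h3)
  rw [h4.fderiv]
  simp
  ring

theorem der_sliceInt_apply (f : 𝓢(E, ℂ)) (v w : E) : der w (sliceInt q hq hm f) v =
    ∫ τ in (0 : ℝ)..1, fderiv ℝ (sliceFun q m τ f) v w := by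
  have h := boundedFamily_sliceFun q hq hm f
  change fderiv ℝ (fun v => ∫ τ in (0 : ℝ)..1, sliceFun q m τ f v) v w = _
  rw [h.fderiv_integral]
  exact ContinuousLinearMap.intervalIntegral_apply
    ((h.fderiv.continuous_left v).intervalIntegrable _ _) w

/-- Neither the Gaussian weight nor the contraction moves in directions of ker q. This is what lets
a homotopy in one coordinate commute with the operators in the others. -/
theorem sliceInt_der (w : E) (hw : q w = 0) :
    der w * sliceInt q hq hm = sliceInt q hq hm * der w := by
  ext f v
  change der w (sliceInt q hq hm f) v = sliceInt q hq hm (der w f) v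
  rw [der_sliceInt_apply, sliceInt_apply]
  congr 1; ext τ
  rw [fderiv_sliceFun, sliceFun, der_apply]
  simp [hw]

theorem sliceInt_mulL (c : E →L[ℝ] ℂ) (hc : ∀ v, c (q v) = 0) :
    mulL c * sliceInt q hq hm = sliceInt q hq hm * mulL c := by
  ext f v
  change mulL c (sliceInt q hq hm f) v = sliceInt q hq hm (mulL c f) v
  rw [mulL_apply, sliceInt_apply, sliceInt_apply, ← intervalIntegral.integral_const_mul]
  congr 1; ext τ
  rw [sliceFun, sliceFun, mulL_apply, map_sub c, map_smul c, hc]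
  simp; ring

/-- The operator `slice` for `τ = 0`: the restriction to the kernel of `q`, extended by a
Gaussian. -/
def slice0 : 𝓢(E, ℂ) →L[ℂ] 𝓢(E, ℂ) := slice q hq hm 0 (by simp)

theorem slice0_apply (f : 𝓢(E, ℂ)) (v : E) :
    slice0 q hq hm f v = (Real.exp (-(m * ‖q v‖ ^ 2)) : ℂ) * f (v - q v) := by
  rw [slice0, slice_apply]; simp

theorem der_slice0_apply (f : 𝓢(E, ℂ)) (v w : E) :
    der w (slice0 q hq hm f) v = (Real.exp (-(m * ‖q v‖ ^ 2)) : ℂ) *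
      ((-(2 * m * inner ℝ (q v) (q w)) : ℝ) * f (v - q v) + der (w - q w) f (v - q v)) := by
  change fderiv ℝ (sliceFun q m 0 f) v w = _
  rw [fderiv_sliceFun, der_apply]; simp

theorem slice0_der (w : E) (hw : q w = 0) :
    der w * slice0 q hq hm = slice0 q hq hm * der w := by
  ext f v
  change der w (slice0 q hq hm f) v = slice0 q hq hm (der w f) v
  rw [der_slice0_apply, slice0_apply, hw]; simp

theorem slice0_mulL (c : E →L[ℝ] ℂ) (hc : ∀ v, c (q v) = 0) :
    mulL c * slice0 q hq hm = slice0 q hq hm * mulL c := by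
  ext f v
  change mulL c (slice0 q hq hm f) v = slice0 q hq hm (mulL c f) v
  rw [mulL_apply, slice0_apply, slice0_apply, mulL_apply, map_sub c, hc]
  simp; ring

theorem slice0_slice0 : slice0 q hq hm * slice0 q hq hm = slice0 q hq hm := by
  ext f v
  change slice0 q hq hm (slice0 q hq hm f) v = slice0 q hq hm f v
  rw [slice0_apply, slice0_apply, slice0_apply]
  simp [hq]

/-- The fundamental theorem of calculus along the segment from `v - q v` to `v`. -/
theorem sub_slice0_apply (f : 𝓢(E, ℂ)) (v : E) :
    f v - slice0 q hq hm f v = ∫ τ in (0 : ℝ)..1, (Real.exp (-(m * (1 - τ ^ 2) * ‖q v‖ ^ 2)) : ℂ) *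
      ((2 * m * τ * ‖q v‖ ^ 2 : ℝ) * f (v - (1 - τ) • q v) +
        der (q v) f (v - (1 - τ) • q v)) := by
  have hd : ∀ τ : ℝ, HasDerivAt (fun τ : ℝ => sliceFun q m τ f v)
      ((Real.exp (-(m * (1 - τ ^ 2) * ‖q v‖ ^ 2)) : ℂ) *
      ((2 * m * τ * ‖q v‖ ^ 2 : ℝ) * f (v - (1 - τ) • q v) +
        der (q v) f (v - (1 - τ) • q v))) τ := by
    intro τ
    have h1 : HasDerivAt (fun τ : ℝ => -(m * (1 - τ ^ 2) * ‖q v‖ ^ 2))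
        (2 * m * τ * ‖q v‖ ^ 2) τ := by
      have := ((((hasDerivAt_id τ).pow 2).const_sub 1).const_mul m |>.mul_const (‖q v‖ ^ 2)).neg
      refine this.congr_deriv ?_
      simp only [id]; ring
    have h2 : HasDerivAt (fun τ : ℝ => ((Real.exp (-(m * (1 - τ ^ 2) * ‖q v‖ ^ 2)) : ℝ) : ℂ))
        _ τ := h1.exp.ofReal_comp
    have h3 : HasDerivAt (fun τ : ℝ => v - (1 - τ) • q v) (q v) τ := by
      have := (((hasDerivAt_id τ).const_sub 1).smul_const (q v)).const_sub v
      refine this.congr_deriv ?_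
      module
    have h4 := h2.mul ((f.hasFDerivAt _).comp_hasDerivAt τ h3)
    refine h4.congr_deriv ?_
    rw [der_apply]
    simp
    ring
  have h := intervalIntegral.integral_eq_sub_of_hasDerivAt (a := 0) (b := 1) (fun τ _ => hd τ) ?_
  · rw [h, slice0_apply]
    simp [sliceFun]
  · apply Continuous.intervalIntegrable
    have h1 : Continuous fun τ : ℝ => f (v - (1 - τ) • q v) := f.continuous.comp (by fun_prop)
    have h2 : Continuous fun τ : ℝ => der (q v) f (v - (1 - τ) • q v) :=
      (der (q v) f).continuous.comp (by fun_prop)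
    fun_prop

/-- A right inverse of the operator `∂_e + 2 m y`, where `y` is a real linear form with
`y e = 1`. -/
theorem der_add_mulL_sliceInt (y : E →L[ℝ] ℝ) (e : E) (hye : y e = 1) (he : ‖e‖ = 1)
    (hqy : ∀ v, q v = y v • e) :
    (der e + (2 * m : ℂ) • mulL (Complex.ofRealCLM.comp y)) *
      (mulL (Complex.ofRealCLM.comp y) * sliceInt q hq hm) = 1 := by
  ext f v
  set H := mulL (Complex.ofRealCLM.comp y) (sliceInt q hq hm f) with hH
  change der e H v + 2 * m * mulL (Complex.ofRealCLM.comp y) H v = f v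
  set v' := v - y v • e with hv'
  have hyv' : y v' = 0 := by simp [hv', hye]
  have hf : Continuous fun r : ℝ => (Real.exp (m * r ^ 2) : ℂ) * f (v' + r • e) := by
    have : Continuous fun r : ℝ => f (v' + r • e) := f.continuous.comp (by fun_prop)
    fun_prop
  -- Variation of constants: the substitution r = τσ absorbs the factor y and exhibits H on each
  -- line parallel to e as the solution of h' + 2mσh = f that vanishes at σ = 0.
  have hline : ∀ σ : ℝ, H (v' + σ • e) = (Real.exp (-(m * σ ^ 2)) : ℂ) *
      ∫ r in (0 : ℝ)..σ, (Real.exp (m * r ^ 2) : ℂ) * f (v' + r • e) := by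
    intro σ
    have h1 := intervalIntegral.smul_integral_comp_mul_right
      (fun r : ℝ => (Real.exp (m * r ^ 2) : ℂ) * f (v' + r • e)) σ (a := 0) (b := 1)
    simp only [zero_mul, one_mul] at h1
    have hy : (Complex.ofRealCLM.comp y) (v' + σ • e) = σ := by simp [hyv', hye]
    rw [← h1, hH, mulL_apply, sliceInt_apply, Complex.real_smul, hy,
      mul_left_comm (Real.exp (-(m * σ ^ 2)) : ℂ)]
    congr 1
    rw [← intervalIntegral.integral_const_mul]
    refine intervalIntegral.integral_congr fun τ _ => ?_
    have h2 : q (v' + σ • e) = σ • e := by rw [hqy]; simp [hyv', hye]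
    have h3 : v' + σ • e - (1 - τ) • σ • e = v' + (τ * σ) • e := by module
    rw [sliceFun, h2, h3, norm_smul, he, ← mul_assoc, ← Complex.ofReal_mul, ← Real.exp_add]
    congr 3
    simp; ring
  have hd : HasDerivAt (fun σ : ℝ => H (v' + σ • e))
      (-(2 * m * y v) * H v + f v) (y v) := by
    have h1 : HasDerivAt (fun σ : ℝ => -(m * σ ^ 2)) (-(2 * m * y v)) (y v) := by
      have := (((hasDerivAt_id (y v)).pow 2).const_mul m).neg
      refine this.congr_deriv ?_
      simp only [id]; ring
    have h2 := h1.exp.ofReal_comp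
    have h3 := intervalIntegral.integral_hasDerivAt_right (hf.intervalIntegrable 0 (y v))
      (hf.stronglyMeasurableAtFilter _ _) hf.continuousAt
    have h4 := h2.mul h3
    have e1 : (fun σ : ℝ => H (v' + σ • e)) = fun σ : ℝ => (Real.exp (-(m * σ ^ 2)) : ℂ) *
      ∫ r in (0 : ℝ)..σ, (Real.exp (m * r ^ 2) : ℂ) * f (v' + r • e) := funext hline
    rw [e1]
    refine h4.congr_deriv ?_
    have e2 : v' + y v • e = v := by simp [hv']
    have e3 := hline (y v)
    rw [e2] at e3
    have hexp : (Real.exp (-(m * y v ^ 2)) : ℂ) * (Real.exp (m * y v ^ 2) : ℂ) = 1 := by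
      rw [← Complex.ofReal_mul, ← Real.exp_add]; simp
    rw [e3, e2]
    simp only [Complex.ofReal_mul, Complex.ofReal_neg, Complex.ofReal_ofNat]
    linear_combination f v * hexp
  -- The same derivative, now read off from the Fréchet derivative of H; comparing the two values is
  -- the claim.
  have hd' : HasDerivAt (fun σ : ℝ => H (v' + σ • e)) (fderiv ℝ H v e) (y v) := by
    have h3 : HasDerivAt (fun σ : ℝ => v' + σ • e) e (y v) := by
      simpa using ((hasDerivAt_id (y v)).smul_const e).const_add v'
    have h4 := (H.hasFDerivAt (v' + y v • e)).comp_hasDerivAt (y v) h3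
    have e2 : v' + y v • e = v := by simp [hv']
    rwa [e2] at h4
  rw [der_apply, ← hd.unique hd', mulL_apply _ H]
  simp only [ContinuousLinearMap.comp_apply, Complex.ofRealCLM_apply]
  ring

end Slice
end
end NCTorus

open scoped SchwartzMap LineDeriv ContDiff TensorProduct ComplexConjugate FourierTransform

namespace NCTorus

noncomputable section

variable {g : ℕ}

/-! ### Real coordinates on ℂ^g and the two first-order operators in each coordinate. -/

/-- The real part of the `j`-th coordinate. -/
def reC (j : Fin g) : V g →L[ℝ] ℝ :=
  Complex.reCLM.comp ((EuclideanSpace.proj j : V g →L[ℂ] ℂ).restrictScalars ℝ)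

/-- The imaginary part of the `j`-th coordinate. -/
def imC (j : Fin g) : V g →L[ℝ] ℝ :=
  Complex.imCLM.comp ((EuclideanSpace.proj j : V g →L[ℂ] ℂ).restrictScalars ℝ)

@[simp] theorem reC_apply (j : Fin g) (z : V g) : reC j z = (z j).re := rfl
@[simp] theorem imC_apply (j : Fin g) (z : V g) : imC j z = (z j).im := rfl

/-- Multiplication by `Re z_j`. -/
def mulX (j : Fin g) : 𝓢(V g, ℂ) →L[ℂ] 𝓢(V g, ℂ) := mulL (Complex.ofRealCLM.comp (reC j))

/-- Multiplication by `Im z_j`. -/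
def mulY (j : Fin g) : 𝓢(V g, ℂ) →L[ℂ] 𝓢(V g, ℂ) := mulL (Complex.ofRealCLM.comp (imC j))

/-- The derivative `∂/∂x_j`. -/
def derX (j : Fin g) : 𝓢(V g, ℂ) →L[ℂ] 𝓢(V g, ℂ) := der (stdVec j)

/-- The derivative `∂/∂y_j`. -/
def derY (j : Fin g) : 𝓢(V g, ℂ) →L[ℂ] 𝓢(V g, ℂ) := der (Complex.I • stdVec j)

@[simp] theorem mulX_apply (j : Fin g) (f : 𝓢(V g, ℂ)) (z : V g) :
    mulX j f z = (z j).re * f z := mulL_apply _ _ _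

@[simp] theorem mulY_apply (j : Fin g) (f : 𝓢(V g, ℂ)) (z : V g) :
    mulY j f z = (z j).im * f z := mulL_apply _ _ _

theorem mulZ_eq (j : Fin g) : mulZ j = mulX j + Complex.I • mulY j := by
  ext f z
  rw [mulZ_apply]
  change _ = mulX j f z + Complex.I * mulY j f z
  rw [mulX_apply, mulY_apply]
  conv_lhs => rw [← Complex.re_add_im (z j)]
  ring

theorem dbar_eq (j : Fin g) : dbar j = (1 / 2 : ℂ) • (derX j + Complex.I • derY j) := rfl

@[simp] theorem stdVec_apply (j k : Fin g) : stdVec j k = if k = j then 1 else 0 := by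
  simp [stdVec]

theorem derX_mulX (j k : Fin g) :
    derX j * mulX k = mulX k * derX j + (if k = j then 1 else 0 : ℂ) • 1 := by
  rw [derX, mulX, der_mul_mulL]
  by_cases h : k = j <;> simp [h]

theorem derY_mulY (j k : Fin g) :
    derY j * mulY k = mulY k * derY j + (if k = j then 1 else 0 : ℂ) • 1 := by
  rw [derY, mulY, der_mul_mulL]
  by_cases h : k = j <;> simp [h]

theorem derX_mulY (j k : Fin g) : derX j * mulY k = mulY k * derX j := by
  rw [derX, mulY, der_mul_mulL]
  by_cases h : k = j <;> simp [h]

theorem derY_mulX (j k : Fin g) : derY j * mulX k = mulX k * derY j := by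
  rw [derY, mulX, der_mul_mulL]
  by_cases h : k = j <;> simp [h]

/-- `∂/∂\bar z_j + 2 π z_j`, which annihilates the Gaussian. -/
def alphaOp (j : Fin g) : 𝓢(V g, ℂ) →L[ℂ] 𝓢(V g, ℂ) := dbar j + (2 * Real.pi : ℂ) • mulZ j

/-- `∂/∂\bar z_j - 2 π z_j`. -/
def gammaOp (j : Fin g) : 𝓢(V g, ℂ) →L[ℂ] 𝓢(V g, ℂ) := dbar j - (2 * Real.pi : ℂ) • mulZ j

/-! ### Multiplication by quadratic phases. -/

section Chirp

/-- The quadratic form `∑_j Re z_j Im z_j`. -/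
def quadXY (z : V g) : ℝ := ∑ j, (z j).re * (z j).im

theorem hasFDerivAt_quadXY (z : V g) :
    HasFDerivAt quadXY (∑ j, ((z j).re • imC j + (z j).im • reC j)) z :=
  HasFDerivAt.fun_sum fun j _ => ((reC j).hasFDerivAt (x := z)).mul ((imC j).hasFDerivAt (x := z))

theorem hasTemperateGrowth_chirp (c : ℝ) : Function.HasTemperateGrowth
    fun z : V g => Complex.exp (Complex.I * (c * quadXY z : ℝ)) := by
  have h1 : Function.HasTemperateGrowth fun t : ℝ => Complex.exp (2 * Real.pi * Complex.I * t) := by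
    refine ⟨?_, fun n => ⟨0, (2 * Real.pi) ^ n, fun t => ?_⟩⟩
    · have : ContDiff ℝ ∞ (fun t : ℝ => (t : ℂ)) := Complex.ofRealCLM.contDiff
      fun_prop
    · rw [norm_iteratedFDeriv_eq_norm_iteratedDeriv, iteratedDeriv_circle, norm_mul, norm_pow]
      have h1 : ‖Complex.exp (2 * Real.pi * Complex.I * t)‖ = 1 := by
        have : (2 * Real.pi * Complex.I * t : ℂ) = ((2 * Real.pi * t : ℝ) : ℂ) * Complex.I := by
          push_cast; ring
        rw [this, Complex.norm_exp_ofReal_mul_I]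
      rw [h1]
      simp [abs_of_pos Real.pi_pos]
  -- The division by 2π matches the normalization t ↦ exp(2πit) of `h1`.
  have h2 : Function.HasTemperateGrowth fun z : V g => c / (2 * Real.pi) * quadXY z := by
    refine (Function.HasTemperateGrowth.const _).mul (Function.HasTemperateGrowth.sum fun j _ => ?_)
    exact (reC j).hasTemperateGrowth.mul (imC j).hasTemperateGrowth
  have h3 := h1.comp h2
  convert h3 using 1
  ext z
  simp only [Function.comp_apply]
  congr 1
  have : (Real.pi : ℂ) ≠ 0 := by exact_mod_cast Real.pi_ne_zero
  push_cast
  field_simp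

/-- Multiplication by `z ↦ exp (i c ∑_j Re z_j Im z_j)`. -/
def chirp (c : ℝ) : 𝓢(V g, ℂ) →L[ℂ] 𝓢(V g, ℂ) :=
  SchwartzMap.smulLeftCLM ℂ fun z : V g => Complex.exp (Complex.I * (c * quadXY z : ℝ))

theorem chirp_apply (c : ℝ) (f : 𝓢(V g, ℂ)) (z : V g) :
    chirp c f z = Complex.exp (Complex.I * (c * quadXY z : ℝ)) * f z :=
  SchwartzMap.smulLeftCLM_apply_apply (hasTemperateGrowth_chirp c) f z

theorem chirp_neg_mul (c : ℝ) : (chirp (-c) * chirp c : 𝓢(V g, ℂ) →L[ℂ] 𝓢(V g, ℂ)) = 1 := by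
  ext f z
  change chirp (-c) (chirp c f) z = f z
  rw [chirp_apply, chirp_apply, ← mul_assoc, ← Complex.exp_add]
  simp

theorem chirp_mulL (c : ℝ) (d : V g →L[ℝ] ℂ) : chirp c * mulL d = mulL d * chirp c := by
  ext f z
  change chirp c (mulL d f) z = mulL d (chirp c f) z
  simp only [chirp_apply, mulL_apply]; ring

/-- A quadratic phase acts as a shear of phase space: positions stay, and each derivative is shifted
by the linear form that differentiates the quadratic form. -/
theorem der_chirp (c : ℝ) (w : V g) : chirp c * der w = (der w - (Complex.I * c) •
    mulL (Complex.ofRealCLM.comp (∑ j, ((w j).im • reC j + (w j).re • imC j)))) * chirp c := by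
  ext f z
  change chirp c (der w f) z = der w (chirp c f) z - Complex.I * c * mulL _ (chirp c f) z
  have h1 : HasFDerivAt (fun z : V g => (Complex.I * (c * quadXY z : ℝ) : ℂ)) _ z :=
    (Complex.ofRealCLM.hasFDerivAt.comp z ((hasFDerivAt_quadXY z).const_mul c)).const_mul Complex.I
  have h2 : HasFDerivAt (chirp c f) _ z :=
    HasFDerivAt.congr_of_eventuallyEq (h1.cexp.mul (f.hasFDerivAt z))
      (Filter.Eventually.of_forall fun z => chirp_apply c f z)
  rw [der_apply w (chirp c f), h2.fderiv, mulL_apply, chirp_apply, chirp_apply, der_apply]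
  simp
  rw [Finset.sum_congr rfl fun j _ => show ((z j).re * (w j).im + (z j).im * (w j).re : ℂ) =
    (w j).im * (z j).re + (w j).re * (z j).im by ring]
  ring

theorem chirp_derX (c : ℝ) (j : Fin g) :
    chirp c * derX j = (derX j - (Complex.I * c) • mulY j) * chirp c := by
  rw [derX, der_chirp, mulY]
  congr 5
  ext z; simp [apply_ite]

theorem chirp_derY (c : ℝ) (j : Fin g) :
    chirp c * derY j = (derY j - (Complex.I * c) • mulX j) * chirp c := by
  rw [derY, der_chirp, mulX]
  congr 5
  ext z; simp [apply_ite]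

end Chirp

/-! ### The Fourier transform on positions and momenta. -/

section Fourier

/-- The Fourier transform. -/
def fourierS : 𝓢(V g, ℂ) →L[ℂ] 𝓢(V g, ℂ) := SchwartzMap.fourierTransformCLM ℂ

theorem inner_stdVec (z : V g) (j : Fin g) : inner ℝ z (stdVec j) = (z j).re := by
  rw [PiLp.inner_apply, Finset.sum_eq_single j]
  · simp [Complex.inner]
  · intro k _ hk; simp [hk]
  · simp

theorem inner_I_stdVec (z : V g) (j : Fin g) : inner ℝ z (Complex.I • stdVec j) = (z j).im := by
  rw [PiLp.inner_apply, Finset.sum_eq_single j]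
  · simp [Complex.inner]
  · intro k _ hk; simp [hk]
  · simp

theorem smulLeft_reC (j : Fin g) (f : 𝓢(V g, ℂ)) :
    SchwartzMap.smulLeftCLM ℂ (inner ℝ · (stdVec j)) f = mulX j f := by
  ext z
  rw [SchwartzMap.smulLeftCLM_apply_apply (by fun_prop), inner_stdVec, mulX_apply,
    Complex.real_smul]

theorem smulLeft_imC (j : Fin g) (f : 𝓢(V g, ℂ)) :
    SchwartzMap.smulLeftCLM ℂ (inner ℝ · (Complex.I • stdVec j)) f = mulY j f := by
  ext z
  rw [SchwartzMap.smulLeftCLM_apply_apply (by fun_prop), inner_I_stdVec, mulY_apply,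
    Complex.real_smul]

theorem fourierS_derX (j : Fin g) :
    fourierS * derX j = (2 * Real.pi * Complex.I : ℂ) • (mulX j * fourierS) := by
  ext f z
  change 𝓕 (∂_{stdVec j} f) z = _
  rw [SchwartzMap.fourier_lineDerivOp_eq, smulLeft_reC]
  rfl

theorem fourierS_derY (j : Fin g) :
    fourierS * derY j = (2 * Real.pi * Complex.I : ℂ) • (mulY j * fourierS) := by
  ext f z
  change 𝓕 (∂_{Complex.I • stdVec j} f) z = _
  rw [SchwartzMap.fourier_lineDerivOp_eq, smulLeft_imC]
  rfl

theorem fourierS_mulX (j : Fin g) :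
    fourierS * mulX j = -(2 * Real.pi * Complex.I : ℂ)⁻¹ • (derX j * fourierS) := by
  ext f z
  change 𝓕 (mulX j f) z = -(2 * Real.pi * Complex.I : ℂ)⁻¹ * (∂_{stdVec j} (𝓕 f)) z
  rw [SchwartzMap.lineDerivOp_fourier_eq, smulLeft_reC, FourierTransform.fourier_smul]
  change _ = -(2 * Real.pi * Complex.I : ℂ)⁻¹ * (-(2 * Real.pi * Complex.I) * (𝓕 (mulX j f)) z)
  field_simp

theorem fourierS_mulY (j : Fin g) :
    fourierS * mulY j = -(2 * Real.pi * Complex.I : ℂ)⁻¹ • (derY j * fourierS) := by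
  ext f z
  change 𝓕 (mulY j f) z = -(2 * Real.pi * Complex.I : ℂ)⁻¹ * (∂_{Complex.I • stdVec j} (𝓕 f)) z
  rw [SchwartzMap.lineDerivOp_fourier_eq, smulLeft_imC, FourierTransform.fourier_smul]
  change _ = -(2 * Real.pi * Complex.I : ℂ)⁻¹ * (-(2 * Real.pi * Complex.I) * (𝓕 (mulY j f)) z)
  field_simp

theorem exists_fourierS_inverse : ∃ G : 𝓢(V g, ℂ) →L[ℂ] 𝓢(V g, ℂ),
    G * fourierS = 1 ∧ fourierS * G = 1 := by
  refine ⟨(FourierTransform.fourierCLE ℂ 𝓢(V g, ℂ)).symm.toContinuousLinearMap,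
    ContinuousLinearMap.ext fun f => ?_, ContinuousLinearMap.ext fun f => ?_⟩
  · change 𝓕⁻ (𝓕 f) = f
    exact FourierTransform.fourierInv_fourier_eq f
  · change 𝓕 (𝓕⁻ f) = f
    exact FourierTransform.fourier_fourierInv_eq f

end Fourier

/-! ### The canonical transformation and the right inverse of `alphaOp`. -/

section RightInverse

/-- The linear canonical transformation which turns `alphaOp` and `gammaOp` into operators in the
real variables `y_j` and `x_j`. -/
def canon : 𝓢(V g, ℂ) →L[ℂ] 𝓢(V g, ℂ) :=
  chirp (-(Real.pi / 2)) * fourierS * chirp (-(4 * Real.pi))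

theorem exists_canon_inverse : ∃ G : 𝓢(V g, ℂ) →L[ℂ] 𝓢(V g, ℂ), G * canon = 1 ∧ canon * G = 1 := by
  obtain ⟨F, h1, h2⟩ := exists_fourierS_inverse (g := g)
  have c1 := fun c : ℝ => chirp_neg_mul (g := g) c
  have c2 : ∀ c : ℝ, (chirp c * chirp (-c) : 𝓢(V g, ℂ) →L[ℂ] 𝓢(V g, ℂ)) = 1 := fun c => by
    simpa using chirp_neg_mul (g := g) (-c)
  refine ⟨chirp (4 * Real.pi) * F * chirp (Real.pi / 2), ?_, ?_⟩
  · calc _ = chirp (4 * Real.pi) * F * (chirp (Real.pi / 2) * chirp (-(Real.pi / 2))) * fourierS *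
          chirp (-(4 * Real.pi)) := by simp only [canon, mul_assoc]
      _ = chirp (4 * Real.pi) * (F * fourierS) * chirp (-(4 * Real.pi)) := by
          rw [c2]; simp only [mul_assoc, one_mul]
      _ = 1 := by rw [h1, mul_one, c2]
  · calc _ = chirp (-(Real.pi / 2)) * fourierS * (chirp (-(4 * Real.pi)) * chirp (4 * Real.pi)) *
          F * chirp (Real.pi / 2) := by simp only [canon, mul_assoc]
      _ = chirp (-(Real.pi / 2)) * (fourierS * F) * chirp (Real.pi / 2) := by
          rw [c1]; simp only [mul_assoc, one_mul]
      _ = 1 := by rw [h2, mul_one, c1]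

/-- The first phase commutes with multiplications, the Fourier transform makes them derivatives, and
the last phase shears these. The three analogous rules below determine the action on every operator
linear in positions and momenta. -/
theorem canon_mulX (j : Fin g) : canon * mulX j = (-(2 * Real.pi * Complex.I : ℂ)⁻¹ •
    (derX j + (Complex.I * (Real.pi / 2)) • mulY j)) * canon := by
  have h1 := chirp_mulL (-(4 * Real.pi)) (Complex.ofRealCLM.comp (reC j))
  have h2 := chirp_derX (-(Real.pi / 2)) j
  calc canon * mulX j = chirp (-(Real.pi / 2)) * (fourierS * mulX j) * chirp (-(4 * Real.pi)) := by
        rw [canon, mul_assoc, mulX, h1]; simp only [mul_assoc]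
    _ = -(2 * Real.pi * Complex.I : ℂ)⁻¹ •
        ((chirp (-(Real.pi / 2)) * derX j) * fourierS * chirp (-(4 * Real.pi))) := by
        rw [fourierS_mulX]; simp only [mul_assoc, smul_mul_assoc, mul_smul_comm]
    _ = _ := by
        rw [h2, canon]
        simp only [mul_assoc, smul_mul_assoc]
        push_cast
        simp only [mul_neg, neg_smul, sub_neg_eq_add]

theorem canon_mulY (j : Fin g) : canon * mulY j = (-(2 * Real.pi * Complex.I : ℂ)⁻¹ •
    (derY j + (Complex.I * (Real.pi / 2)) • mulX j)) * canon := by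
  have h1 := chirp_mulL (-(4 * Real.pi)) (Complex.ofRealCLM.comp (imC j))
  have h2 := chirp_derY (-(Real.pi / 2)) j
  calc canon * mulY j = chirp (-(Real.pi / 2)) * (fourierS * mulY j) * chirp (-(4 * Real.pi)) := by
        rw [canon, mul_assoc, mulY, h1]; simp only [mul_assoc]
    _ = -(2 * Real.pi * Complex.I : ℂ)⁻¹ •
        ((chirp (-(Real.pi / 2)) * derY j) * fourierS * chirp (-(4 * Real.pi))) := by
        rw [fourierS_mulY]; simp only [mul_assoc, smul_mul_assoc, mul_smul_comm]
    _ = _ := by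
        rw [h2, canon]
        simp only [mul_assoc, smul_mul_assoc]
        push_cast
        simp only [mul_neg, neg_smul, sub_neg_eq_add]

theorem canon_derX (j : Fin g) :
    canon * derX j = ((Real.pi * Complex.I) • mulX j - (2 : ℂ) • derY j) * canon := by
  have h1 := chirp_derX (-(4 * Real.pi)) j
  have h2 := chirp_derY (-(Real.pi / 2)) j
  have h3 := chirp_mulL (-(Real.pi / 2)) (Complex.ofRealCLM.comp (reC j))
  have hpi : (Real.pi : ℂ) ≠ 0 := by exact_mod_cast Real.pi_ne_zero
  calc canon * derX j = chirp (-(Real.pi / 2)) * (fourierS * (derX j -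
        (Complex.I * ((-(4 * Real.pi) : ℝ) : ℂ)) • mulY j)) * chirp (-(4 * Real.pi)) := by
        rw [canon, mul_assoc, h1]; simp only [mul_assoc]
    _ = (2 * Real.pi * Complex.I : ℂ) • ((chirp (-(Real.pi / 2)) * mulX j) * fourierS *
          chirp (-(4 * Real.pi))) - (2 : ℂ) •
          ((chirp (-(Real.pi / 2)) * derY j) * fourierS * chirp (-(4 * Real.pi))) := by
        rw [mul_sub, mul_smul_comm, fourierS_derX, fourierS_mulY, smul_smul]
        have : Complex.I * ((-(4 * Real.pi) : ℝ) : ℂ) * -(2 * Real.pi * Complex.I)⁻¹ = 2 := by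
          push_cast
          field_simp
          norm_num
        rw [this]
        simp only [mul_assoc, mul_sub, sub_mul, smul_mul_assoc, mul_smul_comm]
    _ = _ := by
        rw [h2, mulX, h3, canon]
        simp only [mul_assoc, sub_mul, smul_mul_assoc, smul_sub, smul_smul]
        push_cast
        module

theorem canon_derY (j : Fin g) :
    canon * derY j = ((Real.pi * Complex.I) • mulY j - (2 : ℂ) • derX j) * canon := by
  have h1 := chirp_derY (-(4 * Real.pi)) j
  have h2 := chirp_derX (-(Real.pi / 2)) j
  have h3 := chirp_mulL (-(Real.pi / 2)) (Complex.ofRealCLM.comp (imC j))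
  have hpi : (Real.pi : ℂ) ≠ 0 := by exact_mod_cast Real.pi_ne_zero
  calc canon * derY j = chirp (-(Real.pi / 2)) * (fourierS * (derY j -
        (Complex.I * ((-(4 * Real.pi) : ℝ) : ℂ)) • mulX j)) * chirp (-(4 * Real.pi)) := by
        rw [canon, mul_assoc, h1]; simp only [mul_assoc]
    _ = (2 * Real.pi * Complex.I : ℂ) • ((chirp (-(Real.pi / 2)) * mulY j) * fourierS *
          chirp (-(4 * Real.pi))) - (2 : ℂ) •
          ((chirp (-(Real.pi / 2)) * derX j) * fourierS * chirp (-(4 * Real.pi))) := by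
        rw [mul_sub, mul_smul_comm, fourierS_derY, fourierS_mulX, smul_smul]
        have : Complex.I * ((-(4 * Real.pi) : ℝ) : ℂ) * -(2 * Real.pi * Complex.I)⁻¹ = 2 := by
          push_cast
          field_simp
          norm_num
        rw [this]
        simp only [mul_assoc, mul_sub, sub_mul, smul_mul_assoc, mul_smul_comm]
    _ = _ := by
        rw [h2, mulY, h3, canon]
        simp only [mul_assoc, sub_mul, smul_mul_assoc, smul_sub, smul_smul]
        push_cast
        module

/-- The parameters -π/2 and -4π of the two phases are tuned so that all terms in x_j and ∂/∂x_j
cancel. What remains is an ordinary differential operator in y_j with the sign for which integration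
from 0 against the Gaussian stays in the Schwartz space. -/
theorem canon_alphaOp (j : Fin g) : canon * alphaOp j =
    ((-2 : ℂ) • (derY j + (Real.pi / 2 : ℂ) • mulY j)) * canon := by
  have hpi : (Real.pi : ℂ) ≠ 0 := by exact_mod_cast Real.pi_ne_zero
  have hc : (2 * Real.pi : ℂ) * (2 * Real.pi * Complex.I : ℂ)⁻¹ = -Complex.I := by
    rw [mul_inv, ← mul_assoc, mul_inv_cancel₀ (by simp [hpi]), one_mul, Complex.inv_I]
  have h2 : (2 * Real.pi : ℂ) • (canon * mulX j) =
      (Complex.I • derX j - (Real.pi / 2 : ℂ) • mulY j) * canon := by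
    rw [canon_mulX, ← smul_mul_assoc, smul_smul, mul_neg, hc, neg_neg, smul_add, smul_smul,
      ← mul_assoc, Complex.I_mul_I]
    congr 1; module
  have h3 : (2 * Real.pi : ℂ) • (canon * mulY j) =
      (Complex.I • derY j - (Real.pi / 2 : ℂ) • mulX j) * canon := by
    rw [canon_mulY, ← smul_mul_assoc, smul_smul, mul_neg, hc, neg_neg, smul_add, smul_smul,
      ← mul_assoc, Complex.I_mul_I]
    congr 1; module
  calc canon * alphaOp j = (1 / 2 : ℂ) • (canon * derX j + Complex.I • (canon * derY j)) +
        ((2 * Real.pi : ℂ) • (canon * mulX j) + Complex.I • (2 * Real.pi : ℂ) • (canon * mulY j)) := by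
        rw [alphaOp, dbar_eq, mulZ_eq]
        simp only [mul_add, mul_smul_comm, smul_add]
        congr 2
        exact smul_comm _ _ _
    _ = ((1 / 2 : ℂ) • (((Real.pi * Complex.I) • mulX j - (2 : ℂ) • derY j) +
        Complex.I • ((Real.pi * Complex.I) • mulY j - (2 : ℂ) • derX j)) +
        ((Complex.I • derX j - (Real.pi / 2 : ℂ) • mulY j) +
          Complex.I • (Complex.I • derY j - (Real.pi / 2 : ℂ) • mulX j))) * canon := by
        rw [canon_derX, canon_derY, h2, h3]
        simp only [add_mul, smul_mul_assoc]
    _ = _ := by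
        congr 1
        simp only [smul_add, smul_sub, smul_smul]
        have e1 : Complex.I * (Real.pi * Complex.I) = -(Real.pi : ℂ) := by
          linear_combination (Real.pi : ℂ) * Complex.I_mul_I
        rw [Complex.I_mul_I, e1]
        module

/-- Here the terms in y_j cancel instead, so a right inverse built in the variable y_j commutes with
every `gammaOp k`, including k = j. -/
theorem canon_gammaOp (j : Fin g) : canon * gammaOp j =
    ((-2 * Complex.I : ℂ) • (derX j - (Real.pi / 2 : ℂ) • mulX j)) * canon := by
  have hpi : (Real.pi : ℂ) ≠ 0 := by exact_mod_cast Real.pi_ne_zero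
  have hc : (2 * Real.pi : ℂ) * (2 * Real.pi * Complex.I : ℂ)⁻¹ = -Complex.I := by
    rw [mul_inv, ← mul_assoc, mul_inv_cancel₀ (by simp [hpi]), one_mul, Complex.inv_I]
  have h2 : (2 * Real.pi : ℂ) • (canon * mulX j) =
      (Complex.I • derX j - (Real.pi / 2 : ℂ) • mulY j) * canon := by
    rw [canon_mulX, ← smul_mul_assoc, smul_smul, mul_neg, hc, neg_neg, smul_add, smul_smul,
      ← mul_assoc, Complex.I_mul_I]
    congr 1; module
  have h3 : (2 * Real.pi : ℂ) • (canon * mulY j) =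
      (Complex.I • derY j - (Real.pi / 2 : ℂ) • mulX j) * canon := by
    rw [canon_mulY, ← smul_mul_assoc, smul_smul, mul_neg, hc, neg_neg, smul_add, smul_smul,
      ← mul_assoc, Complex.I_mul_I]
    congr 1; module
  calc canon * gammaOp j = (1 / 2 : ℂ) • (canon * derX j + Complex.I • (canon * derY j)) -
        ((2 * Real.pi : ℂ) • (canon * mulX j) + Complex.I • (2 * Real.pi : ℂ) • (canon * mulY j)) := by
        rw [gammaOp, dbar_eq, mulZ_eq]
        simp only [mul_add, mul_sub, mul_smul_comm, smul_add]
        congr 2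
        exact smul_comm _ _ _
    _ = ((1 / 2 : ℂ) • (((Real.pi * Complex.I) • mulX j - (2 : ℂ) • derY j) +
        Complex.I • ((Real.pi * Complex.I) • mulY j - (2 : ℂ) • derX j)) -
        ((Complex.I • derX j - (Real.pi / 2 : ℂ) • mulY j) +
          Complex.I • (Complex.I • derY j - (Real.pi / 2 : ℂ) • mulX j))) * canon := by
        rw [canon_derX, canon_derY, h2, h3]
        simp only [add_mul, sub_mul, smul_mul_assoc]
    _ = _ := by
        congr 1
        simp only [smul_add, smul_sub, smul_smul]
        have e1 : Complex.I * (Real.pi * Complex.I) = -(Real.pi : ℂ) := by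
          linear_combination (Real.pi : ℂ) * Complex.I_mul_I
        rw [Complex.I_mul_I, e1]
        module

/-- The projection onto the imaginary axis in the `j`-th coordinate. -/
def projY (j : Fin g) : V g →L[ℝ] V g := (imC j).smulRight (Complex.I • stdVec j)

theorem projY_apply (j : Fin g) (z : V g) : projY j z = (z j).im • (Complex.I • stdVec j) := rfl

theorem projY_projY (j : Fin g) (z : V g) : projY j (projY j z) = projY j z := by
  simp [projY_apply]

/-- A right inverse of `∂/∂y_j + (π / 2) y_j`. -/
def rightInvY (j : Fin g) : 𝓢(V g, ℂ) →L[ℂ] 𝓢(V g, ℂ) :=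
  -- The value π/4 of m is half of the coefficient π/2, as `der_add_mulL_sliceInt` inverts ∂ + 2my.
  mulY j * sliceInt (projY j) (projY_projY j) (m := Real.pi / 4) (by positivity)

theorem rightInvY_spec (j : Fin g) : (derY j + (Real.pi / 2 : ℂ) • mulY j) * rightInvY j = 1 := by
  have h := der_add_mulL_sliceInt (projY j) (projY_projY j) (m := Real.pi / 4) (by positivity)
    (imC j) (Complex.I • stdVec j) (by simp) (by simp [norm_smul, stdVec]) (projY_apply j)
  have e : (2 * ((Real.pi / 4 : ℝ) : ℂ)) = Real.pi / 2 := by push_cast; ring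
  rw [e] at h
  exact h

theorem rightInvY_derX (j k : Fin g) : derX k * rightInvY j = rightInvY j * derX k := by
  have h : projY j (stdVec k) = 0 := by simp [projY_apply, apply_ite]
  rw [rightInvY, ← mul_assoc, derX_mulY, mul_assoc, derX, sliceInt_der _ _ _ _ h, mul_assoc]

theorem rightInvY_mulX (j k : Fin g) : mulX k * rightInvY j = rightInvY j * mulX k := by
  have h : ∀ v, (Complex.ofRealCLM.comp (reC k)) (projY j v) = 0 := fun v => by
    simp [projY_apply, apply_ite]
  rw [rightInvY, ← mul_assoc, mulX, mulY, mulL_comm, mul_assoc, sliceInt_mulL _ _ _ _ h, mul_assoc]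

theorem rightInvY_derY {j k : Fin g} (hk : k ≠ j) : derY k * rightInvY j = rightInvY j * derY k := by
  have h : projY j (Complex.I • stdVec k) = 0 := by simp [projY_apply, hk.symm]
  rw [rightInvY, ← mul_assoc, derY_mulY, if_neg hk.symm, zero_smul, add_zero, mul_assoc, derY,
    sliceInt_der _ _ _ _ h, mul_assoc]

theorem rightInvY_mulY {j k : Fin g} (hk : k ≠ j) : mulY k * rightInvY j = rightInvY j * mulY k := by
  have h : ∀ v, (Complex.ofRealCLM.comp (imC k)) (projY j v) = 0 := fun v => by
    simp [projY_apply, hk]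
  rw [rightInvY, ← mul_assoc, mulY, mulY, mulL_comm, mul_assoc, sliceInt_mulL _ _ _ _ h, mul_assoc]

/-- `alphaOp j` has a continuous right inverse which commutes with all the other `alphaOp k` and
with the `gammaOp k`. -/
theorem exists_rightInverse (j : Fin g) : ∃ R : 𝓢(V g, ℂ) →L[ℂ] 𝓢(V g, ℂ),
    alphaOp j * R = 1 ∧ (∀ k, k ≠ j → alphaOp k * R = R * alphaOp k) ∧
      ∀ k, gammaOp k * R = R * gammaOp k := by
  obtain ⟨G, h1, h2⟩ := exists_canon_inverse (g := g)
  have key : ∀ A A' : 𝓢(V g, ℂ) →L[ℂ] 𝓢(V g, ℂ), canon * A = A' * canon → A = G * A' * canon := by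
    intro A A' h
    rw [mul_assoc, ← h, ← mul_assoc, h1, one_mul]
  -- Commutation is checked on the transformed side, where the operators live in separate real
  -- variables, and transported back by `canon`.
  have comm : ∀ A A' : 𝓢(V g, ℂ) →L[ℂ] 𝓢(V g, ℂ), canon * A = A' * canon →
      A' * rightInvY j = rightInvY j * A' →
      A * (G * ((-1 / 2 : ℂ) • rightInvY j) * canon) =
        G * ((-1 / 2 : ℂ) • rightInvY j) * canon * A := by
    intro A A' h hc
    calc _ = G * A' * (canon * G) * ((-1 / 2 : ℂ) • rightInvY j) * canon := by
          rw [key A A' h]; simp only [mul_assoc]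
      _ = (-1 / 2 : ℂ) • (G * (A' * rightInvY j) * canon) := by
          rw [h2, mul_one]; simp only [mul_assoc, mul_smul_comm, smul_mul_assoc]
      _ = (-1 / 2 : ℂ) • (G * rightInvY j * (A' * canon)) := by rw [hc]; simp only [mul_assoc]
      _ = _ := by rw [← h]; simp only [mul_assoc, mul_smul_comm, smul_mul_assoc]
  -- The scalar -1/2 inverts the factor -2 of `canon_alphaOp`.
  refine ⟨G * ((-1 / 2 : ℂ) • rightInvY j) * canon, ?_, fun k hk => ?_, fun k => ?_⟩
  · calc _ = G * ((-2 : ℂ) • (derY j + (Real.pi / 2 : ℂ) • mulY j)) * (canon * G) *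
          ((-1 / 2 : ℂ) • rightInvY j) * canon := by
          rw [key _ _ (canon_alphaOp j)]; simp only [mul_assoc]
      _ = ((-2 : ℂ) * (-1 / 2 : ℂ)) • (G * ((derY j + (Real.pi / 2 : ℂ) • mulY j) * rightInvY j) *
          canon) := by
          rw [h2, mul_one]
          simp only [mul_assoc, mul_smul_comm, smul_mul_assoc, smul_smul]
          rw [mul_comm (-1 / 2 : ℂ)]
      _ = 1 := by rw [rightInvY_spec, mul_one, h1]; norm_num
  · refine comm _ _ (canon_alphaOp k) ?_
    simp only [smul_mul_assoc, mul_smul_comm, add_mul, mul_add, rightInvY_derY hk,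
      rightInvY_mulY hk]
  · refine comm _ _ (canon_gammaOp k) ?_
    simp only [smul_mul_assoc, mul_smul_comm, sub_mul, mul_sub, rightInvY_derX, rightInvY_mulX]

end RightInverse
end
end NCTorus

open scoped SchwartzMap LineDeriv ContDiff TensorProduct ComplexConjugate

namespace NCTorus

noncomputable section

variable {g : ℕ}

/-! ### Restriction to z_j = 0 and division by z_j on the kernel of `alphaOp j`. -/

section Contraction

theorem conj_eq_re_sub_im (w : ℂ) : conj w = w.re - w.im * Complex.I := by
  apply Complex.ext <;> simp

/-- The projection onto the `j`-th coordinate axis. -/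
def projC (j : Fin g) : V g →L[ℝ] V g :=
  ((EuclideanSpace.proj j : V g →L[ℂ] ℂ).smulRight (stdVec j)).restrictScalars ℝ

theorem projC_apply (j : Fin g) (z : V g) : projC j z = z j • stdVec j := rfl

@[simp] theorem projC_apply_self (j : Fin g) (z : V g) : projC j z j = z j := by
  simp [projC_apply]

theorem projC_apply_ne {j k : Fin g} (h : k ≠ j) (z : V g) : projC j z k = 0 := by
  simp [projC_apply, h]

theorem projC_projC (j : Fin g) (z : V g) : projC j (projC j z) = projC j z := by
  rw [projC_apply, projC_apply_self, projC_apply]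

theorem norm_projC (j : Fin g) (z : V g) : ‖projC j z‖ = ‖z j‖ := by
  simp [projC_apply, norm_smul, stdVec]

/-- Averages over the segments from the hyperplane `z_j = 0`, weighted by a Gaussian. -/
def avgC (j : Fin g) : 𝓢(V g, ℂ) →L[ℂ] 𝓢(V g, ℂ) :=
  sliceInt (projC j) (projC_projC j) (m := 2 * Real.pi) (by positivity)

/-- The restriction to `z_j = 0`, extended by a Gaussian. -/
def restr (j : Fin g) : 𝓢(V g, ℂ) →L[ℂ] 𝓢(V g, ℂ) :=
  slice0 (projC j) (projC_projC j) (m := 2 * Real.pi) (by positivity)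

/-- Multiplication by `\bar z_j`. -/
def mulZbar (j : Fin g) : 𝓢(V g, ℂ) →L[ℂ] 𝓢(V g, ℂ) := mulX j - Complex.I • mulY j

theorem mulZbar_apply (j : Fin g) (f : 𝓢(V g, ℂ)) (z : V g) :
    mulZbar j f z = conj (z j) * f z := by
  change mulX j f z - Complex.I * mulY j f z = _
  rw [mulX_apply, mulY_apply, conj_eq_re_sub_im]
  ring

/-- The operator `∂/∂z_j`. -/
def del (j : Fin g) : 𝓢(V g, ℂ) →L[ℂ] 𝓢(V g, ℂ) := (1 / 2 : ℂ) • (derX j - Complex.I • derY j)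

/-- `∂/∂z_j + 2 π \bar z_j`. -/
def betaOp (j : Fin g) : 𝓢(V g, ℂ) →L[ℂ] 𝓢(V g, ℂ) := del j + (2 * Real.pi : ℂ) • mulZbar j

/-- The real derivative in the direction z_j of the j-th coordinate line splits into its (1,0) and
(0,1) parts. -/
theorem der_projC (j : Fin g) (f : 𝓢(V g, ℂ)) (v w : V g) :
    der (projC j v) f w = v j * del j f w + conj (v j) * dbar j f w := by
  have h1 : projC j v = (v j).re • stdVec j + (v j).im • (Complex.I • stdVec j) := by
    rw [projC_apply]
    conv_lhs => rw [← Complex.re_add_im (v j)]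
    rw [add_smul, mul_smul, Complex.coe_smul, Complex.coe_smul]
  rw [der_apply, h1, map_add, map_smul, map_smul, ← der_apply, ← der_apply]
  change (v j).re • derX j f w + (v j).im • derY j f w = v j * ((1 / 2) * (derX j f w -
    Complex.I * derY j f w)) + conj (v j) * ((1 / 2) * (derX j f w + Complex.I * derY j f w))
  have h2 : v j = (v j).re + (v j).im * Complex.I := (Complex.re_add_im _).symm
  rw [Complex.real_smul, Complex.real_smul, conj_eq_re_sub_im]
  linear_combination ((v j).im * derY j f w : ℂ) * Complex.I_mul_I -
    (1 / 2 : ℂ) * (derX j f w - Complex.I * derY j f w) * h2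

/-- The weight in `sub_slice0_apply` contributes 4πτ|z_j|², and the contracted point has j-th
coordinate τz_j. Half of this term completes z_j ∂/∂z_j to z_j times `betaOp j`, the other half
completes z̄_j ∂/∂z̄_j to z̄_j times `alphaOp j`. On the kernel of `alphaOp j` only the multiple of
z_j survives, which makes this a division formula. -/
theorem one_sub_restr (j : Fin g) : 1 - restr j =
    mulZ j * (avgC j * betaOp j) + mulZbar j * (avgC j * alphaOp j) := by
  ext f v
  have hint : ∀ f : 𝓢(V g, ℂ), IntervalIntegrable
      (fun τ => sliceFun (projC j) (2 * Real.pi) τ f v) MeasureTheory.volume 0 1 := fun f =>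
    ((boundedFamily_sliceFun (projC j) (projC_projC j)
      (by positivity : 0 < 2 * Real.pi) f).continuous_left v).intervalIntegrable _ _
  change f v - restr j f v = mulZ j (avgC j (betaOp j f)) v + mulZbar j (avgC j (alphaOp j f)) v
  rw [restr, sub_slice0_apply, mulZ_apply, mulZbar_apply, avgC, sliceInt_apply, sliceInt_apply,
    ← intervalIntegral.integral_const_mul, ← intervalIntegral.integral_const_mul,
    ← intervalIntegral.integral_add ((hint _).const_mul _) ((hint _).const_mul _)]
  refine intervalIntegral.integral_congr fun τ _ => ?_
  simp only [sliceFun]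
  rw [der_projC, norm_projC]
  set ℓ := v - (1 - τ) • projC j v with hℓ
  have hj : ℓ j = τ * v j := by simp [hℓ]; ring
  change _ = v j * (_ * (del j f ℓ + 2 * Real.pi * mulZbar j f ℓ)) +
    conj (v j) * (_ * (dbar j f ℓ + 2 * Real.pi * mulZ j f ℓ))
  rw [mulZbar_apply, mulZ_apply, hj, Complex.ofReal_mul, Complex.ofReal_mul, Complex.ofReal_pow,
    ← Complex.mul_conj' (v j)]
  simp
  ring

/-- Off the hyperplane z_j = 0 one divides. On it the relation [∂/∂x_j, z_j] = 1 recovers the value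
of f from the derivative of z_j f. -/
theorem mulZ_injective (j : Fin g) {f : 𝓢(V g, ℂ)} (h : mulZ j f = 0) : f = 0 := by
  ext z
  by_cases hz : z j = 0
  · have h1 : derX j (mulZ j f) = mulZ j (derX j f) + f := by
      have : derX j * mulZ j = mulZ j * derX j + 1 := by
        rw [mulZ_eq, mul_add, mul_smul_comm, derX_mulX, derX_mulY]
        simp only [add_mul, smul_mul_assoc, if_true, one_smul]
        abel
      exact DFunLike.congr_fun this f
    have h2 := DFunLike.congr_fun h1 z
    rw [h, map_zero] at h2
    change 0 = mulZ j (derX j f) z + f z at h2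
    rw [mulZ_apply, hz, zero_mul, zero_add] at h2
    exact h2.symm
  · have h2 := DFunLike.congr_fun h z
    rw [mulZ_apply] at h2
    exact (mul_eq_zero.1 h2).resolve_left hz

/-- Identities for `gammaInv` can thus be verified after multiplication by z_j, where the division
formula computes it. -/
theorem mulZ_mul_left_cancel (j : Fin g) {S T : 𝓢(V g, ℂ) →L[ℂ] 𝓢(V g, ℂ)}
    (h : mulZ j * S = mulZ j * T) : S = T := by
  ext1 f
  rw [← sub_eq_zero]
  refine mulZ_injective j ?_
  rw [map_sub, sub_eq_zero]
  exact DFunLike.congr_fun h f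

theorem dbar_mulZ (j k : Fin g) : dbar j * mulZ k = mulZ k * dbar j := by
  rw [dbar_eq, mulZ_eq]
  simp only [mul_add, add_mul, mul_smul_comm, smul_mul_assoc, derX_mulX, derX_mulY, derY_mulX,
    derY_mulY, smul_add, smul_smul]
  by_cases h : k = j
  · simp only [h, if_true]
    rw [show Complex.I * (1 / 2 * Complex.I * 1) = (-(1 / 2) : ℂ) by
      linear_combination (1 / 2 : ℂ) * Complex.I_mul_I]
    module
  · simp only [h, if_false]
    module

theorem mulZ_comm (j k : Fin g) : mulZ j * mulZ k = mulZ k * mulZ j := by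
  ext f z
  change mulZ j (mulZ k f) z = mulZ k (mulZ j f) z
  simp only [mulZ_apply]; ring

theorem dbar_comm (j k : Fin g) : dbar j * dbar k = dbar k * dbar j := by
  have h := fun v w : V g => der_comm v w
  rw [dbar_eq, dbar_eq]
  simp only [derX, derY, mul_add, add_mul, mul_smul_comm, smul_mul_assoc, smul_add,
    h (stdVec j), h (Complex.I • stdVec j)]
  module

theorem alphaOp_mulZ (j k : Fin g) : alphaOp j * mulZ k = mulZ k * alphaOp j := by
  rw [alphaOp, add_mul, mul_add, dbar_mulZ, smul_mul_assoc, mul_smul_comm, mulZ_comm]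

/-- On the kernel of `alphaOp j` this leaves multiplication by -4πz_j, so inverting `gammaOp j`
there means dividing by z_j. -/
theorem gammaOp_eq (j : Fin g) : gammaOp j = alphaOp j - (4 * Real.pi : ℂ) • mulZ j := by
  rw [gammaOp, alphaOp]; module

theorem alphaOp_comm (j k : Fin g) : alphaOp j * alphaOp k = alphaOp k * alphaOp j := by
  simp only [alphaOp, mul_add, add_mul, mul_smul_comm, smul_mul_assoc, dbar_mulZ, dbar_comm j k,
    mulZ_comm j k]
  module

theorem restr_mulZ (j : Fin g) : restr j * mulZ j = 0 := by
  ext f v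
  change restr j (mulZ j f) v = 0
  rw [restr, slice0_apply, mulZ_apply]
  simp

theorem dbar_restr (j : Fin g) (f : 𝓢(V g, ℂ)) (v : V g) :
    dbar j (restr j f) v = -(2 * Real.pi * v j) * restr j f v := by
  have h1 : projC j (stdVec j) = stdVec j := by simp [projC_apply]
  have h2 : projC j (Complex.I • stdVec j) = Complex.I • stdVec j := by simp [projC_apply]
  have hX : derX j (restr j f) v = -(4 * Real.pi * (v j).re) * restr j f v := by
    rw [derX, restr, der_slice0_apply, slice0_apply, h1, inner_stdVec, projC_apply_self, sub_self,
      der_apply, map_zero]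
    push_cast; ring
  have hY : derY j (restr j f) v = -(4 * Real.pi * (v j).im) * restr j f v := by
    rw [derY, restr, der_slice0_apply, slice0_apply, h2, inner_I_stdVec, projC_apply_self, sub_self,
      der_apply, map_zero]
    push_cast; ring
  change (1 / 2 : ℂ) * (derX j (restr j f) v + Complex.I * derY j (restr j f) v) = _
  rw [hX, hY]
  conv_rhs => rw [← Complex.re_add_im (v j)]
  ring

/-- In the variable z_j a function in the image of `restr j` is a multiple of exp(-2π|z_j|²), which
`alphaOp j` annihilates. -/
theorem alphaOp_restr (j : Fin g) : alphaOp j * restr j = 0 := by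
  ext f v
  change dbar j (restr j f) v + 2 * Real.pi * mulZ j (restr j f) v = 0
  rw [dbar_restr, mulZ_apply]; ring

/-- The right inverse of `alphaOp j`. -/
def rightInv (j : Fin g) : 𝓢(V g, ℂ) →L[ℂ] 𝓢(V g, ℂ) := (exists_rightInverse j).choose

theorem alphaOp_rightInv (j : Fin g) : alphaOp j * rightInv j = 1 :=
  (exists_rightInverse j).choose_spec.1

theorem alphaOp_rightInv_comm {j k : Fin g} (h : k ≠ j) :
    alphaOp k * rightInv j = rightInv j * alphaOp k :=
  (exists_rightInverse j).choose_spec.2.1 k h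

theorem gammaOp_rightInv_comm (j k : Fin g) : gammaOp k * rightInv j = rightInv j * gammaOp k :=
  (exists_rightInverse j).choose_spec.2.2 k

/-- The projection onto the kernel of `alphaOp j` along the range of its right inverse. -/
def kerProj (j : Fin g) : 𝓢(V g, ℂ) →L[ℂ] 𝓢(V g, ℂ) := 1 - rightInv j * alphaOp j

theorem alphaOp_kerProj (j : Fin g) : alphaOp j * kerProj j = 0 := by
  rw [kerProj, mul_sub, ← mul_assoc, alphaOp_rightInv, one_mul, mul_one, sub_self]

theorem alphaOp_kerProj_comm {j k : Fin g} (h : k ≠ j) :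
    alphaOp k * kerProj j = kerProj j * alphaOp k := by
  rw [kerProj, mul_sub, sub_mul, ← mul_assoc, alphaOp_rightInv_comm h, mul_assoc, mul_assoc,
    alphaOp_comm, mul_one, one_mul]

/-- The inverse of `gammaOp j` on the kernel of `alphaOp j`, up to the projection `restr j`. -/
def gammaInv (j : Fin g) : 𝓢(V g, ℂ) →L[ℂ] 𝓢(V g, ℂ) :=
  (-(4 * Real.pi : ℂ)⁻¹) • (avgC j * betaOp j)

theorem four_pi_ne_zero : (4 * Real.pi : ℂ) ≠ 0 := by simp [Real.pi_ne_zero]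

theorem mulZ_gammaInv_kerProj (j : Fin g) : (4 * Real.pi : ℂ) • (mulZ j * (gammaInv j * kerProj j)) =
    restr j * kerProj j - kerProj j := by
  have h := congrArg (· * kerProj j) (one_sub_restr j)
  simp only [add_mul, sub_mul, one_mul] at h
  rw [mul_assoc (mulZbar j), mul_assoc (avgC j), alphaOp_kerProj, mul_zero, mul_zero, add_zero] at h
  rw [gammaInv, smul_mul_assoc, mul_smul_comm, smul_smul, mul_neg, mul_inv_cancel₀ four_pi_ne_zero,
    neg_one_smul, ← mul_assoc, ← h, neg_sub]

/-- Division by z_j does not leave the kernel of `alphaOp j`: after multiplication by z_j, which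
commutes with `alphaOp j`, both terms of the division formula are killed. -/
theorem alphaOp_gammaInv_kerProj (j : Fin g) : alphaOp j * (gammaInv j * kerProj j) = 0 := by
  refine mulZ_mul_left_cancel j ?_
  have h := congrArg (alphaOp j * ·) (mulZ_gammaInv_kerProj j)
  simp only [mul_smul_comm, mul_sub, alphaOp_kerProj, sub_zero] at h
  rw [← mul_assoc (alphaOp j) (restr j), alphaOp_restr, zero_mul, ← mul_assoc, alphaOp_mulZ,
    mul_assoc, smul_eq_zero] at h
  rw [h.resolve_left four_pi_ne_zero, mul_zero]

theorem gammaOp_gammaInv_kerProj (j : Fin g) :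
    gammaOp j * (gammaInv j * kerProj j) = kerProj j - restr j * kerProj j := by
  rw [gammaOp_eq, sub_mul, alphaOp_gammaInv_kerProj, smul_mul_assoc, mulZ_gammaInv_kerProj]
  abel

/-- Applied to a multiple of z_j the restriction term drops out, so dividing after multiplying is
exact. Multiplying after dividing instead leaves the error `restr j`, the only source of cohomology.
-/
theorem gammaInv_gammaOp_kerProj (j : Fin g) :
    gammaInv j * (gammaOp j * kerProj j) = kerProj j := by
  refine mulZ_mul_left_cancel j ?_
  have h := congrArg (· * (mulZ j * kerProj j)) (one_sub_restr j)
  simp only [add_mul, sub_mul, one_mul] at h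
  rw [mul_assoc (mulZbar j), mul_assoc (avgC j), ← mul_assoc (alphaOp j), alphaOp_mulZ,
    mul_assoc (mulZ j) (alphaOp j), alphaOp_kerProj, ← mul_assoc (restr j), restr_mulZ] at h
  simp only [mul_zero, zero_mul, add_zero, sub_zero] at h
  have h2 : gammaInv j * (gammaOp j * kerProj j) = avgC j * betaOp j * (mulZ j * kerProj j) := by
    rw [gammaOp_eq, sub_mul, alphaOp_kerProj, zero_sub, gammaInv, smul_mul_assoc (4 * Real.pi : ℂ),
      ← smul_neg, smul_mul_assoc, mul_smul_comm, smul_smul, neg_mul,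
      inv_mul_cancel₀ four_pi_ne_zero, mul_neg, smul_neg, neg_one_smul, neg_neg]
  rw [h2, ← mul_assoc, ← h]

/-! ### Operators that act in one coordinate only, and functions fixed by all restrictions. -/

section Away

/-- The operator `A` commutes with the multiplications and derivatives in the `k`-th coordinate. -/
structure IsAway (k : Fin g) (A : 𝓢(V g, ℂ) →L[ℂ] 𝓢(V g, ℂ)) : Prop where
  derX : Commute (derX k) A
  derY : Commute (derY k) A
  mulX : Commute (mulX k) A
  mulY : Commute (mulY k) A

variable {j k : Fin g} {S T : 𝓢(V g, ℂ) →L[ℂ] 𝓢(V g, ℂ)}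

theorem IsAway.add (hS : IsAway k S) (hT : IsAway k T) : IsAway k (S + T) :=
  ⟨hS.1.add_right hT.1, hS.2.add_right hT.2, hS.3.add_right hT.3, hS.4.add_right hT.4⟩

theorem IsAway.mul (hS : IsAway k S) (hT : IsAway k T) : IsAway k (S * T) :=
  ⟨hS.1.mul_right hT.1, hS.2.mul_right hT.2, hS.3.mul_right hT.3, hS.4.mul_right hT.4⟩

theorem IsAway.smul (hS : IsAway k S) (c : ℂ) : IsAway k (c • S) :=
  ⟨hS.1.smul_right c, hS.2.smul_right c, hS.3.smul_right c, hS.4.smul_right c⟩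

theorem IsAway.sub (hS : IsAway k S) (hT : IsAway k T) : IsAway k (S - T) :=
  ⟨hS.1.sub_right hT.1, hS.2.sub_right hT.2, hS.3.sub_right hT.3, hS.4.sub_right hT.4⟩

theorem IsAway.dbar (hS : IsAway k S) : Commute (dbar k) S := by
  rw [dbar_eq]
  exact (hS.1.add_left (hS.2.smul_left _)).smul_left _

theorem IsAway.mulZ (hS : IsAway k S) : Commute (mulZ k) S := by
  rw [mulZ_eq]
  exact hS.3.add_left (hS.4.smul_left _)

theorem IsAway.alphaOp (hS : IsAway k S) : Commute (alphaOp k) S :=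
  hS.dbar.add_left (hS.mulZ.smul_left _)

theorem IsAway.gammaOp (hS : IsAway k S) : Commute (gammaOp k) S :=
  hS.dbar.sub_left (hS.mulZ.smul_left _)

theorem isAway_derX (h : k ≠ j) : IsAway k (derX j) where
  derX := der_comm _ _
  derY := der_comm _ _
  mulX := by
    have := derX_mulX j k
    rw [if_neg h, zero_smul, add_zero] at this
    exact this.symm
  mulY := (derX_mulY j k).symm

theorem isAway_derY (h : k ≠ j) : IsAway k (derY j) where
  derX := der_comm _ _
  derY := der_comm _ _
  mulX := (derY_mulX j k).symm
  mulY := by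
    have := derY_mulY j k
    rw [if_neg h, zero_smul, add_zero] at this
    exact this.symm

theorem isAway_mulX (h : k ≠ j) : IsAway k (mulX j) where
  derX := (isAway_derX h.symm).mulX.symm
  derY := (isAway_derY h.symm).mulX.symm
  mulX := mulL_comm _ _
  mulY := mulL_comm _ _

theorem isAway_mulY (h : k ≠ j) : IsAway k (mulY j) where
  derX := (isAway_derX h.symm).mulY.symm
  derY := (isAway_derY h.symm).mulY.symm
  mulX := mulL_comm _ _
  mulY := mulL_comm _ _

theorem isAway_avgC (h : k ≠ j) : IsAway k (avgC j) where
  derX := sliceInt_der _ _ _ _ (by simp [projC_apply, h.symm])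
  derY := sliceInt_der _ _ _ _ (by simp [projC_apply, h.symm])
  mulX := sliceInt_mulL _ _ _ _ fun v => by simp [projC_apply_ne h]
  mulY := sliceInt_mulL _ _ _ _ fun v => by simp [projC_apply_ne h]

theorem isAway_restr (h : k ≠ j) : IsAway k (restr j) where
  derX := slice0_der _ _ _ _ (by simp [projC_apply, h.symm])
  derY := slice0_der _ _ _ _ (by simp [projC_apply, h.symm])
  mulX := slice0_mulL _ _ _ _ fun v => by simp [projC_apply_ne h]
  mulY := slice0_mulL _ _ _ _ fun v => by simp [projC_apply_ne h]

theorem isAway_gammaInv (h : k ≠ j) : IsAway k (gammaInv j) :=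
  ((isAway_avgC h).mul ((((isAway_derX h).sub ((isAway_derY h).smul _)).smul _).add
    (((isAway_mulX h).sub ((isAway_mulY h).smul _)).smul _))).smul _

theorem alphaOp_gammaOp_comm (i k : Fin g) : Commute (alphaOp k) (gammaOp i) := by
  rw [gammaOp_eq]
  exact Commute.sub_right (alphaOp_comm k i) (Commute.smul_right (alphaOp_mulZ k i) _)

theorem gammaOp_comm (i k : Fin g) : Commute (gammaOp i) (gammaOp k) := by
  rw [gammaOp_eq k]
  exact (alphaOp_gammaOp_comm i k).symm.sub_right (Commute.smul_right
    (Commute.sub_left (dbar_mulZ i k) (Commute.smul_left (mulZ_comm i k) _)) _)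

theorem restr_restr (j : Fin g) : restr j * restr j = restr j := slice0_slice0 _ _ _

theorem restr_comm (j k : Fin g) : restr j * restr k = restr k * restr j := by
  by_cases h : k = j
  · rw [h]
  have key : ∀ {j k : Fin g}, k ≠ j → ∀ (f : 𝓢(V g, ℂ)) v, restr j (restr k f) v =
      (Real.exp (-(2 * Real.pi * ‖v j‖ ^ 2)) : ℂ) * ((Real.exp (-(2 * Real.pi * ‖v k‖ ^ 2)) : ℂ) *
        f (v - projC j v - projC k v)) := by
    intro j k h f v
    have h1 : projC k (v - projC j v) = projC k v := by
      rw [projC_apply k, projC_apply k, PiLp.sub_apply, projC_apply_ne h, sub_zero]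
    rw [restr, restr, slice0_apply, slice0_apply, h1, norm_projC, norm_projC]
  ext f v
  change restr j (restr k f) v = restr k (restr j f) v
  rw [key h, key (Ne.symm h), sub_right_comm]
  ring

/-- A function which is fixed by all the `restr j` is a multiple of the Gaussian. -/
theorem eq_of_restr_eq_self {f : 𝓢(V g, ℂ)} (h : ∀ j, restr j f = f) (v : V g) :
    f v = f 0 * (Real.exp (-(2 * Real.pi * ‖v‖ ^ 2)) : ℂ) := by
  -- Being fixed by `restr k` pulls out the Gaussian in z_k and sets that coordinate to 0; the
  -- coordinates are removed one at a time until only f 0 is left.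
  have key : ∀ s : Finset (Fin g), f v = (Real.exp (-(2 * Real.pi * ∑ j ∈ s, ‖v j‖ ^ 2)) : ℂ) *
      f (v - ∑ j ∈ s, projC j v) := by
    intro s
    induction s using Finset.induction_on with
    | empty => simp
    | insert k s hk ih =>
      have h1 : projC k (v - ∑ j ∈ s, projC j v) = projC k v := by
        rw [projC_apply k, projC_apply k, PiLp.sub_apply, WithLp.ofLp_sum, Finset.sum_apply,
          Finset.sum_eq_zero, sub_zero]
        intro j hj
        exact projC_apply_ne (ne_of_mem_of_not_mem hj hk).symm v
      have h2 := DFunLike.congr_fun (h k) (v - ∑ j ∈ s, projC j v)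
      rw [restr, slice0_apply, h1, norm_projC] at h2
      rw [ih, ← h2, Finset.sum_insert hk, Finset.sum_insert hk, ← mul_assoc, ← Complex.ofReal_mul,
        ← Real.exp_add, sub_sub, add_comm (projC k v)]
      congr 3
      ring
  have h1 : ∑ j, projC j v = v := by
    ext i
    rw [WithLp.ofLp_sum, Finset.sum_apply, Finset.sum_eq_single i, projC_apply_self]
    · intro j _ hj
      exact projC_apply_ne hj.symm v
    · simp
  rw [key Finset.univ, h1, sub_self, EuclideanSpace.norm_sq_eq, mul_comm]

end Away
end Contraction
end
end NCTorus

open scoped SchwartzMap LineDeriv ContDiff TensorProduct ComplexConjugate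

namespace NCTorus

noncomputable section

variable {g : ℕ}

/-! ### Exterior multiplication and contraction on the exterior algebra. -/

section Exterior

/-- Contraction with a linear form on `V_{1,0} ⊕ V^{0,1}`. -/
def contr (d : Module.Dual ℂ (Cov g)) : Module.End ℂ (Ext g) :=
  CliffordAlgebra.contractLeft (Q := (0 : QuadraticForm ℂ (Cov g))) d

/-- Left exterior multiplication by an element of `V_{1,0} ⊕ V^{0,1}`, as an endomorphism. -/
def wedgeE (v : Cov g) : Module.End ℂ (Ext g) := wedge v

theorem wedgeE_apply (v : Cov g) (x : Ext g) : wedgeE v x = ExteriorAlgebra.ι ℂ v * x := rfl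

theorem contr_ι_mul (d : Module.Dual ℂ (Cov g)) (v : Cov g) (x : Ext g) :
    contr d (ExteriorAlgebra.ι ℂ v * x) = d v • x - ExteriorAlgebra.ι ℂ v * contr d x :=
  CliffordAlgebra.contractLeft_ι_mul (Q := (0 : QuadraticForm ℂ (Cov g))) d v x

@[simp] theorem contr_algebraMap (d : Module.Dual ℂ (Cov g)) (c : ℂ) :
    contr d (algebraMap ℂ (Ext g) c) = 0 := CliffordAlgebra.contractLeft_algebraMap _ _ _

@[simp] theorem contr_one (d : Module.Dual ℂ (Cov g)) : contr d (1 : Ext g) = 0 :=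
  CliffordAlgebra.contractLeft_one _ _

theorem contr_wedge (d : Module.Dual ℂ (Cov g)) (v : Cov g) :
    contr d * wedgeE v = d v • (1 : Module.End ℂ (Ext g)) - wedgeE v * contr d :=
  LinearMap.ext fun x => contr_ι_mul d v x

theorem contr_mul_self (d : Module.Dual ℂ (Cov g)) : contr d * contr d = 0 :=
  LinearMap.ext fun x => CliffordAlgebra.contractLeft_contractLeft _ x

theorem contr_anticomm (d d' : Module.Dual ℂ (Cov g)) : contr d * contr d' = -(contr d' * contr d) :=
  LinearMap.ext fun x => CliffordAlgebra.contractLeft_comm _ _ x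

theorem wedgeE_mul_self (v : Cov g) : wedgeE v * wedgeE v = 0 := LinearMap.ext fun x => by
  change ExteriorAlgebra.ι ℂ v * (ExteriorAlgebra.ι ℂ v * x) = 0
  rw [← mul_assoc, ExteriorAlgebra.ι_sq_zero, zero_mul]

theorem wedgeE_anticomm (v w : Cov g) : wedgeE v * wedgeE w = -(wedgeE w * wedgeE v) :=
  LinearMap.ext fun x => by
    change ExteriorAlgebra.ι ℂ v * (ExteriorAlgebra.ι ℂ w * x) =
      -(ExteriorAlgebra.ι ℂ w * (ExteriorAlgebra.ι ℂ v * x))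
    rw [← mul_assoc, ← mul_assoc, ← neg_mul, eq_neg_of_add_eq_zero_left
      (ExteriorAlgebra.ι_add_mul_swap v w)]

theorem wedgeE_add (v w : Cov g) : wedgeE (v + w) = wedgeE v + wedgeE w :=
  LinearMap.ext fun x => by simp [wedgeE_apply, add_mul]

theorem wedgeE_sub (v w : Cov g) : wedgeE (v - w) = wedgeE v - wedgeE w :=
  LinearMap.ext fun x => by simp [wedgeE_apply, sub_mul]

theorem wedgeE_smul (c : ℂ) (v : Cov g) : wedgeE (c • v) = c • wedgeE v :=
  LinearMap.ext fun x => by simp [wedgeE_apply]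

theorem wedgeE_mem_succ (v : Cov g) {k : ℕ} {x : Ext g} (hx : x ∈ ⋀[ℂ]^k (Cov g)) :
    wedgeE v x ∈ ⋀[ℂ]^(k + 1) (Cov g) := by
  rw [wedgeE_apply, add_comm]
  exact SetLike.mul_mem_graded (A := fun i => ⋀[ℂ]^i (Cov g)) (by
    change _ ∈ LinearMap.range (ExteriorAlgebra.ι ℂ) ^ 1
    rw [pow_one]; exact ⟨v, rfl⟩) hx

theorem exteriorPower_induction {P : ℕ → Ext g → Prop}
    (h0 : ∀ c : ℂ, P 0 (algebraMap ℂ _ c)) (hadd : ∀ k x y, P k x → P k y → P k (x + y))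
    (hmul : ∀ k v x, x ∈ ⋀[ℂ]^k (Cov g) → P k x → P (k + 1) (wedgeE v x)) {k : ℕ} {x : Ext g}
    (hx : x ∈ ⋀[ℂ]^k (Cov g)) : P k x := by
  induction hx using Submodule.pow_induction_on_left' with
  | algebraMap r => exact h0 r
  | add x y i _ _ ihx ihy => exact hadd i x y ihx ihy
  | mem_mul m hm i x hx ih =>
    obtain ⟨v, rfl⟩ := hm
    exact hmul i v x hx ih

/-- Both cases travel through one induction, because the wedge step from degree 0 to 1 needs that
contraction kills scalars. -/
theorem contr_mem (d : Module.Dual ℂ (Cov g)) {k : ℕ} {x : Ext g} (hx : x ∈ ⋀[ℂ]^k (Cov g)) :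
    (k = 0 → contr d x = 0) ∧ ∀ m, k = m + 1 → contr d x ∈ ⋀[ℂ]^m (Cov g) := by
  refine exteriorPower_induction (P := fun k x => (k = 0 → contr d x = 0) ∧
    ∀ m, k = m + 1 → contr d x ∈ ⋀[ℂ]^m (Cov g)) (fun c => ⟨fun _ => contr_algebraMap d c,
    fun m hm => by omega⟩) (fun k x y h1 h2 => ⟨fun hk => ?_, fun m hm => ?_⟩)
    (fun k v x hx h => ⟨fun hk => by omega, fun m hm => ?_⟩) hx
  · rw [map_add, h1.1 hk, h2.1 hk, add_zero]
  · rw [map_add]; exact add_mem (h1.2 m hm) (h2.2 m hm)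
  · obtain rfl : k = m := by omega
    rw [wedgeE_apply, contr_ι_mul]
    refine sub_mem (Submodule.smul_mem _ _ hx) ?_
    rcases k with _ | k
    · rw [h.1 rfl, mul_zero]; exact zero_mem _
    · exact wedgeE_mem_succ v (h.2 k rfl)

/-- The vector dual to `dualPlus`. -/
def uPlus (j : Fin g) : Cov g := (1 / 2 : ℂ) • (dzbar j + Complex.I • dzeta j)

/-- The vector dual to `dualMinus`. -/
def uMinus (j : Fin g) : Cov g := (1 / 2 : ℂ) • eMinus j

/-- The linear form which maps `d\bar z_j` to `1` and `d\bar ζ_j` to `-i`. -/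
def dualPlus (j : Fin g) : Module.Dual ℂ (Cov g) :=
  (LinearMap.proj j ∘ₗ LinearMap.snd ℂ _ _) - Complex.I • (LinearMap.proj j ∘ₗ LinearMap.fst ℂ _ _)

/-- The linear form which maps `d\bar z_j` to `1` and `d\bar ζ_j` to `i`. -/
def dualMinus (j : Fin g) : Module.Dual ℂ (Cov g) :=
  (LinearMap.proj j ∘ₗ LinearMap.snd ℂ _ _) + Complex.I • (LinearMap.proj j ∘ₗ LinearMap.fst ℂ _ _)

theorem dualPlus_apply (j : Fin g) (v : Cov g) : dualPlus j v = v.2 j - Complex.I * v.1 j := rfl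
theorem dualMinus_apply (j : Fin g) (v : Cov g) : dualMinus j v = v.2 j + Complex.I * v.1 j := rfl

theorem dualPlus_eMinus (j k : Fin g) : dualPlus j (eMinus k) = 0 := by
  by_cases h : k = j
  · subst h
    simp [dualPlus_apply, eMinus, dzbar, dzeta]
  · simp [dualPlus_apply, eMinus, dzbar, dzeta, Ne.symm h]

theorem dualMinus_eMinus (j k : Fin g) : dualMinus j (eMinus k) = if k = j then 2 else 0 := by
  by_cases h : k = j
  · subst h
    simp [dualMinus_apply, eMinus, dzbar, dzeta]
    norm_num
  · simp [dualMinus_apply, eMinus, dzbar, dzeta, Ne.symm h, h]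

theorem dualPlus_uMinus (j k : Fin g) : dualPlus j (uMinus k) = 0 := by
  rw [uMinus, map_smul, dualPlus_eMinus, smul_zero]

theorem dualMinus_uMinus (j k : Fin g) : dualMinus j (uMinus k) = if k = j then 1 else 0 := by
  rw [uMinus, map_smul, dualMinus_eMinus]
  split_ifs <;> simp

theorem dualPlus_uPlus (j k : Fin g) : dualPlus j (uPlus k) = if k = j then 1 else 0 := by
  by_cases h : k = j
  · subst h
    simp [dualPlus_apply, uPlus, dzbar, dzeta]
    rw [mul_left_comm, Complex.I_mul_I]
    norm_num
  · simp [dualPlus_apply, uPlus, dzbar, dzeta, Ne.symm h, h]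

theorem dualMinus_uPlus (j k : Fin g) : dualMinus j (uPlus k) = 0 := by
  by_cases h : k = j
  · subst h
    simp [dualMinus_apply, uPlus, dzbar, dzeta]
    rw [mul_left_comm, Complex.I_mul_I]
    norm_num
  · simp [dualMinus_apply, uPlus, dzbar, dzeta, Ne.symm h]

theorem sum_dual_smul (v : Cov g) :
    ∑ j, (dualPlus j v • uPlus j + dualMinus j v • uMinus j) = v := by
  have h : ∀ j : Fin g, dualPlus j v • uPlus j + dualMinus j v • uMinus j =
      (v.1 j • dzeta j + v.2 j • dzbar j : Cov g) := by
    intro j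
    rw [dualPlus_apply, dualMinus_apply, uPlus, uMinus, eMinus]
    simp only [smul_add, smul_sub, smul_smul]
    rw [show (v.2 j - Complex.I * v.1 j) * (1 / 2 * Complex.I) = v.2 j * Complex.I / 2 + v.1 j / 2 by
        linear_combination (-v.1 j / 2) * Complex.I_mul_I,
      show (v.2 j + Complex.I * v.1 j) * (1 / 2 * Complex.I) = v.2 j * Complex.I / 2 - v.1 j / 2 by
        linear_combination (v.1 j / 2) * Complex.I_mul_I]
    module
  rw [Finset.sum_congr rfl fun j _ => h j]
  ext i
  · simp [Prod.fst_sum, dzeta, dzbar, Pi.single_apply]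
  · simp [Prod.snd_sum, dzeta, dzbar, Pi.single_apply]

/-- The operator which multiplies forms by their degree. -/
def numberOp (g : ℕ) : Module.End ℂ (Ext g) :=
  ∑ j : Fin g, (wedgeE (uPlus j) * contr (dualPlus j) + wedgeE (uMinus j) * contr (dualMinus j))

/-- The u± and the dual± are dual bases, so expanding v in them (`sum_dual_smul`) identifies the
extra term as one copy of v∧: this is the Euler derivation. -/
theorem numberOp_wedge (v : Cov g) : numberOp g * wedgeE v = wedgeE v + wedgeE v * numberOp g := by
  have h : ∀ (d : Module.Dual ℂ (Cov g)) (u : Cov g), wedgeE u * contr d * wedgeE v =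
      d v • wedgeE u + wedgeE v * (wedgeE u * contr d) := by
    intro d u
    have e : -(wedgeE v * wedgeE u) * contr d = -(wedgeE v * wedgeE u * contr d) :=
      LinearMap.neg_comp _ _
    rw [mul_assoc, contr_wedge, mul_sub, ← mul_assoc (wedgeE u) (wedgeE v), wedgeE_anticomm u v,
      e, sub_neg_eq_add, mul_smul_comm, mul_one, mul_assoc]
  have hv : wedgeE v = ∑ j, (dualPlus j v • wedgeE (uPlus j) + dualMinus j v • wedgeE (uMinus j)) := by
    conv_lhs => rw [← sum_dual_smul v]
    ext x
    simp [wedgeE_apply, Finset.sum_mul, add_mul]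
  calc numberOp g * wedgeE v = (∑ j, (dualPlus j v • wedgeE (uPlus j) +
        dualMinus j v • wedgeE (uMinus j))) + wedgeE v * numberOp g := ?_
    _ = _ := by rw [← hv]
  rw [numberOp, Finset.sum_mul, Finset.mul_sum, ← Finset.sum_add_distrib]
  refine Finset.sum_congr rfl fun j _ => ?_
  rw [add_mul, h, h, mul_add]
  abel

theorem numberOp_apply {k : ℕ} {x : Ext g} (hx : x ∈ ⋀[ℂ]^k (Cov g)) :
    numberOp g x = (k : ℂ) • x := by
  refine exteriorPower_induction (P := fun k x => numberOp g x = (k : ℂ) • x) (fun c => ?_)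
    (fun k x y h1 h2 => ?_) (fun k v x _ h => ?_) hx
  · simp [numberOp]
  · rw [map_add, h1, h2, smul_add]
  · have := LinearMap.congr_fun (numberOp_wedge v) x
    change numberOp g (wedgeE v x) = wedgeE v x + wedgeE v (numberOp g x) at this
    rw [this, h, map_smul]
    push_cast
    rw [add_smul, one_smul, add_comm]

/-- Such an element is annihilated by `numberOp`, which acts on degree i by i; all components of
positive degree must vanish. -/
theorem mem_range_algebraMap_of_contr_eq_zero {x : Ext g} (hp : ∀ j, contr (dualPlus j) x = 0)
    (hm : ∀ j, contr (dualMinus j) x = 0) : ∃ c : ℂ, x = algebraMap ℂ _ c := by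
  classical
  let 𝒜 : ℕ → Submodule ℂ (Ext g) := fun i => ⋀[ℂ]^i (Cov g)
  have h0 : numberOp g x = 0 := by simp [numberOp, hp, hm]
  have key : ∀ (y : Ext g) (i : ℕ), GradedRing.proj 𝒜 i (numberOp g y) =
      (i : ℂ) • GradedRing.proj 𝒜 i y := by
    intro y i
    induction y using DirectSum.Decomposition.inductionOn 𝒜 with
    | zero => simp
    | @homogeneous k m =>
      rw [numberOp_apply m.2]
      simp only [GradedRing.proj_apply]
      rw [DirectSum.decompose_smul]
      by_cases h : k = i
      · subst h; rfl
      · have h1 := DirectSum.decompose_of_mem_ne 𝒜 m.2 h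
        change (k : ℂ) • ((DirectSum.decompose 𝒜 (m : Ext g)) i : Ext g) = _
        rw [h1, smul_zero, smul_zero]
    | add a b ha hb => rw [map_add, map_add, map_add, ha, hb, smul_add]
  have h1 : ∀ i, i ≠ 0 → GradedRing.proj 𝒜 i x = 0 := fun i hi => by
    have := key x i
    rw [h0, map_zero, eq_comm, smul_eq_zero] at this
    exact this.resolve_left (by exact_mod_cast hi)
  have h2 : x = GradedRing.proj 𝒜 0 x := by
    conv_lhs => rw [← DirectSum.sum_support_decompose 𝒜 x]
    rw [Finset.sum_eq_single 0]
    · rfl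
    · intro i _ hi; exact h1 i hi
    · intro h; simpa using h
  have h3 : GradedRing.proj 𝒜 0 x ∈ ⋀[ℂ]^0 (Cov g) := ((DirectSum.decompose 𝒜 x) 0).2
  rw [← h2] at h3
  have h4 : x ∈ LinearMap.range (ExteriorAlgebra.ι ℂ : Cov g →ₗ[ℂ] _) ^ 0 := h3
  rw [pow_zero, Submodule.one_eq_range] at h4
  obtain ⟨c, hc⟩ := h4
  exact ⟨c, hc.symm⟩

/-- The exterior product of the `e^-_j` over a list of indices. -/
def minusProd (l : List (Fin g)) : Ext g := (l.map fun j => ExteriorAlgebra.ι ℂ (eMinus j)).prod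

theorem minusProd_cons (j : Fin g) (l : List (Fin g)) :
    minusProd (j :: l) = ExteriorAlgebra.ι ℂ (eMinus j) * minusProd l := by simp [minusProd]

theorem minusProd_finRange : minusProd (List.finRange g) = eMinusTop g := by
  rw [minusProd, eMinusTop, ExteriorAlgebra.ιMulti_apply, List.ofFn_eq_map]

theorem contr_minusProd (d : Module.Dual ℂ (Cov g)) (l : List (Fin g))
    (h : ∀ j ∈ l, d (eMinus j) = 0) : contr d (minusProd l) = 0 := by
  induction l with
  | nil => simp [minusProd]
  | cons j l ih =>
    rw [minusProd_cons, contr_ι_mul, h j (by simp), ih fun i hi => h i (by simp [hi])]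
    simp

theorem wedge_minusProd {j : Fin g} {l : List (Fin g)} (h : j ∈ l) :
    wedgeE (eMinus j) (minusProd l) = 0 := by
  induction l with
  | nil => simp at h
  | cons i l ih =>
    rw [minusProd_cons, ← wedgeE_apply]
    by_cases hij : j = i
    · subst hij
      exact LinearMap.congr_fun (wedgeE_mul_self (eMinus j)) _
    · have h1 := LinearMap.congr_fun (wedgeE_anticomm (eMinus j) (eMinus i)) (minusProd l)
      change wedgeE (eMinus j) (wedgeE (eMinus i) (minusProd l)) =
        -(wedgeE (eMinus i) (wedgeE (eMinus j) (minusProd l))) at h1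
      rw [h1, ih ((List.mem_cons.1 h).resolve_left hij), map_zero, neg_zero]

/-- Contracting with the dual forms strips the factors one by one; the factor 1/2 compensates for
the value 2 of `dualMinus j` on e⁻_j. In particular the product is nonzero. -/
theorem exists_minusProd_functional (l : List (Fin g)) (hl : l.Nodup) :
    ∃ C : Ext g →ₗ[ℂ] Ext g, C (minusProd l) = 1 := by
  induction l with
  | nil => exact ⟨LinearMap.id, by simp [minusProd]⟩
  | cons j l ih =>
    obtain ⟨hj, hl⟩ := List.nodup_cons.1 hl
    obtain ⟨C, hC⟩ := ih hl
    refine ⟨(1 / 2 : ℂ) • C ∘ₗ contr (dualMinus j), ?_⟩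
    have h1 : contr (dualMinus j) (minusProd l) = 0 := contr_minusProd _ _ fun i hi => by
      rw [dualMinus_eMinus, if_neg (ne_of_mem_of_not_mem hi hj)]
    simp [minusProd_cons, contr_ι_mul, h1, dualMinus_eMinus, hC]

theorem exists_eMinusTop_functional (g : ℕ) : ∃ f : Ext g →ₗ[ℂ] ℂ, f (eMinusTop g) = 1 := by
  obtain ⟨C, hC⟩ := exists_minusProd_functional (List.finRange g) (List.nodup_finRange g)
  refine ⟨ExteriorAlgebra.algebraMapInv.toLinearMap ∘ₗ C, ?_⟩
  rw [← minusProd_finRange, LinearMap.comp_apply, hC]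
  simp

theorem eMinusTop_mem (g : ℕ) : eMinusTop g ∈ ⋀[ℂ]^g (Cov g) :=
  ExteriorAlgebra.ιMulti_range ℂ g (Set.mem_range_self _)

theorem contr_dualPlus_eMinusTop (j : Fin g) : contr (dualPlus j) (eMinusTop g) = 0 := by
  rw [← minusProd_finRange]
  exact contr_minusProd _ _ fun i _ => dualPlus_eMinus j i

theorem wedge_eMinus_eMinusTop (j : Fin g) : wedgeE (eMinus j) (eMinusTop g) = 0 := by
  rw [← minusProd_finRange]
  exact wedge_minusProd (List.mem_finRange j)

theorem wedge_uMinus_eMinusTop (j : Fin g) : wedgeE (uMinus j) (eMinusTop g) = 0 := by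
  rw [uMinus, wedgeE_smul, LinearMap.smul_apply, wedge_eMinus_eMinusTop, smul_zero]

/-- If u⁻_j∧x = 0, the anticommutation relation reads x = u⁻_j∧(contraction of x), which splits off
one factor. The third clause records that the quotient inherits every vanishing contraction of x; it
serves the induction and later forces the quotient to be a scalar. -/
theorem exists_eq_minusProd_mul (l : List (Fin g)) (hl : l.Nodup) (x : Ext g)
    (hx : ∀ j ∈ l, wedgeE (uMinus j) x = 0) : ∃ y, x = minusProd l * y ∧
      (∀ j ∈ l, contr (dualMinus j) y = 0) ∧ ∀ d, contr d x = 0 → contr d y = 0 := by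
  induction l generalizing x with
  | nil => exact ⟨x, by simp [minusProd], by simp, fun d h => h⟩
  | cons j l ih =>
    obtain ⟨hj, hl⟩ := List.nodup_cons.1 hl
    have h1 := LinearMap.congr_fun (contr_wedge (dualMinus j) (uMinus j)) x
    simp only [dualMinus_uMinus, if_true, one_smul] at h1
    change contr (dualMinus j) (wedgeE (uMinus j) x) = x - wedgeE (uMinus j) (contr (dualMinus j) x)
      at h1
    rw [hx j (by simp), map_zero, eq_comm, sub_eq_zero] at h1
    obtain ⟨y, hy1, hy2, hy3⟩ := ih hl ((1 / 2 : ℂ) • contr (dualMinus j) x) fun i hi => by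
      have h2 := LinearMap.congr_fun (contr_wedge (dualMinus j) (uMinus i)) x
      rw [dualMinus_uMinus, if_neg (ne_of_mem_of_not_mem hi hj), zero_smul] at h2
      change contr (dualMinus j) (wedgeE (uMinus i) x) =
        0 - wedgeE (uMinus i) (contr (dualMinus j) x) at h2
      rw [hx i (by simp [hi]), map_zero, eq_comm, zero_sub, neg_eq_zero] at h2
      rw [map_smul, h2, smul_zero]
    refine ⟨y, ?_, fun i hi => ?_, fun d hd => hy3 d ?_⟩
    · rw [minusProd_cons, mul_assoc, ← hy1]
      conv_lhs => rw [h1]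
      rw [uMinus, wedgeE_smul, LinearMap.smul_apply, mul_smul_comm, wedgeE_apply]
    · rcases List.mem_cons.1 hi with rfl | hi
      · refine hy3 _ ?_
        rw [map_smul]
        have := LinearMap.congr_fun (contr_mul_self (dualMinus i)) x
        exact (congrArg _ this).trans (smul_zero _)
      · exact hy2 i hi
    · have := LinearMap.congr_fun (contr_anticomm d (dualMinus j)) x
      change contr d (contr (dualMinus j) x) = -(contr (dualMinus j) (contr d x)) at this
      rw [map_smul, this, hd, map_zero, neg_zero, smul_zero]

theorem exists_eq_smul_eMinusTop {x : Ext g} (hp : ∀ j, contr (dualPlus j) x = 0)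
    (hm : ∀ j, wedgeE (uMinus j) x = 0) : ∃ c : ℂ, x = c • eMinusTop g := by
  obtain ⟨y, h1, h2, h3⟩ := exists_eq_minusProd_mul (List.finRange g) (List.nodup_finRange g) x
    fun j _ => hm j
  obtain ⟨c, rfl⟩ := mem_range_algebraMap_of_contr_eq_zero (fun j => h3 _ (hp j))
    fun j => h2 j (List.mem_finRange j)
  exact ⟨c, by rw [h1, minusProd_finRange, ← Algebra.commutes, ← Algebra.smul_def]⟩

end Exterior
end
end NCTorus

open scoped SchwartzMap LineDeriv ContDiff TensorProduct ComplexConjugate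

namespace NCTorus

noncomputable section

variable {g : ℕ} {Λ : Submodule ℤ (V g)} {B : V g →L[ℝ] V g →L[ℝ] ℝ}

/-! ### The gauge transformation, and 𝕏⁰ as a Koszul differential. -/

section Operators

/-- Multiplication by `σ(l, z)` on `𝓢(V × Λ)`. -/
def gaugeX (B : V g →L[ℝ] V g →L[ℝ] ℝ) (φ : SX Λ) : SX Λ :=
  ⟨fun l => gauge B (l : V g) (φ l), fun k n m => by
    -- Differentiating the phase σ(l, z) n times costs up to n powers of ‖l‖, paid for by extra
    -- decay of φ.
    obtain ⟨C, hC0, hC⟩ := gauge_bound' (B := B) φ k n (m + n)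
    refine ⟨C, fun l => ?_⟩
    have h := hC (l : V g) l
    have hp : 0 < (1 + ‖l‖) ^ n := by positivity
    rw [pow_add, Submodule.coe_norm] at h
    have h2 : (1 + ‖l‖) ^ m * SchwartzMap.seminorm ℂ k n (gauge B (l : V g) (φ l)) ≤ C := by
      refine le_of_mul_le_mul_right ?_ hp
      rw [Submodule.coe_norm] at *
      linarith
    refine le_trans ?_ h2
    gcongr
    linarith [norm_nonneg l]⟩

@[simp] theorem gaugeX_apply (φ : SX Λ) (l : Λ) : gaugeX B φ l = gauge B (l : V g) (φ l) := rfl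

theorem gauge_neg_gauge (u : V g) (f : 𝓢(V g, ℂ)) : gauge (-B) u (gauge B u f) = f := by
  ext z
  rw [gauge_apply, gauge_apply, ← mul_assoc, sigma, sigma, ← Complex.exp_add]
  simp

theorem gauge_gauge_neg (u : V g) (f : 𝓢(V g, ℂ)) : gauge B u (gauge (-B) u f) = f := by
  ext z
  rw [gauge_apply, gauge_apply, ← mul_assoc, sigma, sigma, ← Complex.exp_add]
  simp

variable (Λ B) in
/-- The action of operators on `𝓢(V)` on the slices of `𝓢(V × Λ)`, conjugated by `σ(l, z)`. -/
def opX : (𝓢(V g, ℂ) →L[ℂ] 𝓢(V g, ℂ)) →ₐ[ℂ] Module.End ℂ (SX Λ) where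
  toFun A :=
    { toFun := fun φ => gaugeX (-B) (SX.map A (gaugeX B φ))
      map_add' := fun φ ψ => DFunLike.ext _ _ fun l => by simp
      map_smul' := fun c φ => DFunLike.ext _ _ fun l => by simp }
  map_one' := LinearMap.ext fun φ => DFunLike.ext _ _ fun l => gauge_neg_gauge _ _
  map_mul' S T := LinearMap.ext fun φ => DFunLike.ext _ _ fun l => by
    change gauge (-B) (l : V g) (S (T (gauge B (l : V g) (φ l)))) =
      gauge (-B) (l : V g) (S (gauge B (l : V g) (gauge (-B) (l : V g)
        (T (gauge B (l : V g) (φ l))))))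
    rw [gauge_gauge_neg]
  map_zero' := LinearMap.ext fun φ => DFunLike.ext _ _ fun l => by
    change gauge (-B) (l : V g) 0 = 0
    simp
  map_add' S T := LinearMap.ext fun φ => DFunLike.ext _ _ fun l => by
    change gauge (-B) (l : V g) (S (gauge B (l : V g) (φ l)) + T (gauge B (l : V g) (φ l))) = _
    rw [map_add]
    rfl
  commutes' c := LinearMap.ext fun φ => DFunLike.ext _ _ fun l => by
    change gauge (-B) (l : V g) (c • (gauge B (l : V g) (φ l))) = c • φ l
    rw [map_smul, gauge_neg_gauge]

theorem opX_apply (A : 𝓢(V g, ℂ) →L[ℂ] 𝓢(V g, ℂ)) (φ : SX Λ) (l : Λ) :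
    opX Λ B A φ l = gauge (-B) (l : V g) (A (gauge B (l : V g) (φ l))) := rfl

theorem opX_mulZ (j : Fin g) (φ : SX Λ) : opX Λ B (mulZ j) φ = SX.map (mulZ j) φ :=
  SX.ext fun l z => by
    rw [opX_apply, SX.map_apply, gauge_apply, mulZ_apply, mulZ_apply, mul_left_comm, ← gauge_apply,
      gauge_neg_gauge]

/-- The derivative of the phase produces exactly 2πi conj(B_j(l)), so one operator on 𝓢(V),
independent of B and of the slice, represents the covariant derivative everywhere. -/
theorem opX_dbar (j : Fin g) (φ : SX Λ) : opX Λ B (dbar j) φ = covDbarL Λ B j φ :=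
  SX.ext fun l z => by
    rw [opX_apply, gauge_apply, dbar_gauge, ← mul_assoc, covDbarL_apply, sigma, sigma,
      ← Complex.exp_add]
    simp
    ring

variable (Λ B) in
/-- The action of operators on `𝓢(V)` on forms. -/
def opS : (𝓢(V g, ℂ) →L[ℂ] 𝓢(V g, ℂ)) →ₐ[ℂ] Module.End ℂ (XForms Λ) :=
  (Module.End.rTensorAlgHom ℂ (SX Λ) (Ext g)).comp (opX Λ B)

variable (Λ) in
/-- The action of endomorphisms of the exterior algebra on forms. -/
def opW : Module.End ℂ (Ext g) →ₐ[ℂ] Module.End ℂ (XForms Λ) :=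
  Module.End.lTensorAlgHom ℂ (Ext g) (SX Λ)

@[simp] theorem opS_tmul (A : 𝓢(V g, ℂ) →L[ℂ] 𝓢(V g, ℂ)) (f : SX Λ) (x : Ext g) :
    opS Λ B A (f ⊗ₜ[ℂ] x) = opX Λ B A f ⊗ₜ[ℂ] x := rfl

@[simp] theorem opW_tmul (w : Module.End ℂ (Ext g)) (f : SX Λ) (x : Ext g) :
    opW Λ w (f ⊗ₜ[ℂ] x) = f ⊗ₜ[ℂ] w x := rfl

theorem opS_opW (A : 𝓢(V g, ℂ) →L[ℂ] 𝓢(V g, ℂ)) (w : Module.End ℂ (Ext g)) :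
    Commute (opS Λ B A) (opW Λ w) :=
  TensorProduct.ext' fun _ _ => rfl

variable (Λ) in
/-- Contraction of forms with `dualPlus j`. -/
def cPlus (j : Fin g) : Module.End ℂ (XForms Λ) := opW Λ (contr (dualPlus j))

variable (Λ) in
/-- Contraction of forms with `dualMinus j`. -/
def cMinus (j : Fin g) : Module.End ℂ (XForms Λ) := opW Λ (contr (dualMinus j))

variable (Λ) in
/-- Exterior multiplication of forms by `uPlus j`. -/
def wPlus (j : Fin g) : Module.End ℂ (XForms Λ) := opW Λ (wedgeE (uPlus j))

variable (Λ) in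
/-- Exterior multiplication of forms by `uMinus j`. -/
def wMinus (j : Fin g) : Module.End ℂ (XForms Λ) := opW Λ (wedgeE (uMinus j))

theorem opW_contr_wedgeE (d : Module.Dual ℂ (Cov g)) (v : Cov g) :
    opW Λ (contr d) * opW Λ (wedgeE v) =
      d v • (1 : Module.End ℂ (XForms Λ)) - opW Λ (wedgeE v) * opW Λ (contr d) := by
  rw [← map_mul, contr_wedge, map_sub, map_smul, map_one, map_mul]

theorem cPlus_wPlus (i j : Fin g) : cPlus Λ j * wPlus Λ i =
    (if i = j then 1 else 0) - wPlus Λ i * cPlus Λ j := by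
  rw [cPlus, wPlus, opW_contr_wedgeE, dualPlus_uPlus]
  split_ifs <;> simp

theorem cMinus_wMinus (i j : Fin g) : cMinus Λ j * wMinus Λ i =
    (if i = j then 1 else 0) - wMinus Λ i * cMinus Λ j := by
  rw [cMinus, wMinus, opW_contr_wedgeE, dualMinus_uMinus]
  split_ifs <;> simp

theorem opW_anticomm {v w : Module.End ℂ (Ext g)} (h : v * w = -(w * v)) :
    opW Λ v * opW Λ w = 0 - opW Λ w * opW Λ v := by
  rw [← map_mul, h, map_neg, map_mul, zero_sub]

theorem opW_mul_self {v : Module.End ℂ (Ext g)} (h : v * v = 0) : opW Λ v * opW Λ v = 0 := by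
  rw [← map_mul, h, map_zero]

variable (Λ B) in
/-- `connX` as a `ℂ`-linear operator. -/
def connC : Module.End ℂ (XForms Λ) :=
  ∑ j, (opS Λ B (alphaOp j) * wPlus Λ j + opS Λ B (gammaOp j) * wMinus Λ j)

theorem connC_tmul (f : SX Λ) (x : Ext g) : connC Λ B (f ⊗ₜ[ℂ] x) =
    ∑ j, (opX Λ B (alphaOp j) f ⊗ₜ[ℂ] wedgeE (uPlus j) x +
      opX Λ B (gammaOp j) f ⊗ₜ[ℂ] wedgeE (uMinus j) x) := by
  rw [connC, LinearMap.sum_apply]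
  rfl

variable [DiscreteTopology Λ]

theorem connX_tmul (f : SX Λ) (x : Ext g) : connX Λ B (f ⊗ₜ[ℂ] x) =
    ∑ j, ((2 * Real.pi * Complex.I : ℂ) • (SX.map (mulZ j) f ⊗ₜ[ℂ] wedgeE (dzeta j) x) +
      covDbarL Λ B j f ⊗ₜ[ℂ] wedgeE (dzbar j) x) := by
  rw [connX, LinearMap.sum_apply]
  rfl

/-- Since dz̄_j = u⁺_j + u⁻_j and i dζ̄_j = u⁺_j - u⁻_j, collecting coefficients gives ∂̄_j + 2πz_j
along u⁺_j and ∂̄_j - 2πz_j along u⁻_j. -/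
theorem connX_eq_connC (φ : XForms Λ) : connX Λ B φ = connC Λ B φ := by
  induction φ using TensorProduct.induction_on with
  | zero => rw [map_zero, map_zero]
  | add a b ha hb => rw [map_add, map_add, ha, hb]
  | tmul f x =>
    rw [connX_tmul, connC_tmul]
    refine Finset.sum_congr rfl fun j _ => ?_
    rw [alphaOp, gammaOp, map_add, map_sub, map_smul, LinearMap.add_apply, LinearMap.sub_apply,
      LinearMap.smul_apply, opX_mulZ, opX_dbar, uPlus, uMinus, eMinus, wedgeE_smul,
      wedgeE_smul, wedgeE_add, wedgeE_sub, wedgeE_smul]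
    simp only [LinearMap.smul_apply, LinearMap.add_apply, LinearMap.sub_apply,
      TensorProduct.add_tmul, TensorProduct.sub_tmul, TensorProduct.tmul_add,
      TensorProduct.tmul_sub, TensorProduct.tmul_smul, ← TensorProduct.smul_tmul', smul_add,
      smul_sub]
    module

theorem gr_induction {k : ℕ} {P : XForms Λ → Prop} (h0 : P 0) (hadd : ∀ x y, P x → P y → P (x + y))
    (ht : ∀ (f : SX Λ) (x : Ext g), x ∈ ⋀[ℂ]^k (Cov g) → P (f ⊗ₜ[ℂ] x)) {φ : XForms Λ}
    (hφ : φ ∈ gr Λ B k) : P φ := by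
  obtain ⟨y, rfl⟩ := hφ
  induction y using TensorProduct.induction_on with
  | zero => rw [map_zero]; exact h0
  | add a b ha hb => rw [map_add]; exact hadd _ _ ha hb
  | tmul f x => exact ht f x x.2

theorem tmul_mem_gr {k : ℕ} (f : SX Λ) {x : Ext g} (hx : x ∈ ⋀[ℂ]^k (Cov g)) :
    f ⊗ₜ[ℂ] x ∈ gr Λ B k := ⟨f ⊗ₜ[ℂ] ⟨x, hx⟩, rfl⟩

theorem opS_mem_gr {A : 𝓢(V g, ℂ) →L[ℂ] 𝓢(V g, ℂ)} {k : ℕ} {φ : XForms Λ} (hφ : φ ∈ gr Λ B k) :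
    opS Λ B A φ ∈ gr Λ B k :=
  gr_induction (P := fun φ => opS Λ B A φ ∈ gr Λ B k) (by rw [map_zero]; exact zero_mem _)
    (fun x y hx hy => by rw [map_add]; exact add_mem hx hy)
    (fun f x hx => tmul_mem_gr _ hx) hφ

theorem opW_wedgeE_mem_gr (v : Cov g) {k : ℕ} {φ : XForms Λ} (hφ : φ ∈ gr Λ B k) :
    opW Λ (wedgeE v) φ ∈ gr Λ B (k + 1) :=
  gr_induction (P := fun φ => opW Λ (wedgeE v) φ ∈ gr Λ B (k + 1))
    (by rw [map_zero]; exact zero_mem _)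
    (fun x y hx hy => by rw [map_add]; exact add_mem hx hy)
    (fun f x hx => tmul_mem_gr _ (wedgeE_mem_succ v hx)) hφ

theorem opW_contr_gr_zero (d : Module.Dual ℂ (Cov g)) {φ : XForms Λ} (hφ : φ ∈ gr Λ B 0) :
    opW Λ (contr d) φ = 0 :=
  gr_induction (P := fun φ => opW Λ (contr d) φ = 0) (map_zero _)
    (fun x y hx hy => by rw [map_add, hx, hy, add_zero])
    (fun f x hx => by rw [opW_tmul, (contr_mem d hx).1 rfl, TensorProduct.tmul_zero]) hφ

theorem opW_contr_mem_gr (d : Module.Dual ℂ (Cov g)) {k : ℕ} {φ : XForms Λ}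
    (hφ : φ ∈ gr Λ B (k + 1)) : opW Λ (contr d) φ ∈ gr Λ B k :=
  gr_induction (P := fun φ => opW Λ (contr d) φ ∈ gr Λ B k) (by rw [map_zero]; exact zero_mem _)
    (fun x y hx hy => by rw [map_add]; exact add_mem hx hy)
    (fun f x hx => tmul_mem_gr _ ((contr_mem d hx).2 k rfl)) hφ

theorem connX_mem_gr {k : ℕ} {φ : XForms Λ} (hφ : φ ∈ gr Λ B k) : connX Λ B φ ∈ gr Λ B (k + 1) := by
  rw [connX_eq_connC, connC, LinearMap.sum_apply]
  exact sum_mem fun j _ => add_mem (opS_mem_gr (opW_wedgeE_mem_gr _ hφ))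
    (opS_mem_gr (opW_wedgeE_mem_gr _ hφ))

/-- The image under `connX` of `opS A (contr d φ)` is a coboundary. -/
theorem connX_contr_mem_coboundaries (A : 𝓢(V g, ℂ) →L[ℂ] 𝓢(V g, ℂ)) (d : Module.Dual ℂ (Cov g))
    {k : ℕ} {φ : XForms Λ} (hφ : φ ∈ gr Λ B k) :
    connX Λ B (opS Λ B A (opW Λ (contr d) φ)) ∈ coboundaries Λ B k := by
  rcases k with _ | k
  · rw [opW_contr_gr_zero d hφ, map_zero, map_zero]
    exact zero_mem _
  · exact Submodule.mem_map_of_mem (opS_mem_gr (opW_contr_mem_gr d hφ))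

end Operators

/-! ### Abstract Koszul differentials and their homotopy formula. -/

section Homotopy

/-- The terms (i, k) and (k, i) cancel, since the A commute and the P anticommute; the diagonal
vanishes by P i * P i = 0. -/
theorem sum_mul_self_eq_zero {R ι : Type*} [Ring R] [Fintype ι] (A P : ι → R)
    (hA : ∀ i k, Commute (A i) (A k)) (hAP : ∀ i k, Commute (A i) (P k))
    (hP : ∀ i k, P i * P k = 0 - P k * P i) (hP' : ∀ i, P i * P i = 0) :
    (∑ i, A i * P i) * ∑ i, A i * P i = 0 := by
  classical
  rw [Finset.sum_mul_sum, ← Finset.sum_product', Finset.univ_product_univ]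
  have h : ∀ i k, A i * P i * (A k * P k) = A i * A k * (P i * P k) := fun i k => by
    rw [mul_assoc, ← mul_assoc (P i), ← (hAP k i).eq]; simp only [mul_assoc]
  refine Finset.sum_involution (fun p _ => p.swap) (fun p _ => ?_) (fun p _ hp => ?_)
    (fun p _ => Finset.mem_univ _) fun p _ => Prod.swap_swap p
  · simp only [Prod.fst_swap, Prod.snd_swap, h]
    rw [(hA p.2 p.1).eq, hP p.2 p.1, zero_sub, mul_neg, add_neg_cancel]
  · intro e
    apply hp
    have e' : p.2 = p.1 := congrArg Prod.fst e
    rw [h, e', hP', mul_zero]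

/-- A Cartan type formula for the homotopy S c. When S commutes with all A i but one and c is dual
to that single P i, the whole sum reduces to one term. -/
theorem sum_mul_homotopy {R ι : Type*} [Ring R] [Fintype ι] (A P δ : ι → R) (S c : R)
    (hSP : ∀ i, Commute S (P i)) (hAc : ∀ i, Commute (A i) c)
    (hc : ∀ i, c * P i = δ i - P i * c) :
    (∑ i, A i * P i) * (S * c) + S * c * ∑ i, A i * P i =
      ∑ i, ((A i * S - S * A i) * P i * c + S * A i * δ i) := by
  rw [Finset.sum_mul, Finset.mul_sum, ← Finset.sum_add_distrib]
  refine Finset.sum_congr rfl fun i _ => ?_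
  have h1 : A i * P i * (S * c) = A i * S * P i * c := by
    rw [mul_assoc, ← mul_assoc (P i), ← (hSP i).eq]; simp only [mul_assoc]
  have h2 : S * c * (A i * P i) = S * A i * (c * P i) := by
    rw [mul_assoc, ← mul_assoc c, ← (hAc i).eq]; simp only [mul_assoc]
  rw [h1, h2, hc]
  noncomm_ring

end Homotopy
end
end NCTorus

open scoped SchwartzMap LineDeriv ContDiff TensorProduct ComplexConjugate

namespace NCTorus

noncomputable section

variable {g : ℕ} {Λ : Submodule ℤ (V g)} {B : V g →L[ℝ] V g →L[ℝ] ℝ}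

/-! ### Reduction of closed forms, one coordinate direction at a time. -/

section Chase

theorem connC_eq_sum : connC Λ B = ∑ i : Fin g ⊕ Fin g,
    opS Λ B (Sum.elim alphaOp gammaOp i) * Sum.elim (wPlus Λ) (wMinus Λ) i := by
  rw [connC, Fintype.sum_sum_type, Finset.sum_add_distrib]
  rfl

theorem connC_mul_self : connC Λ B * connC Λ B = 0 := by
  rw [connC_eq_sum]
  refine sum_mul_self_eq_zero (fun i => opS Λ B (Sum.elim alphaOp gammaOp i))
    (Sum.elim (wPlus Λ) (wMinus Λ)) (fun i k => ?_) (fun i k => ?_) (fun i k => ?_) fun i => ?_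
  · refine Commute.map ?_ (opS Λ B)
    rcases i with i | i <;> rcases k with k | k
    · exact alphaOp_comm i k
    · exact alphaOp_gammaOp_comm k i
    · exact (alphaOp_gammaOp_comm i k).symm
    · exact gammaOp_comm i k
  · rcases k with k | k <;> exact opS_opW _ _
  · rcases i with i | i <;> rcases k with k | k <;> exact opW_anticomm (wedgeE_anticomm _ _)
  · rcases i with i | i <;> exact opW_mul_self (wedgeE_mul_self _)

theorem connC_homotopy (A : 𝓢(V g, ℂ) →L[ℂ] 𝓢(V g, ℂ)) (d : Module.Dual ℂ (Cov g)) :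
    connC Λ B * (opS Λ B A * opW Λ (contr d)) + opS Λ B A * opW Λ (contr d) * connC Λ B =
      (∑ i, (opS Λ B (alphaOp i * A - A * alphaOp i) * wPlus Λ i * opW Λ (contr d) +
        d (uPlus i) • opS Λ B (A * alphaOp i))) +
      ∑ i, (opS Λ B (gammaOp i * A - A * gammaOp i) * wMinus Λ i * opW Λ (contr d) +
        d (uMinus i) • opS Λ B (A * gammaOp i)) := by
  have h := sum_mul_homotopy (fun i => opS Λ B (Sum.elim alphaOp gammaOp i))
    (Sum.elim (wPlus Λ) (wMinus Λ)) (Sum.elim (fun i => d (uPlus i) • 1) fun i => d (uMinus i) • 1)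
    (opS Λ B A) (opW Λ (contr d)) (fun i => by rcases i with i | i <;> exact opS_opW _ _)
    (fun i => opS_opW _ _)
    (fun i => by rcases i with i | i <;> exact opW_contr_wedgeE d _)
  rw [connC_eq_sum, h, Fintype.sum_sum_type]
  simp only [Sum.elim_inl, Sum.elim_inr, map_sub, map_mul, mul_smul_comm, mul_one]

/-- Only the term of α_j survives and equals kerProj w c + (1 - kerProj), where w and c are
multiplication by u⁺_j and its contraction; w c = 1 - c w gives the right side. A closed form can
therefore be moved into the kernels of `alphaOp j` and `cPlus j`. -/
theorem connC_homotopy_rightInv (j : Fin g) :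
    connC Λ B * (opS Λ B (rightInv j) * cPlus Λ j) + opS Λ B (rightInv j) * cPlus Λ j * connC Λ B =
      1 - opS Λ B (kerProj j) * (cPlus Λ j * wPlus Λ j) := by
  rw [cPlus, connC_homotopy, Finset.sum_eq_single j, Finset.sum_eq_zero, add_zero]
  · rw [alphaOp_rightInv, ← kerProj, dualPlus_uPlus, if_pos rfl, one_smul, ← cPlus, cPlus_wPlus,
      if_pos rfl, mul_sub, mul_one, mul_assoc]
    conv_rhs => rw [kerProj, map_sub, map_one]
    rw [kerProj, map_sub, map_one]
    abel
  · intro i _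
    rw [gammaOp_rightInv_comm, sub_self, map_zero, zero_mul, zero_mul, dualPlus_uMinus, zero_smul,
      add_zero]
  · intro i _ hi
    rw [alphaOp_rightInv_comm hi, sub_self, map_zero, zero_mul, zero_mul, dualPlus_uPlus,
      if_neg hi, zero_smul, add_zero]
  · simp

/-- In general `gammaInv j` commutes with neither operator of index j, so the formula is used only
after `kerProj j`. There both products with α_j vanish, and the commutator with γ_j is minus the
restriction term. -/
theorem connC_homotopy_gammaInv (j : Fin g) :
    (connC Λ B * (opS Λ B (gammaInv j) * cMinus Λ j) +
      opS Λ B (gammaInv j) * cMinus Λ j * connC Λ B) * opS Λ B (kerProj j) =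
      opS Λ B (kerProj j) - opS Λ B (restr j) * (wMinus Λ j * cMinus Λ j) * opS Λ B (kerProj j) := by
  have hc : ∀ A w, opW Λ w * opS Λ B A = opS Λ B A * opW Λ w := fun A w => (opS_opW A w).symm
  rw [cMinus, connC_homotopy, add_mul, Finset.sum_eq_single j, Finset.sum_eq_single j]
  · rw [dualMinus_uPlus, zero_smul, add_zero, dualMinus_uMinus, if_pos rfl, one_smul, wPlus,
      wMinus]
    have e : ∀ (S : 𝓢(V g, ℂ) →L[ℂ] 𝓢(V g, ℂ)) (v w : Module.End ℂ (Ext g)),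
        opS Λ B S * opW Λ v * opW Λ w * opS Λ B (kerProj j) =
          opS Λ B (S * kerProj j) * (opW Λ v * opW Λ w) := fun S v w => by
      rw [mul_assoc, hc, ← mul_assoc, mul_assoc (opS Λ B S), hc, map_mul]; simp only [mul_assoc]
    have e2 : (alphaOp j * gammaInv j - gammaInv j * alphaOp j) * kerProj j = 0 := by
      rw [sub_mul, mul_assoc, alphaOp_gammaInv_kerProj, mul_assoc, alphaOp_kerProj, mul_zero,
        sub_zero]
    have e3 : (gammaOp j * gammaInv j - gammaInv j * gammaOp j) * kerProj j =
        kerProj j - restr j * kerProj j - kerProj j := by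
      rw [sub_mul, mul_assoc, gammaOp_gammaInv_kerProj, mul_assoc, gammaInv_gammaOp_kerProj]
    rw [add_mul, e, e, ← mul_assoc (opS Λ B (restr j)), e, ← map_mul (opS Λ B) (gammaInv j * gammaOp j), e2,
      e3, mul_assoc, gammaInv_gammaOp_kerProj,
      map_zero, zero_mul, zero_add, map_sub, map_sub, sub_mul, sub_mul]
    abel
  · intro i _ hi
    rw [(isAway_gammaInv hi).gammaOp.eq, sub_self, map_zero, zero_mul, zero_mul, dualMinus_uMinus,
      if_neg hi, zero_smul, add_zero]
  · simp
  · intro i _ hi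
    rw [(isAway_gammaInv hi).alphaOp.eq, sub_self, map_zero, zero_mul, zero_mul, dualMinus_uPlus,
      zero_smul, add_zero]
  · simp

theorem opS_comm_apply {S T : 𝓢(V g, ℂ) →L[ℂ] 𝓢(V g, ℂ)} (h : S * T = T * S) (φ : XForms Λ) :
    opS Λ B S (opS Λ B T φ) = opS Λ B T (opS Λ B S φ) := by
  have := congrArg (opS Λ B) h
  rw [map_mul, map_mul] at this
  exact LinearMap.congr_fun this φ

theorem opS_opW_apply (A : 𝓢(V g, ℂ) →L[ℂ] 𝓢(V g, ℂ)) (w : Module.End ℂ (Ext g)) (φ : XForms Λ) :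
    opS Λ B A (opW Λ w φ) = opW Λ w (opS Λ B A φ) :=
  LinearMap.congr_fun (opS_opW A w) φ

theorem opS_mul_eq_zero {S T : 𝓢(V g, ℂ) →L[ℂ] 𝓢(V g, ℂ)} (h : S * T = 0) (φ : XForms Λ) :
    opS Λ B S (opS Λ B T φ) = 0 := by
  have := congrArg (opS Λ B) h
  rw [map_mul, map_zero] at this
  exact LinearMap.congr_fun this φ

theorem opW_anticomm_apply {v w : Module.End ℂ (Ext g)} (h : v * w = -(w * v)) (φ : XForms Λ) :
    opW Λ v (opW Λ w φ) = -opW Λ w (opW Λ v φ) := by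
  have := LinearMap.congr_fun (opW_anticomm (Λ := Λ) h) φ
  change opW Λ v (opW Λ w φ) = 0 - opW Λ w (opW Λ v φ) at this
  rw [this, zero_sub]

theorem opW_contr_wedgeE_apply {d : Module.Dual ℂ (Cov g)} {v : Cov g} (h : d v = 0)
    (φ : XForms Λ) : opW Λ (contr d) (opW Λ (wedgeE v) φ) = -opW Λ (wedgeE v) (opW Λ (contr d) φ) := by
  have := LinearMap.congr_fun (opW_contr_wedgeE (Λ := Λ) d v) φ
  change opW Λ (contr d) (opW Λ (wedgeE v) φ) = d v • φ - opW Λ (wedgeE v) (opW Λ (contr d) φ)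
    at this
  rw [this, h, zero_smul, zero_sub]

variable (B) in
/-- Subgroups `Z` of closed forms and `Q` of exact forms which are large enough for the reduction
of the forms in `Z` by homotopies. -/
structure IsReductionPair (Z Q : AddSubgroup (XForms Λ)) : Prop where
  closed : ∀ φ ∈ Z, connC Λ B φ = 0
  exact : ∀ (A : 𝓢(V g, ℂ) →L[ℂ] 𝓢(V g, ℂ)) (d : Module.Dual ℂ (Cov g)), ∀ φ ∈ Z,
    connC Λ B (opS Λ B A (opW Λ (contr d) φ)) ∈ Q
  le : Q ≤ Z

variable {Z Q : AddSubgroup (XForms Λ)}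

/-- One step of a reduction: `φ - φ'` is exact if it is given by a homotopy. -/
theorem IsReductionPair.sub_mem (h : IsReductionPair B Z Q) {A : 𝓢(V g, ℂ) →L[ℂ] 𝓢(V g, ℂ)}
    {d : Module.Dual ℂ (Cov g)} {φ φ' : XForms Λ} (hφ : φ ∈ Z)
    (hA : (connC Λ B * (opS Λ B A * opW Λ (contr d)) +
      opS Λ B A * opW Λ (contr d) * connC Λ B) φ = φ - φ') : φ - φ' ∈ Q := by
  have h1 : (connC Λ B * (opS Λ B A * opW Λ (contr d)) +
      opS Λ B A * opW Λ (contr d) * connC Λ B) φ =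
      connC Λ B (opS Λ B A (opW Λ (contr d) φ)) + opS Λ B A (opW Λ (contr d) (connC Λ B φ)) := rfl
  rw [← hA, h1, h.closed φ hφ, map_zero, map_zero, add_zero]
  exact h.exact A d φ hφ

theorem IsReductionPair.mem (h : IsReductionPair B Z Q) {φ φ' : XForms Λ} (hφ : φ ∈ Z)
    (hs : φ - φ' ∈ Q) : φ' ∈ Z := by
  have := _root_.sub_mem hφ (h.le hs)
  rwa [sub_sub_cancel] at this

/-- The reduction for j uses operators commuting, up to sign, with the conditions already achieved
for i ≠ j, so they persist and the indices can be added successively. -/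
theorem exists_reduction_plus (h : IsReductionPair B Z Q) {φ : XForms Λ} (hφ : φ ∈ Z)
    (s : Finset (Fin g)) : ∃ φ' ∈ Z, φ - φ' ∈ Q ∧
      ∀ i ∈ s, opS Λ B (alphaOp i) φ' = 0 ∧ cPlus Λ i φ' = 0 := by
  induction s using Finset.induction_on with
  | empty => exact ⟨φ, hφ, by rw [sub_self]; exact zero_mem _, by simp⟩
  | insert j s hj ih =>
    obtain ⟨φ₁, h1, h2, h3⟩ := ih
    have hb : φ₁ - opS Λ B (kerProj j) (cPlus Λ j (wPlus Λ j φ₁)) ∈ Q :=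
      h.sub_mem h1 (LinearMap.congr_fun (connC_homotopy_rightInv j) φ₁)
    refine ⟨_, h.mem h1 hb, ?_, fun i hi => ?_⟩
    · have := add_mem h2 hb
      rwa [sub_add_sub_cancel] at this
    · by_cases hij : i = j
      · subst hij
        refine ⟨opS_mul_eq_zero (alphaOp_kerProj i) _, ?_⟩
        rw [cPlus, ← opS_opW_apply]
        have := LinearMap.congr_fun (opW_mul_self (Λ := Λ) (contr_mul_self (dualPlus i)))
          (wPlus Λ i φ₁)
        exact (congrArg _ this).trans (map_zero _)
      · obtain ⟨h4, h5⟩ := h3 i ((Finset.mem_insert.1 hi).resolve_left hij)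
        refine ⟨?_, ?_⟩
        · rw [opS_comm_apply (alphaOp_kerProj_comm hij), cPlus, wPlus, opS_opW_apply (alphaOp i),
            opS_opW_apply (alphaOp i), h4, map_zero, map_zero, map_zero]
        · rw [cPlus] at h5 ⊢
          rw [← opS_opW_apply, cPlus, wPlus, opW_anticomm_apply (contr_anticomm _ _),
            opW_contr_wedgeE_apply (by rw [dualPlus_uPlus, if_neg (Ne.symm hij)]), h5, map_zero,
            neg_zero, map_zero, neg_zero, map_zero]

theorem exists_reduction_minus (h : IsReductionPair B Z Q) {φ : XForms Λ} (hφ : φ ∈ Z)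
    (ha : ∀ i, opS Λ B (alphaOp i) φ = 0) (hc : ∀ i, cPlus Λ i φ = 0)
    (s : Finset (Fin g)) : ∃ φ' ∈ Z, φ - φ' ∈ Q ∧
      (∀ i, opS Λ B (alphaOp i) φ' = 0) ∧ (∀ i, cPlus Λ i φ' = 0) ∧
      ∀ i ∈ s, wMinus Λ i φ' = 0 ∧ opS Λ B (restr i) φ' = φ' := by
  induction s using Finset.induction_on with
  | empty => exact ⟨φ, hφ, by rw [sub_self]; exact zero_mem _, ha, hc, by simp⟩
  | insert j s hj ih =>
    obtain ⟨φ₁, h1, h2, ha, hc, h3⟩ := ih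
    -- The homotopy for γ_j is available only on the image of `kerProj j`; forms annihilated by
    -- `alphaOp j` are fixed by it.
    have hK : opS Λ B (kerProj j) φ₁ = φ₁ := by
      rw [kerProj, map_sub, map_one, map_mul]
      change φ₁ - opS Λ B (rightInv j) (opS Λ B (alphaOp j) φ₁) = φ₁
      rw [ha, map_zero, sub_zero]
    have hb : φ₁ - opS Λ B (restr j) (wMinus Λ j (cMinus Λ j φ₁)) ∈ Q := by
      refine h.sub_mem (A := gammaInv j) (d := dualMinus j) h1 ?_
      have := LinearMap.congr_fun (connC_homotopy_gammaInv (Λ := Λ) (B := B) j) φ₁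
      change (connC Λ B * (opS Λ B (gammaInv j) * cMinus Λ j) +
        opS Λ B (gammaInv j) * cMinus Λ j * connC Λ B) (opS Λ B (kerProj j) φ₁) =
        opS Λ B (kerProj j) φ₁ -
          opS Λ B (restr j) (wMinus Λ j (cMinus Λ j (opS Λ B (kerProj j) φ₁))) at this
      rwa [hK] at this
    refine ⟨_, h.mem h1 hb, ?_, fun i => ?_, fun i => ?_, fun i hi => ?_⟩
    · have := add_mem h2 hb
      rwa [sub_add_sub_cancel] at this
    · by_cases hij : i = j
      · subst hij
        exact opS_mul_eq_zero (alphaOp_restr i) _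
      · rw [opS_comm_apply (isAway_restr hij).alphaOp, wMinus, cMinus,
          opS_opW_apply (alphaOp i), opS_opW_apply (alphaOp i), ha, map_zero, map_zero, map_zero]
    · have h5 := hc i
      rw [cPlus] at h5 ⊢
      rw [← opS_opW_apply, wMinus, cMinus, opW_contr_wedgeE_apply (dualPlus_uMinus i j),
        opW_anticomm_apply (contr_anticomm _ _), h5, map_zero, neg_zero, map_zero, neg_zero,
        map_zero]
    · by_cases hij : i = j
      · subst hij
        refine ⟨?_, ?_⟩
        · rw [wMinus, ← opS_opW_apply]
          have := LinearMap.congr_fun (opW_mul_self (Λ := Λ) (wedgeE_mul_self (uMinus i)))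
            (cMinus Λ i φ₁)
          exact (congrArg _ this).trans (map_zero _)
        · have := congrArg (opS Λ B) (restr_restr i)
          rw [map_mul] at this
          exact LinearMap.congr_fun this _
      · obtain ⟨h4, h5⟩ := h3 i ((Finset.mem_insert.1 hi).resolve_left hij)
        refine ⟨?_, ?_⟩
        · rw [wMinus] at h4 ⊢
          have h6 := opW_contr_wedgeE_apply (Λ := Λ) (d := dualMinus j) (v := uMinus i)
            (by rw [dualMinus_uMinus, if_neg hij]) φ₁
          rw [h4, map_zero, eq_comm, neg_eq_zero] at h6
          rw [← opS_opW_apply, wMinus, cMinus, opW_anticomm_apply (wedgeE_anticomm _ _), h6,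
            map_zero, neg_zero, map_zero]
        · rw [opS_comm_apply (restr_comm i j), wMinus, cMinus, opS_opW_apply (restr i),
            opS_opW_apply (restr i), h5]

/-- Every closed form is cohomologous to one which is annihilated by the `cPlus i` and the `wMinus i`
and fixed by the `restr i`. -/
theorem exists_reduction (h : IsReductionPair B Z Q) {φ : XForms Λ} (hφ : φ ∈ Z) :
    ∃ φ' ∈ Z, φ - φ' ∈ Q ∧ ∀ i, cPlus Λ i φ' = 0 ∧ wMinus Λ i φ' = 0 ∧
      opS Λ B (restr i) φ' = φ' := by
  obtain ⟨φ₁, h1, h2, h3⟩ := exists_reduction_plus h hφ Finset.univ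
  obtain ⟨φ₂, h4, h5, -, h6, h7⟩ := exists_reduction_minus h h1 (fun i => (h3 i (by simp)).1)
    (fun i => (h3 i (by simp)).2) Finset.univ
  refine ⟨φ₂, h4, ?_, fun i => ⟨h6 i, h7 i (by simp)⟩⟩
  have := add_mem h2 h5
  rwa [sub_add_sub_cancel] at this

variable [DiscreteTopology Λ]

theorem connX_connX (φ : XForms Λ) : connX Λ B (connX Λ B φ) = 0 := by
  rw [connX_eq_connC, connX_eq_connC]
  exact LinearMap.congr_fun connC_mul_self φ

theorem coboundaries_le_cocycles (k : ℕ) : coboundaries Λ B k ≤ cocycles Λ B k := by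
  rcases k with _ | k
  · exact bot_le
  · rintro _ ⟨ψ, hψ, rfl⟩
    exact ⟨connX_connX ψ, connX_mem_gr hψ⟩

/-- The ungraded version serves the harmonic forms, which are not assumed homogeneous. -/
theorem isReductionPair_ker_range : IsReductionPair B
    (LinearMap.ker (connX Λ B)).toAddSubgroup (LinearMap.range (connX Λ B)).toAddSubgroup where
  closed φ hφ := by rw [← connX_eq_connC]; exact hφ
  exact A d φ _ := by rw [← connX_eq_connC]; exact LinearMap.mem_range_self _ _
  le := by
    rintro _ ⟨ψ, rfl⟩
    exact connX_connX ψ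

theorem isReductionPair_cocycles (k : ℕ) : IsReductionPair B
    (cocycles Λ B k).toAddSubgroup (coboundaries Λ B k).toAddSubgroup where
  closed φ hφ := by rw [← connX_eq_connC]; exact hφ.1
  exact A d φ hφ := by
    rw [← connX_eq_connC]
    exact connX_contr_mem_coboundaries A d hφ.2
  le := coboundaries_le_cocycles k

end Chase

/-! ### Reduced forms live in degree g. -/

section Degree

/-- Each u⁻_j∧ composed with its contraction acts as the identity on a reduced form, and each u⁺_j
counterpart as zero, so the degree operator counts the g indices. -/
theorem opW_numberOp_of_reduced {φ : XForms Λ} (hp : ∀ i, cPlus Λ i φ = 0)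
    (hm : ∀ i, wMinus Λ i φ = 0) : opW Λ (numberOp g) φ = (g : ℂ) • φ := by
  have h : ∀ j, wMinus Λ j (cMinus Λ j φ) = φ := fun j => by
    have := LinearMap.congr_fun (cMinus_wMinus (Λ := Λ) j j) φ
    rw [if_pos rfl] at this
    change cMinus Λ j (wMinus Λ j φ) = φ - wMinus Λ j (cMinus Λ j φ) at this
    rw [hm, map_zero, eq_comm, sub_eq_zero] at this
    exact this.symm
  rw [numberOp, map_sum, LinearMap.sum_apply]
  have h2 : ∀ j ∈ Finset.univ, opW Λ (wedgeE (uPlus j) * contr (dualPlus j) +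
      wedgeE (uMinus j) * contr (dualMinus j)) φ = φ := fun j _ => by
    rw [map_add, map_mul, map_mul]
    change wPlus Λ j (cPlus Λ j φ) + wMinus Λ j (cMinus Λ j φ) = φ
    rw [hp, map_zero, zero_add, h]
  rw [Finset.sum_congr rfl h2, Finset.sum_const, Finset.card_univ, Fintype.card_fin,
    Nat.cast_smul_eq_nsmul]

variable [DiscreteTopology Λ]

theorem opW_numberOp_of_mem_gr {k : ℕ} {φ : XForms Λ} (hφ : φ ∈ gr Λ B k) :
    opW Λ (numberOp g) φ = (k : ℂ) • φ :=
  gr_induction (P := fun φ => opW Λ (numberOp g) φ = (k : ℂ) • φ) (by simp)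
    (fun x y hx hy => by rw [map_add, hx, hy, smul_add])
    (fun f x hx => by rw [opW_tmul, numberOp_apply hx, TensorProduct.tmul_smul]) hφ

theorem eq_zero_of_reduced {k : ℕ} (hk : k ≠ g) {φ : XForms Λ} (hφ : φ ∈ gr Λ B k)
    (hp : ∀ i, cPlus Λ i φ = 0) (hm : ∀ i, wMinus Λ i φ = 0) : φ = 0 := by
  have h := (opW_numberOp_of_mem_gr hφ).symm.trans (opW_numberOp_of_reduced hp hm)
  rw [← sub_eq_zero, ← sub_smul, smul_eq_zero, sub_eq_zero, Nat.cast_inj] at h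
  exact h.resolve_left hk

end Degree

/-! ### Reduced forms are multiples of `eMinusTop`. -/

section Top

/-- Contraction of the exterior algebra part of a form with a linear functional. -/
def pairExt (f : Ext g →ₗ[ℂ] ℂ) : XForms Λ →ₗ[ℂ] SX Λ :=
  (TensorProduct.rid ℂ (SX Λ)).toLinearMap ∘ₗ LinearMap.lTensor (SX Λ) f

@[simp] theorem pairExt_tmul (f : Ext g →ₗ[ℂ] ℂ) (u : SX Λ) (x : Ext g) :
    pairExt f (u ⊗ₜ[ℂ] x) = f x • u := rfl

/-- Contraction of the coefficients of a form with a linear functional. -/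
def pairFun (ℓ : SX Λ →ₗ[ℂ] ℂ) : XForms Λ →ₗ[ℂ] Ext g :=
  (TensorProduct.lid ℂ (Ext g)).toLinearMap ∘ₗ LinearMap.rTensor (Ext g) ℓ

@[simp] theorem pairFun_tmul (ℓ : SX Λ →ₗ[ℂ] ℂ) (u : SX Λ) (x : Ext g) :
    pairFun ℓ (u ⊗ₜ[ℂ] x) = ℓ u • x := rfl

theorem pairFun_opW (ℓ : SX Λ →ₗ[ℂ] ℂ) (w : Module.End ℂ (Ext g)) (φ : XForms Λ) :
    pairFun ℓ (opW Λ w φ) = w (pairFun ℓ φ) := by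
  induction φ using TensorProduct.induction_on with
  | zero => simp only [map_zero]
  | add a b ha hb => simp only [map_add, ha, hb]
  | tmul u x => rw [opW_tmul, pairFun_tmul, pairFun_tmul, map_smul]

theorem pairFun_pairExt (ℓ : SX Λ →ₗ[ℂ] ℂ) (f : Ext g →ₗ[ℂ] ℂ) (φ : XForms Λ) :
    f (pairFun ℓ φ) = ℓ (pairExt f φ) := by
  induction φ using TensorProduct.induction_on with
  | zero => simp only [map_zero]
  | add a b ha hb => simp only [map_add, ha, hb]
  | tmul u x => simp [mul_comm]

theorem pairExt_opS (f : Ext g →ₗ[ℂ] ℂ) (A : 𝓢(V g, ℂ) →L[ℂ] 𝓢(V g, ℂ)) (φ : XForms Λ) :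
    pairExt f (opS Λ B A φ) = opX Λ B A (pairExt f φ) := by
  induction φ using TensorProduct.induction_on with
  | zero => simp only [map_zero]
  | add a b ha hb => simp only [map_add, ha, hb]
  | tmul u x => simp

theorem coeff_eq_pairExt (I : Finset (Fin g ⊕ₗ Fin g)) (φ : XForms Λ) :
    coeff I φ = pairExt ((extBasis g).coord I) φ := rfl

theorem eq_sum_coeff (φ : XForms Λ) : φ = ∑ I, coeff I φ ⊗ₜ[ℂ] extBasis g I := by
  induction φ using TensorProduct.induction_on with
  | zero => simp only [map_zero, TensorProduct.zero_tmul, Finset.sum_const_zero]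
  | add a b ha hb =>
    simp only [map_add, TensorProduct.add_tmul, Finset.sum_add_distrib]
    rw [← ha, ← hb]
  | tmul u x =>
    conv_lhs => rw [← (extBasis g).sum_repr x]
    rw [TensorProduct.tmul_sum]
    refine Finset.sum_congr rfl fun I _ => ?_
    rw [coeff_eq_pairExt, pairExt_tmul, TensorProduct.smul_tmul]
    rfl

theorem eq_zero_of_pairFun {φ : XForms Λ} (h : ∀ ℓ, pairFun ℓ φ = 0) : φ = 0 := by
  rw [eq_sum_coeff φ]
  refine Finset.sum_eq_zero fun I _ => ?_
  have : coeff I φ = 0 := by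
    rw [← Module.forall_dual_apply_eq_zero_iff ℂ]
    intro ℓ
    rw [coeff_eq_pairExt, ← pairFun_pairExt, h, map_zero]
  rw [this, TensorProduct.zero_tmul]

variable (g) in
/-- A linear functional which maps `eMinusTop` to `1`. -/
def topFunctional : Ext g →ₗ[ℂ] ℂ := (exists_eMinusTop_functional g).choose

@[simp] theorem topFunctional_eMinusTop : topFunctional g (eMinusTop g) = 1 :=
  (exists_eMinusTop_functional g).choose_spec

/-- Applying a functional to the coefficients commutes with wedges and contractions, so it carries φ
to an element of the exterior algebra with the same annihilators, a multiple of `eMinusTop`.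
Functionals separate points, which reassembles φ. -/
theorem eq_tmul_eMinusTop {φ : XForms Λ} (hp : ∀ i, cPlus Λ i φ = 0)
    (hm : ∀ i, wMinus Λ i φ = 0) : φ = pairExt (topFunctional g) φ ⊗ₜ[ℂ] eMinusTop g := by
  rw [← sub_eq_zero]
  refine eq_zero_of_pairFun fun ℓ => ?_
  obtain ⟨c, hc⟩ := exists_eq_smul_eMinusTop (x := pairFun ℓ φ)
    (fun j => by rw [← pairFun_opW]; exact (congrArg _ (hp j)).trans (map_zero _))
    (fun j => by rw [← pairFun_opW]; exact (congrArg _ (hm j)).trans (map_zero _))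
  rw [map_sub, pairFun_tmul, ← pairFun_pairExt, hc, map_smul, topFunctional_eMinusTop,
    smul_eq_mul, mul_one, sub_self]

end Top
end
end NCTorus

open scoped SchwartzMap LineDeriv ContDiff TensorProduct ComplexConjugate

namespace NCTorus

noncomputable section

variable {g : ℕ} {Λ : Submodule ℤ (V g)} {B : V g →L[ℝ] V g →L[ℝ] ℝ}

/-! ### Deformed Gaussians, their rapidly decreasing sums, and the functions fixed by all
restrictions. -/

section Gaussian

variable (g) in
/-- The Gaussian as a complex valued Schwartz function. -/
def gaussC : 𝓢(V g, ℂ) := (gaussR g).postcompCLM Complex.ofRealCLM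

theorem gaussC_apply (z : V g) : gaussC g z = (Real.exp (-(2 * Real.pi * ‖z‖ ^ 2)) : ℂ) := rfl

theorem gauge_neg (u : V g) : gauge B (-u) = gauge (-B) u := by
  ext f z
  rw [gauge_apply, gauge_apply, sigma, sigma]
  simp

theorem gauss_eq_gauge (B : V g →L[ℝ] V g →L[ℝ] ℝ) (u : V g) :
    gauss B u = gauge (-B) u (gaussC g) := by
  rw [← gauge_neg]
  exact DFunLike.ext' (gauss_eq B u)

theorem gauge_gauss (u : V g) : gauge B u (gauss B u) = gaussC g := by
  rw [gauss_eq_gauge, gauge_gauge_neg]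

theorem norm_sub_projC (j : Fin g) (z : V g) :
    ‖z j‖ ^ 2 + ‖z - projC j z‖ ^ 2 = ‖z‖ ^ 2 := by
  rw [EuclideanSpace.norm_sq_eq, EuclideanSpace.norm_sq_eq, ← Finset.add_sum_erase _ _
    (Finset.mem_univ j), ← Finset.add_sum_erase _ _ (Finset.mem_univ j), PiLp.sub_apply,
    projC_apply_self, sub_self, norm_zero]
  have : ∀ i ∈ Finset.univ.erase j, ‖(z - projC j z) i‖ ^ 2 = ‖z i‖ ^ 2 := fun i hi => by
    rw [PiLp.sub_apply, projC_apply_ne (Finset.ne_of_mem_erase hi), sub_zero]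
  rw [Finset.sum_congr rfl this]
  ring

theorem restr_gaussC (j : Fin g) : restr j (gaussC g) = gaussC g := by
  ext z
  rw [restr, slice0_apply, gaussC_apply, gaussC_apply, norm_projC, ← Complex.ofReal_mul,
    ← Real.exp_add, ← norm_sub_projC j z]
  congr 2
  ring

/-- exp(-2π|z_j|²) is killed by ∂/∂z_j + 2πz̄_j too; this second equation is what makes the Gaussian
forms coclosed. -/
theorem betaOp_restr (j : Fin g) : betaOp j * restr j = 0 := by
  ext f v
  have h1 : projC j (stdVec j) = stdVec j := by simp [projC_apply]
  have h2 : projC j (Complex.I • stdVec j) = Complex.I • stdVec j := by simp [projC_apply]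
  have hX : derX j (restr j f) v = -(4 * Real.pi * (v j).re) * restr j f v := by
    rw [derX, restr, der_slice0_apply, slice0_apply, h1, inner_stdVec, projC_apply_self, sub_self,
      der_apply, map_zero]
    push_cast; ring
  have hY : derY j (restr j f) v = -(4 * Real.pi * (v j).im) * restr j f v := by
    rw [derY, restr, der_slice0_apply, slice0_apply, h2, inner_I_stdVec, projC_apply_self, sub_self,
      der_apply, map_zero]
    push_cast; ring
  change (1 / 2 : ℂ) * (derX j (restr j f) v - Complex.I * derY j (restr j f) v) +
    2 * Real.pi * mulZbar j (restr j f) v = 0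
  rw [mulZbar_apply, conj_eq_re_sub_im, hX, hY]
  ring

theorem gauss_bound (B : V g →L[ℝ] V g →L[ℝ] ℝ) (k n : ℕ) : ∃ C : ℝ, 0 ≤ C ∧ ∀ u : V g,
    SchwartzMap.seminorm ℂ k n (gauss B u) ≤ C * (1 + ‖u‖) ^ n := by
  obtain ⟨C, hC0, hC⟩ := gauge_bound (-B) k n
  refine ⟨C * ∑ i ∈ Finset.range (n + 1), SchwartzMap.seminorm ℂ k i (gaussC g), by positivity,
    fun u => ?_⟩
  rw [gauss_eq_gauge]
  refine (hC u _).trans (le_of_eq ?_)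
  ring

/-- The phase makes the seminorms of the deformed Gaussians grow polynomially in l, which the rapid
decrease of c absorbs. -/
theorem gauss_weight_bound [DiscreteTopology Λ] (c : TwAlg Λ B) (k n m : ℕ) :
    Summable fun l : Λ => ‖l‖ ^ m * SchwartzMap.seminorm ℂ k n (c l • gauss B (l : V g)) := by
  obtain ⟨C, hC0, hC⟩ := gauss_bound B k n
  refine Summable.of_nonneg_of_le (fun l => by positivity) (fun l => ?_)
    ((c.summable_weight (m + n)).mul_left C)
  rw [map_smul_eq_mul]
  calc ‖l‖ ^ m * (‖c l‖ * SchwartzMap.seminorm ℂ k n (gauss B (l : V g)))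
      ≤ (1 + ‖l‖) ^ m * (‖c l‖ * (C * (1 + ‖(l : V g)‖) ^ n)) := by
        gcongr
        · linarith [norm_nonneg l]
        · exact hC _
    _ = C * ((1 + ‖l‖) ^ (m + n) * ‖c l‖) := by rw [Submodule.coe_norm, pow_add]; ring

theorem bFun_apply_self (m : Λ) : bFun B m m = gauss B (m : V g) :=
  Pi.single_eq_same (M := fun _ : Λ => 𝓢(V g, ℂ)) m _

theorem bFun_apply_ne {m l : Λ} (h : l ≠ m) : bFun B m l = 0 :=
  Pi.single_eq_of_ne (M := fun _ : Λ => 𝓢(V g, ℂ)) h _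

theorem SX.sum_apply {ι : Type*} (s : Finset ι) (φ : ι → SX Λ) (l : Λ) :
    (∑ i ∈ s, φ i) l = ∑ i ∈ s, φ i l := by
  classical
  induction s using Finset.induction_on with
  | empty => simp
  | insert i s hi ih => rw [Finset.sum_insert hi, Finset.sum_insert hi, SX.add_apply, ih]

theorem SX.seminorm_le {φ : SX Λ} {i : ℕ × ℕ × ℕ} {C : ℝ}
    (h : ∀ l : Λ, ‖l‖ ^ i.2.2 * SchwartzMap.seminorm ℂ i.1 i.2.1 (φ l) ≤ C) :
    SX.seminorm Λ i φ ≤ C := ciSup_le h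

theorem SX.le_seminorm (φ : SX Λ) (i : ℕ × ℕ × ℕ) (l : Λ) :
    ‖l‖ ^ i.2.2 * SchwartzMap.seminorm ℂ i.1 i.2.1 (φ l) ≤ SX.seminorm Λ i φ := by
  obtain ⟨C, hC⟩ := φ.decay i.1 i.2.1 i.2.2
  exact le_ciSup (f := fun l : Λ => ‖l‖ ^ i.2.2 * SchwartzMap.seminorm ℂ i.1 i.2.1 (φ l))
    ⟨C, by rintro _ ⟨l, rfl⟩; exact hC l⟩ l

instance SX.t2Space : T2Space (SX Λ) := by
  have : T1Space (SX Λ) := (SX.withSeminorms (Λ := Λ)).T1_of_separating fun φ hφ => by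
    by_contra! h
    refine hφ (DFunLike.ext _ _ fun l => SchwartzMap.ext fun z => ?_)
    have h1 := (SchwartzMap.norm_le_seminorm ℂ (φ l) z).trans (by
      simpa using SX.le_seminorm φ (0, 0, 0) l)
    rw [h] at h1
    simpa using h1
  infer_instance

variable [DiscreteTopology Λ]

/-- The function which is `c(l)` times the deformed Gaussian on the slice `V × {l}`. -/
def gaussSum (c : TwAlg Λ B) : SX Λ :=
  ⟨fun l => c l • gauss B (l : V g), fun k n m =>
    ⟨_, fun l => (gauss_weight_bound c k n m).le_tsum l fun _ _ => by positivity⟩⟩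

@[simp] theorem gaussSum_apply (c : TwAlg Λ B) (l : Λ) : gaussSum c l = c l • gauss B (l : V g) := rfl

theorem restr_gaussSum (j : Fin g) (c : TwAlg Λ B) : opX Λ B (restr j) (gaussSum c) = gaussSum c :=
  DFunLike.ext _ _ fun l => by
    rw [opX_apply, gaussSum_apply, map_smul, map_smul, map_smul, gauge_gauss, restr_gaussC,
      gauss_eq_gauge]

/-- After the gauge transformation each slice is a multiple of the plain Gaussian. The multiple is
the value at z = 0, where the phase is 1, so it inherits rapid decrease from f. -/
theorem exists_eq_gaussSum {f : SX Λ} (h : ∀ j, opX Λ B (restr j) f = f) :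
    ∃ c : TwAlg Λ B, f = gaussSum c := by
  have h1 : ∀ (l : Λ) j, restr j (gauge B (l : V g) (f l)) = gauge B (l : V g) (f l) := by
    intro l j
    have h2 := DFunLike.congr_fun (h j) l
    rw [opX_apply] at h2
    have h3 := congrArg (gauge B (l : V g)) h2
    rwa [gauge_gauge_neg] at h3
  refine ⟨⟨fun l => f l 0, fun m => ?_⟩, DFunLike.ext _ _ fun l => ?_⟩
  · obtain ⟨C, hC⟩ := f.decay 0 0 m
    refine ⟨C, fun l => le_trans ?_ (hC l)⟩
    gcongr
    exact SchwartzMap.norm_le_seminorm ℂ _ _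
  · have h4 : gauge B (l : V g) (f l) = f l 0 • gaussC g := by
      ext z
      rw [eq_of_restr_eq_self (h1 l) z, gauge_apply, sigma_zero_right, one_mul]
      rfl
    have h5 := congrArg (gauge (-B) (l : V g)) h4
    rw [gauge_neg_gauge, map_smul, ← gauss_eq_gauge] at h5
    exact h5

theorem gaussSum_injective {c c' : TwAlg Λ B} (h : gaussSum c = gaussSum c') : c = c' := by
  ext l
  have h1 := DFunLike.congr_fun (DFunLike.congr_fun h l) 0
  have h2 : gauss B (l : V g) 0 = 1 := by
    rw [gauss_eq_gauge, gauge_apply, sigma_zero_right, gaussC_apply]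
    simp
  simpa [h2] using h1

theorem gaussSum_single (m : Λ) : gaussSum (single Λ B m) = bFun B m :=
  DFunLike.ext _ _ fun l => by
    rw [gaussSum_apply, single_apply]
    by_cases h : l = m
    · subst h; rw [bFun_apply_self, if_pos rfl, one_smul]
    · rw [bFun_apply_ne h, if_neg h, zero_smul]

theorem hasSum_gaussSum (c : TwAlg Λ B) : HasSum (fun m : Λ => c m • bFun B m) (gaussSum c) := by
  classical
  rw [HasSum, (SX.withSeminorms (Λ := Λ)).tendsto_nhds]
  intro i ε hε
  have hs := (gauss_weight_bound c i.1 i.2.1 i.2.2).tendsto_cofinite_zero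
  -- The slices are disjoint, so a seminorm of the remainder is a supremum over the missing slices.
  -- A supremum of values below ε/2 is only known to be at most ε/2, whence the half.
  have hfin : {l : Λ | ¬ ‖l‖ ^ i.2.2 * SchwartzMap.seminorm ℂ i.1 i.2.1
      (c l • gauss B (l : V g)) < ε / 2}.Finite := hs.eventually (gt_mem_nhds (half_pos hε))
  rw [SummationFilter.unconditional_filter]
  filter_upwards [Filter.eventually_ge_atTop hfin.toFinset] with s hsub
  refine lt_of_le_of_lt (SX.seminorm_le fun l => ?_) (half_lt_self hε)
  have h1 : (∑ m ∈ s, c m • bFun B m - gaussSum c) l =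
      (if l ∈ s then c l • gauss B (l : V g) else 0) - c l • gauss B (l : V g) := by
    change (∑ m ∈ s, c m • bFun B m) l - gaussSum c l = _
    rw [SX.sum_apply, gaussSum_apply]
    congr 1
    split_ifs with h
    · rw [Finset.sum_eq_single l, SX.smul_apply, bFun_apply_self]
      · intro m _ hm
        rw [SX.smul_apply, bFun_apply_ne hm.symm, smul_zero]
      · intro h'; exact absurd h h'
    · refine Finset.sum_eq_zero fun m hm => ?_
      rw [SX.smul_apply, bFun_apply_ne (ne_of_mem_of_not_mem hm h).symm, smul_zero]
  rw [h1]
  split_ifs with h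
  · rw [sub_self, map_zero, mul_zero]; positivity
  · rw [zero_sub, map_neg_eq_map]
    by_contra h2
    exact h (hsub (hfin.mem_toFinset.2 fun h3 => h2 h3.le))

theorem tsum_bFun (c : TwAlg Λ B) : ∑' m : Λ, c m • bFun B m = gaussSum c :=
  (hasSum_gaussSum c).tsum_eq

end Gaussian

/-! ### Representatives of cohomology classes and the vanishing outside degree g. -/

section Cohomology

variable [DiscreteTopology Λ]

theorem reduced_gaussSum (c : TwAlg Λ B) (j : Fin g) :
    opX Λ B (alphaOp j) (gaussSum c) = 0 ∧ opX Λ B (betaOp j) (gaussSum c) = 0 := by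
  rw [← restr_gaussSum j]
  have h1 := congrArg (opX Λ B) (alphaOp_restr j)
  have h2 := congrArg (opX Λ B) (betaOp_restr j)
  rw [map_mul, map_zero] at h1 h2
  exact ⟨LinearMap.congr_fun h1 _, LinearMap.congr_fun h2 _⟩

theorem connX_gaussSum_tmul (c : TwAlg Λ B) :
    connX Λ B (gaussSum c ⊗ₜ[ℂ] eMinusTop g) = 0 := by
  rw [connX_eq_connC, connC_tmul]
  refine Finset.sum_eq_zero fun j _ => ?_
  have : wedgeE (uMinus j) (eMinusTop g) = 0 := wedge_uMinus_eMinusTop j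
  rw [(reduced_gaussSum c j).1, this, TensorProduct.zero_tmul, TensorProduct.tmul_zero, add_zero]

theorem gaussSum_tmul_mem_cocycles (c : TwAlg Λ B) :
    gaussSum c ⊗ₜ[ℂ] eMinusTop g ∈ cocycles Λ B g :=
  ⟨connX_gaussSum_tmul c, tmul_mem_gr _ (eMinusTop_mem g)⟩

/-- Every closed form is cohomologous to a sum of deformed Gaussians times `eMinusTop`. -/
theorem exists_gaussSum_representative {Z Q : AddSubgroup (XForms Λ)} (h : IsReductionPair B Z Q)
    {φ : XForms Λ} (hφ : φ ∈ Z) : ∃ c : TwAlg Λ B, φ - gaussSum c ⊗ₜ[ℂ] eMinusTop g ∈ Q := by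
  obtain ⟨φ', -, h1, h2⟩ := exists_reduction h hφ
  have h3 := eq_tmul_eMinusTop (fun i => (h2 i).1) fun i => (h2 i).2.1
  obtain ⟨c, hc⟩ := exists_eq_gaussSum (B := B) (f := pairExt (topFunctional g) φ') fun j => by
    rw [← pairExt_opS, (h2 j).2.2]
  exact ⟨c, by rwa [← hc, ← h3]⟩

theorem cocycles_le_coboundaries {k : ℕ} (hk : k ≠ g) : cocycles Λ B k ≤ coboundaries Λ B k := by
  intro φ hφ
  obtain ⟨φ', h0, h1, h2⟩ := exists_reduction (isReductionPair_cocycles k) hφ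
  rw [eq_zero_of_reduced hk h0.2 (fun i => (h2 i).1) fun i => (h2 i).2.1, sub_zero] at h1
  exact h1

theorem subsingleton_cohomology {k : ℕ} (hk : k ≠ g) : Subsingleton (Cohomology Λ B k) := by
  rw [Submodule.Quotient.subsingleton_iff, Submodule.submoduleOf_eq_top]
  exact cocycles_le_coboundaries hk

/-- The element [m] moves the slice over 0 to the slice over -m, whence the reflection. No scalar
appears because σ(-l, l) = 1 for alternating B, and the remaining phase turns the Gaussian into its
deformation. -/
theorem op_smul_bFun_zero (hB : ∀ v, B v v = 0) (a c : TwAlg Λ B) (h : ∀ l, c l = a (-l)) :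
    MulOpposite.op a • bFun B (0 : Λ) = gaussSum c := by
  refine SX.ext fun l z => ?_
  rw [op_smul_apply, tsum_eq_single (-l), add_neg_cancel, bFun_apply_self, gaussSum_apply, h]
  · change _ = a (-l) * gauss B (l : V g) z
    rw [gauss_eq_gauge B l, gauss_eq_gauge, gauge_apply, gauge_apply, Submodule.coe_neg,
      sigma_add_right]
    have h1 : sigma B (-(l : V g)) (l : V g) = 1 := by
      rw [sigma, map_neg, neg_apply, hB]; simp
    have h2 : sigma B (-(l : V g)) z = sigma (-B) (l : V g) z := by
      rw [sigma, sigma]; simp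
    rw [h1, h2, Submodule.coe_zero, sigma_zero_left]
    ring
  · intro m hm
    rw [bFun_apply_ne fun e => hm (eq_neg_of_add_eq_zero_right e)]
    simp

end Cohomology
end
end NCTorus

open scoped SchwartzMap LineDeriv ContDiff TensorProduct ComplexConjugate

namespace NCTorus

noncomputable section

variable {g : ℕ} {Λ : Submodule ℤ (V g)} {B : V g →L[ℝ] V g →L[ℝ] ℝ}

/-! ### Contraction as the adjoint of exterior multiplication. -/

section Transpose

variable (g) in
/-- The basis of `V_{1,0} ⊕ V^{0,1}` formed by the `d\bar ζ_j, d\bar z_j`. -/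
def covBasis : Module.Basis (Fin g ⊕ₗ Fin g) ℂ (Cov g) :=
  ((Pi.basisFun ℂ (Fin g)).prod (Pi.basisFun ℂ (Fin g))).reindex toLex

theorem covBasis_inl (j : Fin g) : covBasis g (toLex (Sum.inl j)) = dzeta j := by
  simp [covBasis, dzeta]

theorem covBasis_inr (j : Fin g) : covBasis g (toLex (Sum.inr j)) = dzbar j := by
  simp [covBasis, dzbar]

theorem extBasis_singleton (i : Fin g ⊕ₗ Fin g) :
    extBasis g {i} = ExteriorAlgebra.ι ℂ (covBasis g i) := by
  refine (ExteriorAlgebra.basis_apply_ofCard (covBasis g) (Finset.card_singleton i)).trans ?_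
  rw [ExteriorAlgebra.ιMulti_family, ExteriorAlgebra.ιMulti_apply]
  simp [Set.powersetCard.ofFinEmbEquiv_symm_apply]

theorem extBasis_empty : extBasis g ∅ = 1 := by
  refine (ExteriorAlgebra.basis_apply_ofCard (covBasis g) Finset.card_empty).trans ?_
  rw [ExteriorAlgebra.ιMulti_family, ExteriorAlgebra.ιMulti_apply]
  simp

theorem wedgeE_extBasis_of_mem {i : Fin g ⊕ₗ Fin g} {J : Finset (Fin g ⊕ₗ Fin g)} (h : i ∈ J) :
    wedgeE (covBasis g i) (extBasis g J) = 0 := by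
  have := ExteriorAlgebra.basis_mul_of_not_disjoint (covBasis g)
    (Set.powersetCard.ofCard (Finset.card_singleton i)) (Set.powersetCard.ofCard (s := J) rfl)
    (by simpa using h)
  rw [wedgeE_apply, ← extBasis_singleton]
  exact this

theorem wedgeE_extBasis_of_notMem {i : Fin g ⊕ₗ Fin g} {J : Finset (Fin g ⊕ₗ Fin g)} (h : i ∉ J) :
    ∃ ε : ℝ, ε * ε = 1 ∧
      wedgeE (covBasis g i) (extBasis g J) = (ε : ℂ) • extBasis g (insert i J) := by
  have hd : Disjoint (Set.powersetCard.ofCard (Finset.card_singleton i)).val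
      (Set.powersetCard.ofCard (s := J) rfl).val := by simpa using h
  have := ExteriorAlgebra.basis_mul_of_disjoint (covBasis g)
    (Set.powersetCard.ofCard (Finset.card_singleton i)) (Set.powersetCard.ofCard (s := J) rfl) hd
  rw [wedgeE_apply, ← extBasis_singleton]
  refine ⟨((Set.powersetCard.permOfDisjoint hd).sign : ℤ), ?_, this.trans ?_⟩
  · norm_cast
    exact Int.units_coe_mul_self _
  · rw [Units.smul_def, ← Int.cast_smul_eq_zsmul ℂ]
    have h2 : (Set.powersetCard.disjUnion hd : Finset (Fin g ⊕ₗ Fin g)) = insert i J := by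
      ext; simp [Set.powersetCard.disjUnion]
    rw [h2]
    simp
    rfl

variable (g) in
/-- The basis dual to `covBasis`. -/
def covDual (i : Fin g ⊕ₗ Fin g) : Module.Dual ℂ (Cov g) := (covBasis g).coord i

theorem covDual_covBasis (i j : Fin g ⊕ₗ Fin g) :
    covDual g i (covBasis g j) = if j = i then 1 else 0 := by
  rw [covDual, Module.Basis.coord_apply, Module.Basis.repr_self, Finsupp.single_apply]

theorem eq_smul_wedgeE_extBasis {i : Fin g ⊕ₗ Fin g} {J : Finset (Fin g ⊕ₗ Fin g)} (h : i ∉ J) :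
    ∃ ε : ℝ, ε * ε = 1 ∧ extBasis g (insert i J) = (ε : ℂ) • wedgeE (covBasis g i) (extBasis g J) := by
  obtain ⟨ε, h1, h2⟩ := wedgeE_extBasis_of_notMem h
  refine ⟨ε, h1, ?_⟩
  rw [h2, smul_smul, ← Complex.ofReal_mul, h1, Complex.ofReal_one, one_smul]

theorem contr_extBasis_of_notMem {i : Fin g ⊕ₗ Fin g} {J : Finset (Fin g ⊕ₗ Fin g)} (h : i ∉ J) :
    contr (covDual g i) (extBasis g J) = 0 := by
  induction J using Finset.induction_on with
  | empty => rw [extBasis_empty, contr_one]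
  | insert k J hk ih =>
    rw [Finset.mem_insert, not_or] at h
    obtain ⟨ε, -, h2⟩ := eq_smul_wedgeE_extBasis hk
    rw [h2, map_smul, wedgeE_apply, contr_ι_mul, ih h.2, covDual_covBasis, if_neg (Ne.symm h.1)]
    simp

theorem contr_extBasis_insert {i : Fin g ⊕ₗ Fin g} {J : Finset (Fin g ⊕ₗ Fin g)} (h : i ∉ J) {c : ℂ}
    (hc : wedgeE (covBasis g i) (extBasis g J) = c • extBasis g (insert i J)) (hc' : c * c = 1) :
    contr (covDual g i) (extBasis g (insert i J)) = c • extBasis g J := by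
  have h1 : c • contr (covDual g i) _ = c • contr (covDual g i) _ := congrArg _ (congrArg _ hc)
  rw [map_smul, smul_smul, hc', one_smul, wedgeE_apply, contr_ι_mul, contr_extBasis_of_notMem h,
    covDual_covBasis, if_pos rfl, mul_zero, sub_zero, one_smul] at h1
  exact h1.symm

/-- In the basis of wedge monomials, contraction is the adjoint of exterior multiplication. -/
theorem coord_wedgeE_extBasis (i : Fin g ⊕ₗ Fin g) (I J : Finset (Fin g ⊕ₗ Fin g)) :
    conj ((extBasis g).coord I (wedgeE (covBasis g i) (extBasis g J))) =
      (extBasis g).coord J (contr (covDual g i) (extBasis g I)) := by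
  classical
  have key : ∀ K L, (extBasis g).coord K (extBasis g L) = if L = K then 1 else 0 := fun K L => by
    rw [Module.Basis.coord_apply, Module.Basis.repr_self, Finsupp.single_apply]
  by_cases hJ : i ∈ J
  · rw [wedgeE_extBasis_of_mem hJ, map_zero, map_zero]
    by_cases hI : i ∈ I
    · obtain ⟨ε, h1, h2⟩ := wedgeE_extBasis_of_notMem (Finset.notMem_erase i I)
      have h3 := contr_extBasis_insert (Finset.notMem_erase i I) h2 (by exact_mod_cast h1)
      rw [Finset.insert_erase hI] at h3
      rw [h3, map_smul, key, if_neg, smul_zero]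
      rintro rfl
      exact Finset.notMem_erase i I hJ
    · rw [contr_extBasis_of_notMem hI, map_zero]
  · obtain ⟨ε, h1, h2⟩ := wedgeE_extBasis_of_notMem hJ
    have h3 := contr_extBasis_insert hJ h2 (by exact_mod_cast h1)
    by_cases hI : I = insert i J
    · rw [h2, hI, h3, map_smul, (LinearMap.map_smul _ (ε : ℂ) (extBasis g J)), key, key, if_pos rfl, if_pos rfl]
      simp [-Module.Basis.coord_apply]
    · rw [h2, map_smul, key, if_neg (Ne.symm hI), smul_zero, map_zero]
      by_cases hiI : i ∈ I
      · obtain ⟨ε', h1', h2'⟩ := wedgeE_extBasis_of_notMem (Finset.notMem_erase i I)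
        have h3' := contr_extBasis_insert (Finset.notMem_erase i I) h2' (by exact_mod_cast h1')
        rw [Finset.insert_erase hiI] at h3'
        rw [h3', map_smul, key, if_neg, smul_zero]
        rintro rfl
        exact hI (Finset.insert_erase hiI).symm
      · rw [contr_extBasis_of_notMem hiI, map_zero]

variable (g) in
/-- The Hermitian product on the exterior algebra for which the wedge monomials are orthonormal. -/
def innerExt (x y : Ext g) : ℂ := ∑ I, conj ((extBasis g).coord I x) * (extBasis g).coord I y

/-- `w'` is the adjoint of `w`. -/
def IsAdjExt (w w' : Module.End ℂ (Ext g)) : Prop := ∀ x y, innerExt g (w x) y = innerExt g x (w' y)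

theorem isAdjExt_wedgeE (i : Fin g ⊕ₗ Fin g) :
    IsAdjExt (wedgeE (covBasis g i)) (contr (covDual g i)) := by
  intro x y
  have h1 : ∀ (w : Module.End ℂ (Ext g)) (I) (x : Ext g), (extBasis g).coord I (w x) =
      ∑ J, (extBasis g).coord J x * (extBasis g).coord I (w (extBasis g J)) := fun w I x => by
    conv_lhs => rw [← (extBasis g).sum_repr x]
    rw [map_sum, map_sum]
    refine Finset.sum_congr rfl fun J _ => ?_
    rw [map_smul, map_smul]
    rfl
  have h2 : innerExt g (wedgeE (covBasis g i) x) y = ∑ I, conj (∑ J, (extBasis g).coord J x *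
      (extBasis g).coord I (wedgeE (covBasis g i) (extBasis g J))) * (extBasis g).coord I y :=
    Finset.sum_congr rfl fun I _ => by rw [h1]
  have h3 : innerExt g x (contr (covDual g i) y) = ∑ J, conj ((extBasis g).coord J x) *
      ∑ I, (extBasis g).coord I y * (extBasis g).coord J (contr (covDual g i) (extBasis g I)) :=
    Finset.sum_congr rfl fun I _ => by rw [h1]
  rw [h2, h3]
  simp only [map_sum, map_mul, Finset.sum_mul, Finset.mul_sum, coord_wedgeE_extBasis]
  rw [Finset.sum_comm]
  exact Finset.sum_congr rfl fun J _ => Finset.sum_congr rfl fun I _ => by ring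

end Transpose

/-! ### The L² product on 𝓢(V) and adjoints of differential operators. -/

section Pairing

/-- The bilinear map `(a, b) ↦ conj a * b`. -/
def conjMul : ℂ →L[ℝ] ℂ →L[ℝ] ℂ :=
  (ContinuousLinearMap.mul ℝ ℂ).comp (Complex.conjCLE : ℂ →L[ℝ] ℂ)

theorem conjMul_apply (a b : ℂ) : conjMul a b = conj a * b := rfl

/-- The `L²` product on `𝓢(V)`. -/
def innerS (f h : 𝓢(V g, ℂ)) : ℂ := ∫ z, conj (f z) * h z

theorem integrable_conj_mul (f h : 𝓢(V g, ℂ)) :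
    MeasureTheory.Integrable fun z => conj (f z) * h z :=
  (SchwartzMap.bilinLeftCLM conjMul h.hasTemperateGrowth f).integrable

theorem innerS_add_left (f f' h : 𝓢(V g, ℂ)) : innerS (f + f') h = innerS f h + innerS f' h := by
  rw [innerS, innerS, innerS, ← MeasureTheory.integral_add (integrable_conj_mul _ _)
    (integrable_conj_mul _ _)]
  exact MeasureTheory.integral_congr_ae (.of_forall fun z => by
    simp only [add_apply, map_add]; ring)

theorem innerS_smul_left (c : ℂ) (f h : 𝓢(V g, ℂ)) : innerS (c • f) h = conj c * innerS f h := by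
  rw [innerS, innerS, ← MeasureTheory.integral_const_mul]
  exact MeasureTheory.integral_congr_ae (.of_forall fun z => by
    simp only [smul_apply, smul_eq_mul, map_mul]; ring)

theorem conj_innerS (f h : 𝓢(V g, ℂ)) : conj (innerS f h) = innerS h f := by
  rw [innerS, innerS, ← integral_conj]
  exact MeasureTheory.integral_congr_ae (.of_forall fun z => by
    simp only [map_mul, Complex.conj_conj]; ring)

theorem innerS_self (f : 𝓢(V g, ℂ)) : innerS f f = ((∫ z, ‖f z‖ ^ 2 : ℝ) : ℂ) := by
  refine Eq.trans ?_ integral_ofReal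
  exact MeasureTheory.integral_congr_ae (.of_forall fun z => by
    simp [Complex.conj_mul'])

theorem eq_zero_of_integral_norm_sq {f : 𝓢(V g, ℂ)} (h : ∫ z, ‖f z‖ ^ 2 = 0) : f = 0 := by
  have hi : MeasureTheory.Integrable fun z => ‖f z‖ ^ 2 := by
    have := (integrable_conj_mul f f).norm
    simpa [sq] using this
  have hc : Continuous fun z => ‖f z‖ ^ 2 := by fun_prop
  have h1 := (MeasureTheory.integral_eq_zero_iff_of_nonneg (fun z => by positivity) hi).1 h
  have h2 := (hc.ae_eq_iff_eq MeasureTheory.volume continuous_const).1 h1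
  ext z
  exact norm_eq_zero.1 (pow_eq_zero_iff two_ne_zero |>.1 (congrFun h2 z))

/-- `A'` is the adjoint of `A` for the `L²` product. -/
def IsAdjS (A A' : 𝓢(V g, ℂ) →L[ℂ] 𝓢(V g, ℂ)) : Prop := ∀ f h, innerS (A f) h = innerS f (A' h)

theorem innerS_add_right (f h h' : 𝓢(V g, ℂ)) : innerS f (h + h') = innerS f h + innerS f h' := by
  rw [← conj_innerS, innerS_add_left, map_add, conj_innerS, conj_innerS]

theorem innerS_smul_right (c : ℂ) (f h : 𝓢(V g, ℂ)) : innerS f (c • h) = c * innerS f h := by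
  rw [← conj_innerS, innerS_smul_left, map_mul, conj_innerS, Complex.conj_conj]

theorem IsAdjS.symm {A A' : 𝓢(V g, ℂ) →L[ℂ] 𝓢(V g, ℂ)} (h : IsAdjS A A') : IsAdjS A' A :=
  fun f k => by rw [← conj_innerS, ← h, conj_innerS]

theorem IsAdjS.add {A A' T T' : 𝓢(V g, ℂ) →L[ℂ] 𝓢(V g, ℂ)} (h : IsAdjS A A') (h' : IsAdjS T T') :
    IsAdjS (A + T) (A' + T') := fun f k => by
  simp only [add_apply, innerS_add_left, innerS_add_right, h f k, h' f k]

theorem IsAdjS.smul {A A' : 𝓢(V g, ℂ) →L[ℂ] 𝓢(V g, ℂ)} (h : IsAdjS A A') (c : ℂ) :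
    IsAdjS (c • A) (conj c • A') := fun f k => by
  simp only [smul_apply, innerS_smul_left, innerS_smul_right, h f k]

theorem isAdjS_mulZ (j : Fin g) : IsAdjS (mulZ j) (mulZbar j) := fun f h =>
  MeasureTheory.integral_congr_ae (.of_forall fun z => by
    simp only [mulZ_apply, mulZbar_apply, map_mul]; ring)

theorem isAdjS_der (w : V g) : IsAdjS (der w) (-der w) := fun f h => by
  have := SchwartzMap.integral_bilinear_lineDerivOp_right_eq_neg_left f h conjMul w
    (μ := MeasureTheory.volume)
  rw [← neg_eq_iff_eq_neg] at this
  rw [innerS, innerS]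
  refine this.symm.trans ?_
  rw [← MeasureTheory.integral_neg]
  exact MeasureTheory.integral_congr_ae (.of_forall fun z => by
    simp only [conjMul_apply, neg_apply, mul_neg]
    rfl)

theorem isAdjS_dbar (j : Fin g) : IsAdjS (dbar j) (-del j) := by
  have := ((isAdjS_der (stdVec j)).add ((isAdjS_der (Complex.I • stdVec j)).smul Complex.I)).smul
    (1 / 2 : ℂ)
  have e : -del j = conj (1 / 2 : ℂ) • (-der (stdVec j) + conj Complex.I •
      -der (Complex.I • stdVec j)) := by
    rw [del, derX, derY, ← smul_neg]
    simp only [map_div₀, map_one, Complex.conj_ofNat, Complex.conj_I]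
    congr 1
    module
  rw [e]
  exact this

/-- The phase has modulus one, so the gauge transformation is unitary and adjoints pass through
`opX` unchanged. -/
theorem isAdjS_gauge (u : V g) : IsAdjS (gauge B u) (gauge (-B) u) := fun f h =>
  MeasureTheory.integral_congr_ae (.of_forall fun z => by
    have : conj (sigma B u z) = sigma (-B) u z := by
      rw [sigma, sigma, ← Complex.exp_conj]
      simp [Complex.conj_ofNat]
    simp only [gauge_apply, map_mul, this]; ring)

theorem norm_innerS_le (f h : 𝓢(V g, ℂ)) :
    ‖innerS f h‖ ≤ SchwartzMap.seminorm ℂ 0 0 f * ∫ z, ‖h z‖ := by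
  rw [innerS, ← MeasureTheory.integral_const_mul]
  refine MeasureTheory.norm_integral_le_of_norm_le (h.integrable.norm.const_mul _)
    (.of_forall fun z => ?_)
  rw [norm_mul, RCLike.norm_conj]
  gcongr
  exact SchwartzMap.norm_le_seminorm ℂ f z

variable (g) in
theorem exists_integral_norm_le : ∃ (N : ℕ) (C : ℝ), 0 ≤ C ∧ ∀ f : 𝓢(V g, ℂ),
    ∫ z, ‖f z‖ ≤ C * (SchwartzMap.seminorm ℂ 0 0 f + SchwartzMap.seminorm ℂ N 0 f) := by
  let μ : MeasureTheory.Measure (V g) := MeasureTheory.volume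
  refine ⟨μ.integrablePower,
    2 ^ μ.integrablePower * ∫ x, (1 + ‖x‖) ^ (-(μ.integrablePower : ℝ)) ∂μ, ?_, fun f => ?_⟩
  · refine mul_nonneg (by positivity) (MeasureTheory.integral_nonneg fun z => ?_)
    positivity
  · simpa using SchwartzMap.integral_pow_mul_iteratedFDeriv_le ℂ μ f 0 0

end Pairing

/-! ### The Hermitian product on 𝓢(V × Λ) and on forms. -/

section PairSX

theorem SX.summable_seminorm [DiscreteTopology Λ] (φ : SX Λ) (k n m : ℕ) :
    Summable fun l : Λ => (1 + ‖l‖) ^ m * SchwartzMap.seminorm ℂ k n (φ l) := by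
  obtain ⟨N, hN⟩ := exists_summable_weight Λ
  obtain ⟨C, hC0, hC⟩ := φ.bound k n (m + N)
  refine Summable.of_nonneg_of_le (fun l => by positivity) (fun l => ?_) (hN.mul_left C)
  rw [← div_eq_mul_inv, le_div_iff₀ (by positivity)]
  calc _ = (1 + ‖l‖) ^ (m + N) * SchwartzMap.seminorm ℂ k n (φ l) := by ring
    _ ≤ C := hC l

/-- The `L²` product on `𝓢(V × Λ)`. -/
def pairSX (f h : SX Λ) : ℂ := ∑' l : Λ, innerS (f l) (h l)

theorem pairSX_smul_left (c : ℂ) (f h : SX Λ) : pairSX (c • f) h = conj c * pairSX f h := by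
  rw [pairSX, pairSX, ← tsum_mul_left]
  exact tsum_congr fun l => innerS_smul_left _ _ _

theorem conj_pairSX (f h : SX Λ) : conj (pairSX f h) = pairSX h f := by
  rw [pairSX, pairSX, Complex.conj_tsum]
  exact tsum_congr fun l => conj_innerS _ _

theorem innerX_eq (φ ψ : XForms Λ) : innerX φ ψ = ∑ I, pairSX (coeff I φ) (coeff I ψ) := rfl

theorem pairSX_opX {A A' : 𝓢(V g, ℂ) →L[ℂ] 𝓢(V g, ℂ)} (h : IsAdjS A A') (f k : SX Λ) :
    pairSX (opX Λ B A f) k = pairSX f (opX Λ B A' k) :=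
  tsum_congr fun l => by
    rw [opX_apply, opX_apply, (isAdjS_gauge (l : V g)).symm, h, isAdjS_gauge]

theorem conj_innerX (φ ψ : XForms Λ) : conj (innerX φ ψ) = innerX ψ φ := by
  simp only [innerX_eq, map_sum, conj_pairSX]

theorem innerX_tmul (f h : SX Λ) (x y : Ext g) :
    innerX (f ⊗ₜ[ℂ] x) (h ⊗ₜ[ℂ] y) = innerExt g x y * pairSX f h := by
  rw [innerX_eq, innerExt, Finset.sum_mul]
  refine Finset.sum_congr rfl fun I _ => ?_
  rw [coeff_eq_pairExt, coeff_eq_pairExt, pairExt_tmul, pairExt_tmul, pairSX_smul_left, ← conj_pairSX,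
    pairSX_smul_left, map_mul, Complex.conj_conj, conj_pairSX]
  ring

variable [DiscreteTopology Λ]

theorem summable_innerS (f h : SX Λ) : Summable fun l : Λ => innerS (f l) (h l) := by
  obtain ⟨N, C, hC0, hC⟩ := exists_integral_norm_le g
  obtain ⟨D, hD0, hD⟩ := f.bound 0 0 0
  refine Summable.of_norm_bounded
    (((h.summable_seminorm 0 0 0).add (h.summable_seminorm N 0 0)).mul_left (D * C)) fun l => ?_
  refine (norm_innerS_le _ _).trans ?_
  calc SchwartzMap.seminorm ℂ 0 0 (f l) * ∫ z, ‖h l z‖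
      ≤ D * (C * (SchwartzMap.seminorm ℂ 0 0 (h l) + SchwartzMap.seminorm ℂ N 0 (h l))) := by
        gcongr
        · simpa using hD l
        · exact hC _
    _ = _ := by ring

theorem pairSX_add_left (f f' h : SX Λ) : pairSX (f + f') h = pairSX f h + pairSX f' h := by
  rw [pairSX, pairSX, pairSX, ← (summable_innerS f h).tsum_add (summable_innerS f' h)]
  exact tsum_congr fun l => innerS_add_left _ _ _

theorem pairSX_self (f : SX Λ) : ∃ r : ℝ, 0 ≤ r ∧ pairSX f f = r ∧ (r = 0 → f = 0) := by
  have h0 : ∀ l : Λ, 0 ≤ ∫ z, ‖f l z‖ ^ 2 := fun l =>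
    MeasureTheory.integral_nonneg fun z => by positivity
  have hs : Summable fun l : Λ => ∫ z, ‖f l z‖ ^ 2 := by
    have := summable_innerS f f
    simp only [innerS_self] at this
    exact_mod_cast this
  refine ⟨∑' l : Λ, ∫ z, ‖f l z‖ ^ 2, tsum_nonneg h0, ?_, fun h => ?_⟩
  · rw [pairSX, Complex.ofReal_tsum]
    exact tsum_congr fun l => innerS_self _
  · have h1 := (hasSum_zero_iff_of_nonneg h0).1 (h ▸ hs.hasSum)
    exact DFunLike.ext _ _ fun l => eq_zero_of_integral_norm_sq (congrFun h1 l)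

theorem innerX_add_left (φ φ' ψ : XForms Λ) : innerX (φ + φ') ψ = innerX φ ψ + innerX φ' ψ := by
  simp only [innerX_eq, map_add, pairSX_add_left, Finset.sum_add_distrib]

theorem innerX_add_right (φ ψ ψ' : XForms Λ) : innerX φ (ψ + ψ') = innerX φ ψ + innerX φ ψ' := by
  rw [← conj_innerX, innerX_add_left, map_add, conj_innerX, conj_innerX]

theorem innerX_zero_left (ψ : XForms Λ) : innerX 0 ψ = 0 := by
  have := innerX_add_left 0 0 ψ
  simpa using this

theorem innerX_zero_right (ψ : XForms Λ) : innerX ψ 0 = 0 := by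
  rw [← conj_innerX, innerX_zero_left, map_zero]

theorem innerX_sum_left {ι : Type*} (s : Finset ι) (φ : ι → XForms Λ) (ψ : XForms Λ) :
    innerX (∑ i ∈ s, φ i) ψ = ∑ i ∈ s, innerX (φ i) ψ :=
  map_sum (⟨⟨fun φ => innerX φ ψ, innerX_zero_left ψ⟩, fun φ φ' => innerX_add_left φ φ' ψ⟩ :
    XForms Λ →+ ℂ) φ s

theorem innerX_sum_right {ι : Type*} (s : Finset ι) (φ : ι → XForms Λ) (ψ : XForms Λ) :
    innerX ψ (∑ i ∈ s, φ i) = ∑ i ∈ s, innerX ψ (φ i) := by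
  rw [← conj_innerX, innerX_sum_left, map_sum]
  simp only [conj_innerX]

theorem innerX_self (φ : XForms Λ) : ∃ r : ℝ, 0 ≤ r ∧ innerX φ φ = r ∧ (r = 0 → φ = 0) := by
  choose r hr0 hr hr' using fun I => pairSX_self (coeff I φ)
  refine ⟨∑ I, r I, Finset.sum_nonneg fun I _ => hr0 I, ?_, fun h => ?_⟩
  · rw [innerX_eq, Complex.ofReal_sum]
    exact Finset.sum_congr rfl fun I _ => hr I
  · rw [Finset.sum_eq_zero_iff_of_nonneg fun I _ => hr0 I] at h
    rw [eq_sum_coeff φ]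
    exact Finset.sum_eq_zero fun I hI => by rw [hr' I (h I hI), TensorProduct.zero_tmul]

theorem eq_zero_of_innerX_self {φ : XForms Λ} (h : innerX φ φ = 0) : φ = 0 := by
  obtain ⟨r, -, h1, h2⟩ := innerX_self φ
  exact h2 (by exact_mod_cast h1.symm.trans h)

theorem innerX_opS_opW {A A' : 𝓢(V g, ℂ) →L[ℂ] 𝓢(V g, ℂ)} (hA : IsAdjS A A')
    {w w' : Module.End ℂ (Ext g)} (hw : IsAdjExt w w') (φ ψ : XForms Λ) :
    innerX (opS Λ B A (opW Λ w φ)) ψ = innerX φ (opS Λ B A' (opW Λ w' ψ)) := by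
  induction φ using TensorProduct.induction_on with
  | zero => simp only [map_zero, innerX_zero_left]
  | add a b ha hb => simp only [map_add, innerX_add_left, ha, hb]
  | tmul f x =>
    induction ψ using TensorProduct.induction_on with
    | zero => simp only [map_zero, innerX_zero_right]
    | add a b ha hb => simp only [map_add, innerX_add_right, ha, hb]
    | tmul h y => rw [opW_tmul, opS_tmul, opW_tmul, opS_tmul, innerX_tmul, innerX_tmul, hw,
        pairSX_opX hA]

end PairSX

/-! ### The adjoint of 𝕏⁰ and the harmonic forms. -/

section Laplacian

variable (Λ B) in
/-- The adjoint of `connX`. -/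
def adjX : Module.End ℂ (XForms Λ) :=
  ∑ j, (opS Λ B (conj (2 * Real.pi * Complex.I : ℂ) • mulZbar j) *
      opW Λ (contr (covDual g (toLex (Sum.inl j)))) +
    opS Λ B (-del j) * opW Λ (contr (covDual g (toLex (Sum.inr j)))))

theorem covDual_inl_apply (j : Fin g) (v : Cov g) : covDual g (toLex (Sum.inl j)) v = v.1 j := by
  simp [covDual, covBasis]

theorem covDual_inr_apply (j : Fin g) (v : Cov g) : covDual g (toLex (Sum.inr j)) v = v.2 j := by
  simp [covDual, covBasis]

/-- Contraction with the form `dualPlus j` kills `eMinusTop`, so only the `dualMinus j` component of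
the coordinate form contributes. -/
theorem contr_eMinusTop_inl (j : Fin g) : contr (covDual g (toLex (Sum.inl j))) (eMinusTop g) =
    (-(Complex.I / 2)) • contr (dualMinus j) (eMinusTop g) := by
  have h : covDual g (toLex (Sum.inl j)) =
      (-(Complex.I / 2)) • dualMinus j + (Complex.I / 2) • dualPlus j := by
    refine LinearMap.ext fun v => ?_
    rw [covDual_inl_apply, LinearMap.add_apply, LinearMap.smul_apply, LinearMap.smul_apply,
      dualMinus_apply, dualPlus_apply, smul_eq_mul, smul_eq_mul]
    linear_combination (v.1 j) * Complex.I_sq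
  have h0 := contr_dualPlus_eMinusTop j
  rw [h]
  simp only [contr, map_add, map_smul, LinearMap.add_apply, LinearMap.smul_apply] at h0 ⊢
  rw [h0, smul_zero, add_zero]

theorem contr_eMinusTop_inr (j : Fin g) : contr (covDual g (toLex (Sum.inr j))) (eMinusTop g) =
    (1 / 2 : ℂ) • contr (dualMinus j) (eMinusTop g) := by
  have h : covDual g (toLex (Sum.inr j)) =
      (1 / 2 : ℂ) • dualMinus j + (1 / 2 : ℂ) • dualPlus j := by
    refine LinearMap.ext fun v => ?_
    rw [covDual_inr_apply, LinearMap.add_apply, LinearMap.smul_apply, LinearMap.smul_apply,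
      dualMinus_apply, dualPlus_apply, smul_eq_mul, smul_eq_mul]
    ring
  have h0 := contr_dualPlus_eMinusTop j
  rw [h]
  simp only [contr, map_add, map_smul, LinearMap.add_apply, LinearMap.smul_apply] at h0 ⊢
  rw [h0, smul_zero, add_zero]

/-- Both parts of the adjoint contract along the same direction here, and their coefficients -πz̄_j
and -½ ∂/∂z_j add up to -½ times `betaOp j`. -/
theorem adjX_tmul_eMinusTop (f : SX Λ) : adjX Λ B (f ⊗ₜ[ℂ] eMinusTop g) =
    ∑ j, opX Λ B (betaOp j) f ⊗ₜ[ℂ] ((-(1 / 2) : ℂ) • contr (dualMinus j) (eMinusTop g)) := by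
  rw [adjX, LinearMap.sum_apply]
  refine Finset.sum_congr rfl fun j _ => ?_
  rw [LinearMap.add_apply, Module.End.mul_apply, Module.End.mul_apply, opW_tmul, opW_tmul,
    opS_tmul, opS_tmul, contr_eMinusTop_inl, contr_eMinusTop_inr, betaOp, map_add, map_smul,
    map_smul, map_neg]
  simp only [LinearMap.add_apply, LinearMap.smul_apply, LinearMap.neg_apply,
    TensorProduct.tmul_smul, ← TensorProduct.smul_tmul', TensorProduct.add_tmul,
    TensorProduct.neg_tmul, map_mul, Complex.conj_ofReal, Complex.conj_I, Complex.conj_ofNat]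
  match_scalars
  · linear_combination (Real.pi : ℂ) * Complex.I_sq
  · ring

theorem innerX_eta_of_ne {m m' : Λ} (h : m ≠ m') : innerX (eta B m) (eta B m') = 0 := by
  rw [eta, eta, innerX_tmul, pairSX]
  have : ∀ l : Λ, innerS (bFun B m l) (bFun B m' l) = 0 := fun l => by
    by_cases hl : l = m
    · rw [bFun_apply_ne (m := m') (hl ▸ h)]; simp [innerS]
    · rw [bFun_apply_ne hl]; simp [innerS]
  simp [this]

variable [DiscreteTopology Λ]

theorem connX_eq_sum (φ : XForms Λ) : connX Λ B φ =
    ∑ j, (opS Λ B ((2 * Real.pi * Complex.I : ℂ) • mulZ j) (opW Λ (wedgeE (dzeta j)) φ) +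
      opS Λ B (dbar j) (opW Λ (wedgeE (dzbar j)) φ)) := by
  induction φ using TensorProduct.induction_on with
  | zero => simp only [map_zero, add_zero, Finset.sum_const_zero]
  | add a b ha hb =>
    rw [map_add, ha, hb, ← Finset.sum_add_distrib]
    refine Finset.sum_congr rfl fun j _ => ?_
    simp only [map_add]
    abel
  | tmul f x =>
    rw [connX_tmul]
    refine Finset.sum_congr rfl fun j _ => ?_
    rw [opW_tmul, opW_tmul, opS_tmul, opS_tmul, opX_dbar, map_smul, LinearMap.smul_apply, opX_mulZ,
      TensorProduct.smul_tmul']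

theorem innerX_connX (φ ψ : XForms Λ) : innerX (connX Λ B φ) ψ = innerX φ (adjX Λ B ψ) := by
  rw [connX_eq_sum, adjX, LinearMap.sum_apply, innerX_sum_left, innerX_sum_right]
  refine Finset.sum_congr rfl fun j _ => ?_
  rw [innerX_add_left, LinearMap.add_apply, innerX_add_right]
  have h1 := isAdjExt_wedgeE (toLex (Sum.inl j) : Fin g ⊕ₗ Fin g)
  have h2 := isAdjExt_wedgeE (toLex (Sum.inr j) : Fin g ⊕ₗ Fin g)
  rw [covBasis_inl] at h1
  rw [covBasis_inr] at h2
  rw [innerX_opS_opW ((isAdjS_mulZ j).smul _) h1, innerX_opS_opW (isAdjS_dbar j) h2]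
  rfl

theorem adjX_gaussSum_tmul (c : TwAlg Λ B) : adjX Λ B (gaussSum c ⊗ₜ[ℂ] eMinusTop g) = 0 := by
  rw [adjX_tmul_eMinusTop]
  exact Finset.sum_eq_zero fun j _ => by rw [(reduced_gaussSum c j).2, TensorProduct.zero_tmul]

/-- A coclosed exact form vanishes. -/
theorem connX_eq_zero_of_adjX {ψ : XForms Λ} (h : adjX Λ B (connX Λ B ψ) = 0) : connX Λ B ψ = 0 :=
  eq_zero_of_innerX_self (by rw [innerX_connX, h, innerX_zero_right])

/-- Pairing the Laplacian with φ gives the sum of the squared norms of 𝕏⁰φ and of its adjoint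
applied to φ. -/
theorem harmonic_iff (φ : XForms Λ) : adjX Λ B (connX Λ B φ) + connX Λ B (adjX Λ B φ) = 0 ↔
    connX Λ B φ = 0 ∧ adjX Λ B φ = 0 := by
  refine ⟨fun h => ?_, fun ⟨h1, h2⟩ => by rw [h1, h2, map_zero, map_zero, add_zero]⟩
  obtain ⟨r, hr, hr1, hr2⟩ := innerX_self (connX Λ B φ)
  obtain ⟨s, hs, hs1, hs2⟩ := innerX_self (adjX Λ B φ)
  have h1 : innerX φ (adjX Λ B (connX Λ B φ)) = r := by rw [← innerX_connX, hr1]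
  have h2 : innerX φ (connX Λ B (adjX Λ B φ)) = s := by
    rw [← conj_innerX, innerX_connX, hs1, Complex.conj_ofReal]
  have h3 : (r : ℂ) + s = 0 := by rw [← h1, ← h2, ← innerX_add_right, h, innerX_zero_right]
  have h4 : r + s = 0 := by exact_mod_cast h3
  exact ⟨hr2 (by linarith), hs2 (by linarith)⟩

/-- A closed form differs from some Gaussian representative by an exact form. If it is also
coclosed, so is the difference, which then vanishes by `connX_eq_zero_of_adjX`. -/
theorem harmonic_iff_gaussSum (φ : XForms Λ) :
    adjX Λ B (connX Λ B φ) + connX Λ B (adjX Λ B φ) = 0 ↔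
      ∃ c : TwAlg Λ B, φ = gaussSum c ⊗ₜ[ℂ] eMinusTop g := by
  rw [harmonic_iff]
  constructor
  · rintro ⟨h1, h2⟩
    obtain ⟨c, ψ, hψ⟩ := exists_gaussSum_representative (isReductionPair_ker_range (B := B)) h1
    refine ⟨c, sub_eq_zero.1 (hψ.symm.trans (connX_eq_zero_of_adjX ?_))⟩
    rw [hψ, map_sub, h2, adjX_gaussSum_tmul, sub_zero]
  · rintro ⟨c, rfl⟩
    exact ⟨connX_gaussSum_tmul c, adjX_gaussSum_tmul c⟩

theorem exists_connX_of_mem_coboundaries {k : ℕ} {φ : XForms Λ} (hφ : φ ∈ coboundaries Λ B k) :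
    ∃ ψ, connX Λ B ψ = φ := by
  rcases k with _ | k
  · exact ⟨0, by rw [map_zero]; exact ((Submodule.mem_bot _).1 hφ).symm⟩
  · obtain ⟨ψ, -, hψ⟩ := hφ
    exact ⟨ψ, hψ⟩

theorem eq_zero_of_harmonic {k : ℕ} (hk : k ≠ g) {φ : XForms Λ} (hφ : φ ∈ gr Λ B k)
    (h : adjX Λ B (connX Λ B φ) + connX Λ B (adjX Λ B φ) = 0) : φ = 0 := by
  obtain ⟨h1, h2⟩ := (harmonic_iff φ).1 h
  obtain ⟨ψ, rfl⟩ := exists_connX_of_mem_coboundaries (cocycles_le_coboundaries hk ⟨h1, hφ⟩)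
  exact connX_eq_zero_of_adjX h2

theorem gaussSum_tmul_injective {c c' : TwAlg Λ B}
    (h : gaussSum c ⊗ₜ[ℂ] eMinusTop g = gaussSum c' ⊗ₜ[ℂ] eMinusTop g) : c = c' := by
  have := congrArg (pairExt (topFunctional g)) h
  rw [pairExt_tmul, pairExt_tmul, topFunctional_eMinusTop, one_smul, one_smul] at this
  exact gaussSum_injective this

theorem eq_zero_of_gaussSum_tmul {c : TwAlg Λ B} (h : gaussSum c ⊗ₜ[ℂ] eMinusTop g = 0) : c = 0 := by
  have h0 : gaussSum (0 : TwAlg Λ B) = 0 := DFunLike.ext _ _ fun l => by simp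
  exact gaussSum_tmul_injective (by rw [h, h0, TensorProduct.zero_tmul])

theorem harmonic_iff_existsUnique (φ : XForms Λ) :
    adjX Λ B (connX Λ B φ) + connX Λ B (adjX Λ B φ) = 0 ↔
      ∃! c : TwAlg Λ B, φ = (∑' m : Λ, c m • bFun B m) ⊗ₜ[ℂ] eMinusTop g := by
  simp only [tsum_bFun]
  rw [harmonic_iff_gaussSum]
  exact ⟨fun ⟨c, hc⟩ => ⟨c, hc, fun c' hc' => gaussSum_tmul_injective (hc'.symm.trans hc)⟩,
    fun h => h.exists⟩

theorem eta_eq (m : Λ) : eta B m = gaussSum (single Λ B m) ⊗ₜ[ℂ] eMinusTop g := by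
  rw [gaussSum_single]; rfl

theorem innerX_eta_ne_zero (m : Λ) : innerX (eta B m) (eta B m) ≠ 0 := by
  intro h
  have h1 := eq_zero_of_innerX_self h
  have h2 : single Λ B m = 0 := eq_zero_of_gaussSum_tmul (by rw [← eta_eq, h1])
  have h3 := DFunLike.congr_fun h2 m
  rw [single_apply, if_pos rfl] at h3
  exact one_ne_zero h3

end Laplacian

/-! ### Freeness of the cohomology in degree g. -/

section Generator

variable [DiscreteTopology Λ]

theorem eta_zero_mem_cocycles : eta B (0 : Λ) ∈ cocycles Λ B g := by
  rw [eta_eq]; exact gaussSum_tmul_mem_cocycles _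

/-- The function `l ↦ a(-l)`. -/
def reflect (a : TwAlg Λ B) : TwAlg Λ B := ⟨fun l => a (-l), fun m => by
  obtain ⟨C, hC⟩ : ∃ C : ℝ, ∀ l : Λ, ‖l‖ ^ m * ‖a l‖ ≤ C := a.2 m
  exact ⟨C, fun l => by simpa only [norm_neg] using hC (-l)⟩⟩

theorem op_smul_eta_zero (hB : ∀ v, B v v = 0) (a : TwAlg Λ B) :
    MulOpposite.op a • eta B (0 : Λ) = gaussSum (reflect a) ⊗ₜ[ℂ] eMinusTop g := by
  rw [eta, TensorProduct.smul_tmul', op_smul_bFun_zero hB a (reflect a) fun l => rfl]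

/-- The orbit map of the class of η_0 is a ↦ the Gaussian sum with coefficients a(-l). It is onto by
the reduction, and injective because an exact Gaussian sum is coclosed, hence zero. -/
theorem exists_basis_cohomology (hB : ∀ v, B v v = 0) : ∃ (h : eta B (0 : Λ) ∈ cocycles Λ B g)
    (b : Module.Basis Unit (TwAlg Λ B)ᵐᵒᵖ (Cohomology Λ B g)),
      b () = Submodule.Quotient.mk ⟨eta B (0 : Λ), h⟩ := by
  refine ⟨eta_zero_mem_cocycles, ?_⟩
  set x : Cohomology Λ B g := Submodule.Quotient.mk ⟨eta B (0 : Λ), eta_zero_mem_cocycles⟩ with hx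
  have hmem : ∀ a : (TwAlg Λ B)ᵐᵒᵖ, a • x = Submodule.Quotient.mk
      ⟨gaussSum (reflect a.unop) ⊗ₜ[ℂ] eMinusTop g, gaussSum_tmul_mem_cocycles _⟩ := fun a => by
    rw [hx, ← Submodule.Quotient.mk_smul]
    congr 1
    exact Subtype.ext (op_smul_eta_zero hB a.unop)
  let F : (TwAlg Λ B)ᵐᵒᵖ →ₗ[(TwAlg Λ B)ᵐᵒᵖ] Cohomology Λ B g := LinearMap.toSpanSingleton _ _ x
  have hinj : Function.Injective F := by
    rw [← LinearMap.ker_eq_bot, LinearMap.ker_eq_bot']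
    intro a ha
    have h1 : a • x = 0 := ha
    rw [hmem, Submodule.Quotient.mk_eq_zero] at h1
    obtain ⟨ψ, hψ⟩ := exists_connX_of_mem_coboundaries h1
    have h2 := connX_eq_zero_of_adjX (B := B) (ψ := ψ) (by rw [hψ]; exact adjX_gaussSum_tmul _)
    have h3 : reflect a.unop = 0 := eq_zero_of_gaussSum_tmul (hψ.symm.trans h2)
    apply MulOpposite.unop_injective
    ext l
    have h4 := DFunLike.congr_fun h3 (-l)
    change a.unop (- -l) = 0 at h4
    rwa [neg_neg] at h4
  have hsurj : Function.Surjective F := by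
    intro y
    obtain ⟨⟨φ, hφ⟩, rfl⟩ := Submodule.Quotient.mk_surjective _ y
    obtain ⟨c, hc⟩ := exists_gaussSum_representative (isReductionPair_cocycles g) hφ
    refine ⟨MulOpposite.op (reflect c), ?_⟩
    change MulOpposite.op (reflect c) • x = _
    rw [hmem]
    symm
    rw [Submodule.Quotient.eq]
    have : reflect (reflect c) = c := by ext l; exact congrArg c (neg_neg l)
    change φ - gaussSum (reflect (reflect c)) ⊗ₜ[ℂ] eMinusTop g ∈ coboundaries Λ B g
    rw [this]
    exact hc
  refine ⟨(Module.Basis.singleton Unit (TwAlg Λ B)ᵐᵒᵖ).map (LinearEquiv.ofBijective F ⟨hinj, hsurj⟩), ?_⟩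
  rw [Module.Basis.map_apply, Module.Basis.singleton_apply]
  exact one_smul (TwAlg Λ B)ᵐᵒᵖ x

end Generator
end
end NCTorus

open scoped SchwartzMap LineDeriv ContDiff TensorProduct ComplexConjugate

namespace NCTorus

noncomputable section

variable {g : ℕ} {Λ : Submodule ℤ (V g)} {B : V g →L[ℝ] V g →L[ℝ] ℝ}

/-! ### The right action in terms of the second tensor factor. -/

section Translation

/-- The translate `z ↦ p(z - u)`. -/
def translate (u : V g) : 𝓢(V g, ℂ) →L[ℂ] 𝓢(V g, ℂ) := SchwartzMap.compSubConstCLM ℂ u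

@[simp] theorem translate_apply (u z : V g) (p : 𝓢(V g, ℂ)) : translate u p z = p (z - u) := rfl

theorem translate_bound (p : 𝓢(V g, ℂ)) (k n : ℕ) : ∃ C : ℝ, 0 ≤ C ∧ ∀ u : V g, ∀ i ≤ n,
    SchwartzMap.seminorm ℂ k i (translate u p) ≤ C * (1 + ‖u‖) ^ k := by
  obtain ⟨C, hC0, hC⟩ := schwartz_weight_bound p k n
  refine ⟨C, hC0, fun u i hi => SchwartzMap.seminorm_le_bound ℂ k i _ (by positivity) fun z => ?_⟩
  have e : (⇑(translate u p) : V g → ℂ) = fun z => p (z - u) := rfl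
  have h1 := peetre (z - u) u k
  rw [sub_add_cancel] at h1
  rw [e, iteratedFDeriv_comp_sub]
  calc ‖z‖ ^ k * ‖iteratedFDeriv ℝ i p (z - u)‖
      ≤ ((1 + ‖z - u‖) ^ k * (1 + ‖u‖) ^ k) * ‖iteratedFDeriv ℝ i p (z - u)‖ := by
        gcongr
        refine le_trans ?_ h1
        gcongr
        linarith
    _ = ((1 + ‖z - u‖) ^ k * ‖iteratedFDeriv ℝ i p (z - u)‖) * (1 + ‖u‖) ^ k := by ring
    _ ≤ _ := by gcongr; exact hC i hi _

variable [DiscreteTopology Λ]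

theorem summable_smul_gauge_translate (a : TwAlg Λ B) (p : 𝓢(V g, ℂ)) (k n : ℕ) :
    Summable fun m : Λ => SchwartzMap.seminorm ℂ k n
      (a m • gauge B (m : V g) (translate (-(m : V g)) p)) := by
  obtain ⟨C, hC0, hC⟩ := gauge_bound B k n
  obtain ⟨D, hD0, hD⟩ := translate_bound p k n
  refine Summable.of_nonneg_of_le (fun m => apply_nonneg _ _) (fun m => ?_)
    ((a.summable_weight (n + k)).mul_left (C * ((n + 1 : ℕ) * D)))
  rw [map_smul_eq_mul]
  calc ‖a m‖ * SchwartzMap.seminorm ℂ k n (gauge B (m : V g) (translate (-(m : V g)) p))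
      ≤ ‖a m‖ * (C * (1 + ‖(m : V g)‖) ^ n * ∑ i ∈ Finset.range (n + 1),
          SchwartzMap.seminorm ℂ k i (translate (-(m : V g)) p)) := by gcongr; exact hC _ _
    _ ≤ ‖a m‖ * (C * (1 + ‖(m : V g)‖) ^ n * ∑ i ∈ Finset.range (n + 1),
          D * (1 + ‖-(m : V g)‖) ^ k) := by
        gcongr with i hi
        exact hD _ i (Nat.lt_succ_iff.mp (Finset.mem_range.mp hi))
    _ = _ := by
        rw [Finset.sum_const, Finset.card_range, norm_neg, nsmul_eq_mul, pow_add,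
          Submodule.coe_norm]
        ring

/-- The right action on `𝓢(V × Λ)` is induced by the one on the second factor. -/
theorem exists_op_smul_tens (a : TwAlg Λ B) (q p : 𝓢(V g, ℂ)) : ∃ pa : 𝓢(V g, ℂ),
    (∀ v, pa v = ∑' m : Λ, a m * (sigma B (m : V g) v * p ((m : V g) + v))) ∧
      MulOpposite.op a • tens Λ q p = tens Λ q pa := by
  have h : ∀ v, schwartzSum _ (summable_smul_gauge_translate a p) v =
      ∑' m : Λ, a m * (sigma B (m : V g) v * p ((m : V g) + v)) := fun v => by
    rw [schwartzSum_apply]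
    refine tsum_congr fun m => ?_
    rw [smul_apply, gauge_apply, translate_apply, smul_eq_mul, sub_neg_eq_add, add_comm v]
  refine ⟨_, h, SX.ext fun l z => ?_⟩
  rw [op_smul_apply, tens_apply, h, ← tsum_mul_left]
  refine tsum_congr fun m => ?_
  rw [tens_apply, Submodule.coe_add]
  rw [show z + ((l : V g) + (m : V g)) = (m : V g) + (z + (l : V g)) by abel]
  ring

end Translation

/-! ### The operator 𝕏⁰ on products. -/

section Leibniz

theorem lineDeriv_shiftMul (q p : 𝓢(V g, ℂ)) (u v z : V g) : (∂_{v} (shiftMul q p u)) z =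
    (∂_{v} q) z * p (z + u) + q z * (∂_{v} p) (z + u) := by
  have e : (⇑(shiftMul q p u) : V g → ℂ) = fun z => q z * p (z + u) :=
    funext fun z => shiftMul_apply q p u z
  have h2 : HasFDerivAt (fun z => p (z + u)) (fderiv ℝ p (z + u)) z :=
    by exact (p.hasFDerivAt (z + u)).comp z ((hasFDerivAt_id z).add_const u)
  have h3 : HasFDerivAt (fun z => q z * p (z + u)) _ z := (q.hasFDerivAt z).mul h2
  simp only [SchwartzMap.lineDerivOp_apply_eq_fderiv]
  rw [e, h3.fderiv]
  simp
  ring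

theorem dbar_shiftMul (j : Fin g) (q p : 𝓢(V g, ℂ)) (u z : V g) : dbar j (shiftMul q p u) z =
    dbar j q z * p (z + u) + q z * dbar j p (z + u) := by
  simp only [dbar_apply, lineDeriv_shiftMul]
  ring

/-- The opposite signs of ω in the two factors are explained by conj(B_j(z + l)) - conj(B_j(z)) =
conj(B_j(l)): the dependence on z cancels. -/
theorem covDbarL_tens (j : Fin g) (q p : 𝓢(V g, ℂ)) : covDbarL Λ B j (tens Λ q p) =
    tens Λ ((dbar j - (2 * Real.pi * Complex.I : ℂ) • mulOmega B j) q) p +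
      tens Λ q ((dbar j + (2 * Real.pi * Complex.I : ℂ) • mulOmega B j) p) := by
  refine SX.ext fun l z => ?_
  rw [covDbarL_apply, tens_apply, SX.add_apply, add_apply, tens_apply, tens_apply]
  change dbar j (shiftMul q p (l : V g)) z + _ =
    (dbar j q z - (2 * Real.pi * Complex.I : ℂ) * mulOmega B j q z) * p (z + (l : V g)) +
    q z * (dbar j p (z + l) + (2 * Real.pi * Complex.I : ℂ) * mulOmega B j p (z + l))
  rw [dbar_shiftMul, mulOmega_apply, mulOmega_apply, map_add (Bj B j), map_add (starRingEnd ℂ)]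
  ring

theorem map_mulZ_tens (j : Fin g) (q p : 𝓢(V g, ℂ)) :
    SX.map (mulZ j) (tens Λ q p) = tens Λ (mulZ j q) p := by
  refine SX.ext fun l z => ?_
  rw [SX.map_apply, mulZ_apply, tens_apply, tens_apply, mulZ_apply]
  ring

theorem tensForms_tmul (q p : 𝓢(V g, ℂ)) (x y : Ext g) :
    tensForms Λ (q ⊗ₜ[ℂ] x) (p ⊗ₜ[ℂ] y) = tens Λ q p ⊗ₜ[ℂ] (x * y) := rfl

/-- This sign from moving a covector past α cancels the (-1) ^ k of the graded Leibniz rule in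
`connX_tensForms`. -/
theorem inQ_mul_ι {k : ℕ} {α : ExteriorAlgebra ℂ (Fin g → ℂ)} (hα : α ∈ ⋀[ℂ]^k (Fin g → ℂ))
    (v : Cov g) : inQ α * ExteriorAlgebra.ι ℂ v =
      (-1 : ℂ) ^ k • (ExteriorAlgebra.ι ℂ v * inQ α) := by
  induction hα using Submodule.pow_induction_on_left' with
  | algebraMap r =>
    rw [AlgHom.commutes, pow_zero, one_smul]
    exact Algebra.commutes r _
  | add x y i _ _ ihx ihy => rw [map_add, add_mul, mul_add, ihx, ihy, smul_add]
  | mem_mul m hm i x hx ih =>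
    obtain ⟨w, rfl⟩ := hm
    have h1 : inQ (ExteriorAlgebra.ι ℂ w) = ExteriorAlgebra.ι ℂ ((w, 0) : Cov g) :=
      ExteriorAlgebra.map_apply_ι _ _
    have h2 : ExteriorAlgebra.ι ℂ ((w, 0) : Cov g) * ExteriorAlgebra.ι ℂ v =
        -(ExteriorAlgebra.ι ℂ v * ExteriorAlgebra.ι ℂ ((w, 0) : Cov g)) :=
      eq_neg_of_add_eq_zero_left (ExteriorAlgebra.ι_add_mul_swap _ _)
    rw [map_mul, h1, mul_assoc, ih, mul_smul_comm, ← mul_assoc, h2, pow_succ, mul_smul, neg_mul,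
      neg_smul, one_smul, mul_assoc]

variable [DiscreteTopology Λ]

theorem connX_tensForms {k : ℕ} {α : ExteriorAlgebra ℂ (Fin g → ℂ)}
    (β : ExteriorAlgebra ℂ (Fin g → ℂ)) (hα : α ∈ ⋀[ℂ]^k (Fin g → ℂ)) (q p : 𝓢(V g, ℂ)) :
    connX Λ B (tensForms Λ (q ⊗ₜ[ℂ] inQ α) (p ⊗ₜ[ℂ] inP β)) =
      tensForms Λ (connQ B (q ⊗ₜ[ℂ] inQ α)) (p ⊗ₜ[ℂ] inP β) +
      (-1 : ℂ) ^ k • tensForms Λ (q ⊗ₜ[ℂ] inQ α) (connP B (p ⊗ₜ[ℂ] inP β)) := by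
  rw [tensForms_tmul, connX_tmul, connQ, connP, LinearMap.sum_apply, LinearMap.sum_apply, map_sum,
    map_sum, LinearMap.sum_apply, Finset.smul_sum, ← Finset.sum_add_distrib]
  refine Finset.sum_congr rfl fun j _ => ?_
  have h1 : tensForms Λ (q ⊗ₜ[ℂ] inQ α) (TensorProduct.map ((dbar j).toLinearMap +
      (2 * Real.pi * Complex.I : ℂ) • (mulOmega B j).toLinearMap) (wedge (dzbar j))
        (p ⊗ₜ[ℂ] inP β)) =
      tens Λ q ((dbar j + (2 * Real.pi * Complex.I : ℂ) • mulOmega B j) p) ⊗ₜ[ℂ]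
        (inQ α * (ExteriorAlgebra.ι ℂ (dzbar j) * inP β)) := rfl
  have h2 : tensForms Λ (TensorProduct.map ((2 * Real.pi * Complex.I : ℂ) • (mulZ j).toLinearMap)
      (wedge (dzeta j)) (q ⊗ₜ[ℂ] inQ α)) (p ⊗ₜ[ℂ] inP β) =
      tens Λ ((2 * Real.pi * Complex.I : ℂ) • mulZ j q) p ⊗ₜ[ℂ]
        (ExteriorAlgebra.ι ℂ (dzeta j) * inQ α * inP β) := rfl
  have h3 : tensForms Λ (TensorProduct.map ((dbar j).toLinearMap -
      (2 * Real.pi * Complex.I : ℂ) • (mulOmega B j).toLinearMap) (wedge (dzbar j))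
        (q ⊗ₜ[ℂ] inQ α)) (p ⊗ₜ[ℂ] inP β) =
      tens Λ ((dbar j - (2 * Real.pi * Complex.I : ℂ) • mulOmega B j) q) p ⊗ₜ[ℂ]
        (ExteriorAlgebra.ι ℂ (dzbar j) * inQ α * inP β) := rfl
  rw [h1, LinearMap.add_apply, map_add, LinearMap.add_apply, h2, h3, map_mulZ_tens, covDbarL_tens,
    ← mul_assoc, inQ_mul_ι hα, wedgeE_apply, wedgeE_apply, map_smul, LinearMap.smul_apply,
    smul_mul_assoc, TensorProduct.tmul_smul, smul_smul, ← mul_pow]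
  simp only [neg_mul_neg, mul_one, one_pow, one_smul, TensorProduct.add_tmul,
    TensorProduct.smul_tmul', mul_assoc, add_assoc]

end Leibniz
end
end NCTorus

open scoped SchwartzMap LineDeriv ContDiff TensorProduct ComplexConjugate

namespace NCTorus

noncomputable section

variable {g : ℕ} {Λ : Submodule ℤ (V g)} {B : V g →L[ℝ] V g →L[ℝ] ℝ}

/-! ### Absolutely convergent series in spaces with countably many seminorms. -/

section Completeness

open Filter Topology

/-- A space with countably many seminorms is complete if all series which converge absolutely for
every seminorm converge. -/
theorem completeSpace_of_hasSum {E : Type*} [AddCommGroup E] [Module ℂ E] [UniformSpace E]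
    [IsUniformAddGroup E] {p : SeminormFamily ℂ E ℕ} (hp : WithSeminorms p)
    (h : ∀ f : ℕ → E, (∀ i, Summable fun n => p i (f n)) → ∃ a, HasSum f a) : CompleteSpace E := by
  have : FirstCountableTopology E := hp.firstCountableTopology
  have : (uniformity E).IsCountablyGenerated := IsUniformAddGroup.uniformity_countably_generated
  refine UniformSpace.complete_of_cauchySeq_tendsto fun u hu => ?_
  have h1 : ∀ i, Tendsto (fun q : ℕ × ℕ => p i (u q.2 - u q.1)) atTop (𝓝 0) := fun i => by
    have h2 := cauchySeq_iff_tendsto.1 hu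
    rw [uniformity_eq_comap_nhds_zero, tendsto_comap_iff] at h2
    have h3 := ((hp.continuous_seminorm i).tendsto 0).comp h2
    rwa [map_zero] at h3
  have h2 : ∀ k, ∀ᶠ N in atTop, ∀ m ≥ N, ∀ i ≤ k, p i (u m - u N) < (1 / 2 : ℝ) ^ k := fun k => by
    have h3 : ∀ᶠ q : ℕ × ℕ in atTop, ∀ i ∈ Set.Iic k, p i (u q.2 - u q.1) < (1 / 2 : ℝ) ^ k :=
      (eventually_all_finite (Set.finite_Iic k)).2 fun i _ =>
        (h1 i).eventually (gt_mem_nhds (by positivity))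
    obtain ⟨⟨a, b⟩, hab⟩ := eventually_atTop.1 h3
    filter_upwards [eventually_ge_atTop (max a b)] with N hN m hm i hi
    exact hab (N, m) ⟨le_trans (le_max_left a b) hN, le_trans (le_max_right a b) (hN.trans hm)⟩ i hi
  -- A diagonal subsequence: the k-th increment is below 2⁻ᵏ for the seminorms of index at most k,
  -- so for each fixed seminorm the increments are eventually dominated by a geometric series.
  obtain ⟨φ, hφ, hφ'⟩ := extraction_forall_of_eventually h2
  obtain ⟨a, ha⟩ := h (fun k => u (φ (k + 1)) - u (φ k)) fun i => by
    refine Summable.of_norm_bounded_eventually_nat (summable_geometric_two) ?_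
    filter_upwards [eventually_ge_atTop i] with k hk
    rw [Real.norm_of_nonneg (apply_nonneg _ _)]
    exact (hφ' k _ (hφ.monotone (Nat.le_succ k)) i hk).le
  have h4 := ha.tendsto_sum_nat
  simp only [Finset.sum_range_sub (fun k => u (φ k))] at h4
  refine ⟨a + u (φ 0), tendsto_nhds_of_cauchySeq_of_subseq hu hφ.tendsto_atTop ?_⟩
  have h5 := h4.add_const (u (φ 0))
  simp only [sub_add_cancel] at h5
  exact h5

theorem summable_of_seminorm {E ι : Type*} [AddCommGroup E] [Module ℂ E] [UniformSpace E]
    [IsUniformAddGroup E] [CompleteSpace E] {p : SeminormFamily ℂ E ℕ} (hp : WithSeminorms p)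
    {f : ι → E} (h : ∀ i, Summable fun n => p i (f n)) : Summable f := by
  rw [summable_iff_vanishing]
  intro e he
  obtain ⟨s, r, hr, hs⟩ := (hp.mem_nhds_iff _ _).1 he
  have h1 : Summable fun n => s.sup p (f n) :=
    Summable.of_nonneg_of_le (fun n => apply_nonneg _ _)
      (fun n => by
        have := Seminorm.finset_sup_le_sum p s (f n)
        rwa [_root_.sum_apply] at this) (summable_sum fun i _ => h i)
  obtain ⟨t, ht⟩ := summable_iff_vanishing_norm.1 h1 r hr
  refine ⟨t, fun t' htt' => hs ?_⟩
  rw [Seminorm.mem_ball, sub_zero]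
  refine lt_of_le_of_lt (Finset.le_sum_of_subadditive _ (map_zero _).le (map_add_le_add _) _ _) ((le_abs_self _).trans_lt (ht t' htt'))

theorem seminorm_tsum_le {E ι : Type*} [AddCommGroup E] [Module ℂ E] [TopologicalSpace E] {p : Seminorm ℂ E}
    (hp : Continuous p) {f : ι → E} {a : E} (hf : HasSum f a) (h : Summable fun n => p (f n)) :
    p a ≤ ∑' n, p (f n) := by
  refine le_of_tendsto ((hp.tendsto a).comp hf) (Eventually.of_forall fun s => ?_)
  exact (Finset.le_sum_of_subadditive _ (map_zero _).le (map_add_le_add _) _ _).trans (h.sum_le_tsum s fun n _ => apply_nonneg _ _)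

end Completeness

/-! ### Convergence of series in 𝓢(V) and 𝓢(V × Λ); the Fréchet property. -/

section Series

open Filter Topology

theorem seminorm_sum_sub_schwartzSum_le {ι : Type*} (h : ι → 𝓢(V g, ℂ))
    (hs : ∀ k n, Summable fun i => SchwartzMap.seminorm ℂ k n (h i)) (s : Finset ι) (k n : ℕ) :
    SchwartzMap.seminorm ℂ k n (∑ i ∈ s, h i - schwartzSum h hs) ≤
      ∑' i : {i // i ∉ s}, SchwartzMap.seminorm ℂ k n (h i) := by
  have hs' : ∀ k n, Summable fun i : {i // i ∉ s} => SchwartzMap.seminorm ℂ k n (h i) :=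
    fun k n => (hs k n).subtype _
  have e : ∑ i ∈ s, h i - schwartzSum h hs = -schwartzSum (fun i : {i // i ∉ s} => h i) hs' := by
    ext z
    have h1 : Summable fun i => h i z := Summable.of_norm_bounded (hs 0 0) fun i =>
      SchwartzMap.norm_le_seminorm ℂ (h i) z
    have h2 := h1.sum_add_tsum_subtype_compl s
    have h3 : (∑ i ∈ s, h i) z = ∑ i ∈ s, h i z := by
      rw [_root_.sum_apply]
    rw [sub_apply, neg_apply, schwartzSum_apply, schwartzSum_apply, h3, ← h2]
    ring
  rw [e, map_neg_eq_map]
  exact seminorm_schwartzSum _ hs' k n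

/-- Upgrades the pointwise sum to convergence in the Schwartz topology, which continuous maps
preserve. -/
theorem hasSum_schwartzSum {ι : Type*} (h : ι → 𝓢(V g, ℂ))
    (hs : ∀ k n, Summable fun i => SchwartzMap.seminorm ℂ k n (h i)) :
    HasSum h (schwartzSum h hs) := by
  rw [HasSum, (schwartz_withSeminorms ℂ (V g) ℂ).tendsto_nhds]
  intro i ε hε
  rw [SummationFilter.unconditional_filter]
  filter_upwards [(tendsto_tsum_compl_atTop_zero fun j => SchwartzMap.seminorm ℂ i.1 i.2 (h j)).eventually
    (gt_mem_nhds hε)] with s hs'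
  exact (seminorm_sum_sub_schwartzSum_le h hs s i.1 i.2).trans_lt hs'

theorem SX.summable_seminorm_apply {ι : Type*} {f : ι → SX Λ}
    (hs : ∀ i, Summable fun n => SX.seminorm Λ i (f n)) (l : Λ) (k n : ℕ) :
    Summable fun j => SchwartzMap.seminorm ℂ k n (f j l) :=
  Summable.of_nonneg_of_le (fun j => apply_nonneg _ _)
    (fun j => by simpa using SX.le_seminorm (f j) (k, n, 0) l) (hs (k, n, 0))

/-- The sum of a family in `𝓢(V × Λ)` all of whose seminorms are summable. -/
def sxSum {ι : Type*} (f : ι → SX Λ) (hs : ∀ i, Summable fun n => SX.seminorm Λ i (f n)) : SX Λ :=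
  ⟨fun l => schwartzSum (fun n => f n l) (SX.summable_seminorm_apply hs l), fun k n m => by
    refine ⟨∑' j, SX.seminorm Λ (k, n, m) (f j), fun l => ?_⟩
    refine (mul_le_mul_of_nonneg_left (seminorm_schwartzSum _ _ k n) (by positivity)).trans ?_
    rw [← tsum_mul_left]
    refine Summable.tsum_le_tsum (fun j => SX.le_seminorm (f j) (k, n, m) l) ?_ (hs (k, n, m))
    exact Summable.of_nonneg_of_le (fun j => by positivity)
      (fun j => SX.le_seminorm (f j) (k, n, m) l) (hs (k, n, m))⟩

theorem hasSum_sxSum {ι : Type*} (f : ι → SX Λ)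
    (hs : ∀ i, Summable fun n => SX.seminorm Λ i (f n)) : HasSum f (sxSum f hs) := by
  rw [HasSum, (SX.withSeminorms (Λ := Λ)).tendsto_nhds]
  intro i ε hε
  rw [SummationFilter.unconditional_filter]
  filter_upwards [(tendsto_tsum_compl_atTop_zero fun j => SX.seminorm Λ i (f j)).eventually
    (gt_mem_nhds hε)] with s hs'
  refine (SX.seminorm_le fun l => ?_).trans_lt hs'
  have e : (∑ j ∈ s, f j - sxSum f hs) l = ∑ j ∈ s, f j l - sxSum f hs l := by
    rw [← SX.sum_apply]; rfl
  rw [e]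
  refine (mul_le_mul_of_nonneg_left (seminorm_sum_sub_schwartzSum_le (fun j => f j l) (SX.summable_seminorm_apply hs l) s i.1 i.2.1)
    (by positivity)).trans ?_
  rw [← tsum_mul_left]
  have h1 : Summable fun j : {j // j ∉ s} => SX.seminorm Λ i (f j) := (hs i).subtype _
  exact Summable.tsum_le_tsum (fun j => SX.le_seminorm (f j) i l)
    (Summable.of_nonneg_of_le (fun j => by positivity) (fun j => SX.le_seminorm (f j) i l) h1) h1

theorem isFrechet_SX : IsFrechet (SX Λ) := by
  obtain ⟨e⟩ : Nonempty (ℕ ≃ ℕ × ℕ × ℕ) := ⟨(Nat.pairEquiv.symm.trans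
    (Equiv.prodCongr (Equiv.refl ℕ) Nat.pairEquiv.symm))⟩
  have hp : WithSeminorms (fun i => SX.seminorm Λ (e i)) :=
    (SX.withSeminorms (Λ := Λ)).congr_equiv e
  refine ⟨⟨_, hp⟩, inferInstance, ?_⟩
  let := IsTopologicalAddGroup.rightUniformSpace (SX Λ)
  have : IsUniformAddGroup (SX Λ) := isUniformAddGroup_of_addCommGroup
  exact completeSpace_of_hasSum hp fun f hf => ⟨_, hasSum_sxSum f fun i => by
    simpa using hf (e.symm i)⟩

end Series

/-! ### Quantitative bounds for translates and shifted products. -/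

section Bounds

/-- The sum of the Schwartz seminorms of orders at most `M`. -/
def swSem (g M : ℕ) : Seminorm ℂ 𝓢(V g, ℂ) :=
  ∑ i ∈ Finset.Iic (M, M), schwartzSeminormFamily ℂ (V g) ℂ i

theorem swSem_apply (M : ℕ) (f : 𝓢(V g, ℂ)) :
    swSem g M f = ∑ i ∈ Finset.Iic (M, M), SchwartzMap.seminorm ℂ i.1 i.2 f := by
  rw [swSem, _root_.sum_apply]; rfl

theorem continuous_swSem (M : ℕ) : Continuous (swSem g M) := by
  have : ⇑(swSem g M) = fun f => ∑ i ∈ Finset.Iic (M, M), SchwartzMap.seminorm ℂ i.1 i.2 f :=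
    funext (swSem_apply M)
  rw [this]
  exact continuous_finsetSum _ fun i _ =>
    (schwartz_withSeminorms ℂ (V g) ℂ).continuous_seminorm i

theorem seminorm_le_swSem {M k n : ℕ} (hk : k ≤ M) (hn : n ≤ M) (f : 𝓢(V g, ℂ)) :
    SchwartzMap.seminorm ℂ k n f ≤ swSem g M f := by
  rw [swSem_apply]
  exact Finset.single_le_sum (f := fun i : ℕ × ℕ => SchwartzMap.seminorm ℂ i.1 i.2 f)
    (fun i _ => apply_nonneg _ _) (Finset.mem_Iic.2 (show (k, n) ≤ (M, M) from ⟨hk, hn⟩))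

theorem weight_le_swSem {M k n : ℕ} (hk : k ≤ M) (hn : n ≤ M) (f : 𝓢(V g, ℂ)) (z : V g) :
    (1 + ‖z‖) ^ k * ‖iteratedFDeriv ℝ n f z‖ ≤ 2 ^ M * swSem g M f := by
  refine (SchwartzMap.one_add_le_sup_seminorm_apply (𝕜 := ℂ) (m := (M, M)) hk hn f z).trans ?_
  gcongr
  exact Seminorm.finset_sup_le_sum _ _ f

theorem swSem_le {M : ℕ} {f : 𝓢(V g, ℂ)} {A : ℝ}
    (h : ∀ k ≤ M, ∀ n ≤ M, SchwartzMap.seminorm ℂ k n f ≤ A) :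
    swSem g M f ≤ (Finset.Iic (M, M)).card * A := by
  rw [swSem_apply, ← nsmul_eq_mul]
  exact Finset.sum_le_card_nsmul _ _ _ fun i hi => h i.1 (Finset.mem_Iic.1 hi).1 i.2
    (Finset.mem_Iic.1 hi).2

theorem swSem_mono {M N : ℕ} (h : M ≤ N) (f : 𝓢(V g, ℂ)) : swSem g M f ≤ swSem g N f := by
  rw [swSem_apply, swSem_apply]
  exact Finset.sum_le_sum_of_subset_of_nonneg (Finset.Iic_subset_Iic.2 ⟨h, h⟩)
    fun i _ _ => apply_nonneg _ _

/-- The supremum norm is among the summands, so each `swSem` is a norm. This settles the degenerate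
case in the boundedness of bilinear maps. -/
theorem eq_zero_of_swSem {M : ℕ} {f : 𝓢(V g, ℂ)} (h : swSem g M f = 0) : f = 0 := by
  ext z
  have := (SchwartzMap.norm_le_seminorm ℂ f z).trans
    (seminorm_le_swSem (Nat.zero_le M) (Nat.zero_le M) f)
  rw [h] at this
  simpa using this

/-- When u is large, z and z + u cannot both be small; Peetre's inequality trades any power of 1 +
‖u‖ for decay of the two factors. -/
theorem seminorm_shiftMul_le (q p : 𝓢(V g, ℂ)) (u : V g) {M k n : ℕ} (K : ℕ) (hk : k ≤ M)
    (hn : n ≤ M) : (1 + ‖u‖) ^ K * SchwartzMap.seminorm ℂ k n (shiftMul q p u) ≤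
      2 ^ M * (2 ^ (M + K) * swSem g (M + K) q) * (2 ^ (M + K) * swSem g (M + K) p) := by
  have h0 : 0 < (1 + ‖u‖) ^ K := by positivity
  rw [mul_comm, ← le_div_iff₀ h0]
  refine SchwartzMap.seminorm_le_bound ℂ k n _ (by positivity) fun z => ?_
  rw [le_div_iff₀ h0, mul_comm]
  have e : (⇑(shiftMul q p u) : V g → ℂ) = fun z => q z * p (z + u) :=
    funext fun z => shiftMul_apply q p u z
  have hs : ContDiff ℝ ∞ fun z => p (z + u) := (p.smooth ⊤).comp (contDiff_id.add contDiff_const)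
  have h1 := norm_iteratedFDeriv_mul_le (q.smooth ⊤) hs z (n := n) (mod_cast le_top)
  have h2 := peetre (-z) (z + u) K
  rw [neg_add_cancel_left, norm_neg] at h2
  rw [e]
  calc (1 + ‖u‖) ^ K * (‖z‖ ^ k * ‖iteratedFDeriv ℝ n (fun z => q z * p (z + u)) z‖)
      ≤ ((1 + ‖z‖) ^ K * (1 + ‖z + u‖) ^ K) * ((1 + ‖z‖) ^ k *
        ∑ i ∈ Finset.range (n + 1), (n.choose i : ℝ) * ‖iteratedFDeriv ℝ i q z‖ *
          ‖iteratedFDeriv ℝ (n - i) (fun z => p (z + u)) z‖) := by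
        gcongr
        linarith [norm_nonneg z]
    _ = ∑ i ∈ Finset.range (n + 1), (n.choose i : ℝ) *
        (((1 + ‖z‖) ^ (k + K) * ‖iteratedFDeriv ℝ i q z‖) * ((1 + ‖z + u‖) ^ K *
          ‖iteratedFDeriv ℝ (n - i) p (z + u)‖)) := by
        rw [Finset.mul_sum, Finset.mul_sum]
        refine Finset.sum_congr rfl fun i _ => ?_
        rw [iteratedFDeriv_comp_add_right, pow_add]; ring
    _ ≤ ∑ i ∈ Finset.range (n + 1), (n.choose i : ℝ) *
        ((2 ^ (M + K) * swSem g (M + K) q) * (2 ^ (M + K) * swSem g (M + K) p)) := by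
        refine Finset.sum_le_sum fun i hi => mul_le_mul_of_nonneg_left (mul_le_mul ?_ ?_
          (by positivity) (by positivity)) (by positivity)
        · exact weight_le_swSem (by omega) (by have := Finset.mem_range.mp hi; omega) q z
        · exact weight_le_swSem (by omega) (by omega) p _
    _ = 2 ^ n * ((2 ^ (M + K) * swSem g (M + K) q) * (2 ^ (M + K) * swSem g (M + K) p)) := by
        rw [← Finset.sum_mul]
        congr 1
        exact_mod_cast Nat.sum_range_choose n
    _ ≤ _ := by
        rw [← mul_assoc]
        gcongr
        norm_num

theorem swSem_shiftMul_le (M K : ℕ) : ∃ C : ℝ, 0 ≤ C ∧ ∀ (q p : 𝓢(V g, ℂ)) (u : V g),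
    (1 + ‖u‖) ^ K * swSem g M (shiftMul q p u) ≤ C * swSem g (M + K) q * swSem g (M + K) p := by
  refine ⟨(Finset.Iic (M, M)).card * (2 ^ M * 2 ^ (M + K) * 2 ^ (M + K)), by positivity,
    fun q p u => ?_⟩
  have h0 : 0 < (1 + ‖u‖) ^ K := by positivity
  have h1 := swSem_le (M := M) fun k hk n hn => (le_div_iff₀' h0).2 (seminorm_shiftMul_le q p u K hk hn)
  rw [← mul_div_assoc, le_div_iff₀' h0] at h1
  exact h1.trans (le_of_eq (by ring))

theorem swSem_translate_le (M : ℕ) (p : 𝓢(V g, ℂ)) : ∃ C : ℝ, 0 ≤ C ∧ ∀ u : V g,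
    swSem g M (translate u p) ≤ C * (1 + ‖u‖) ^ M := by
  choose D hD0 hD using fun k => translate_bound p k M
  refine ⟨(Finset.Iic (M, M)).card * ∑ k ∈ Finset.range (M + 1), D k,
    mul_nonneg (Nat.cast_nonneg _) (Finset.sum_nonneg fun k _ => hD0 k), fun u => ?_⟩
  rw [mul_assoc]
  refine swSem_le fun k hk n hn => (hD k u n hn).trans ?_
  gcongr
  · exact Finset.sum_nonneg fun i _ => hD0 i
  · exact Finset.single_le_sum (f := D) (fun i _ => hD0 i) (Finset.mem_range.2 (by omega))
  · linarith [norm_nonneg u]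

end Bounds

/-! ### Continuous bilinear maps in terms of seminorms. -/

section Bilinear

open Filter Topology

theorem exists_swSem_ball_subset {U : Set 𝓢(V g, ℂ)} (hU : U ∈ 𝓝 0) :
    ∃ (M : ℕ) (r : ℝ), 0 < r ∧ ∀ f, swSem g M f < r → f ∈ U := by
  obtain ⟨s, r, hr, hs⟩ := ((schwartz_withSeminorms ℂ (V g) ℂ).mem_nhds_iff _ _).1 hU
  refine ⟨s.sup fun i => max i.1 i.2, r, hr, fun f hf => hs ?_⟩
  rw [Seminorm.mem_ball, sub_zero]
  refine Seminorm.finset_sup_apply_lt hr fun i hi => lt_of_le_of_lt ?_ hf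
  have := Finset.le_sup (f := fun i : ℕ × ℕ => max i.1 i.2) hi
  exact seminorm_le_swSem ((le_max_left _ _).trans this) ((le_max_right _ _).trans this) f

/-- Both arguments are rescaled into a neighbourhood of 0 on which p ∘ T is below 1. This is
possible because their norms vanish only at 0. -/
theorem exists_bound_of_continuous {L : Type*} [AddCommGroup L] [Module ℂ L] [TopologicalSpace L]
    {p : Seminorm ℂ L} (hp : Continuous p) {T : 𝓢(V g, ℂ) →ₗ[ℂ] 𝓢(V g, ℂ) →ₗ[ℂ] L}
    (hT : Continuous fun x : 𝓢(V g, ℂ) × 𝓢(V g, ℂ) => T x.1 x.2) :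
    ∃ (M : ℕ) (C : ℝ), 0 ≤ C ∧ ∀ f h, p (T f h) ≤ C * swSem g M f * swSem g M h := by
  have h1 : {x : 𝓢(V g, ℂ) × 𝓢(V g, ℂ) | p (T x.1 x.2) < 1} ∈ 𝓝 (0, 0) := by
    refine (hp.comp hT).continuousAt.eventually (gt_mem_nhds ?_)
    simp
  obtain ⟨U, hU, W, hW, hUW⟩ := mem_nhds_prod_iff.1 h1
  obtain ⟨M, r, hr, hM⟩ := exists_swSem_ball_subset hU
  obtain ⟨N, s, hs, hN⟩ := exists_swSem_ball_subset hW
  refine ⟨max M N, (2 / r) * (2 / s), by positivity, fun f h => ?_⟩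
  have key : p (T f h) ≤ (2 / r) * (2 / s) * swSem g M f * swSem g N h := by
    rcases eq_or_lt_of_le (apply_nonneg (swSem g M) f) with hf | hf
    · rw [eq_zero_of_swSem hf.symm]; simp
    rcases eq_or_lt_of_le (apply_nonneg (swSem g N) h) with hh | hh
    · rw [eq_zero_of_swSem hh.symm]; simp
    set a := r / (2 * swSem g M f) with ha
    set b := s / (2 * swSem g N h) with hb
    have ha0 : 0 < a := by positivity
    have hb0 : 0 < b := by positivity
    have e1 : swSem g M ((a : ℂ) • f) < r := by
      rw [map_smul_eq_mul, Complex.norm_real, Real.norm_of_nonneg ha0.le, ha]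
      field_simp
      linarith
    have e2 : swSem g N ((b : ℂ) • h) < s := by
      rw [map_smul_eq_mul, Complex.norm_real, Real.norm_of_nonneg hb0.le, hb]
      field_simp
      linarith
    have e3 : p (T ((a : ℂ) • f) ((b : ℂ) • h)) < 1 := hUW (Set.mk_mem_prod (hM _ e1) (hN _ e2))
    rw [LinearMap.map_smul, LinearMap.map_smul, LinearMap.smul_apply, map_smul_eq_mul, map_smul_eq_mul,
      Complex.norm_real, Complex.norm_real, Real.norm_of_nonneg ha0.le,
      Real.norm_of_nonneg hb0.le, ← mul_assoc] at e3
    have e4 : b * a * ((2 / r) * (2 / s) * swSem g M f * swSem g N h) = 1 := by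
      rw [ha, hb]; field_simp
    have e5 : 0 < b * a := by positivity
    exact (lt_of_mul_lt_mul_left (e3.trans_eq e4.symm) e5.le).le
  refine key.trans ?_
  gcongr
  · exact swSem_mono (le_max_left _ _) f
  · exact swSem_mono (le_max_right _ _) h

theorem continuous_of_bound {L ι : Type*} [AddCommGroup L] [Module ℂ L] [TopologicalSpace L]
    {p : SeminormFamily ℂ L ι} (hp : WithSeminorms p)
    {T : 𝓢(V g, ℂ) →ₗ[ℂ] 𝓢(V g, ℂ) →ₗ[ℂ] L} (h : ∀ i, ∃ (M : ℕ) (C : ℝ), 0 ≤ C ∧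
      ∀ f k, p i (T f k) ≤ C * swSem g M f * swSem g M k) :
    Continuous fun x : 𝓢(V g, ℂ) × 𝓢(V g, ℂ) => T x.1 x.2 := by
  rw [continuous_iff_continuousAt]
  rintro ⟨a, b⟩
  rw [ContinuousAt, hp.tendsto_nhds]
  intro i ε hε
  obtain ⟨M, C, hC0, hC⟩ := h i
  have hc : Continuous fun x : 𝓢(V g, ℂ) × 𝓢(V g, ℂ) =>
      C * swSem g M (x.1 - a) * swSem g M x.2 + C * swSem g M a * swSem g M (x.2 - b) := by
    have := continuous_swSem (g := g) M
    fun_prop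
  have h1 : ∀ᶠ x : 𝓢(V g, ℂ) × 𝓢(V g, ℂ) in 𝓝 (a, b),
      C * swSem g M (x.1 - a) * swSem g M x.2 + C * swSem g M a * swSem g M (x.2 - b) < ε :=
    hc.continuousAt.eventually (gt_mem_nhds (by simpa using hε))
  filter_upwards [h1] with x hx
  refine lt_of_le_of_lt ?_ hx
  have e : T x.1 x.2 - T a b = T (x.1 - a) x.2 + T a (x.2 - b) := by
    rw [map_sub, map_sub, LinearMap.sub_apply]; abel
  rw [e]
  exact (map_add_le_add _ _ _).trans (add_le_add (hC _ _) (hC _ _))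

theorem seminorm_tens_le (i : ℕ × ℕ × ℕ) : ∃ (M : ℕ) (C : ℝ), 0 ≤ C ∧ ∀ q p : 𝓢(V g, ℂ),
    SX.seminorm Λ i (tens Λ q p) ≤ C * swSem g M q * swSem g M p := by
  obtain ⟨k, n, m⟩ := i
  refine ⟨max k n + m, 2 ^ max k n * 2 ^ (max k n + m) * 2 ^ (max k n + m), by positivity,
    fun q p => SX.seminorm_le fun l => ?_⟩
  have h1 := seminorm_shiftMul_le q p (l : V g) m (le_max_left k n) (le_max_right k n)
  refine le_trans ?_ (h1.trans (le_of_eq (by ring)))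
  change ‖l‖ ^ m * SchwartzMap.seminorm ℂ k n (shiftMul q p (l : V g)) ≤ _
  gcongr
  rw [Submodule.coe_norm]
  linarith [norm_nonneg l]

theorem continuous_tens : Continuous fun x : 𝓢(V g, ℂ) × 𝓢(V g, ℂ) => tens Λ x.1 x.2 :=
  continuous_of_bound (SX.withSeminorms (Λ := Λ)) seminorm_tens_le

theorem isBalanced_tens : IsBalanced Λ (tens Λ) := by
  intro f _ hf q qf p fp hq hp
  refine SX.ext fun l z => ?_
  rw [tens_apply, tens_apply, hq, hp, hf]
  ring

end Bilinear
end
end NCTorus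

open scoped SchwartzMap LineDeriv ContDiff TensorProduct ComplexConjugate

namespace NCTorus

noncomputable section

variable {g : ℕ} {Λ : Submodule ℤ (V g)} {B : V g →L[ℝ] V g →L[ℝ] ℝ}

/-! ### Sums over translates along points comparable to the lattice. -/

section Periodization

/-- The hypothesis on v covers the three families used later: -l, -s⁻¹l and -(u + l). -/
theorem summable_seminorm_shiftMul [DiscreteTopology Λ] (q h : 𝓢(V g, ℂ)) {v : Λ → V g} {D : ℝ}
    (hD : 0 ≤ D) (hv : ∀ l, 1 + ‖l‖ ≤ D * (1 + ‖v l‖)) (k n : ℕ) :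
    Summable fun l => SchwartzMap.seminorm ℂ k n (shiftMul q h (v l)) := by
  obtain ⟨N, hN⟩ := exists_summable_weight Λ
  refine Summable.of_nonneg_of_le (fun l => apply_nonneg _ _) (fun l => ?_)
    (hN.mul_left (D ^ N * (2 ^ max k n * (2 ^ (max k n + N) * swSem g (max k n + N) q) *
      (2 ^ (max k n + N) * swSem g (max k n + N) h))))
  rw [← div_eq_mul_inv, le_div_iff₀ (by positivity), mul_comm]
  calc (1 + ‖l‖) ^ N * SchwartzMap.seminorm ℂ k n (shiftMul q h (v l))
      ≤ (D * (1 + ‖v l‖)) ^ N * SchwartzMap.seminorm ℂ k n (shiftMul q h (v l)) := by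
        gcongr; exact hv l
    _ = D ^ N * ((1 + ‖v l‖) ^ N * SchwartzMap.seminorm ℂ k n (shiftMul q h (v l))) := by
        rw [mul_pow]; ring
    _ ≤ _ := mul_le_mul_of_nonneg_left
        (seminorm_shiftMul_le q h (v l) N (le_max_left k n) (le_max_right k n)) (by positivity)

/-- The sum is not a Schwartz function, but its product with a Gaussian is a convergent series in
the Schwartz space; dividing by the nowhere vanishing Gaussian keeps smoothness. -/
theorem contDiff_tsum_translate [DiscreteTopology Λ] (h : 𝓢(V g, ℂ)) {v : Λ → V g} {D : ℝ}
    (hD : 0 ≤ D) (hv : ∀ l, 1 + ‖l‖ ≤ D * (1 + ‖v l‖)) :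
    ContDiff ℝ ∞ fun z => ∑' l, h (z + v l) := by
  have h0 : ∀ z, gaussC g z ≠ 0 := fun z => by
    rw [gaussC_apply]
    exact_mod_cast (Real.exp_pos _).ne'
  have e : (fun z => ∑' l, h (z + v l)) = fun z =>
      schwartzSum _ (summable_seminorm_shiftMul (gaussC g) h hD hv) z * (gaussC g z)⁻¹ := by
    ext z
    rw [schwartzSum_apply, ← div_eq_mul_inv, eq_div_iff (h0 z), ← tsum_mul_right]
    exact tsum_congr fun l => by rw [shiftMul_apply, mul_comm]
  rw [e]
  exact (SchwartzMap.smooth (schwartzSum _ _) ⊤).mul (((gaussC g).smooth ⊤).inv h0)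

theorem summable_translate [DiscreteTopology Λ] (h : 𝓢(V g, ℂ)) {v : Λ → V g} {D : ℝ}
    (hD : 0 ≤ D) (hv : ∀ l, 1 + ‖l‖ ≤ D * (1 + ‖v l‖)) (z : V g) :
    Summable fun l => h (z + v l) := by
  have h0 : gaussC g z ≠ 0 := by
    rw [gaussC_apply]
    exact_mod_cast (Real.exp_pos _).ne'
  have h1 : Summable fun l => gaussC g z * h (z + v l) :=
    Summable.of_norm_bounded (summable_seminorm_shiftMul (gaussC g) h hD hv 0 0) fun l => by
      rw [← shiftMul_apply]
      exact SchwartzMap.norm_le_seminorm ℂ _ _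
  exact (summable_mul_left_iff h0).1 h1

theorem one_add_norm_le_neg (l : Λ) : 1 + ‖l‖ ≤ 1 * (1 + ‖-(l : V g)‖) := by
  rw [norm_neg, one_mul, Submodule.coe_norm]

theorem one_add_norm_le_smul {s : ℕ} (hs : 0 < s) (l : Λ) :
    1 + ‖l‖ ≤ s * (1 + ‖-((s : ℝ)⁻¹ • (l : V g))‖) := by
  have h1 : (1 : ℝ) ≤ s := by exact_mod_cast hs
  have h2 : (s : ℝ) ≠ 0 := by positivity
  rw [norm_neg, norm_smul, Real.norm_of_nonneg (by positivity), mul_add, ← mul_assoc,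
    mul_inv_cancel₀ h2, one_mul, mul_one, Submodule.coe_norm]
  linarith

end Periodization

/-! ### A fine partition of unity and a cutoff adapted to the lattice. -/

section Localizer

/-- `χ` is a partition of unity under the translates by `s⁻¹ Λ`, `ψ` is one on the support of `χ`
and has disjoint translates under `Λ`. -/
structure IsLocalizer (Λ : Submodule ℤ (V g)) (s : ℕ) (χ ψ : 𝓢(V g, ℂ)) : Prop where
  pos : 0 < s
  tsum_eq_one : ∀ z, ∑' l : Λ, χ (z - (s : ℝ)⁻¹ • (l : V g)) = 1
  eq_one : ∀ z, χ z ≠ 0 → ψ z = 1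
  disjoint : ∀ m : Λ, m ≠ 0 → ∀ z, ψ z * ψ (z + (m : V g)) = 0

variable (Λ) in
theorem exists_pos_separation [DiscreteTopology Λ] : ∃ ε : ℝ, 0 < ε ∧ ∀ l : Λ, ‖l‖ < ε → l = 0 := by
  have h : ({0} : Set Λ) ∈ nhds 0 := (isOpen_discrete _).mem_nhds rfl
  obtain ⟨ε, hε, h1⟩ := Metric.mem_nhds_iff.1 h
  exact ⟨ε, hε, fun l hl => h1 (by simpa using hl)⟩

variable (Λ) in
theorem exists_covering_radius [DiscreteTopology Λ] [IsZLattice ℝ Λ] :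
    ∃ R : ℝ, 0 < R ∧ ∀ z : V g, ∃ l : Λ, ‖z - l‖ ≤ R := by
  let b := (Module.Free.chooseBasis ℤ Λ).ofZLatticeBasis ℝ Λ
  have hb : Submodule.span ℤ (Set.range b) = Λ :=
    (Module.Free.chooseBasis ℤ Λ).ofZLatticeBasis_span ℝ Λ
  refine ⟨∑ i, ‖b i‖ + 1, by positivity, fun z => ?_⟩
  refine ⟨⟨ZSpan.floor b z, hb.le (ZSpan.floor b z).2⟩, ?_⟩
  have := ZSpan.norm_fract_le (K := ℝ) b z
  rw [ZSpan.fract_apply] at this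
  exact this.trans (by linarith)

/-- A smooth bump function, as a complex valued Schwartz function. -/
def bumpC (f : ContDiffBump (0 : V g)) : 𝓢(V g, ℂ) :=
  (HasCompactSupport.toSchwartzMap f.hasCompactSupport f.contDiff).postcompCLM Complex.ofRealCLM

theorem bumpC_apply (f : ContDiffBump (0 : V g)) (z : V g) : bumpC f z = (f z : ℂ) := rfl

theorem norm_lt_of_bumpC_ne_zero {f : ContDiffBump (0 : V g)} {z : V g} (h : bumpC f z ≠ 0) :
    ‖z‖ < f.rOut := by
  rw [bumpC_apply, Complex.ofReal_ne_zero] at h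
  have : z ∈ Function.support f := h
  rw [f.support_eq] at this
  simpa using this

variable (Λ) in
-- Let ε separate the lattice points and R be a covering radius. With s > R/(ε/8), every z is within
-- ε/8 of s⁻¹Λ, so the translates of a bump of radius ε/6 have a positive sum P, and χ is the bump
-- divided by P. The cutoff ψ is 1 up to ε/5 > ε/6 and vanishes beyond ε/3, so two points where it
-- is nonzero differ by less than ε.
theorem exists_isLocalizer [DiscreteTopology Λ] [IsZLattice ℝ Λ] :
    ∃ s χ ψ, IsLocalizer Λ s χ ψ := by
  obtain ⟨ε, hε, hsep⟩ := exists_pos_separation Λ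
  obtain ⟨R, hR, hcov⟩ := exists_covering_radius Λ
  obtain ⟨s, hs⟩ := exists_nat_gt (R / (ε / 8))
  have hs0 : (0 : ℝ) < s := lt_trans (by positivity) hs
  have hs1 : 0 < s := by exact_mod_cast hs0
  let f : ContDiffBump (0 : V g) := ⟨ε / 8, ε / 6, by positivity, by linarith⟩
  let F : ContDiffBump (0 : V g) := ⟨ε / 5, ε / 3, by positivity, by linarith⟩
  let P : V g → ℂ := fun z => ∑' l : Λ, bumpC f (z + -((s : ℝ)⁻¹ • (l : V g)))
  have hP : ContDiff ℝ ∞ P := contDiff_tsum_translate _ hs0.le (one_add_norm_le_smul hs1)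
  have hsum : ∀ z, Summable fun l : Λ => bumpC f (z + -((s : ℝ)⁻¹ • (l : V g))) :=
    summable_translate _ hs0.le (one_add_norm_le_smul hs1)
  have hP0 : ∀ z, P z ≠ 0 := fun z => by
    obtain ⟨l, hl⟩ := hcov ((s : ℝ) • z)
    have h1 : Summable fun l : Λ => f (z + -((s : ℝ)⁻¹ • (l : V g))) :=
      Complex.summable_ofReal.1 (hsum z)
    have h2 : 0 < f (z + -((s : ℝ)⁻¹ • (l : V g))) := by
      refine f.pos_of_mem_ball ?_
      rw [mem_ball_zero_iff]
      have e : z + -((s : ℝ)⁻¹ • (l : V g)) = (s : ℝ)⁻¹ • ((s : ℝ) • z - l) := by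
        rw [smul_sub, smul_smul, inv_mul_cancel₀ hs0.ne', one_smul, sub_eq_add_neg]
      rw [e, norm_smul, Real.norm_of_nonneg (by positivity), inv_mul_eq_div, div_lt_iff₀ hs0]
      rw [div_lt_iff₀ (by positivity)] at hs
      change _ < ε / 6 * s
      nlinarith
    have h3 := h1.tsum_pos (fun l => f.nonneg) l h2
    have h4 : P z = ((∑' l : Λ, f (z + -((s : ℝ)⁻¹ • (l : V g))) : ℝ) : ℂ) := by
      rw [Complex.ofReal_tsum]; rfl
    rw [h4]
    exact_mod_cast h3.ne'
  -- Invariance of P under s⁻¹Λ is what makes the normalized translates sum to 1.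
  have hPper : ∀ (z : V g) (m : Λ), P (z - (s : ℝ)⁻¹ • (m : V g)) = P z := fun z m => by
    change ∑' l : Λ, _ = ∑' l : Λ, _
    rw [← (Equiv.addLeft m).tsum_eq (fun l : Λ => bumpC f (z + -((s : ℝ)⁻¹ • (l : V g))))]
    refine tsum_congr fun l => ?_
    congr 1
    rw [Equiv.coe_addLeft, Submodule.coe_add, smul_add]
    abel
  have hχ : HasCompactSupport fun z => bumpC f z / P z := by
    have h1 : HasCompactSupport (bumpC f) := f.hasCompactSupport.comp_left Complex.ofReal_zero
    have h2 := h1.mul_right (f' := fun z => (P z)⁻¹)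
    have e : (fun z => bumpC f z / P z) = ⇑(bumpC f) * fun z => (P z)⁻¹ := rfl
    rw [e]
    exact h2
  let χ : 𝓢(V g, ℂ) := hχ.toSchwartzMap (((bumpC f).smooth ⊤).mul (hP.inv hP0))
  have hχ_apply : ∀ z, χ z = bumpC f z / P z := fun z => rfl
  refine ⟨s, χ, bumpC F, hs1, fun z => ?_, fun z hz => ?_, fun m hm z => ?_⟩
  · simp only [hχ_apply, hPper, div_eq_mul_inv]
    rw [tsum_mul_right]
    have : ∑' l : Λ, bumpC f (z - (s : ℝ)⁻¹ • (l : V g)) = P z :=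
      tsum_congr fun l => by rw [sub_eq_add_neg]
    rw [this, mul_inv_cancel₀ (hP0 z)]
  · have h1 : bumpC f z ≠ 0 := fun h => hz (by rw [hχ_apply, h, zero_div])
    have h2 : ‖z‖ < ε / 6 := norm_lt_of_bumpC_ne_zero h1
    rw [bumpC_apply, F.one_of_mem_closedBall, Complex.ofReal_one]
    rw [mem_closedBall_zero_iff]
    change ‖z‖ ≤ ε / 5
    linarith
  · by_contra h
    have h1 : ‖z‖ < ε / 3 := norm_lt_of_bumpC_ne_zero (left_ne_zero_of_mul h)
    have h2 : ‖z + (m : V g)‖ < ε / 3 := norm_lt_of_bumpC_ne_zero (right_ne_zero_of_mul h)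
    refine hm (hsep m ?_)
    have h3 := norm_sub_le (z + (m : V g)) z
    rw [add_sub_cancel_left] at h3
    rw [Submodule.coe_norm]
    linarith

end Localizer
end
end NCTorus

open scoped SchwartzMap LineDeriv ContDiff TensorProduct ComplexConjugate

namespace NCTorus

noncomputable section

variable {g : ℕ} {Λ : Submodule ℤ (V g)} {B : V g →L[ℝ] V g →L[ℝ] ℝ}

/-! ### The series defining the induced map. -/

section Universal

open Filter Topology

theorem shiftMul_add (q q' p : 𝓢(V g, ℂ)) (u : V g) :
    shiftMul (q + q') p u = shiftMul q p u + shiftMul q' p u := by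
  ext z; simp only [shiftMul_apply, add_apply, add_mul]

theorem shiftMul_smul (c : ℂ) (q p : 𝓢(V g, ℂ)) (u : V g) :
    shiftMul (c • q) p u = c • shiftMul q p u := by
  ext z; simp only [shiftMul_apply, smul_apply, smul_eq_mul, mul_assoc]

/-- The sum of the seminorms of `𝓢(V × Λ)` with all indices at most `R`. -/
def SX.wSem (Λ : Submodule ℤ (V g)) (R : ℕ) : Seminorm ℂ (SX Λ) :=
  ∑ i ∈ Finset.Iic (R, R, R), SX.seminorm Λ i

theorem SX.wSem_apply (R : ℕ) (φ : SX Λ) :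
    SX.wSem Λ R φ = ∑ i ∈ Finset.Iic (R, R, R), SX.seminorm Λ i φ := by
  rw [SX.wSem, _root_.sum_apply]

theorem SX.continuous_wSem (R : ℕ) : Continuous (SX.wSem Λ R) := by
  have e : ⇑(SX.wSem Λ R) = fun φ => ∑ i ∈ Finset.Iic (R, R, R), SX.seminorm Λ i φ :=
    funext (SX.wSem_apply R)
  rw [e]
  exact continuous_finsetSum _ fun i _ => (SX.withSeminorms (Λ := Λ)).continuous_seminorm i

theorem SX.seminorm_le_wSem {R k n m : ℕ} (hk : k ≤ R) (hn : n ≤ R) (hm : m ≤ R) (φ : SX Λ) :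
    SX.seminorm Λ (k, n, m) φ ≤ SX.wSem Λ R φ := by
  rw [SX.wSem_apply]
  exact Finset.single_le_sum (f := fun i => SX.seminorm Λ i φ) (fun i _ => apply_nonneg _ _)
    (Finset.mem_Iic.2 ⟨hk, hn, hm⟩)

theorem SX.weight_mul_swSem_le (R : ℕ) : ∃ C : ℝ, 0 ≤ C ∧ ∀ (φ : SX Λ) (l : Λ),
    (1 + ‖l‖) ^ R * swSem g R (φ l) ≤ C * SX.wSem Λ R φ := by
  refine ⟨(Finset.Iic (R, R)).card * (2 ^ (R - 1) * 2), by positivity, fun φ l => ?_⟩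
  have h0 : 0 < (1 + ‖l‖) ^ R := by positivity
  have h1 := swSem_le (M := R) (f := φ l) (A := 2 ^ (R - 1) * (SX.wSem Λ R φ + SX.wSem Λ R φ) /
      (1 + ‖l‖) ^ R) fun k hk n hn => by
    rw [le_div_iff₀' h0]
    refine one_add_pow_le' R (norm_nonneg _) (apply_nonneg _ _) ?_ ?_
    · refine le_trans ?_ (SX.seminorm_le_wSem hk hn (Nat.zero_le R) φ)
      simpa using SX.le_seminorm φ (k, n, 0) l
    · exact (SX.le_seminorm φ (k, n, R) l).trans (SX.seminorm_le_wSem hk hn le_rfl φ)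
  rw [← mul_div_assoc, le_div_iff₀' h0] at h1
  exact h1.trans (le_of_eq (by ring))

variable {L : Type*} [AddCommGroup L] [Module ℂ L]

/-- The terms of the series which defines the linear map on `𝓢(V × Λ)` induced by a balanced
bilinear map `T`. -/
def locTerm (s : ℕ) (χ ψ : 𝓢(V g, ℂ)) (T : 𝓢(V g, ℂ) →ₗ[ℂ] 𝓢(V g, ℂ) →ₗ[ℂ] L) (φ : SX Λ)
    (x : Λ × Λ) : L :=
  T (shiftMul (φ x.2) χ (-((s : ℝ)⁻¹ • (x.1 : V g))))
    (translate ((s : ℝ)⁻¹ • (x.1 : V g) + (x.2 : V g)) ψ)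

theorem locTerm_add (s : ℕ) (χ ψ : 𝓢(V g, ℂ)) (T : 𝓢(V g, ℂ) →ₗ[ℂ] 𝓢(V g, ℂ) →ₗ[ℂ] L)
    (φ φ' : SX Λ) (x : Λ × Λ) :
    locTerm s χ ψ T (φ + φ') x = locTerm s χ ψ T φ x + locTerm s χ ψ T φ' x := by
  rw [locTerm, SX.add_apply, shiftMul_add, map_add, LinearMap.add_apply]; rfl

theorem locTerm_smul (s : ℕ) (χ ψ : 𝓢(V g, ℂ)) (T : 𝓢(V g, ℂ) →ₗ[ℂ] 𝓢(V g, ℂ) →ₗ[ℂ] L)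
    (c : ℂ) (φ : SX Λ) (x : Λ × Λ) : locTerm s χ ψ T (c • φ) x = c • locTerm s χ ψ T φ x := by
  rw [locTerm, SX.smul_apply, shiftMul_smul, map_smul, LinearMap.smul_apply]; rfl

variable [TopologicalSpace L]

/-- Translating ψ costs M powers in each lattice variable. Asking for M + N powers of decay, from
the shifted product in x.1 and from φ in x.2, leaves N in both, enough for summation over Λ × Λ. -/
theorem seminorm_locTerm_le {s : ℕ} (hs : 0 < s) (χ ψ : 𝓢(V g, ℂ))
    {T : 𝓢(V g, ℂ) →ₗ[ℂ] 𝓢(V g, ℂ) →ₗ[ℂ] L}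
    (hT : Continuous fun x : 𝓢(V g, ℂ) × 𝓢(V g, ℂ) => T x.1 x.2)
    {p : Seminorm ℂ L} (hp : Continuous p) (N : ℕ) :
    ∃ (R : ℕ) (C : ℝ), 0 ≤ C ∧ ∀ (φ : SX Λ) (x : Λ × Λ), p (locTerm s χ ψ T φ x) ≤
      C * SX.wSem Λ R φ * (((1 + ‖x.1‖) ^ N)⁻¹ * ((1 + ‖x.2‖) ^ N)⁻¹) := by
  obtain ⟨M, C, hC0, hC⟩ := exists_bound_of_continuous hp hT
  obtain ⟨C₁, hC₁0, hC₁⟩ := swSem_shiftMul_le (g := g) M (M + N)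
  obtain ⟨C₂, hC₂0, hC₂⟩ := swSem_translate_le M ψ
  obtain ⟨C₃, hC₃0, hC₃⟩ := SX.weight_mul_swSem_le (Λ := Λ) (M + (M + N))
  refine ⟨M + (M + N), C * C₁ * C₂ * C₃ * s ^ N * swSem g (M + (M + N)) χ, by positivity,
    fun φ x => ?_⟩
  obtain ⟨l', l⟩ := x
  set R := M + (M + N) with hR
  set u : V g := (s : ℝ)⁻¹ • (l' : V g) with hu
  have h1 : 1 + ‖l'‖ ≤ s * (1 + ‖u‖) := by
    have := one_add_norm_le_smul hs l'
    rwa [norm_neg] at this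
  have h2 := hC₁ (φ l) χ (-u)
  rw [norm_neg] at h2
  have h3 := (hC₂ (u + (l : V g))).trans (mul_le_mul_of_nonneg_left (peetre u (l : V g) M) hC₂0)
  rw [← Submodule.coe_norm] at h3
  have h4 := hC₃ φ l
  rw [← mul_inv, ← div_eq_mul_inv, le_div_iff₀ (by positivity)]
  set a := swSem g M (shiftMul (φ l) χ (-u))
  set b := swSem g M (translate (u + (l : V g)) ψ)
  set X := swSem g R χ
  set Y := swSem g R (φ l)
  have hY : (1 + ‖l‖) ^ (M + N) * Y ≤ C₃ * SX.wSem Λ R φ := by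
    refine le_trans ?_ h4
    gcongr
    · linarith [norm_nonneg l]
    · omega
  calc p (locTerm s χ ψ T φ (l', l)) * ((1 + ‖l'‖) ^ N * (1 + ‖l‖) ^ N)
      ≤ (C * a * b) * ((s * (1 + ‖u‖)) ^ N * (1 + ‖l‖) ^ N) := by
        gcongr
        exact hC _ _
    _ ≤ (C * a * (C₂ * ((1 + ‖u‖) ^ M * (1 + ‖l‖) ^ M))) *
        ((s * (1 + ‖u‖)) ^ N * (1 + ‖l‖) ^ N) := by gcongr
    _ = C * C₂ * s ^ N * (1 + ‖l‖) ^ (M + N) * ((1 + ‖u‖) ^ (M + N) * a) := by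
        rw [mul_pow, pow_add, pow_add]; ring
    _ ≤ C * C₂ * s ^ N * (1 + ‖l‖) ^ (M + N) * (C₁ * Y * X) := by gcongr
    _ = C * C₁ * C₂ * s ^ N * X * ((1 + ‖l‖) ^ (M + N) * Y) := by ring
    _ ≤ C * C₁ * C₂ * s ^ N * X * (C₃ * SX.wSem Λ R φ) := by gcongr
    _ = _ := by ring

variable [IsTopologicalAddGroup L] [DiscreteTopology Λ]

theorem IsFrechet.summable_of_seminorm {ι : Type*} (hL : IsFrechet L) {f : ι → L}
    (h : ∀ p : Seminorm ℂ L, Continuous p → Summable fun i => p (f i)) : Summable f := by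
  obtain ⟨⟨p, hp⟩, -, hc⟩ := hL
  letI := IsTopologicalAddGroup.rightUniformSpace L
  haveI : IsUniformAddGroup L := isUniformAddGroup_of_addCommGroup
  exact NCTorus.summable_of_seminorm hp fun i => h _ (hp.continuous_seminorm i)

theorem summable_seminorm_locTerm {s : ℕ} (hs : 0 < s) (χ ψ : 𝓢(V g, ℂ))
    {T : 𝓢(V g, ℂ) →ₗ[ℂ] 𝓢(V g, ℂ) →ₗ[ℂ] L}
    (hT : Continuous fun x : 𝓢(V g, ℂ) × 𝓢(V g, ℂ) => T x.1 x.2)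
    {p : Seminorm ℂ L} (hp : Continuous p) (φ : SX Λ) :
    Summable fun x => p (locTerm s χ ψ T φ x) := by
  obtain ⟨N, hN⟩ := exists_summable_weight Λ
  obtain ⟨R, C, hC0, hC⟩ := seminorm_locTerm_le (Λ := Λ) hs χ ψ hT hp N
  exact Summable.of_nonneg_of_le (fun _ => apply_nonneg _ _) (hC φ)
    ((hN.mul_of_nonneg hN (fun _ => by positivity) (fun _ => by positivity)).mul_left _)

theorem summable_locTerm (hL : IsFrechet L) {s : ℕ} (hs : 0 < s) (χ ψ : 𝓢(V g, ℂ))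
    {T : 𝓢(V g, ℂ) →ₗ[ℂ] 𝓢(V g, ℂ) →ₗ[ℂ] L}
    (hT : Continuous fun x : 𝓢(V g, ℂ) × 𝓢(V g, ℂ) => T x.1 x.2) (φ : SX Λ) :
    Summable (locTerm s χ ψ T φ) :=
  hL.summable_of_seminorm fun _ hp => summable_seminorm_locTerm hs χ ψ hT hp φ

theorem exists_hasSum_locTerm (hL : IsFrechet L) {s : ℕ} (hs : 0 < s) (χ ψ : 𝓢(V g, ℂ))
    {T : 𝓢(V g, ℂ) →ₗ[ℂ] 𝓢(V g, ℂ) →ₗ[ℂ] L}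
    (hT : Continuous fun x : 𝓢(V g, ℂ) × 𝓢(V g, ℂ) => T x.1 x.2) :
    ∃ F : SX Λ →L[ℂ] L, ∀ φ, HasSum (locTerm s χ ψ T φ) (F φ) := by
  have hsum := summable_locTerm (Λ := Λ) hL hs χ ψ hT
  obtain ⟨⟨p, hp⟩, hT2, -⟩ := hL
  haveI := hp.continuousSMul
  let F : SX Λ →ₗ[ℂ] L :=
    { toFun := fun φ => ∑' x, locTerm s χ ψ T φ x
      map_add' := fun φ φ' => by
        rw [← (hsum φ).tsum_add (hsum φ')]
        exact tsum_congr (locTerm_add s χ ψ T φ φ')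
      map_smul' := fun c φ => by
        rw [RingHom.id_apply, ← (hsum φ).tsum_const_smul c]
        exact tsum_congr (locTerm_smul s χ ψ T c φ) }
  have hF : ∀ φ, HasSum (locTerm s χ ψ T φ) (F φ) := fun φ => (hsum φ).hasSum
  refine ⟨⟨F, ?_⟩, hF⟩
  refine continuous_of_continuousAt_zero F ?_
  rw [ContinuousAt, hp.tendsto_nhds]
  intro i ε hε
  obtain ⟨N, hN⟩ := exists_summable_weight Λ
  have hpi := hp.continuous_seminorm i
  obtain ⟨R, C, hC0, hC⟩ := seminorm_locTerm_le (Λ := Λ) hs χ ψ hT hpi N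
  have hNN := hN.mul_of_nonneg hN (fun _ => by positivity) (fun _ => by positivity)
  have h1 : Tendsto (fun φ => C * SX.wSem Λ R φ *
      ∑' x : Λ × Λ, (((1 + ‖x.1‖) ^ N)⁻¹ * ((1 + ‖x.2‖) ^ N)⁻¹)) (𝓝 0) (𝓝 0) := by
    have : Continuous (fun φ => C * SX.wSem Λ R φ *
      ∑' x : Λ × Λ, (((1 + ‖x.1‖) ^ N)⁻¹ * ((1 + ‖x.2‖) ^ N)⁻¹)) := by
      have := SX.continuous_wSem (Λ := Λ) R
      fun_prop
    simpa using this.tendsto 0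
  filter_upwards [h1.eventually (gt_mem_nhds hε)] with φ hφ
  rw [map_zero, sub_zero]
  refine lt_of_le_of_lt ?_ hφ
  have h2 := summable_seminorm_locTerm hs χ ψ hT hpi φ
  refine (seminorm_tsum_le hpi (hF φ) h2).trans ?_
  rw [← tsum_mul_left]
  exact h2.tsum_le_tsum (hC φ) (hNN.mul_left _)

end Universal
end
end NCTorus

open scoped SchwartzMap LineDeriv ContDiff TensorProduct ComplexConjugate

namespace NCTorus

noncomputable section

variable {g : ℕ} {Λ : Submodule ℤ (V g)} {B : V g →L[ℝ] V g →L[ℝ] ℝ}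

/-! ### Proof of the universal property. -/

section UniversalProperty

theorem tsum_translate_neg_add (h : V g → ℂ) (l : Λ) (z : V g) :
    ∑' m : Λ, h (z + l + -(m : V g)) = ∑' m : Λ, h (z + -(m : V g)) := by
  rw [← (Equiv.addLeft l).tsum_eq fun m : Λ => h (z + l + -(m : V g))]
  refine tsum_congr fun m => congrArg h ?_
  rw [Equiv.coe_addLeft, Submodule.coe_add]
  abel

namespace IsLocalizer

variable {s : ℕ} {χ ψ : 𝓢(V g, ℂ)}

theorem eq_zero (h : IsLocalizer Λ s χ ψ) {z : V g} (hz : χ z ≠ 0) {m : Λ} (hm : m ≠ 0) :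
    ψ (z + (m : V g)) = 0 := by
  have := h.disjoint m hm z
  rwa [h.eq_one z hz, one_mul] at this

variable [DiscreteTopology Λ]

/-- On the slice over l, disjointness of the translates of ψ leaves only the term n = l, where ψ is
1 on the support of χ; the translates of χ then sum to 1. Hence a continuous linear map is
determined by its values on the image of `tens`. -/
theorem hasSum_locTerm_tens (h : IsLocalizer Λ s χ ψ) (φ : SX Λ) :
    HasSum (locTerm s χ ψ (tens Λ) φ) φ := by
  have hs : ∀ i, Summable fun x => SX.seminorm Λ i (locTerm s χ ψ (tens Λ) φ x) := fun i =>
    summable_seminorm_locTerm h.pos χ ψ continuous_tens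
      ((SX.withSeminorms (Λ := Λ)).continuous_seminorm i) φ
  have e : sxSum (locTerm s χ ψ (tens Λ) φ) hs = φ := by
    refine SX.ext fun l z => ?_
    have h1 : sxSum (locTerm s χ ψ (tens Λ) φ) hs l z = ∑' x, locTerm s χ ψ (tens Λ) φ x l z := rfl
    have h2 : Summable fun x => locTerm s χ ψ (tens Λ) φ x l z :=
      Summable.of_norm_bounded (SX.summable_seminorm_apply hs l 0 0) fun x =>
        SchwartzMap.norm_le_seminorm ℂ _ z
    rw [h1, h2.tsum_prod]
    have h3 : ∀ m : Λ, ∑' n : Λ, locTerm s χ ψ (tens Λ) φ (m, n) l z =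
        φ l z * χ (z - (s : ℝ)⁻¹ • (m : V g)) := fun m => by
      have e1 : ∀ n : Λ, locTerm s χ ψ (tens Λ) φ (m, n) l z =
          φ n z * χ (z - (s : ℝ)⁻¹ • (m : V g)) *
            ψ (z - (s : ℝ)⁻¹ • (m : V g) + ((l - n : Λ) : V g)) := fun n => by
        rw [locTerm, tens_apply, shiftMul_apply, translate_apply, ← sub_eq_add_neg,
          Submodule.coe_sub]
        congr 2
        abel
      rw [tsum_eq_single l]
      · rw [e1, sub_self, Submodule.coe_zero, add_zero]
        by_cases hz : χ (z - (s : ℝ)⁻¹ • (m : V g)) = 0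
        · rw [hz]; simp
        · rw [h.eq_one _ hz, mul_one]
      · intro n hn
        rw [e1]
        by_cases hz : χ (z - (s : ℝ)⁻¹ • (m : V g)) = 0
        · rw [hz]; simp
        · rw [h.eq_zero hz (sub_ne_zero.2 hn.symm), mul_zero]
    rw [tsum_congr h3, tsum_mul_left, h.tsum_eq_one, mul_one]
  have := hasSum_sxSum (locTerm s χ ψ (tens Λ) φ) hs
  rwa [e] at this

variable {L : Type*} [AddCommGroup L] [Module ℂ L]

/-- Write u = s⁻¹m. The periodization of ψ(z - u) p(z + l) agrees with p(z + l) where the translate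
of χ is nonzero, so balancedness moves it to the second slot. There the translate of ψ selects the
one summand equal to p times the translated ψ, hence the square of ψ. -/
theorem locTerm_tens (h : IsLocalizer Λ s χ ψ) {T : 𝓢(V g, ℂ) →ₗ[ℂ] 𝓢(V g, ℂ) →ₗ[ℂ] L}
    (hB : IsBalanced Λ T) (q p : 𝓢(V g, ℂ)) (m l : Λ) :
    locTerm s χ ψ T (tens Λ q p) (m, l) =
      T (shiftMul q χ (-((s : ℝ)⁻¹ • (m : V g))))
        (shiftMul p (shiftMul ψ ψ 0) (-((s : ℝ)⁻¹ • (m : V g) + (l : V g)))) := by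
  set u : V g := (s : ℝ)⁻¹ • (m : V g) with hu
  have hv : ∀ l : Λ, ((-l : Λ) : V g) = -(l : V g) := fun l => Submodule.coe_neg _ l
  refine hB (fun z => ∑' n : Λ, shiftMul (translate u ψ) p l (z + -(n : V g)))
    (contDiff_tsum_translate _ zero_le_one one_add_norm_le_neg) (fun n z => ?_) _ _ _ _
    (fun z => ?_) (fun z => ?_)
  · exact tsum_translate_neg_add _ n z
  · change shiftMul (tens Λ q p l) χ (-u) z = _
    rw [shiftMul_apply, tens_apply, shiftMul_apply]
    by_cases hz : χ (z + -u) = 0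
    · rw [hz]; simp
    rw [tsum_eq_single 0]
    · rw [Submodule.coe_zero, neg_zero, add_zero, shiftMul_apply, translate_apply, sub_eq_add_neg,
        h.eq_one _ hz]
      ring
    · intro n hn
      have := h.eq_zero hz (neg_ne_zero.2 hn)
      rw [shiftMul_apply, translate_apply]
      rw [hv] at this
      rw [show z + -(n : V g) - u = z + -u + -(n : V g) by abel, this, zero_mul]
  · rw [← tsum_mul_right, tsum_eq_single l]
    · simp only [shiftMul_apply, translate_apply]
      rw [show z + -(u + (l : V g)) + 0 = z - (u + (l : V g)) by abel,
        show z + -(u + (l : V g)) = z - (u + (l : V g)) by abel,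
        show z + -(l : V g) - u = z - (u + (l : V g)) by abel,
        show z + -(l : V g) + (l : V g) = z by abel]
      ring
    · intro n hn
      have := h.disjoint (l - n) (sub_ne_zero.2 hn.symm) (z - (u + (l : V g)))
      rw [Submodule.coe_sub, show z - (u + (l : V g)) + ((l : V g) - (n : V g)) =
        z + -(n : V g) - u by abel] at this
      simp only [shiftMul_apply, translate_apply]
      linear_combination p (z + -(n : V g) + (l : V g)) * this

variable [TopologicalSpace L] [IsTopologicalAddGroup L]

/-- Summing over l multiplies p by the periodization of a translate of ψ². Being periodic, that
factor moves back to the first slot, where it equals 1 on the support of the translated χ. -/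
theorem hasSum_locTerm_tens_right (h : IsLocalizer Λ s χ ψ)
    {T : 𝓢(V g, ℂ) →ₗ[ℂ] 𝓢(V g, ℂ) →ₗ[ℂ] L} (hB : IsBalanced Λ T)
    (hT : Continuous fun x : 𝓢(V g, ℂ) × 𝓢(V g, ℂ) => T x.1 x.2) (q p : 𝓢(V g, ℂ)) (m : Λ) :
    HasSum (fun l => locTerm s χ ψ T (tens Λ q p) (m, l))
      (T (shiftMul q χ (-((s : ℝ)⁻¹ • (m : V g)))) p) := by
  set u : V g := (s : ℝ)⁻¹ • (m : V g) with hu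
  have hv : ∀ l : Λ, 1 + ‖l‖ ≤ (1 + ‖u‖) * (1 + ‖-(u + (l : V g))‖) := fun l => by
    have h1 := norm_sub_le (u + (l : V g)) u
    rw [add_sub_cancel_left] at h1
    rw [norm_neg, Submodule.coe_norm]
    nlinarith [norm_nonneg u, norm_nonneg (u + (l : V g)),
      mul_nonneg (norm_nonneg u) (norm_nonneg (u + (l : V g)))]
  have hu0 : 0 ≤ 1 + ‖u‖ := by positivity
  have h1 := hasSum_schwartzSum _ (summable_seminorm_shiftMul p (shiftMul ψ ψ 0) hu0 hv)
  have h2 := h1.map (T (shiftMul q χ (-u))) (hT.comp (continuous_const.prodMk continuous_id))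
  have h3 : T (shiftMul q χ (-u)) (schwartzSum _
      (summable_seminorm_shiftMul p (shiftMul ψ ψ 0) hu0 hv)) = T (shiftMul q χ (-u)) p := by
    refine (hB (fun z => ∑' n : Λ, translate u (shiftMul ψ ψ 0) (z + -(n : V g)))
      (contDiff_tsum_translate _ zero_le_one one_add_norm_le_neg) (fun n z => ?_) _ _ _ _
      (fun z => ?_) (fun z => ?_)).symm
    · exact tsum_translate_neg_add _ n z
    · rw [shiftMul_apply]
      by_cases hz : χ (z + -u) = 0
      · rw [hz]; simp
      rw [tsum_eq_single 0]
      · rw [Submodule.coe_zero, neg_zero, add_zero, translate_apply, shiftMul_apply, add_zero,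
          sub_eq_add_neg, h.eq_one _ hz]
        ring
      · intro n hn
        have := h.eq_zero hz (neg_ne_zero.2 hn)
        rw [Submodule.coe_neg] at this
        rw [translate_apply, shiftMul_apply, show z + -(n : V g) - u = z + -u + -(n : V g) by abel,
          this, zero_mul]
    · rw [schwartzSum_apply, ← tsum_mul_right]
      refine tsum_congr fun n => ?_
      rw [shiftMul_apply, translate_apply, mul_comm]
      congr 2
      abel
  rw [h3] at h2
  exact h2.congr_fun fun l => h.locTerm_tens hB q p m l

theorem hasSum_shiftMul (h : IsLocalizer Λ s χ ψ) (q : 𝓢(V g, ℂ)) :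
    HasSum (fun m : Λ => shiftMul q χ (-((s : ℝ)⁻¹ • (m : V g)))) q := by
  have h1 := hasSum_schwartzSum _ (summable_seminorm_shiftMul q χ (Nat.cast_nonneg s)
    (one_add_norm_le_smul (Λ := Λ) h.pos))
  convert h1 using 1
  ext z
  rw [schwartzSum_apply]
  simp only [shiftMul_apply, ← sub_eq_add_neg]
  rw [tsum_mul_left, h.tsum_eq_one, mul_one]

end IsLocalizer

/-- For existence the double series on `tens Λ q p` is summed over l first, which restores p, then
over m, where the translates of χ restore q. Uniqueness comes from expanding φ itself by
`hasSum_locTerm_tens`. -/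
theorem exists_lift_of_isBalanced [DiscreteTopology Λ] [IsZLattice ℝ Λ] {L : Type*} [AddCommGroup L]
    [Module ℂ L] [TopologicalSpace L] [IsTopologicalAddGroup L] (hL : IsFrechet L)
    {T : 𝓢(V g, ℂ) →ₗ[ℂ] 𝓢(V g, ℂ) →ₗ[ℂ] L} (hB : IsBalanced Λ T)
    (hT : Continuous fun x : 𝓢(V g, ℂ) × 𝓢(V g, ℂ) => T x.1 x.2) :
    ∃! F : SX Λ →L[ℂ] L, ∀ q p, F (tens Λ q p) = T q p := by
  obtain ⟨s, χ, ψ, h⟩ := exists_isLocalizer Λ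
  obtain ⟨F, hF⟩ := exists_hasSum_locTerm (Λ := Λ) hL h.pos χ ψ hT
  have hT2 : T2Space L := hL.2.1
  refine ⟨F, fun q p => ?_, fun F' hF' => ?_⟩
  · have h1 := (hF (tens Λ q p)).prod_fiberwise (h.hasSum_locTerm_tens_right hB hT q p)
    have h2 := (h.hasSum_shiftMul q).map (T.flip p) (hT.comp (continuous_id.prodMk continuous_const))
    exact h1.unique h2
  · ext φ
    have h1 := (h.hasSum_locTerm_tens φ).map F' F'.continuous
    exact h1.unique ((hF φ).congr_fun fun x => hF' _ _)

theorem isCompletedTensorProduct_tens.{w} (Λ : Submodule ℤ (V g)) [DiscreteTopology Λ]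
    [IsZLattice ℝ Λ] : IsCompletedTensorProduct.{w} Λ (tens Λ) :=
  ⟨isFrechet_SX, isBalanced_tens, continuous_tens, fun _ _ _ _ _ hL _ hB hT =>
    exists_lift_of_isBalanced hL hB hT⟩

end UniversalProperty
end
end NCTorus

theorem mainTheorem2 (g : ℕ) (Λ : Submodule ℤ (V g)) [DiscreteTopology Λ] [IsZLattice ℝ Λ]
    (B : V g →L[ℝ] V g →L[ℝ] ℝ) (hB : ∀ v, B v v = 0) :
    -- `𝓢(V × Λ)` is the module `𝒬 ⊗ 𝒫` over the smooth functions on the torus `V / Λ`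
    IsCompletedTensorProduct.{u} Λ (tens Λ) ∧
    -- the right action on it is induced by the one on `𝒫`
    (∀ (a : TwAlg Λ B) (q p : 𝓢(V g, ℂ)), ∃ pa : 𝓢(V g, ℂ),
      (∀ v, pa v = ∑' m : Λ, a m * (sigma B (m : V g) v * p ((m : V g) + v))) ∧
      MulOpposite.op a • tens Λ q p = tens Λ q pa) ∧
    -- `𝕏^0 = ℚ ⊗ 1 + 1 ⊗ ℙ^0`
    (∀ (k : ℕ) (α β : ExteriorAlgebra ℂ (Fin g → ℂ)), α ∈ ⋀[ℂ]^k (Fin g → ℂ) →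
      ∀ q p : 𝓢(V g, ℂ),
        connX Λ B (tensForms Λ (q ⊗ₜ[ℂ] inQ α) (p ⊗ₜ[ℂ] inP β)) =
          tensForms Λ (connQ B (q ⊗ₜ[ℂ] inQ α)) (p ⊗ₜ[ℂ] inP β) +
          (-1 : ℂ) ^ k • tensForms Λ (q ⊗ₜ[ℂ] inQ α) (connP B (p ⊗ₜ[ℂ] inP β))) ∧
    -- `(𝒳, 𝕏^0)` is a complex
    (∀ (k : ℕ) (φ : XForms Λ), φ ∈ gr Λ B k → connX Λ B φ ∈ gr Λ B (k + 1)) ∧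
    (∀ φ : XForms Λ, connX Λ B (connX Λ B φ) = 0) ∧
    -- the cohomology vanishes outside degree `g`
    (∀ k : ℕ, k ≠ g → Subsingleton (Cohomology Λ B k)) ∧
    -- in degree `g` it is free of rank one with generator the class of `η_0^0`
    (∃ (h : eta B (0 : Λ) ∈ cocycles Λ B g)
      (b : Module.Basis Unit (TwAlg Λ B)ᵐᵒᵖ (Cohomology Λ B g)),
      b () = Submodule.Quotient.mk ⟨eta B (0 : Λ), h⟩) ∧
    -- the kernel of the Laplacian
    (∃ D : XForms Λ →ₗ[ℂ] XForms Λ,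
      (∀ φ ψ : XForms Λ, innerX (connX Λ B φ) ψ = innerX φ (D ψ)) ∧
      (∀ k : ℕ, k ≠ g → ∀ φ ∈ gr Λ B k, D (connX Λ B φ) + connX Λ B (D φ) = 0 → φ = 0) ∧
      (∀ m : Λ, eta B m ∈ gr Λ B g) ∧
      (∀ m m' : Λ, m ≠ m' → innerX (eta B m) (eta B m') = 0) ∧
      (∀ m : Λ, innerX (eta B m) (eta B m) ≠ 0) ∧
      (∀ c : TwAlg Λ B, Summable fun m : Λ => c m • bFun B m) ∧
      ∀ φ : XForms Λ, D (connX Λ B φ) + connX Λ B (D φ) = 0 ↔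
        ∃! c : TwAlg Λ B, φ = (∑' m : Λ, c m • bFun B m) ⊗ₜ[ℂ] eMinusTop g) := by
  refine ⟨isCompletedTensorProduct_tens Λ, fun a q p => exists_op_smul_tens a q p,
    fun k α β hα q p => connX_tensForms β hα q p, fun k φ h => connX_mem_gr h, connX_connX,
    fun k hk => subsingleton_cohomology hk, exists_basis_cohomology hB, adjX Λ B, innerX_connX,
    fun k hk φ hφ h => eq_zero_of_harmonic hk hφ h, fun m => tmul_mem_gr _ (eMinusTop_mem g),
    fun m m' h => innerX_eta_of_ne h, innerX_eta_ne_zero, fun c => (hasSum_gaussSum c).summable,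
    harmonic_iff_existsUnique⟩
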